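/- **Setting.** Let $\mathfrak g$ be a finite dimensional complex semisimple Lie algebra, $G$ the corresponding connected simply connected Lie group, and $\mathcal A(G)$ the algebra of polynomial functions on $G$ (matrix coefficients of finite dimensional representations), with the two commuting actions of $\mathfrak g$ $(\rho_1(x)a)(p)=\frac{d}{ds}\big|_0a(e^{-sx}p)$ and $(\rho_2(x)a)(p)=\frac{d}{ds}\big|_0a(pe^{sx})$. Let $\mathfrak g=\mathfrak n^-\oplus\mathfrak l\oplus\mathfrak n^+$, where $\mathfrak l$ is a Levi subalgebra (the centralizer of an element of a Cartan subalgebra) and $\mathfrak n^\pm$ are subalgebras normalized by $\mathfrak l$ (so that $\mathfrak l\oplus\mathfrak n^\pm$ are opposite parabolic subalgebras). Let $\mathfrak c$ be the centre of $\mathfrak l$; identify $\mathfrak c^*$ with the linear forms on $\mathfrak g$ that vanish on $\mathfrak n^\pm$ and on $[\mathfrak l,\mathfrak l]$. Let $\lambda(t)=\lambda_0+t\lambda_1+\dots\in\mathfrak c^*[[t]]$ be a formal path such that $\mathfrak l$ is the stabilizer of $\lambda_0$ in $\mathfrak g$, let $H\subset G$ be the connected subgroup with Lie algebra $\mathfrak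 l$, and realize $M=G/H$ as the coadjoint orbit of $\lambda_0$. The global sections of the vector bundle $V(M)$ with fibre a finite dimensional $\mathfrak l$-module $V$ are the elements of $(\mathcal A(G)\otimes V)^{\mathfrak l}$ ($\mathfrak l$ acting on $\mathcal A(G)$ by $\rho_2$); $\mathcal A(M)=\mathcal A(G)^{\mathfrak l}$; $\mathfrak g$ acts on sections by $\rho_1$. For $\alpha\in\mathfrak c^*$, $\mathbb C_\alpha$ is the corresponding one dimensional $\mathfrak l$-module. **Dynamical multiplication.** Over a field $k$, for an $\mathfrak l$-module $X$ let $M_X=U(\mathfrak g)\otimes_{U(\mathfrak l\oplus\mathfrak n^+)}X$ ($\mathfrak n^+$ acting on $X$ by $0$). The *expectation value* of a map $M_Y\to M_X\otimes V$ is its composition with $Y\to M_Y$ and with the projection $M_X\to X$ along $\mathfrak n^-M_X$. For $\mathfrak g$-modules $V,W$ the twist $F^{X}_{V,W}\in\mathrm{End}(X\otimes V\otimes W)$ is the expectation value of the composition $M_{X\otimes V\otimes W}\to M_{X\otimes V}\otimes W\to M_X\otimes V\otimes W$ of the $\mathfrak g$-morphisms whose expectation values are the identity maps; for one dimensional $X$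 with character $\chi$ write $F^X_{V,W}=\mathrm{id}_X\otimes F^\chi_{V,W}$. Take $k=\mathbb C((t))$ and extend scalars; the dynamical multiplication at $\lambda(t)/t$ is $\bar m_{\lambda(t)/t}=m\circ F^{\lambda(t)/t}$ on $\mathcal A(G)\otimes\mathcal A(G)$, where $F$ acts through $\rho_2$ and $m$ is the multiplication of $\mathcal A(G)$. **Theorem.** The dynamical multiplication $\bar m_{\lambda(t)/t}$ is well defined and unique, and takes values in $\mathcal A(G)[[t]]$: $a\star b=\sum_{n\ge0}t^n\,a\star_nb$. With $(a\otimes v)\star(b\otimes w)=(a\star b)\otimes v\otimes w$ it defines a $U(\mathfrak g)$-equivariant $\mathbb C[[t]]$-bilinear multiplication $\star=\star_{\lambda(t)}$ of (formal series of) global sections of the bundles $V(M)$, the product of sections of $V(M)$ and $W(M)$ being a series of sections of $(V\otimes W)(M)$, which modulo $t$ is the usual tensor product of sections. Moreover: 1. $\star$ restricts to a unital associative product on $\mathcal A(M)[[t]]$ with $a\star b=ab+O(t)$ and $a\star b-b\star a=t\{a,b\}+O(t^2)$, where $\{\cdot,\cdot\}$ is the Kirillov bracket of the coadjoint orbit of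 $\lambda_0$ (the Poisson bracket with $\{x,y\}=[x,y]$ for the linear coordinate functions $x,y\in\mathfrak g$). Denote this algebra by $\mathcal A_{\lambda(t)}(M)$. 2. For a function $a$ and sections $s_V$, $s_W$ of $V(M)$, $W(M)$ one has $a\star(s_V\star s_W)=(a\star s_V)\star s_W$. The sections of any $V(M)$ form a unital left $\mathcal A_{\lambda(t)}(M)$-module with respect to $a\otimes s\mapsto a\star s$. 3. For $\alpha\in\mathfrak c^*$ the sections of the line bundle $\mathbb C_\alpha(M)$ form a unital right module over $\mathcal A_{\lambda(t)-t\alpha}(M)$ with respect to $s\otimes b\mapsto s\star_{\lambda(t)}b$. (The sections are zero unless $\alpha$ is an integer weight.) -/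

import Mathlib

open scoped TensorProduct

noncomputable section

namespace DynQuant

universe u v w

/-! ## The Hopf algebra `U(L)` (coproduct and counit) -/

section Enveloping

attribute [local instance 100] LieRing.ofAssociativeRing

variable (R : Type v) [CommRing R] (L : Type u) [LieRing L] [LieAlgebra R L]

/-- The universal enveloping algebra. -/
abbrev U := UniversalEnvelopingAlgebra R L

/-- The canonical map from the Lie algebra to its enveloping algebra, as a linear map. -/
def iota : L →ₗ[R] U R L := (UniversalEnvelopingAlgebra.ι R : L →ₗ⁅R⁆ U R L)

variable {R L}

lemma iota_lie (x y : L) :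
    iota R L ⁅x, y⁆ = iota R L x * iota R L y - iota R L y * iota R L x := by
  exact LieHom.map_lie (UniversalEnvelopingAlgebra.ι R : L →ₗ⁅R⁆ U R L) x y

lemma enveloping_hom_ext {B : Type*} [Ring B] [Algebra R B] {f g : U R L →ₐ[R] B}
    (h : ∀ x, f (iota R L x) = g (iota R L x)) : f = g := by
  apply UniversalEnvelopingAlgebra.hom_ext
  exact LieHom.ext h

variable (R)

/-- The extension of a Lie algebra map into an associative algebra to `U(L)`. -/
def envLift {B : Type*} [Ring B] [Algebra R B] (f : L →ₗ[R] B)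
    (hf : ∀ x y, f ⁅x, y⁆ = f x * f y - f y * f x) : U R L →ₐ[R] B :=
  UniversalEnvelopingAlgebra.lift R
    { f with map_lie' := fun {x y} => hf x y }

lemma envLift_iota {B : Type*} [Ring B] [Algebra R B] (f : L →ₗ[R] B)
    (hf : ∀ x y, f ⁅x, y⁆ = f x * f y - f y * f x) (x : L) :
    envLift R f hf (iota R L x) = f x := by
  exact UniversalEnvelopingAlgebra.lift_ι_apply R
    { f with map_lie' := fun {x y} => hf x y } x

variable (L)

/-- The coproduct `x ↦ x ⊗ 1 + 1 ⊗ x`. -/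
def envComul : U R L →ₐ[R] U R L ⊗[R] U R L :=
  envLift R
    ((TensorProduct.mk R _ _).flip 1 ∘ₗ iota R L + TensorProduct.mk R _ _ 1 ∘ₗ iota R L)
    (fun x y => by
      simp [iota_lie, TensorProduct.tmul_sub, mul_add, add_mul]
      abel)

/-- The counit `x ↦ 0`. -/
def envCounit : U R L →ₐ[R] R := envLift R 0 (fun x y => by simp)

@[simp] lemma envComul_iota (x : L) : envComul R L (iota R L x) =
    iota R L x ⊗ₜ[R] 1 + 1 ⊗ₜ[R] iota R L x := envLift_iota R _ _ x

@[simp] lemma envCounit_iota (x : L) : envCounit R L (iota R L x) = 0 :=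
  envLift_iota R _ _ x

instance instBialgebraEnv : Bialgebra R (U R L) :=
  .ofAlgHom (envComul R L) (envCounit R L)
    (by
      apply enveloping_hom_ext
      intro x
      simp [Algebra.TensorProduct.one_def, TensorProduct.add_tmul, TensorProduct.tmul_add]
      abel)
    (by apply enveloping_hom_ext; intro x; simp)
    (by apply enveloping_hom_ext; intro x; simp)

@[simp] lemma comul_iota (x : L) : Coalgebra.comul (R := R) (iota R L x) =
    iota R L x ⊗ₜ[R] 1 + 1 ⊗ₜ[R] iota R L x := envComul_iota R L x

instance instIsCocommEnv : Coalgebra.IsCocomm R (U R L) where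
  comm_comp_comul := by
    have h : (Algebra.TensorProduct.comm R (U R L) (U R L)).toAlgHom.comp
        (Bialgebra.comulAlgHom R _) = Bialgebra.comulAlgHom R (U R L) := by
      apply enveloping_hom_ext
      intro x
      simp
      abel
    exact congr(($h).toLinearMap)

end Enveloping

/-! ## The algebra `𝒜(G)` of polynomial functions -/

section Functions

open Coalgebra WithConv

attribute [local instance 100] LieRing.ofAssociativeRing

variable (g : Type u) [LieRing g] [LieAlgebra ℂ g]

/-- Linear functionals on `U(g)`, with the convolution product dual to the coproduct. A function
`f` on a Lie group with Lie algebra `g` gives the functional `u ↦ (u f)(1)`, where `u` acts by left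
invariant differential operators; products of functions correspond to convolution products. -/
abbrev EnvDual := WithConv (U ℂ g →ₗ[ℂ] ℂ)

variable {g}

/-- A matrix coefficient of a finite dimensional representation `π`: a functional `ξ ∘ π` with
`ξ ∈ End(V)^*`. -/
def IsMatrixCoeff (f : EnvDual g) : Prop :=
  ∃ (n : ℕ) (π : U ℂ g →ₐ[ℂ] Matrix (Fin n) (Fin n) ℂ)
    (ξ : Matrix (Fin n) (Fin n) ℂ →ₗ[ℂ] ℂ), ∀ x, f x = ξ (π x)

lemma isMatrixCoeff_of_algHom {B : Type*} [Ring B] [Algebra ℂ B] [Module.Finite ℂ B]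
    (π : U ℂ g →ₐ[ℂ] B) (ξ : B →ₗ[ℂ] ℂ) (f : EnvDual g) (hf : ∀ x, f x = ξ (π x)) :
    IsMatrixCoeff f := by
  let b := Module.finBasis ℂ B
  refine ⟨_, (Algebra.leftMulMatrix b).comp π,
    ξ ∘ₗ LinearMap.applyₗ (1 : B) ∘ₗ (Matrix.toLin b b).toLinearMap, fun x => ?_⟩
  simp [hf, Algebra.leftMulMatrix_apply]

variable (g)

/-- The algebra `𝒜(G)` of polynomial functions on the connected simply connected Lie group `G` with
(semisimple) Lie algebra `g`: the matrix coefficients of all finite dimensional representations. -/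
def polyFun : Subalgebra ℂ (EnvDual g) where
  carrier := {f | IsMatrixCoeff f}
  mul_mem' := by
    rintro f h ⟨n, π, ξ, hf⟩ ⟨m, π', ξ', hh⟩
    refine isMatrixCoeff_of_algHom
      ((Algebra.TensorProduct.map π π').comp (Bialgebra.comulAlgHom ℂ _))
      (LinearMap.mul' ℂ ℂ ∘ₗ TensorProduct.map ξ ξ') _ fun x => ?_
    have h1 : f.ofConv = ξ ∘ₗ π.toLinearMap := LinearMap.ext hf
    have h2 : h.ofConv = ξ' ∘ₗ π'.toLinearMap := LinearMap.ext hh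
    rw [LinearMap.convMul_apply, h1, h2, TensorProduct.map_comp]
    rfl
  add_mem' := by
    rintro f h ⟨n, π, ξ, hf⟩ ⟨m, π', ξ', hh⟩
    refine isMatrixCoeff_of_algHom (π.prod π')
      (ξ ∘ₗ LinearMap.fst ℂ _ _ + ξ' ∘ₗ LinearMap.snd ℂ _ _) _ fun x => ?_
    change f x + h x = _
    rw [hf, hh]
    rfl
  algebraMap_mem' := by
    intro r
    refine isMatrixCoeff_of_algHom (Bialgebra.counitAlgHom ℂ (U ℂ g)) (r • LinearMap.id) _
      fun x => ?_
    rw [LinearMap.convAlgebraMap_apply]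
    simp [Algebra.smul_def]

/-- `𝒜(G)`. -/
def PolyFun : Type u := ↥(polyFun g)

instance : CommRing (PolyFun g) := inferInstanceAs (CommRing ↥(polyFun g))

instance : Algebra ℂ (PolyFun g) := inferInstanceAs (Algebra ℂ ↥(polyFun g))

variable {g}

lemma PolyFun.ext' {a b : PolyFun g} (h : ∀ x, a.1 x = b.1 x) : a = b :=
  Subtype.ext (WithConv.ofConv_injective (LinearMap.ext h))

/-- The action `ρ₁` of `g`, `(ρ₁(x) a)(p) = d/ds a(exp(-s x) p)`, `p ∈ G`. -/
def rho1 (x : g) : PolyFun g →ₗ[ℂ] PolyFun g where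
  toFun a := ⟨toConv (-(a.1.ofConv ∘ₗ LinearMap.mulLeft ℂ (iota ℂ g x))), by
    obtain ⟨n, π, ξ, hf⟩ := a.2
    refine ⟨n, π, -(ξ ∘ₗ LinearMap.mulLeft ℂ (π (iota ℂ g x))), fun y => ?_⟩
    have := hf (iota ℂ g x * y)
    rw [map_mul π] at this
    simpa using this⟩
  map_add' a b := by apply PolyFun.ext'; intro y; exact neg_add _ _
  map_smul' r a := by apply PolyFun.ext'; intro y; exact (smul_neg r (a.1 (iota ℂ g x * y))).symm

/-- The action `ρ₂` of `g`, `(ρ₂(x) a)(p) = d/ds a(p exp(s x))`, `p ∈ G`. -/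
def rho2 (x : g) : PolyFun g →ₗ[ℂ] PolyFun g where
  toFun a := ⟨toConv (a.1.ofConv ∘ₗ LinearMap.mulRight ℂ (iota ℂ g x)), by
    obtain ⟨n, π, ξ, hf⟩ := a.2
    refine ⟨n, π, ξ ∘ₗ LinearMap.mulRight ℂ (π (iota ℂ g x)), fun y => ?_⟩
    have := hf (y * iota ℂ g x)
    rw [map_mul π] at this
    simpa using this⟩
  map_add' a b := by apply PolyFun.ext'; intro y; rfl
  map_smul' r a := by apply PolyFun.ext'; intro y; rfl

lemma rho1_apply (x : g) (a : PolyFun g) (y : U ℂ g) :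
    (rho1 x a).1 y = - a.1 (iota ℂ g x * y) := rfl

lemma rho2_apply (x : g) (a : PolyFun g) (y : U ℂ g) :
    (rho2 x a).1 y = a.1 (y * iota ℂ g x) := rfl

/-- `𝒜(G)` is a `g`-module by the action `ρ₂`. -/
instance : LieRingModule g (PolyFun g) where
  bracket x a := rho2 x a
  add_lie x y a := by
    apply PolyFun.ext'; intro z
    change a.1 (z * iota ℂ g (x + y)) = a.1 (z * iota ℂ g x) + a.1 (z * iota ℂ g y)
    rw [map_add, mul_add]
    exact map_add a.1.ofConv _ _
  lie_add x a b := map_add (rho2 x) a b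
  leibniz_lie x y a := by
    apply PolyFun.ext'; intro z
    change a.1 (z * iota ℂ g x * iota ℂ g y) =
      a.1 (z * iota ℂ g ⁅x, y⁆) + a.1 (z * iota ℂ g y * iota ℂ g x)
    rw [iota_lie, mul_sub, ← mul_assoc, ← mul_assoc]
    exact eq_add_of_sub_eq (map_sub a.1.ofConv _ _).symm

lemma lie_polyFun (x : g) (a : PolyFun g) : ⁅x, a⁆ = rho2 x a := rfl

instance : LieModule ℂ g (PolyFun g) where
  smul_lie r x a := by
    apply PolyFun.ext'; intro z
    change a.1 (z * iota ℂ g (r • x)) = r • a.1 (z * iota ℂ g x)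
    rw [map_smul, mul_smul_comm]
    exact map_smul a.1.ofConv _ _
  lie_smul r x a := map_smul (rho2 x) r a

/-- `ρ₂(x)` is a derivation of `𝒜(G)`. -/
lemma rho2_mul (x : g) (a b : PolyFun g) : rho2 x (a * b) = rho2 x a * b + a * rho2 x b := by
  apply PolyFun.ext'; intro z
  change (a.1 * b.1) (z * iota ℂ g x) = ((rho2 x a).1 * b.1) z + (a.1 * (rho2 x b).1) z
  rw [LinearMap.convMul_apply, LinearMap.convMul_apply, LinearMap.convMul_apply,
    Bialgebra.comul_mul, comul_iota]
  induction (comul z : U ℂ g ⊗[ℂ] U ℂ g) using TensorProduct.induction_on with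
  | zero => simp
  | tmul p q =>
    simp only [mul_add, Algebra.TensorProduct.tmul_mul_tmul, mul_one, map_add,
      TensorProduct.map_tmul, LinearMap.mul'_apply]
    rfl
  | add p q hp hq =>
    simp only [add_mul, map_add] at hp hq ⊢
    rw [hp, hq]; ring

lemma rho2_one (x : g) : rho2 x (1 : PolyFun g) = 0 := by
  apply PolyFun.ext'; intro z
  change (1 : EnvDual g) (z * iota ℂ g x) = 0
  have : (Coalgebra.counit (R := ℂ) (iota ℂ g x)) = 0 := envCounit_iota ℂ g x
  simp [this]

/-- The algebra `𝒜(M)` of functions on `M = G/H`, for `H ⊆ G` the connected subgroup with Lie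
algebra `l`: the functions on `G` that are invariant for the action `ρ₂` of `l`. -/
def orbitFun (l : LieSubalgebra ℂ g) : Subalgebra ℂ (PolyFun g) where
  carrier := {a | ∀ x ∈ l, rho2 x a = 0}
  mul_mem' := by
    intro a b ha hb x hx
    rw [rho2_mul, ha x hx, hb x hx, zero_mul, mul_zero, add_zero]
  add_mem' := by
    intro a b ha hb x hx
    rw [map_add, ha x hx, hb x hx, add_zero]
  algebraMap_mem' := by
    intro r x _
    rw [Algebra.algebraMap_eq_smul_one, map_smul, rho2_one, smul_zero]

/-- The global sections of the vector bundle `V(M)` with fibre `V`: the space `(𝒜(G) ⊗ V)^l`. -/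
def bundleSections (l : LieSubalgebra ℂ g) (V : Type*) [AddCommGroup V] [Module ℂ V]
    [LieRingModule l V] [LieModule ℂ l V] : Submodule ℂ (PolyFun g ⊗[ℂ] V) :=
  (LieModule.maxTrivSubmodule ℂ l (PolyFun g ⊗[ℂ] V)).toSubmodule

/-- The action of `U(g)` on a `g`-module. -/
def envAction (M : Type*) [AddCommGroup M] [Module ℂ M] [LieRingModule g M] [LieModule ℂ g M] :
    U ℂ g →ₐ[ℂ] Module.End ℂ M :=
  envLift ℂ (LieModule.toEnd ℂ g M).toLinearMap
    (fun x y => LieHom.map_lie (LieModule.toEnd ℂ g M) x y)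

lemma envAction_iota (M : Type*) [AddCommGroup M] [Module ℂ M] [LieRingModule g M]
    [LieModule ℂ g M] (x : g) (m : M) : envAction M (iota ℂ g x) m = ⁅x, m⁆ := by
  rw [envAction, envLift_iota]; rfl

/-- The linear function `ξ ↦ ξ(x)` on `g^*` pulled back to `G` along the orbit map `p ↦ p·μ` of
`μ ∈ g^*` under the coadjoint action. -/
def coordFun [FiniteDimensional ℂ g] (μ : Module.Dual ℂ g) (x : g) : PolyFun g :=
  ⟨toConv (LinearMap.applyₗ x ∘ₗ LinearMap.applyₗ μ ∘ₗ
      (envAction (g := g) (Module.Dual ℂ g)).toLinearMap),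
    isMatrixCoeff_of_algHom (envAction (g := g) (Module.Dual ℂ g))
      (LinearMap.applyₗ x ∘ₗ LinearMap.applyₗ μ) _ fun _ => rfl⟩

lemma coordFun_apply [FiniteDimensional ℂ g] (μ : Module.Dual ℂ g) (x : g) (y : U ℂ g) :
    (coordFun μ x).1 y = envAction (g := g) (Module.Dual ℂ g) y μ x := rfl

lemma coordFun_mem [FiniteDimensional ℂ g] (l : LieSubalgebra ℂ g) (μ : Module.Dual ℂ g)
    (h : ∀ z ∈ l, ∀ y, μ ⁅z, y⁆ = 0) (x : g) : coordFun μ x ∈ orbitFun l := by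
  intro z hz
  apply PolyFun.ext'; intro y
  have h1 : ⁅z, μ⁆ = 0 := by ext y; simp [h z hz y]
  rw [rho2_apply, coordFun_apply, map_mul, Module.End.mul_apply, envAction_iota, h1, map_zero]
  rfl

end Functions

/-! ## Generalized Verma modules and the dynamical twist -/

section Twist

variable {k : Type v} [Field k] {L : Type u} [LieRing L] [LieAlgebra k L]

attribute [local instance 100] LieRing.ofAssociativeRing

/-- The relations of `U(L) ⊗_{U(l + n)} X` in `U(L) ⊗ X`, where the `l`-module `X` is extended to
`l + n` by the trivial action of `n`. -/
def vermaRel (l n : LieSubalgebra k L) (X : Type*) [AddCommGroup X] [Module k X]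
    [LieRingModule l X] [LieModule k l X] : Submodule (U k L) (U k L ⊗[k] X) :=
  Submodule.span (U k L)
    ({m | ∃ (z : l) (x : X), m = iota k L z ⊗ₜ[k] x - 1 ⊗ₜ[k] ⁅z, x⁆} ∪
      {m | ∃ (z : n) (x : X), m = iota k L z ⊗ₜ[k] x})

/-- The generalized Verma module `M_X = U(L) ⊗_{U(l + n)} X`. -/
def Verma (l n : LieSubalgebra k L) (X : Type*) [AddCommGroup X] [Module k X]
    [LieRingModule l X] [LieModule k l X] : Type _ :=
  (U k L ⊗[k] X) ⧸ vermaRel l n X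

namespace Verma

variable (l n : LieSubalgebra k L) (X : Type*) [AddCommGroup X] [Module k X]
    [LieRingModule l X] [LieModule k l X]

instance : AddCommGroup (Verma l n X) :=
  inferInstanceAs (AddCommGroup ((U k L ⊗[k] X) ⧸ vermaRel l n X))

instance : Module (U k L) (Verma l n X) :=
  inferInstanceAs (Module (U k L) ((U k L ⊗[k] X) ⧸ vermaRel l n X))

instance : Module k (Verma l n X) :=
  inferInstanceAs (Module k ((U k L ⊗[k] X) ⧸ vermaRel l n X))

instance : IsScalarTower k (U k L) (Verma l n X) :=
  inferInstanceAs (IsScalarTower k (U k L) ((U k L ⊗[k] X) ⧸ vermaRel l n X))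

instance : LieRingModule L (Verma l n X) where
  bracket x m := iota k L x • m
  add_lie x y m := by
    change iota k L (x + y) • m = _
    rw [map_add, add_smul]
  lie_add x m m' := smul_add (iota k L x) m m'
  leibniz_lie x y m := by
    change iota k L x • iota k L y • m = iota k L ⁅x, y⁆ • m + iota k L y • iota k L x • m
    rw [iota_lie, sub_smul, mul_smul, mul_smul, sub_add_cancel]

lemma lie_def (x : L) (m : Verma l n X) : ⁅x, m⁆ = iota k L x • m := rfl

instance : LieModule k L (Verma l n X) where
  smul_lie r x m := by
    rw [lie_def, map_smul, smul_assoc]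
    rfl
  lie_smul r x m := by
    rw [lie_def, lie_def]
    exact smul_comm (iota k L x) r m

/-- The embedding `X → M_X`, `x ↦ 1 ⊗ x`. -/
def top : X →ₗ[k] Verma l n X :=
  ((vermaRel l n X).mkQ.restrictScalars k) ∘ₗ TensorProduct.mk k (U k L) X 1

/-- The subspace `n⁻ M_X` of `M_X`; it is complementary to `1 ⊗ X` if `L = n⁻ ⊕ l ⊕ n`. -/
def lower (nm : LieSubalgebra k L) : Submodule k (Verma l n X) :=
  Submodule.span k {m | ∃ (y : nm) (m' : Verma l n X), m = ⁅(y : L), m'⁆}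

end Verma

variable (nm l np : LieSubalgebra k L)

/-- `φ : Y → X ⊗ V` is the expectation value of `Φ : M_Y → M_X ⊗ V`, i.e. the composition of `Φ` with
the embedding `Y → M_Y` and the projection `M_X → X` along `n⁻ M_X`. -/
def HasExpectation {Y X V : Type*} [AddCommGroup Y] [Module k Y] [LieRingModule l Y]
    [LieModule k l Y] [AddCommGroup X] [Module k X] [LieRingModule l X] [LieModule k l X]
    [AddCommGroup V] [Module k V]
    (Φ : Verma l np Y →ₗ[k] Verma l np X ⊗[k] V) (φ : Y →ₗ[k] X ⊗[k] V) : Prop :=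
  ∀ y : Y, Φ (Verma.top l np Y y) - (Verma.top l np X).rTensor V (φ y) ∈
    LinearMap.range ((Verma.lower l np X nm).subtype.rTensor V)

/-- `F` is the value at the `l`-module `X` of the dynamical twist on the `L`-modules `V`, `W`: the
expectation value of the composition
`M_{X ⊗ V ⊗ W} → M_{X ⊗ V} ⊗ W → M_X ⊗ V ⊗ W`
of the morphisms of `L`-modules whose expectation values are the identity maps. -/
def IsDynTwist (X V W : Type*) [AddCommGroup X] [Module k X] [LieRingModule l X] [LieModule k l X]
    [AddCommGroup V] [Module k V] [LieRingModule L V] [LieModule k L V]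
    [AddCommGroup W] [Module k W] [LieRingModule L W] [LieModule k L W]
    (F : (X ⊗[k] V) ⊗[k] W →ₗ[k] X ⊗[k] (V ⊗[k] W)) : Prop :=
  ∃ (Φ : Verma l np ((X ⊗[k] V) ⊗[k] W) →ₗ⁅k,L⁆ Verma l np (X ⊗[k] V) ⊗[k] W)
    (Ψ : Verma l np (X ⊗[k] V) →ₗ⁅k,L⁆ Verma l np X ⊗[k] V),
    HasExpectation nm l np (X := X ⊗[k] V) Φ.toLinearMap LinearMap.id ∧
    HasExpectation nm l np (X := X) Ψ.toLinearMap LinearMap.id ∧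
    HasExpectation nm l np (X := X)
      ((TensorProduct.assoc k (Verma l np X) V W).toLinearMap ∘ₗ
        Ψ.toLinearMap.rTensor W ∘ₗ Φ.toLinearMap) F

variable {l}

/-- The one dimensional `l`-module `ℂ_χ` defined by a linear form `χ` on `l` that vanishes on
`[l, l]`. -/
def CharModule (χ : LieAlgebra.LieCharacter k l) : Type v := (fun _ => k) χ

namespace CharModule

variable (χ : LieAlgebra.LieCharacter k l)

instance : AddCommGroup (CharModule χ) := inferInstanceAs (AddCommGroup k)

instance : Module k (CharModule χ) := inferInstanceAs (Module k k)

instance : Module.Finite k (CharModule χ) := inferInstanceAs (Module.Finite k k)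

instance : LieRingModule l (CharModule χ) where
  bracket x m := χ x • m
  add_lie x y m := by
    change χ (x + y) • m = χ x • m + χ y • m
    rw [map_add, add_smul]
  lie_add x m m' := smul_add (χ x) m m'
  leibniz_lie x y m := by
    change χ x • χ y • m = χ ⁅x, y⁆ • m + χ y • χ x • m
    rw [LieAlgebra.lieCharacter_apply_lie, zero_smul, zero_add, smul_comm]

instance : LieModule k l (CharModule χ) where
  smul_lie r x m := by
    change χ (r • x) • m = r • χ x • m
    rw [map_smul, smul_assoc]
  lie_smul r x m := by
    change χ x • r • m = r • χ x • m
    rw [smul_comm]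

end CharModule

/-- `F` is the operator `F^χ_{V,W}` on `V ⊗ W`, i.e. `id ⊗ F` is the value of the dynamical twist at
the one dimensional module of the character `χ`. -/
def IsCharTwist (χ : LieAlgebra.LieCharacter k l) (V W : Type*)
    [AddCommGroup V] [Module k V] [LieRingModule L V] [LieModule k L V]
    [AddCommGroup W] [Module k W] [LieRingModule L W] [LieModule k L W]
    (F : V ⊗[k] W →ₗ[k] V ⊗[k] W) : Prop :=
  IsDynTwist nm l np (CharModule χ) V W
    (F.lTensor (CharModule χ) ∘ₗ (TensorProduct.assoc k (CharModule χ) V W).toLinearMap)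

/-- A linear form vanishing on brackets, as a character. -/
def mkCharacter (χ : l →ₗ[k] k) (h : ∀ x y : l, χ ⁅x, y⁆ = 0) : LieAlgebra.LieCharacter k l :=
  { χ with
    map_lie' := fun {x y} => by
      rw [LieRing.of_associative_ring_bracket, mul_comm, sub_self]
      exact h x y }

end Twist

/-! ## The dynamical multiplication at `λ(t)/t` -/

section Star

attribute [local instance 100] LieRing.ofAssociativeRing

variable {g : Type u} [LieRing g] [LieAlgebra ℂ g]

/-- The subalgebra `K ⊗ l` of `K ⊗ g`. -/
def extendScalars (K : Type v) [Field K] [Algebra ℂ K] (l : LieSubalgebra ℂ g) :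
    LieSubalgebra K (K ⊗[ℂ] g) :=
  { l.toSubmodule.baseChange K with
    lie_mem' := by
      intro x y hx hy
      simp only [AddSubsemigroup.mem_carrier, AddSubmonoid.mem_toSubsemigroup,
        Submodule.mem_toAddSubmonoid] at hx hy ⊢
      rw [Submodule.baseChange_eq_span] at hx hy ⊢
      induction hx, hy using Submodule.span_induction₂ with
      | mem_mem x y hx hy =>
        obtain ⟨x', hx', rfl⟩ := hx
        obtain ⟨y', hy', rfl⟩ := hy
        refine Submodule.subset_span ⟨⁅x', y'⁆, l.lie_mem hx' hy', ?_⟩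
        simp
      | zero_left y hy => simp
      | zero_right x hx => simp
      | add_left x y z _ _ _ h1 h2 => rw [add_lie]; exact add_mem h1 h2
      | add_right x y z _ _ _ h1 h2 => rw [lie_add]; exact add_mem h1 h2
      | smul_left r x y _ _ h => rw [smul_lie]; exact Submodule.smul_mem _ _ h
      | smul_right r x y _ _ h => rw [lie_smul]; exact Submodule.smul_mem _ _ h }

/-- The space `c^* ⊆ g^*` for the decomposition `g = n⁻ ⊕ l ⊕ n⁺`, where `c` is the centre of `l`:
the linear forms on `l = c ⊕ [l, l]` that vanish on `[l, l]`, extended by zero to `n⁻` and `n⁺`. -/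
def centreDual (nm l np : LieSubalgebra ℂ g) : Submodule ℂ (Module.Dual ℂ g) where
  carrier := {ξ | (∀ x ∈ nm, ξ x = 0) ∧ (∀ x ∈ np, ξ x = 0) ∧ ∀ x ∈ l, ∀ y ∈ l, ξ ⁅x, y⁆ = 0}
  add_mem' := by
    rintro a b ⟨h1, h2, h3⟩ ⟨h1', h2', h3'⟩
    refine ⟨fun x hx => ?_, fun x hx => ?_, fun x hx y hy => ?_⟩
    · simp [h1 x hx, h1' x hx]
    · simp [h2 x hx, h2' x hx]
    · simp [h3 x hx y hy, h3' x hx y hy]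
  zero_mem' := by simp
  smul_mem' := by
    rintro r a ⟨h1, h2, h3⟩
    refine ⟨fun x hx => ?_, fun x hx => ?_, fun x hx y hy => ?_⟩
    · simp [h1 x hx]
    · simp [h2 x hx]
    · simp [h3 x hx y hy]

variable {nm l np : LieSubalgebra ℂ g}

/-- The field `ℂ((t))` of formal Laurent series. -/
def LaurentC : Type := LaurentSeries ℂ

instance : Field LaurentC := inferInstanceAs (Field (LaurentSeries ℂ))

/-- The constants in `ℂ((t))`. -/
def laurentC : ℂ →+* LaurentC := (HahnSeries.C : ℂ →+* LaurentSeries ℂ)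

instance : Algebra ℂ LaurentC := laurentC.toAlgebra

/-- The Laurent series `(a₀ + a₁ t + a₂ t² + …)/t`. -/
def divT (a : ℕ → ℂ) : LaurentC :=
  (HahnSeries.single (-1 : ℤ) (1 : ℂ) * HahnSeries.ofPowerSeries ℤ ℂ (PowerSeries.mk a) :
    LaurentSeries ℂ)

/-- The coefficient at `t^n`. -/
def laurentCoeff (n : ℤ) : LaurentC →ₗ[ℂ] ℂ where
  toFun a := HahnSeries.coeff (Γ := ℤ) (R := ℂ) a n
  map_add' _ _ := rfl
  map_smul' r a := by
    have key : ∀ b : LaurentSeries ℂ, (HahnSeries.C r * b).coeff n = r * b.coeff n := fun b => by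
      rw [HahnSeries.C_mul_eq_smul]; rfl
    exact key a

lemma laurentCoeff_ext {a b : LaurentC} (h : ∀ n, laurentCoeff n a = laurentCoeff n b) : a = b :=
  HahnSeries.ext (funext h)

lemma laurentCoeff_divT (a : ℕ → ℂ) (n : ℤ) :
    laurentCoeff n (divT a) = if 0 ≤ n + 1 then a (n + 1).toNat else 0 := by
  change HahnSeries.coeff (HahnSeries.single (-1 : ℤ) (1 : ℂ) *
    HahnSeries.ofPowerSeries ℤ ℂ (PowerSeries.mk a)) n = _
  obtain ⟨m, rfl⟩ : ∃ m, n = m + (-1) := ⟨n + 1, by ring⟩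
  rw [mul_comm, HahnSeries.coeff_mul_single_add, mul_one]
  simp only [neg_add_cancel_right]
  split_ifs with h
  · obtain ⟨j, rfl⟩ := Int.eq_ofNat_of_zero_le h
    rw [HahnSeries.ofPowerSeries_apply_coeff]
    simp
  · rw [HahnSeries.ofPowerSeries_apply]
    apply HahnSeries.embDomain_of_notMem_range
    rintro ⟨j, hj⟩
    apply h
    rw [← hj]
    exact Int.natCast_nonneg j

/-- The linear form `λ(t)/t : g → ℂ((t))` of a formal path `λ(t) = λ₀ + t λ₁ + …` in `c^*`. -/
def pathForm (lam : ℕ → centreDual nm l np) : g →ₗ[ℂ] LaurentC where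
  toFun x := divT fun i => (lam i : Module.Dual ℂ g) x
  map_add' x y := by
    apply laurentCoeff_ext; intro n
    rw [map_add]
    simp only [laurentCoeff_divT]
    split_ifs <;> simp
  map_smul' r x := by
    apply laurentCoeff_ext; intro n
    rw [RingHom.id_apply, map_smul]
    simp only [laurentCoeff_divT]
    split_ifs <;> simp

/-- The character `λ(t)/t` of `ℂ((t)) ⊗ l`. -/
def pathCharacter (lam : ℕ → centreDual nm l np) :
    LieAlgebra.LieCharacter LaurentC (extendScalars LaurentC l) :=
  mkCharacter
    (((pathForm lam).liftBaseChange LaurentC) ∘ₗ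
      (extendScalars LaurentC l).toSubmodule.subtype) (by
    rintro ⟨x, hx⟩ ⟨y, hy⟩
    change (pathForm lam).liftBaseChange LaurentC ⁅x, y⁆ = 0
    replace hx : x ∈ l.toSubmodule.baseChange LaurentC := hx
    replace hy : y ∈ l.toSubmodule.baseChange LaurentC := hy
    rw [Submodule.baseChange_eq_span] at hx hy
    induction hx, hy using Submodule.span_induction₂ with
    | mem_mem x y hx hy =>
      obtain ⟨x', hx', rfl⟩ := hx
      obtain ⟨y', hy', rfl⟩ := hy
      have : pathForm lam ⁅x', y'⁆ = 0 := by
        apply laurentCoeff_ext; intro n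
        change laurentCoeff n (divT _) = _
        rw [laurentCoeff_divT, map_zero]
        split_ifs
        · exact (lam _).2.2.2 x' hx' y' hy'
        · rfl
      simp [this]
    | zero_left y hy => simp
    | zero_right x hx => simp
    | add_left x y z _ _ _ h1 h2 => rw [add_lie, map_add, h1, h2, add_zero]
    | add_right x y z _ _ _ h1 h2 => rw [lie_add, map_add, h1, h2, add_zero]
    | smul_left r x y _ _ h => rw [smul_lie, map_smul, h, smul_zero]
    | smul_right r x y _ _ h => rw [lie_smul, map_smul, h, smul_zero])

/-- `ℂ((t)) ⊗ 𝒜(G)`. It is a module over `ℂ((t)) ⊗ g` by the action `ρ₂`. -/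
abbrev PolyFunT (g : Type u) [LieRing g] [LieAlgebra ℂ g] : Type u := LaurentC ⊗[ℂ] PolyFun g

/-- The coefficient at `t^n`, `ℂ((t)) ⊗ 𝒜(G) → 𝒜(G)`. -/
def coeffT (n : ℤ) : PolyFunT g →ₗ[ℂ] PolyFun g :=
  (TensorProduct.lid ℂ (PolyFun g)).toLinearMap ∘ₗ (laurentCoeff n).rTensor (PolyFun g)

/-- A sequence of bilinear operations `⋆₀, ⋆₁, …` on `𝒜(G)` is the dynamical multiplication
`a ⋆ b = ∑ tⁿ a ⋆ₙ b` at `λ(t)/t`: it is the composition of the multiplication of `𝒜(G)` with the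
dynamical twist `F^{λ(t)/t}` (over the field `ℂ((t))`), acting on `𝒜(G) ⊗ 𝒜(G)` via `ρ₂`. In
particular `a ⋆ b` contains no negative powers of `t`. -/
def IsDynMul (lam : ℕ → centreDual nm l np)
    (star : ℕ → PolyFun g →ₗ[ℂ] PolyFun g →ₗ[ℂ] PolyFun g) : Prop :=
  ∃ F : PolyFunT g ⊗[LaurentC] PolyFunT g →ₗ[LaurentC] PolyFunT g ⊗[LaurentC] PolyFunT g,
    IsCharTwist (extendScalars LaurentC nm) (extendScalars LaurentC np) (pathCharacter lam)
      (PolyFunT g) (PolyFunT g) F ∧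
    ∀ (a b : PolyFun g) (n : ℤ),
      coeffT n (LinearMap.mul' LaurentC (PolyFunT g)
        (F ((1 ⊗ₜ[ℂ] a) ⊗ₜ[LaurentC] (1 ⊗ₜ[ℂ] b)))) =
      if 0 ≤ n then star n.toNat a b else 0

end Star

/-! ## Levi decompositions, formal series, the Kirillov bracket, deformation quantizations -/

section Statement

variable {g : Type u} [LieRing g] [LieAlgebra ℂ g]

/-- A decomposition `g = n⁻ ⊕ l ⊕ n⁺` of a semisimple Lie algebra, where `l` is a Levi subalgebra
(the centralizer of an element of a Cartan subalgebra), and `n⁻`, `n⁺` are subalgebras normalized by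
`l`. Then `n⁻` and `n⁺` are automatically sums of root spaces, for two opposite sets of roots, and
`l ⊕ n⁻` and `l ⊕ n⁺` are opposite parabolic subalgebras with nilradicals `n⁻` and `n⁺`. -/
structure IsLeviDecomposition (nm l np : LieSubalgebra ℂ g) : Prop where
  levi : ∃ H : LieSubalgebra ℂ g, H.IsCartanSubalgebra ∧ ∃ s ∈ H, ∀ x : g, x ∈ l ↔ ⁅s, x⁆ = 0
  lie_mem_nm : ∀ x ∈ l, ∀ y ∈ nm, ⁅x, y⁆ ∈ nm
  lie_mem_np : ∀ x ∈ l, ∀ y ∈ np, ⁅x, y⁆ ∈ np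
  isInternal : DirectSum.IsInternal ![nm.toSubmodule, l.toSubmodule, np.toSubmodule]

/-- The product of formal series `e = ∑ tⁱ eᵢ ∈ E[[t]]`, `f = ∑ tʲ fⱼ ∈ F[[t]]` with respect to the
`ℂ[[t]]`-bilinear extension of a bilinear map `∑ tⁿ Bₙ : E × F → N[[t]]`. Formal series are
represented by the sequences of their coefficients. -/
def seriesMul {E F N : Type*} [AddCommGroup E] [Module ℂ E] [AddCommGroup F] [Module ℂ F]
    [AddCommGroup N] [Module ℂ N] (B : ℕ → E →ₗ[ℂ] F →ₗ[ℂ] N) (e : ℕ → E) (f : ℕ → F) : ℕ → N :=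
  fun n => ∑ p ∈ Finset.HasAntidiagonal.antidiagonal n, ∑ q ∈ Finset.HasAntidiagonal.antidiagonal p.2, B p.1 (e q.1) (f q.2)

/-- `∑ tⁿ Bₙ` is a deformation quantization of the commutative algebra `R` with bracket `P`: a
unital associative product on `R[[t]]` with `a ⋆ b = a b + O(t)` and
`a ⋆ b - b ⋆ a = t P(a, b) + O(t²)`. -/
structure IsDeformationQuantization {R : Type*} [CommRing R] [Algebra ℂ R]
    (P : R →ₗ[ℂ] R →ₗ[ℂ] R) (B : ℕ → R →ₗ[ℂ] R →ₗ[ℂ] R) : Prop where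
  assoc : ∀ a b c : ℕ → R, seriesMul B (seriesMul B a b) c = seriesMul B a (seriesMul B b c)
  one_mul : ∀ a : ℕ → R, seriesMul B (Pi.single 0 1) a = a
  mul_one : ∀ a : ℕ → R, seriesMul B a (Pi.single 0 1) = a
  zeroth : ∀ a b : R, B 0 a b = a * b
  first : ∀ a b : R, B 1 a b - B 1 b a = P a b

/-- The Kirillov bracket on the functions on the orbit `M = G μ ⊆ g^*`, where `l` is the stabilizer
of `μ`: the Poisson bracket with `{x, y} = [x, y]` for the linear coordinates `x, y ∈ g` restricted
to `M` (these generate the algebra of functions, as the orbit of a semisimple `μ` is closed). -/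
structure IsKirillovBracket [FiniteDimensional ℂ g] (l : LieSubalgebra ℂ g) (μ : Module.Dual ℂ g)
    (P : orbitFun l →ₗ[ℂ] orbitFun l →ₗ[ℂ] orbitFun l) : Prop where
  skew : ∀ a, P a a = 0
  jacobi : ∀ a b c, P a (P b c) + P b (P c a) + P c (P a b) = 0
  leibniz : ∀ a b c, P a (b * c) = P a b * c + b * P a c
  coord : ∀ (x y : g) (hx : coordFun μ x ∈ orbitFun l) (hy : coordFun μ y ∈ orbitFun l),
    (P ⟨_, hx⟩ ⟨_, hy⟩ : PolyFun g) = coordFun μ ⁅x, y⁆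

/-- The operations `Bₙ` on `𝒜(M)` are the restrictions of the operations `⋆ₙ` on `𝒜(G)`. -/
def IsRestriction (l : LieSubalgebra ℂ g) (star : ℕ → PolyFun g →ₗ[ℂ] PolyFun g →ₗ[ℂ] PolyFun g)
    (B : ℕ → orbitFun l →ₗ[ℂ] orbitFun l →ₗ[ℂ] orbitFun l) : Prop :=
  ∀ n a b, (B n a b : PolyFun g) = star n a b

section Sections

variable (V W : Type*) [AddCommGroup V] [Module ℂ V] [AddCommGroup W] [Module ℂ W]

/-- The tensor product of sections, `(a ⊗ v) (b ⊗ w) = a b ⊗ v ⊗ w`. -/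
def sectionTensor : PolyFun g ⊗[ℂ] V →ₗ[ℂ] PolyFun g ⊗[ℂ] W →ₗ[ℂ] PolyFun g ⊗[ℂ] (V ⊗[ℂ] W) :=
  TensorProduct.map₂ (LinearMap.mul ℂ (PolyFun g)) (TensorProduct.mk ℂ V W)

/-- The product of sections, `(a ⊗ v) ⋆ₙ (b ⊗ w) = (a ⋆ₙ b) ⊗ v ⊗ w`. -/
def sectionMul (star : ℕ → PolyFun g →ₗ[ℂ] PolyFun g →ₗ[ℂ] PolyFun g) (n : ℕ) :
    PolyFun g ⊗[ℂ] V →ₗ[ℂ] PolyFun g ⊗[ℂ] W →ₗ[ℂ] PolyFun g ⊗[ℂ] (V ⊗[ℂ] W) :=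
  TensorProduct.map₂ (star n) (TensorProduct.mk ℂ V W)

/-- The product of a function and a section, `a ⋆ₙ (b ⊗ v) = (a ⋆ₙ b) ⊗ v`. -/
def leftAct (l : LieSubalgebra ℂ g) (star : ℕ → PolyFun g →ₗ[ℂ] PolyFun g →ₗ[ℂ] PolyFun g)
    (n : ℕ) : orbitFun l →ₗ[ℂ] PolyFun g ⊗[ℂ] V →ₗ[ℂ] PolyFun g ⊗[ℂ] V :=
  LinearMap.rTensorHom V ∘ₗ star n ∘ₗ (orbitFun l).val.toLinearMap

/-- The product of a section and a function, `(a ⊗ v) ⋆ₙ b = (a ⋆ₙ b) ⊗ v`. -/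
def rightAct (l : LieSubalgebra ℂ g) (star : ℕ → PolyFun g →ₗ[ℂ] PolyFun g →ₗ[ℂ] PolyFun g)
    (n : ℕ) : PolyFun g ⊗[ℂ] V →ₗ[ℂ] orbitFun l →ₗ[ℂ] PolyFun g ⊗[ℂ] V :=
  (LinearMap.rTensorHom V ∘ₗ (star n).flip ∘ₗ (orbitFun l).val.toLinearMap).flip

end Sections

variable {nm l np : LieSubalgebra ℂ g}

/-- An element `α ∈ c^*` as a character of `l`. -/
def charOf (α : centreDual nm l np) : LieAlgebra.LieCharacter ℂ l :=
  mkCharacter ((α : Module.Dual ℂ g) ∘ₗ l.toSubmodule.subtype)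
    (fun x y => α.2.2.2 x x.2 y y.2)

/-- The path `λ(t) - t α`. -/
def shiftPath (lam : ℕ → centreDual nm l np) (α : centreDual nm l np) : ℕ → centreDual nm l np :=
  lam - Pi.single 1 α

end Statement

end DynQuant

end

open scoped TensorProduct

noncomputable section

namespace DynQuant

universe u v w

/-! ## The Poincaré–Birkhoff–Witt theorem in characteristic zero -/

section PBW

open Coalgebra WithConv

variable {k : Type v} [Field k] {L : Type u} [LieRing L] [LieAlgebra k L]

/-! The product is read off from intertwining operators. Call an `l`-module X generic if the pairing
of U(n⁺) and U(n⁻) with values in End X is nondegenerate in every degree (`Triangular.IsGeneric`).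
If X is generic and n⁺ acts locally nilpotently on W, each element of X ⊗ W is the expectation value
of exactly one vector of M_X ⊗ W killed by n⁺ (`exists_singular`, `singular_ext`). Hence morphisms
M_Y → M_X ⊗ W correspond to `l`-morphisms Y → X ⊗ W, and the dynamical twist exists and is unique
(`isDynTwist_iff`).

Associativity comes from the same correspondence. For an algebra A on which L acts by derivations,
multiplication A ⊗ A → A is a morphism, so iterated intertwiners followed by multiplication are
again intertwiners; they are compared through expectation values and the associativity of A
(`starMap_assoc`). An element a of weight χ' − χ is a morphism ℂ_χ' → ℂ_χ ⊗ A, which gives a ⋆_χ (b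
⋆_χ' c) = (a ⋆_χ b) ⋆_χ c (`charStar_assoc`). Weight zero yields the algebra of functions on the
orbit and its left modules; weight −α yields the right modules over the algebra at the path λ(t) −
tα.

It remains to prove that λ(t)/t is generic and that no negative powers of t occur. The forms λ₀
vanish on n± and have stabilizer `l`, so λ₀([·,·]) pairs n⁺ and n⁻ perfectly; choose dual bases e_i,
f_j and replace f_j by t f_j. On suitable ℂ[[t]]-lattices the pole of the character cancels the
factor t, and modulo t each e_i acts on words in the f_j as a derivative, up to longer words. The
Gram matrix modulo t is then triangular with respect to the number of letters, with nonzero natural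
numbers on the diagonal (`pairing_lattice`), and Nakayama's lemma inverts it over ℂ[[t]]
(`famLat_le_map_gram`). A word of r letters t f_j acts on A with a factor t^r, so only words of at
most one letter matter modulo t²: a ⋆ b = ab − t ∑ (f_i a)(e_i b) + O(t²) (`charStar_expansion`).
The antisymmetric part of the first order term inverts λ₀([·,·]), hence is the Kirillov bracket
(`firstOrder_coordFun`); its Jacobi identity is the t² part of associativity.

Two structural inputs are the Poincaré–Birkhoff–Witt theorem, proved by pairing words with products
of functionals, and a grading element: the sum of the coroots of the roots of n⁺ is central in `l`
and acts on n⁺ with positive integral eigenvalues (`exists_triangular`). -/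

lemma env_submodule_eq_top (S : Submodule k (U k L)) (h1 : 1 ∈ S)
    (hmul : ∀ (x : L), ∀ y ∈ S, iota k L x * y ∈ S) : S = ⊤ := by
  -- The elements whose left multiplication preserves S form a subalgebra containing L. The
  -- universal property maps U(L) into it, and uniqueness makes the composite with the inclusion the
  -- identity, so it is everything.
  let T : Subalgebra k (U k L) :=
    { carrier := {a | ∀ y ∈ S, a * y ∈ S}
      mul_mem' := fun {a b} ha hb y hy => by rw [mul_assoc]; exact ha _ (hb y hy)
      add_mem' := fun {a b} ha hb y hy => by rw [add_mul]; exact S.add_mem (ha y hy) (hb y hy)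
      algebraMap_mem' := fun r y hy => by
        rw [← Algebra.smul_def]; exact S.smul_mem r hy }
  let f : U k L →ₐ[k] T := envLift k
    { toFun := fun x => ⟨iota k L x, hmul x⟩
      map_add' := fun x y => Subtype.ext (map_add _ x y)
      map_smul' := fun r x => Subtype.ext (map_smul _ r x) }
    (fun x y => Subtype.ext (iota_lie x y))
  have hf : T.val.comp f = AlgHom.id k _ := by
    apply enveloping_hom_ext
    intro x
    change ((f (iota k L x) : T) : U k L) = _
    rw [envLift_iota]; rfl
  rw [Submodule.eq_top_iff']
  intro a
  have : a = (f a : T) := congr($hf a).symm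
  rw [this]
  simpa using (f a).2 1 h1

lemma env_induction {P : U k L → Prop} (h1 : P 1) (hadd : ∀ a b, P a → P b → P (a + b))
    (hsmul : ∀ (r : k) a, P a → P (r • a)) (hmul : ∀ x a, P a → P (iota k L x * a)) (a : U k L) :
    P a := by
  let S : Submodule k (U k L) :=
    { carrier := {a | P a}, add_mem' := fun {a b} => hadd a b,
      zero_mem' := by simpa using hsmul 0 1 h1, smul_mem' := fun r a => hsmul r a }
  have : S = ⊤ := env_submodule_eq_top S h1 fun x y hy => hmul x y hy
  exact (this ▸ Submodule.mem_top : a ∈ S)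

variable {ι : Type w} (b : Module.Basis ι k L)

/-- The product of a word in the basis vectors. -/
def word (w : List ι) : U k L := (w.map fun i => iota k L (b i)).prod

@[simp] lemma word_nil : word b [] = 1 := rfl
@[simp] lemma word_cons (i : ι) (w : List ι) : word b (i :: w) = iota k L (b i) * word b w := by
  simp [word]
@[simp] lemma word_append (w w' : List ι) : word b (w ++ w') = word b w * word b w' := by
  simp [word]

/-- The filtration of `U(L)` by the length of words. -/
def wordFil (n : ℕ) : Submodule k (U k L) :=
  Submodule.span k {a | ∃ w : List ι, w.length < n ∧ a = word b w}

lemma word_mem_fil {w : List ι} {n : ℕ} (h : w.length < n) : word b w ∈ wordFil b n :=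
  Submodule.subset_span ⟨w, h, rfl⟩

lemma wordFil_mono {m n : ℕ} (h : m ≤ n) : wordFil b m ≤ wordFil b n :=
  Submodule.span_mono fun _ ⟨w, hw, e⟩ => ⟨w, hw.trans_le h, e⟩

lemma iota_mul_fil (x : L) {n : ℕ} {a : U k L} (ha : a ∈ wordFil b n) :
    iota k L x * a ∈ wordFil b (n + 1) := by
  induction ha using Submodule.span_induction with
  | mem a ha =>
    obtain ⟨w, hw, rfl⟩ := ha
    induction b.mem_span x using Submodule.span_induction with
    | mem x hx =>
      obtain ⟨i, rfl⟩ := hx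
      rw [← word_cons]
      exact word_mem_fil b (by simpa using hw)
    | zero => simp
    | add x y _ _ hx hy => rw [map_add, add_mul]; exact add_mem hx hy
    | smul r x _ hx => rw [map_smul, smul_mul_assoc]; exact Submodule.smul_mem _ _ hx
  | zero => simp
  | add a a' _ _ h h' => rw [mul_add]; exact add_mem h h'
  | smul r a _ h => rw [mul_smul_comm]; exact Submodule.smul_mem _ _ h

/-- Interchanging two neighbouring letters costs the word in which they are replaced by their
bracket, which is shorter by one letter. -/
lemma word_sub_word_of_perm {w w' : List ι} (h : w.Perm w') :
    word b w - word b w' ∈ wordFil b w.length := by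
  induction h with
  | nil => simp
  | cons i h ih =>
    rw [word_cons, word_cons, ← mul_sub]
    exact iota_mul_fil b _ ih
  | swap i j w =>
    simp only [word_cons, ← mul_assoc, ← sub_mul, ← iota_lie]
    exact iota_mul_fil b _ (word_mem_fil b (Nat.lt_succ_self _))
  | trans h1 h2 ih1 ih2 =>
    rw [← sub_add_sub_cancel]
    exact add_mem ih1 (h1.length_eq ▸ ih2)

/-- The spanning half of PBW: by induction on the length, any word agrees with the chosen ordering
of its letters modulo shorter words. It does not need L to embed into U(L). -/
lemma span_words_eq_top {P : Type*} (W : P → List ι)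
    (hW : Function.Surjective fun p => (W p : Multiset ι)) :
    Submodule.span k (Set.range fun p => word b (W p)) = ⊤ := by
  have key : ∀ n, wordFil b n ≤ Submodule.span k (Set.range fun p => word b (W p)) := by
    intro n
    induction n with
    | zero =>
      refine Submodule.span_le.2 ?_
      rintro _ ⟨w, hw, rfl⟩
      exact absurd hw (Nat.not_lt_zero _)
    | succ n ih =>
      refine Submodule.span_le.2 ?_
      rintro _ ⟨w, hw, rfl⟩
      obtain ⟨p, hp⟩ := hW (w : Multiset ι)
      have hperm : w.Perm (W p) := (Multiset.coe_eq_coe.1 hp).symm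
      rw [← sub_add_cancel (word b w) (word b (W p))]
      exact add_mem (ih (wordFil_mono b (Nat.lt_succ_iff.1 hw) (word_sub_word_of_perm b hperm)))
        (Submodule.subset_span ⟨p, rfl⟩)
  have h2 : (⨆ n, wordFil b n) = ⊤ := by
    have hdir : Directed (· ≤ ·) (wordFil b) := (monotone_nat_of_le_succ
      fun n => wordFil_mono b n.le_succ).directed_le
    apply env_submodule_eq_top
    · exact Submodule.mem_iSup_of_mem 1 (word_mem_fil b (w := []) (by simp))
    · intro x y hy
      obtain ⟨n, hn⟩ := (Submodule.mem_iSup_of_directed _ hdir).1 hy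
      exact Submodule.mem_iSup_of_mem (n + 1) (iota_mul_fil b x hn)
  exact top_le_iff.1 (h2 ▸ iSup_le key)

/-- The derivation `f ↦ (u ↦ f (u x))` of the algebra of functionals on `U(L)`. -/
def convRight (x : L) (f : WithConv (U k L →ₗ[k] k)) : WithConv (U k L →ₗ[k] k) :=
  toConv (f.ofConv ∘ₗ LinearMap.mulRight k (iota k L x))

lemma convRight_apply (x : L) (f : WithConv (U k L →ₗ[k] k)) (a : U k L) :
    convRight x f a = f (a * iota k L x) := rfl

lemma conv_ext {f g : WithConv (U k L →ₗ[k] k)} (h : ∀ a, f a = g a) : f = g :=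
  WithConv.ofConv_injective (LinearMap.ext h)

/-- Elements of L are primitive for the coproduct, so right translation by them is a derivation of
the dual convolution product. -/
lemma convRight_mul (x : L) (f g : WithConv (U k L →ₗ[k] k)) :
    convRight x (f * g) = convRight x f * g + f * convRight x g := by
  apply conv_ext; intro z
  change (f * g) (z * iota k L x) = (convRight x f * g) z + (f * convRight x g) z
  rw [LinearMap.convMul_apply, LinearMap.convMul_apply, LinearMap.convMul_apply,
    Bialgebra.comul_mul, comul_iota]
  induction (comul z : U k L ⊗[k] U k L) using TensorProduct.induction_on with
  | zero => simp
  | tmul p q =>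
    simp only [mul_add, Algebra.TensorProduct.tmul_mul_tmul, mul_one, map_add,
      TensorProduct.map_tmul, LinearMap.mul'_apply]
    rfl
  | add p q hp hq =>
    simp only [add_mul, map_add] at hp hq ⊢
    rw [hp, hq]; ring

lemma conv_mul_one (f g : WithConv (U k L →ₗ[k] k)) : (f * g) 1 = f 1 * g 1 := by
  rw [LinearMap.convMul_apply, Bialgebra.comul_one, Algebra.TensorProduct.one_def]
  rfl

/-- The functional `f` vanishes on all words of length less than `n`. -/
def VanishOrder : ℕ → WithConv (U k L →ₗ[k] k) → Prop
  | 0, _ => True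
  | n + 1, f => f 1 = 0 ∧ ∀ x, VanishOrder n (convRight x f)

lemma VanishOrder.add {n : ℕ} {f g : WithConv (U k L →ₗ[k] k)} (hf : VanishOrder n f)
    (hg : VanishOrder n g) : VanishOrder n (f + g) := by
  induction n generalizing f g with
  | zero => trivial
  | succ n ih =>
    refine ⟨?_, fun x => ih (hf.2 x) (hg.2 x)⟩
    change f 1 + g 1 = 0
    rw [hf.1, hg.1, add_zero]

lemma VanishOrder.of_le {m n : ℕ} (h : m ≤ n) {f : WithConv (U k L →ₗ[k] k)}
    (hf : VanishOrder n f) : VanishOrder m f := by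
  induction m generalizing n f with
  | zero => trivial
  | succ m ih =>
    obtain ⟨n, rfl⟩ : ∃ n', n = n' + 1 := ⟨n - 1, by omega⟩
    exact ⟨hf.1, fun x => ih (by omega) (hf.2 x)⟩

/-- Orders of vanishing at the identity add up, by induction with the Leibniz rule. -/
lemma VanishOrder.mul {m n : ℕ} {f g : WithConv (U k L →ₗ[k] k)} (hf : VanishOrder m f)
    (hg : VanishOrder n g) : VanishOrder (m + n) (f * g) := by
  induction hN : m + n generalizing m n f g with
  | zero => trivial
  | succ N ih =>
    refine ⟨?_, fun x => ?_⟩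
    · rw [conv_mul_one]
      rcases m with _ | m
      · rcases n with _ | n
        · omega
        · rw [hg.1, mul_zero]
      · rw [hf.1, zero_mul]
    · rw [convRight_mul]
      refine VanishOrder.add ?_ ?_
      · rcases m with _ | m
        -- An order zero factor carries no condition and its derivative is again unrestricted; the
        -- order lost by differentiating is taken from the other factor.
        · exact (ih (m := 0) (n := n - 1) trivial (hg.of_le (by omega)) (by omega))
        · exact ih (hf.2 x) hg (by omega)
      · rcases n with _ | n
        · exact (ih (m := m - 1) (n := 0) (hf.of_le (by omega)) trivial (by omega))
        · exact ih hf (hg.2 x) (by omega)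

lemma VanishOrder.word_eq_zero {n : ℕ} {f : WithConv (U k L →ₗ[k] k)} (hf : VanishOrder n f)
    (w : List ι) (hw : w.length < n) : f (word b w) = 0 := by
  induction w using List.reverseRecOn generalizing n f with
  | nil =>
    obtain ⟨n, rfl⟩ : ∃ n', n = n' + 1 := ⟨n - 1, by simp at hw; omega⟩
    exact hf.1
  | append_singleton w i ih =>
    simp at hw
    obtain ⟨n, rfl⟩ : ∃ n', n = n' + 1 := ⟨n - 1, by omega⟩
    simpa [convRight_apply] using ih (hf.2 (b i)) (by omega)

variable (hι : Function.Injective (iota k L))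

-- A linear retraction of `iota` gives coordinates on L. Subtracting a multiple of the counit
-- removes the value at 1 without changing the values on L.
include hι in
lemma exists_coordinate_functionals [DecidableEq ι] :
    ∃ ℓ : ι → WithConv (U k L →ₗ[k] k), (∀ i, ℓ i 1 = 0) ∧
      ∀ i j, ℓ i (iota k L (b j)) = if j = i then 1 else 0 := by
  obtain ⟨p, hp⟩ := (iota k L).exists_leftInverse_of_injective (LinearMap.ker_eq_bot.2 hι)
  have hc : ∀ x : L, (counit (R := k) (iota k L x)) = (0 : k) := envCounit_iota k L
  refine ⟨fun i => toConv (b.coord i ∘ₗ p - (b.coord i (p 1)) • counit), fun i => ?_, fun i j => ?_⟩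
  · change b.coord i (p 1) - b.coord i (p 1) * counit (R := k) (1 : U k L) = 0
    rw [Bialgebra.counit_one, mul_one, sub_self]
  · change b.coord i (p (iota k L (b j))) - b.coord i (p 1) * counit (R := k) _ = _
    rw [hc, mul_zero, sub_zero, show p (iota k L (b j)) = b j from congr($hp (b j)),
      Module.Basis.coord_apply, b.repr_self, Finsupp.single_apply]

/-! ### Monomials in the coordinate functionals evaluated on words -/

section Pairing

variable [DecidableEq ι] {ℓ : ι → WithConv (U k L →ₗ[k] k)} (h1 : ∀ i, ℓ i 1 = 0)
  (hℓ : ∀ i j, ℓ i (iota k L (b j)) = if j = i then 1 else 0)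

include h1 in
omit [DecidableEq ι] in
lemma vanishOrder_prod (s : Multiset ι) :
    VanishOrder (Multiset.card s) ((s.map ℓ).prod) := by
  induction s using Multiset.induction_on with
  | empty => trivial
  | cons i s ih =>
    rw [Multiset.map_cons, Multiset.prod_cons, Multiset.card_cons, add_comm]
    exact VanishOrder.mul (m := 1) ⟨h1 i, fun _ => trivial⟩ ih

-- The functionals `ℓ i` behave like coordinates at the identity: to leading order b_i acts on
-- monomials as the partial derivative in the i-th coordinate, and the remainder vanishes to one
-- order more than that derivative.
include h1 hℓ in
lemma convRight_prod (s : Multiset ι) (i : ι) :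
    ∃ r, VanishOrder (Multiset.card s) r ∧ convRight (b i) ((s.map ℓ).prod) =
      (s.count i : k) • (((s.erase i).map ℓ).prod) + r := by
  induction s using Multiset.induction_on with
  | empty => exact ⟨convRight (b i) 1, trivial, by simp⟩
  | cons j s ih =>
    obtain ⟨r, hr, e⟩ := ih
    have hj : ∃ q, VanishOrder 1 q ∧ convRight (b i) (ℓ j) = (if i = j then 1 else 0) + q := by
      refine ⟨convRight (b i) (ℓ j) - (if i = j then 1 else 0), ⟨?_, fun _ => trivial⟩, by abel⟩
      change convRight (b i) (ℓ j) 1 - _ = 0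
      rw [convRight_apply, one_mul, hℓ]
      split_ifs
      · have : (1 : WithConv (U k L →ₗ[k] k)) 1 = 1 := by simp
        exact sub_eq_zero.2 this.symm
      · exact sub_zero _
    obtain ⟨q, hq, e'⟩ := hj
    refine ⟨q * (s.map ℓ).prod + ℓ j * r, ?_, ?_⟩
    · rw [Multiset.card_cons, add_comm]
      exact (hq.mul (vanishOrder_prod h1 s)).add
        (VanishOrder.mul (m := 1) ⟨h1 j, fun _ => trivial⟩ hr)
    · rw [Multiset.map_cons, Multiset.prod_cons, convRight_mul, e, e', Multiset.count_cons]
      by_cases hij : i = j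
      · subst hij
        by_cases his : i ∈ s
        · have hmul : ℓ i * ((s.erase i).map ℓ).prod = (s.map ℓ).prod := by
            rw [← Multiset.prod_cons, ← Multiset.map_cons, Multiset.cons_erase his]
          rw [mul_add (ℓ i), mul_smul_comm, hmul]
          simp only [if_true, Multiset.erase_cons_head, Nat.cast_add, Nat.cast_one, add_smul,
            one_smul, add_mul, one_mul]
          abel
        · simp [Multiset.count_eq_zero_of_notMem his, add_mul]
          abel
      · rw [Multiset.erase_cons_tail _ (by simpa [eq_comm] using hij), Multiset.map_cons,
          Multiset.prod_cons]
        simp [hij, mul_add]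
        abel

-- Differentiating a monomial once for each letter leaves a product of multiplicities, which is
-- nonzero in characteristic zero exactly when letters and monomial match.
include h1 hℓ in
lemma prod_word [CharZero k] (s : Multiset ι) (w : List ι) (hw : w.length = Multiset.card s) :
    (s.map ℓ).prod (word b w) ≠ 0 ↔ (w : Multiset ι) = s := by
  induction w using List.reverseRecOn generalizing s with
  | nil =>
    have : s = 0 := by simpa [eq_comm] using hw
    subst this
    simp
  | append_singleton w i ih =>
    obtain ⟨r, hr, e⟩ := convRight_prod b h1 hℓ s i
    have hlen : w.length + 1 = Multiset.card s := by simpa using hw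
    have h2 : (s.map ℓ).prod (word b (w ++ [i])) =
        (s.count i : k) * ((s.erase i).map ℓ).prod (word b w) := by
      have : (s.map ℓ).prod (word b (w ++ [i])) =
          convRight (b i) ((s.map ℓ).prod) (word b w) := by
        simp [convRight_apply]
      rw [this, e]
      change _ * _ + r (word b w) = _
      rw [hr.word_eq_zero b w (by omega), add_zero]
      rfl
    rw [h2]
    by_cases his : i ∈ s
    · have hc : (s.count i : k) ≠ 0 := Nat.cast_ne_zero.2 (Multiset.count_ne_zero.2 his)
      rw [mul_ne_zero_iff_left hc, ih (s.erase i) (by rw [Multiset.card_erase_of_mem his, Nat.pred_eq_sub_one]; omega)]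
      rw [← Multiset.coe_add, Multiset.coe_singleton]
      constructor
      · intro h; rw [h, add_comm, Multiset.singleton_add, Multiset.cons_erase his]
      · intro h; rw [← h, add_comm, Multiset.singleton_add, Multiset.erase_cons_head]
    · rw [Multiset.count_eq_zero_of_notMem his]
      simp only [Nat.cast_zero, zero_mul, ne_eq, not_true_eq_false, false_iff]
      rintro rfl
      simp at his

end Pairing

include hι in
lemma linearIndependent_words [CharZero k] {P : Type*} (W : P → List ι)
    (hW : Function.Injective fun p => (W p : Multiset ι)) :
    LinearIndependent k fun p => word b (W p) := by
  classical
  obtain ⟨ℓ, h1, hℓ⟩ := exists_coordinate_functionals b hι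
  rw [linearIndependent_iff]
  intro c hc
  by_contra hne
  -- In a relation take a longest word: its dual monomial vanishes on the shorter words and on the
  -- other words of the same length, so its coefficient is zero.
  obtain ⟨p, hp, hmax⟩ := c.support.exists_max_image (fun p => (W p).length)
    (Finsupp.support_nonempty_iff.2 hne)
  have h := congrArg (fun a => ((W p : Multiset ι).map ℓ).prod a) hc
  simp only [Finsupp.linearCombination_apply, Finsupp.sum] at h
  have h' : ∑ q ∈ c.support, c q * ((W p : Multiset ι).map ℓ).prod (word b (W q)) = 0 := by
    refine Eq.trans ?_ (h.trans (map_zero (((W p : Multiset ι).map ℓ).prod).ofConv))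
    exact ((map_sum (((W p : Multiset ι).map ℓ).prod).ofConv _ _).trans
      (Finset.sum_congr rfl fun q _ => map_smul _ _ _)).symm
  rw [Finset.sum_eq_single p] at h'
  · rcases mul_eq_zero.1 h' with h0 | h0
    · exact (Finsupp.mem_support_iff.1 hp) h0
    · exact (prod_word b h1 hℓ _ _ (by simp)).2 rfl h0
  · intro q hq hqp
    rcases (hmax q hq).lt_or_eq with hlt | heq
    · rw [(vanishOrder_prod h1 (W p : Multiset ι)).word_eq_zero b _ (by simpa using hlt), mul_zero]
    · have := (prod_word b h1 hℓ (W p) (W q) (by simpa using heq)).not.2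
        (fun e => hqp (hW e))
      rw [not_not.1 this, mul_zero]
  · intro h; exact absurd hp h

/-- **Poincaré–Birkhoff–Witt**: words that represent each multiset of basis vectors exactly once
form a basis of `U(L)`. -/
def pbwBasis [CharZero k] {P : Type*} (W : P → List ι)
    (hW : Function.Bijective fun p => (W p : Multiset ι)) : Module.Basis P k (U k L) :=
  .mk (linearIndependent_words b hι W hW.1) (span_words_eq_top b W hW.2).ge

lemma pbwBasis_apply [CharZero k] {P : Type*} (W : P → List ι)
    (hW : Function.Bijective fun p => (W p : Multiset ι)) (p : P) :
    pbwBasis b hι W hW p = word b (W p) := by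
  simp [pbwBasis]

end PBW

end DynQuant

end

open scoped TensorProduct

noncomputable section

namespace DynQuant

universe u v w

/-! ## Triangular decompositions of enveloping algebras -/

section Triangular

variable {k : Type v} [Field k] {L : Type u} [LieRing L] [LieAlgebra k L]

/-- The map of enveloping algebras of the inclusion of a subalgebra. -/
def envIncl (l : LieSubalgebra k L) : U k l →ₐ[k] U k L :=
  envLift k (iota k L ∘ₗ l.toSubmodule.subtype) (fun x y => iota_lie (x : L) (y : L))

@[simp] lemma envIncl_iota (l : LieSubalgebra k L) (x : l) :
    envIncl l (iota k l x) = iota k L (x : L) := envLift_iota k _ _ x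

lemma iota_subalgebra_injective (h : Function.Injective (iota k L)) (l : LieSubalgebra k L) :
    Function.Injective (iota k l) := by
  intro x y hxy
  have := congrArg (envIncl l) hxy
  rw [envIncl_iota, envIncl_iota] at this
  exact Subtype.ext (h this)

lemma envCounit_apply_iota (x : L) : Coalgebra.counit (R := k) (iota k L x) = (0 : k) :=
  envCounit_iota k L x

/-- A decomposition `L = n⁻ ⊕ l ⊕ n⁺` with bases of `n⁻` and `n⁺` that are homogeneous for the
grading by a central element of `l`. -/
structure Triangular (nm l np : LieSubalgebra k L) (ι : Type w) where
  e : Module.Basis ι k np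
  f : Module.Basis ι k nm
  deg : ι → ℕ
  deg_pos : ∀ i, 0 < deg i
  h : L
  h_mem : h ∈ l
  lie_h : ∀ z ∈ l, ⁅h, z⁆ = 0
  lie_h_e : ∀ i, ⁅h, (e i : L)⁆ = (deg i : k) • (e i : L)
  lie_h_f : ∀ i, ⁅h, (f i : L)⁆ = -((deg i : k) • (f i : L))
  lie_mem_nm : ∀ x ∈ l, ∀ y ∈ nm, ⁅x, y⁆ ∈ nm
  lie_mem_np : ∀ x ∈ l, ∀ y ∈ np, ⁅x, y⁆ ∈ np
  bijective : Function.Bijective fun p : nm × l × np => (p.1 + (p.2.1 + p.2.2) : L)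
  iota_injective : Function.Injective (iota k L)

namespace Triangular

variable {nm l np : LieSubalgebra k L} {ι : Type w} (D : Triangular nm l np ι)

include D in
lemma exists_decomp (x : L) : ∃ a ∈ nm, ∃ b ∈ l, ∃ c ∈ np, x = a + (b + c) := by
  obtain ⟨⟨a, b, c⟩, h⟩ := D.bijective.2 x
  exact ⟨a, a.2, b, b.2, c, c.2, h.symm⟩

/-- The decomposition as a linear equivalence. -/
def decompEquiv : (nm × l × np) ≃ₗ[k] L :=
  .ofBijective (nm.toSubmodule.subtype.coprod
    (l.toSubmodule.subtype.coprod np.toSubmodule.subtype)) D.bijective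

lemma decompEquiv_apply (p : nm × l × np) : D.decompEquiv p = p.1 + (p.2.1 + p.2.2 : L) := rfl

/-- The basis of `L` adapted to the decomposition. -/
def basis : Module.Basis (ι ⊕ Module.Basis.ofVectorSpaceIndex k l ⊕ ι) k L :=
  (D.f.prod ((Module.Basis.ofVectorSpace k l).prod D.e)).map D.decompEquiv

/-- A word for each triple of multisets of basis vectors. -/
def tripleWord {κ : Type*} (p : Multiset ι × Multiset κ × Multiset ι) : List (ι ⊕ κ ⊕ ι) :=
  p.1.toList.map Sum.inl ++ (p.2.1.toList.map (Sum.inr ∘ Sum.inl) ++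
    p.2.2.toList.map (Sum.inr ∘ Sum.inr))

lemma filterMap_map_some {α β : Type*} (s : Multiset α) {g : α → β} {φ : β → Option α}
    (h : ∀ a, φ (g a) = some a) : (s.map g).filterMap φ = s := by
  induction s using Multiset.induction_on with
  | empty => rfl
  | cons a s ih => rw [Multiset.map_cons, Multiset.filterMap_cons_some _ _ _ (h a), ih]

lemma filterMap_map_none {α β γ : Type*} (s : Multiset α) {g : α → β} {φ : β → Option γ}
    (h : ∀ a, φ (g a) = none) : (s.map g).filterMap φ = 0 := by
  induction s using Multiset.induction_on with
  | empty => rfl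
  | cons a s ih => rw [Multiset.map_cons, Multiset.filterMap_cons_none _ _ (h a), ih]

lemma tripleWord_bijective {κ : Type*} :
    Function.Bijective fun p : Multiset ι × Multiset κ × Multiset ι =>
      (tripleWord p : Multiset (ι ⊕ κ ⊕ ι)) := by
  have hcoe : ∀ p : Multiset ι × Multiset κ × Multiset ι,
      (tripleWord p : Multiset (ι ⊕ κ ⊕ ι)) =
        p.1.map Sum.inl + (p.2.1.map (Sum.inr ∘ Sum.inl) + p.2.2.map (Sum.inr ∘ Sum.inr)) := by
    intro p
    simp only [tripleWord, ← Multiset.coe_add, ← Multiset.map_coe, Multiset.coe_toList]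
  let q : Multiset (ι ⊕ κ ⊕ ι) → Multiset ι × Multiset κ × Multiset ι := fun m =>
    (m.filterMap (Sum.elim some fun _ => none),
      m.filterMap (Sum.elim (fun _ => none) (Sum.elim some fun _ => none)),
      m.filterMap (Sum.elim (fun _ => none) (Sum.elim (fun _ => none) some)))
  refine ⟨Function.LeftInverse.injective (g := q) ?_, fun m => ?_⟩
  · rintro ⟨s, t, r⟩
    simp only [hcoe, q, Multiset.filterMap_add]
    refine Prod.ext ?_ (Prod.ext ?_ ?_) <;> dsimp only
    · rw [filterMap_map_some s (by simp), filterMap_map_none t (by simp),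
        filterMap_map_none r (by simp)]
      simp
    · rw [filterMap_map_none s (by simp), filterMap_map_some t (by simp),
        filterMap_map_none r (by simp)]
      simp
    · rw [filterMap_map_none s (by simp), filterMap_map_none t (by simp),
        filterMap_map_some r (by simp)]
      simp
  · simp only [hcoe]
    induction m using Multiset.induction_on with
    | empty => exact ⟨(0, 0, 0), by simp⟩
    | cons a m ih =>
      obtain ⟨⟨s, t, r⟩, rfl⟩ := ih
      rcases a with i | i | i
      · exact ⟨(i ::ₘ s, t, r), by simp⟩
      · exact ⟨(s, i ::ₘ t, r), by simp⟩
      · exact ⟨(s, t, i ::ₘ r), by simp⟩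

lemma word_envIncl {κ : Type*} (l' : LieSubalgebra k L) (c : Module.Basis κ k l') {ι' : Type*}
    (b : Module.Basis ι' k L) (g : κ → ι') (h : ∀ i, b (g i) = (c i : L)) (w : List κ) :
    word b (w.map g) = envIncl l' (word c w) := by
  induction w with
  | nil => simp
  | cons i w ih => simp [ih, h]

lemma toList_bijective {κ : Type*} :
    Function.Bijective fun s : Multiset κ => (s.toList : Multiset κ) := by
  simp only [Multiset.coe_toList]
  exact Function.bijective_id

/-- The multiplication `U(n⁻) ⊗ U(l) ⊗ U(n⁺) → U(L)`. -/
def mulMap (nm l np : LieSubalgebra k L) : U k nm ⊗[k] (U k l ⊗[k] U k np) →ₗ[k] U k L :=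
  TensorProduct.lift ((LinearMap.mul k (U k L)).compl₁₂ (envIncl nm).toLinearMap
    (TensorProduct.lift ((LinearMap.mul k (U k L)).compl₁₂ (envIncl l).toLinearMap
      (envIncl np).toLinearMap)))

lemma mulMap_tmul (a : U k nm) (b : U k l) (c : U k np) :
    mulMap nm l np (a ⊗ₜ (b ⊗ₜ c)) = envIncl nm a * (envIncl l b * envIncl np c) := rfl

-- A word in the adapted basis, ordered as n⁻, `l`, n⁺, is a product of three words; hence
-- multiplication carries the tensor product of three PBW bases to a PBW basis.
include D in
lemma mulMap_bijective [CharZero k] : Function.Bijective (mulMap nm l np) := by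
  let c := Module.Basis.ofVectorSpace k l
  let b1 := pbwBasis D.f (iota_subalgebra_injective D.iota_injective nm) _ toList_bijective
  let b2 := pbwBasis c (iota_subalgebra_injective D.iota_injective l) _ toList_bijective
  let b3 := pbwBasis D.e (iota_subalgebra_injective D.iota_injective np) _ toList_bijective
  let B := pbwBasis D.basis D.iota_injective _ tripleWord_bijective
  let E := (b1.tensorProduct (b2.tensorProduct b3)).equiv B (Equiv.refl _)
  have : mulMap nm l np = E.toLinearMap := by
    refine (b1.tensorProduct (b2.tensorProduct b3)).ext ?_
    rintro ⟨s, t, r⟩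
    have h2 : E ((b1.tensorProduct (b2.tensorProduct b3)) (s, t, r)) = B (s, t, r) :=
      Module.Basis.equiv_apply _ _ _ _
    change _ = E ((b1.tensorProduct (b2.tensorProduct b3)) (s, t, r))
    rw [h2, Module.Basis.tensorProduct_apply, Module.Basis.tensorProduct_apply, mulMap_tmul]
    simp only [b1, b2, b3, B, pbwBasis_apply, tripleWord, word_append]
    rw [word_envIncl nm D.f D.basis Sum.inl, word_envIncl l c D.basis (Sum.inr ∘ Sum.inl),
      word_envIncl np D.e D.basis (Sum.inr ∘ Sum.inr)]
    all_goals intro i; simp [basis, decompEquiv_apply, c]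
  rw [this]
  exact E.bijective

/-! ### The Harish-Chandra projection -/

section Projection

variable [CharZero k]

/-- The projection `U(L) = U(n⁻) ⊗ U(l) ⊗ U(n⁺) → U(l)`. -/
def hcProj : U k L →ₗ[k] U k l :=
  ((TensorProduct.lid k _).toLinearMap ∘ₗ TensorProduct.map Coalgebra.counit
    ((TensorProduct.rid k _).toLinearMap ∘ₗ TensorProduct.map LinearMap.id Coalgebra.counit)) ∘ₗ
    (LinearEquiv.ofBijective _ D.mulMap_bijective).symm.toLinearMap

lemma hcProj_mul (a : U k nm) (b : U k l) (c : U k np) :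
    D.hcProj (envIncl nm a * (envIncl l b * envIncl np c)) =
      (Coalgebra.counit (R := k) a * Coalgebra.counit (R := k) c) • b := by
  rw [← mulMap_tmul]
  have : (LinearEquiv.ofBijective _ D.mulMap_bijective).symm (mulMap nm l np (a ⊗ₜ (b ⊗ₜ c))) =
      a ⊗ₜ (b ⊗ₜ c) := LinearEquiv.symm_apply_apply (LinearEquiv.ofBijective _ D.mulMap_bijective) _
  simp only [hcProj, LinearMap.comp_apply, LinearEquiv.coe_coe, this]
  simp only [TensorProduct.map_tmul, LinearMap.comp_apply, LinearMap.id_apply,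
    LinearEquiv.coe_coe, TensorProduct.rid_tmul, TensorProduct.lid_tmul, mul_smul]

include D in
lemma env_triple_induction {P : U k L → Prop} (hadd : ∀ a b, P a → P b → P (a + b))
    (h : ∀ a b c, P (envIncl nm a * (envIncl l b * envIncl np c))) (u : U k L) : P u := by
  obtain ⟨t, rfl⟩ := D.mulMap_bijective.2 u
  induction t using TensorProduct.induction_on with
  | zero => simpa using h 0 0 0
  | add x y hx hy => rw [map_add]; exact hadd _ _ hx hy
  | tmul a t =>
    induction t using TensorProduct.induction_on with
    | zero => simpa using h 0 0 0
    | add x y hx hy => rw [TensorProduct.tmul_add, map_add]; exact hadd _ _ hx hy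
    | tmul b c => exact h a b c

lemma hcProj_one : D.hcProj 1 = 1 := by
  have := D.hcProj_mul 1 1 1
  simpa using this

lemma hcProj_nm_mul (x : nm) (u : U k L) : D.hcProj (iota k L x * u) = 0 := by
  induction u using D.env_triple_induction with
  | hadd a b ha hb => rw [mul_add, map_add, ha, hb, add_zero]
  | h a b c =>
    rw [← envIncl_iota, ← mul_assoc, ← map_mul, hcProj_mul, Bialgebra.counit_mul,
      envCounit_apply_iota]
    simp

lemma hcProj_mul_np (u : U k L) (x : np) : D.hcProj (u * iota k L x) = 0 := by
  induction u using D.env_triple_induction with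
  | hadd a b ha hb => rw [add_mul, map_add, ha, hb, add_zero]
  | h a b c =>
    rw [← envIncl_iota, mul_assoc, mul_assoc, ← map_mul, hcProj_mul, Bialgebra.counit_mul,
      envCounit_apply_iota]
    simp

-- Since `l` normalizes n⁺, moving an element of `l` to the left past U(n⁺) leaves an error in the
-- augmentation ideal. This is what makes `hcProj` right linear over U(l).
omit [CharZero k] in
include D in
lemma exists_mul_iota (c : U k np) (z : l) : ∃ c' : U k np, Coalgebra.counit (R := k) c' = 0 ∧
    envIncl np c * iota k L z = iota k L z * envIncl np c + envIncl np c' := by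
  induction c using env_induction with
  | h1 => exact ⟨0, by simp, by simp⟩
  | hadd a b ha hb =>
    obtain ⟨a', h1, h2⟩ := ha
    obtain ⟨b', h3, h4⟩ := hb
    exact ⟨a' + b', by rw [map_add, h1, h3, add_zero], by
      rw [map_add, add_mul, h2, h4, map_add, mul_add]; abel⟩
  | hsmul r a ha =>
    obtain ⟨a', h1, h2⟩ := ha
    exact ⟨r • a', by rw [map_smul, h1, smul_zero], by
      rw [map_smul, smul_mul_assoc, h2, map_smul, mul_smul_comm, smul_add]⟩
  | hmul x a ha =>
    obtain ⟨a', h1, h2⟩ := ha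
    let y : np := ⟨⁅(x : L), (z : L)⁆, by
      rw [← lie_skew]; exact np.neg_mem (D.lie_mem_np _ z.2 _ x.2)⟩
    refine ⟨iota k np x * a' + iota k np y * a, ?_, ?_⟩
    · rw [map_add, Bialgebra.counit_mul, Bialgebra.counit_mul, envCounit_apply_iota,
        envCounit_apply_iota]
      simp
    · have hy : iota k L y = iota k L x * iota k L z - iota k L z * iota k L x :=
        iota_lie (x : L) (z : L)
      rw [map_mul, map_add, map_mul, map_mul, envIncl_iota, envIncl_iota, mul_assoc, h2, hy]
      noncomm_ring

lemma hcProj_mul_l (u : U k L) (z : l) :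
    D.hcProj (u * iota k L z) = D.hcProj u * iota k l z := by
  induction u using D.env_triple_induction with
  | hadd a b ha hb => rw [add_mul, map_add, ha, hb, map_add, add_mul]
  | h a b c =>
    obtain ⟨c', h1, h2⟩ := D.exists_mul_iota c z
    rw [mul_assoc, mul_assoc, h2, mul_add, mul_add, map_add, hcProj_mul, hcProj_mul, h1, mul_zero,
      zero_smul, add_zero, ← envIncl_iota l z, ← mul_assoc (envIncl l b), ← map_mul, hcProj_mul,
      smul_mul_assoc]

end Projection

end Triangular

attribute [local instance 100] LieRing.ofAssociativeRing in
/-- The action of `U(L)` on an `L`-module. -/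
def envAct (N : Type*) [AddCommGroup N] [Module k N] [LieRingModule L N] [LieModule k L N] :
    U k L →ₐ[k] Module.End k N :=
  envLift k (LieModule.toEnd k L N).toLinearMap
    (fun x y => LieHom.map_lie (LieModule.toEnd k L N) x y)

attribute [local instance 100] LieRing.ofAssociativeRing in
@[simp] lemma envAct_iota {N : Type*} [AddCommGroup N] [Module k N] [LieRingModule L N]
    [LieModule k L N] (x : L) (m : N) : envAct N (iota k L x) m = ⁅x, m⁆ := by
  rw [envAct, envLift_iota]; rfl

namespace Verma

variable {nm l np : LieSubalgebra k L}

section Basic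

variable {X : Type*} [AddCommGroup X] [Module k X] [LieRingModule l X] [LieModule k l X]

lemma induction {P : Verma l np X → Prop} (hadd : ∀ a b, P a → P b → P (a + b))
    (h : ∀ (u : U k L) x, P (u • top l np X x)) (m : Verma l np X) : P m := by
  obtain ⟨t, rfl⟩ := Submodule.mkQ_surjective _ m
  induction t using TensorProduct.induction_on with
  | zero =>
    have := h 0 0
    rw [zero_smul] at this
    exact this
  | add x y hx hy => rw [map_add]; exact hadd _ _ hx hy
  | tmul u x =>
    have : (vermaRel l np X).mkQ (u ⊗ₜ x) = u • top l np X x := by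
      change _ = u • (vermaRel l np X).mkQ (1 ⊗ₜ x)
      rw [← map_smul, TensorProduct.smul_tmul', smul_eq_mul, mul_one]
    rw [this]
    exact h u x

lemma lie_top (z : l) (x : X) : ⁅(z : L), top l np X x⁆ = top l np X ⁅z, x⁆ := by
  rw [lie_def]
  change iota k L z • (vermaRel l np X).mkQ (1 ⊗ₜ x) = (vermaRel l np X).mkQ (1 ⊗ₜ ⁅z, x⁆)
  rw [← map_smul, TensorProduct.smul_tmul', smul_eq_mul, mul_one, ← sub_eq_zero, ← map_sub]
  exact (Submodule.Quotient.mk_eq_zero _).2 (Submodule.subset_span (Or.inl ⟨z, x, rfl⟩))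

lemma np_lie_top (z : np) (x : X) : ⁅(z : L), top l np X x⁆ = 0 := by
  rw [lie_def]
  change iota k L z • (vermaRel l np X).mkQ (1 ⊗ₜ x) = 0
  rw [← map_smul, TensorProduct.smul_tmul', smul_eq_mul, mul_one]
  exact (Submodule.Quotient.mk_eq_zero _).2 (Submodule.subset_span (Or.inr ⟨z, x, rfl⟩))

lemma envIncl_l_smul_top (b : U k l) (x : X) :
    envIncl l b • top l np X x = top l np X (envAct X b x) := by
  induction b using env_induction generalizing x with
  | h1 => simp
  | hadd a b ha hb => rw [map_add, add_smul, ha, hb, map_add, ← map_add]; rfl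
  | hsmul r a ha => rw [map_smul, smul_assoc, ha, map_smul, ← map_smul]; rfl
  | hmul y a ha =>
    rw [map_mul, mul_smul, ha, envIncl_iota, ← lie_def, lie_top, map_mul, Module.End.mul_apply,
      envAct_iota]

lemma envIncl_np_smul_top (b : U k np) (x : X) :
    envIncl np b • top l np X x = Coalgebra.counit (R := k) b • top l np X x := by
  induction b using env_induction with
  | h1 => simp
  | hadd a b ha hb => rw [map_add, add_smul, ha, hb, map_add, add_smul]
  | hsmul r a ha => rw [map_smul, smul_assoc, ha, map_smul, smul_assoc]
  | hmul y a ha =>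
    rw [map_mul, mul_smul, ha, envIncl_iota, Bialgebra.counit_mul, envCounit_apply_iota, zero_mul,
      zero_smul, ← lie_def, lie_smul, np_lie_top, smul_zero]

/-- The universal property of the generalized Verma module. -/
def lift {N : Type*} [AddCommGroup N] [Module k N] [LieRingModule L N] [LieModule k L N]
    (φ : X →ₗ[k] N) (hl : ∀ (z : l) x, φ ⁅z, x⁆ = ⁅(z : L), φ x⁆)
    (hn : ∀ (z : np) x, ⁅(z : L), φ x⁆ = 0) : Verma l np X →ₗ⁅k,L⁆ N :=
  let Θ : U k L ⊗[k] X →ₗ[k] N :=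
    TensorProduct.lift ((LinearMap.lcomp k N φ) ∘ₗ (envAct N).toLinearMap)
  have hΘ : ∀ (a : U k L) t, Θ (a • t) = envAct N a (Θ t) := fun a t => by
    induction t using TensorProduct.induction_on with
    | zero => simp
    | add x y hx hy => rw [smul_add, map_add, hx, hy, map_add, map_add]
    | tmul u x =>
      change envAct N (a * u) (φ x) = envAct N a (envAct N u (φ x))
      rw [map_mul]; rfl
  have hrel : (vermaRel l np X).restrictScalars k ≤ LinearMap.ker Θ := fun t ht => by
    change t ∈ vermaRel l np X at ht
    rw [LinearMap.mem_ker]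
    induction ht using Submodule.span_induction with
    | zero => simp
    | add x y _ _ hx hy => rw [map_add, hx, hy, add_zero]
    | smul a x _ hx => rw [hΘ, hx, map_zero]
    | mem t ht =>
      rcases ht with ⟨z, x, rfl⟩ | ⟨z, x, rfl⟩
      · change Θ (_ - _) = 0
        rw [map_sub]
        change envAct N (iota k L z) (φ x) - envAct N 1 (φ ⁅z, x⁆) = 0
        rw [envAct_iota, map_one, hl, Module.End.one_apply, sub_self]
      · change envAct N (iota k L z) (φ x) = 0
        rw [envAct_iota, hn]
  { ((vermaRel l np X).restrictScalars k).liftQ Θ hrel with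
    map_lie' := fun {x m} => by
      obtain ⟨t, rfl⟩ := Submodule.mkQ_surjective _ m
      change Θ (iota k L x • t) = ⁅x, Θ t⁆
      rw [hΘ, envAct_iota] }

@[simp] lemma lift_top {N : Type*} [AddCommGroup N] [Module k N] [LieRingModule L N]
    [LieModule k L N] (φ : X →ₗ[k] N) (hl : ∀ (z : l) x, φ ⁅z, x⁆ = ⁅(z : L), φ x⁆)
    (hn : ∀ (z : np) x, ⁅(z : L), φ x⁆ = 0) (x : X) : lift φ hl hn (top l np X x) = φ x := by
  change envAct N 1 (φ x) = φ x
  rw [map_one]; rfl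

lemma hom_env {N : Type*} [AddCommGroup N] [Module k N] [LieRingModule L N] [LieModule k L N]
    (Φ : Verma l np X →ₗ⁅k,L⁆ N) (u : U k L) (m : Verma l np X) :
    Φ (u • m) = envAct N u (Φ m) := by
  induction u using env_induction generalizing m with
  | h1 => simp
  | hadd a b ha hb => rw [add_smul, map_add, ha, hb, map_add]; rfl
  | hsmul r a ha => rw [smul_assoc, map_smul, ha, map_smul]; rfl
  | hmul y a ha =>
    rw [mul_smul, ← lie_def, LieModuleHom.map_lie, ha, map_mul, Module.End.mul_apply, envAct_iota]

lemma hom_ext {N : Type*} [AddCommGroup N] [Module k N] [LieRingModule L N] [LieModule k L N]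
    {Φ Φ' : Verma l np X →ₗ⁅k,L⁆ N} (h : ∀ x, Φ (top l np X x) = Φ' (top l np X x)) : Φ = Φ' := by
  ext m
  induction m using Verma.induction with
  | hadd a b ha hb => rw [map_add, map_add, ha, hb]
  | h u x => rw [hom_env, hom_env, h]

end Basic

/-! ### The projection of M_X onto X along n⁻ M_X -/

section Projection

variable {ι : Type w} (D : Triangular nm l np ι) [CharZero k] (X : Type*) [AddCommGroup X]
  [Module k X] [LieRingModule l X] [LieModule k l X]

/-- The projection `M_X → X` along `n⁻ M_X`. -/
def proj : Verma l np X →ₗ[k] X :=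
  let Θ : U k L ⊗[k] X →ₗ[k] X :=
    TensorProduct.lift ((envAct X).toLinearMap ∘ₗ D.hcProj)
  have hrel : (vermaRel l np X).restrictScalars k ≤ LinearMap.ker Θ := fun t ht => by
    change t ∈ vermaRel l np X at ht
    -- Θ is not linear over U(L), so its kernel has to be tested on all multiples of a relation for
    -- the induction over the U(L)-span to pass through scalars.
    have key : ∀ u : U k L, Θ (u • t) = 0 := by
      induction ht using Submodule.span_induction with
      | zero => simp
      | add x y _ _ hx hy => intro u; rw [smul_add, map_add, hx, hy, add_zero]
      | smul a x _ hx => intro u; rw [← mul_smul]; exact hx _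
      | mem t ht =>
        intro u
        rcases ht with ⟨z, x, rfl⟩ | ⟨z, x, rfl⟩
        · rw [smul_sub, map_sub]
          change envAct X (D.hcProj (u * iota k L z)) x - envAct X (D.hcProj (u * 1)) ⁅z, x⁆ = 0
          rw [D.hcProj_mul_l, mul_one, map_mul, Module.End.mul_apply, envAct_iota, sub_self]
        · change envAct X (D.hcProj (u * iota k L z)) x = 0
          rw [D.hcProj_mul_np, map_zero]; rfl
    simpa using key 1
  ((vermaRel l np X).restrictScalars k).liftQ Θ hrel

lemma proj_smul_top (u : U k L) (x : X) :
    proj D X (u • top l np X x) = envAct X (D.hcProj u) x := by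
  change envAct X (D.hcProj (u * 1)) x = _
  rw [mul_one]

@[simp] lemma proj_top (x : X) : proj D X (top l np X x) = x := by
  have := proj_smul_top D X 1 x
  rwa [one_smul, D.hcProj_one, map_one] at this

lemma proj_nm_lie (y : nm) (m : Verma l np X) : proj D X ⁅(y : L), m⁆ = 0 := by
  induction m using Verma.induction with
  | hadd a b ha hb => rw [lie_add, map_add, ha, hb, add_zero]
  | h u x => rw [lie_def, ← mul_smul, proj_smul_top, D.hcProj_nm_mul, map_zero]; rfl

lemma lower_le_ker_proj : lower l np X nm ≤ LinearMap.ker (proj D X) := by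
  refine Submodule.span_le.2 ?_
  rintro _ ⟨y, m, rfl⟩
  exact proj_nm_lie D X y m

omit [CharZero k] in
include D in
lemma lie_mem_lower (z : l) {m : Verma l np X} (hm : m ∈ lower l np X nm) :
    ⁅(z : L), m⁆ ∈ lower l np X nm := by
  induction hm using Submodule.span_induction with
  | mem m hm =>
    obtain ⟨y, m', rfl⟩ := hm
    rw [leibniz_lie]
    exact add_mem (Submodule.subset_span ⟨⟨_, D.lie_mem_nm _ z.2 _ y.2⟩, m', rfl⟩)
      (Submodule.subset_span ⟨y, _, rfl⟩)
  | zero => simp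
  | add a b _ _ ha hb => rw [lie_add]; exact add_mem ha hb
  | smul r a _ ha => rw [lie_smul]; exact Submodule.smul_mem _ _ ha

-- By the triangular decomposition M_X is the sum of X and n⁻ M_X, because n⁺ kills X and `l`
-- preserves it.
include D in
lemma sub_top_proj_mem (m : Verma l np X) : m - top l np X (proj D X m) ∈ lower l np X nm := by
  have key : ∃ x, m - top l np X x ∈ lower l np X nm := by
    induction m using Verma.induction with
    | hadd a b ha hb =>
      obtain ⟨x, hx⟩ := ha
      obtain ⟨y, hy⟩ := hb
      refine ⟨x + y, ?_⟩
      rw [map_add, add_sub_add_comm]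
      exact add_mem hx hy
    | h u x =>
      induction u using D.env_triple_induction with
      | hadd a b ha hb =>
        obtain ⟨x', hx⟩ := ha
        obtain ⟨y', hy⟩ := hb
        refine ⟨x' + y', ?_⟩
        rw [map_add, add_smul, add_sub_add_comm]
        exact add_mem hx hy
      | h a b c =>
        rw [mul_smul, mul_smul, envIncl_np_smul_top, ← map_smul, envIncl_l_smul_top]
        generalize envAct X b _ = y
        induction a using env_induction with
        | h1 => exact ⟨y, by simp⟩
        | hadd a b ha hb =>
          obtain ⟨x', hx⟩ := ha
          obtain ⟨y', hy⟩ := hb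
          refine ⟨x' + y', ?_⟩
          rw [map_add, map_add, add_smul, add_sub_add_comm]
          exact add_mem hx hy
        | hsmul r a ha =>
          obtain ⟨x', hx⟩ := ha
          refine ⟨r • x', ?_⟩
          rw [map_smul, map_smul, smul_assoc, ← smul_sub]
          exact Submodule.smul_mem _ _ hx
        | hmul x a ha =>
          refine ⟨0, ?_⟩
          rw [map_zero, sub_zero, map_mul, envIncl_iota, mul_smul, ← lie_def]
          exact Submodule.subset_span ⟨x, _, rfl⟩
  obtain ⟨x, hx⟩ := key
  -- Applying the projection identifies the unknown component x.
  have h := lower_le_ker_proj D X hx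
  rw [LinearMap.mem_ker, map_sub, proj_top, sub_eq_zero] at h
  rwa [h]

lemma ker_proj : LinearMap.ker (proj D X) = lower l np X nm := by
  refine le_antisymm (fun m hm => ?_) (lower_le_ker_proj D X)
  have := sub_top_proj_mem D X m
  rwa [LinearMap.mem_ker.1 hm, map_zero, sub_zero] at this

/-- Both summands X and n⁻ M_X are stable under `l`, so the projection is `l`-linear. -/
lemma proj_lie (z : l) (m : Verma l np X) : proj D X ⁅(z : L), m⁆ = ⁅z, proj D X m⁆ := by
  have h := lower_le_ker_proj D X (lie_mem_lower D X z (sub_top_proj_mem D X m))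
  rwa [LinearMap.mem_ker, lie_sub, map_sub, lie_top, proj_top, sub_eq_zero] at h

lemma proj_surjective : Function.Surjective (proj D X) := fun x => ⟨_, proj_top D X x⟩

/-- Right exactness of the tensor product turns the range in the definition of expectation values
into the kernel of an explicit map. -/
lemma mem_range_lower_iff {V : Type*} [AddCommGroup V] [Module k V] (s : Verma l np X ⊗[k] V) :
    s ∈ LinearMap.range ((lower l np X nm).subtype.rTensor V) ↔ (proj D X).rTensor V s = 0 := by
  have h1 : Function.Exact (lower l np X nm).subtype (proj D X) := by
    rw [LinearMap.exact_iff, ker_proj, Submodule.range_subtype]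
  exact (rTensor_exact V h1 (proj_surjective D X) s).symm

lemma hasExpectation_iff {Y V : Type*} [AddCommGroup Y] [Module k Y] [LieRingModule l Y]
    [LieModule k l Y] [AddCommGroup V] [Module k V] (Φ : Verma l np Y →ₗ[k] Verma l np X ⊗[k] V)
    (φ : Y →ₗ[k] X ⊗[k] V) : HasExpectation nm l np Φ φ ↔
      ∀ y, (proj D X).rTensor V (Φ (top l np Y y)) = φ y := by
  refine forall_congr' fun y => ?_
  have h : (proj D X).rTensor V ((top l np X).rTensor V (φ y)) = φ y := by
    rw [← LinearMap.comp_apply, ← LinearMap.rTensor_comp,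
      show proj D X ∘ₗ top l np X = LinearMap.id from LinearMap.ext (proj_top D X),
      LinearMap.rTensor_id, LinearMap.id_apply]
  rw [mem_range_lower_iff D X, map_sub, sub_eq_zero, h]

end Projection

end Verma

end Triangular

end DynQuant

end

open scoped TensorProduct

noncomputable section

namespace DynQuant

universe u v w

/-! ## Singular vectors in `M_X ⊗ W` -/

section Singular

variable {k : Type v} [Field k] {L : Type u} [LieRing L] [LieAlgebra k L]

@[simp] lemma envAct_verma {l np : LieSubalgebra k L} {X : Type*} [AddCommGroup X] [Module k X]
    [LieRingModule l X] [LieModule k l X] (a : U k L) (m : Verma l np X) :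
    envAct (Verma l np X) a m = a • m := by
  induction a using env_induction generalizing m with
  | h1 => simp
  | hadd a b ha hb => rw [map_add, add_smul, ← ha, ← hb]; rfl
  | hsmul r a ha => rw [map_smul, smul_assoc, ← ha]; rfl
  | hmul y a ha => rw [map_mul, mul_smul, ← ha, Module.End.mul_apply, envAct_iota, Verma.lie_def]

attribute [local instance 100] LieRing.ofAssociativeRing in
/-- The action of `U(L)` on an `L`-module through the antipode. -/
def antiAct (W : Type*) [AddCommGroup W] [Module k W] [LieRingModule L W] [LieModule k L W] :
    U k L →ₐ[k] (Module.End k W)ᵐᵒᵖ :=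
  envLift k ((MulOpposite.opLinearEquiv k).toLinearMap ∘ₗ
      (-(LieModule.toEnd k L W).toLinearMap)) (fun x y => by
    apply MulOpposite.unop_injective
    ext m
    change -⁅⁅x, y⁆, m⁆ = (-⁅y, -⁅x, m⁆⁆) - (-⁅x, -⁅y, m⁆⁆)
    rw [lie_lie, lie_neg, lie_neg]
    abel)

section

variable {W : Type*} [AddCommGroup W] [Module k W] [LieRingModule L W] [LieModule k L W]

attribute [local instance 100] LieRing.ofAssociativeRing in
@[simp] lemma antiAct_iota (x : L) (m : W) :
    (antiAct W (iota k L x)).unop m = -⁅x, m⁆ := by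
  rw [antiAct, envLift_iota]; rfl

lemma antiAct_iota_mul (x : L) (a : U k L) (m : W) :
    (antiAct W (iota k L x * a)).unop m = -(antiAct W a).unop ⁅x, m⁆ := by
  rw [map_mul, MulOpposite.unop_mul, Module.End.mul_apply, antiAct_iota, map_neg]

lemma antiAct_mul_iota (x : L) (a : U k L) (m : W) :
    (antiAct W (a * iota k L x)).unop m = -⁅x, (antiAct W a).unop m⁆ := by
  rw [map_mul, MulOpposite.unop_mul, Module.End.mul_apply, antiAct_iota]

end

namespace Triangular

variable {nm l np : LieSubalgebra k L} {ι : Type w} (D : Triangular nm l np ι)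

/-- The degree of a multiset of basis vectors. -/
def mdeg (s : Multiset ι) : ℕ := (s.map D.deg).sum

@[simp] lemma mdeg_zero : D.mdeg 0 = 0 := rfl

@[simp] lemma mdeg_cons (i : ι) (s : Multiset ι) : D.mdeg (i ::ₘ s) = D.deg i + D.mdeg s := by
  simp [mdeg]

/-- All degrees are positive, so a bounded degree bounds the number of letters; this makes every
homogeneous piece finite. -/
lemma card_le_mdeg (s : Multiset ι) : Multiset.card s ≤ D.mdeg s := by
  induction s using Multiset.induction_on with
  | empty => rfl
  | cons i s ih => have := D.deg_pos i; rw [Multiset.card_cons, mdeg_cons]; omega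

lemma mdeg_eq_zero {s : Multiset ι} : D.mdeg s = 0 ↔ s = 0 := by
  refine ⟨fun h => ?_, fun h => by rw [h, mdeg_zero]⟩
  have := D.card_le_mdeg s
  rw [h] at this
  exact Multiset.card_eq_zero.1 (Nat.le_zero.1 this)

lemma finite_card_le [Finite ι] (d : ℕ) : {s : Multiset ι | Multiset.card s ≤ d}.Finite := by
  classical
  have := Fintype.ofFinite ι
  refine (Set.finite_Iic (d • (Finset.univ : Finset ι).val)).subset fun s hs => ?_
  rw [Set.mem_Iic, Multiset.le_iff_count]
  intro i
  have h2 : Multiset.count i (Finset.univ : Finset ι).val = 1 :=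
    Multiset.count_eq_one_of_mem Finset.univ.nodup (Finset.mem_univ i)
  rw [Multiset.count_nsmul, h2, mul_one]
  exact (Multiset.count_le_card i s).trans hs

lemma finite_mdeg_le [Finite ι] (d : ℕ) : {s : Multiset ι | D.mdeg s ≤ d}.Finite :=
  (finite_card_le d).subset fun s hs => (D.card_le_mdeg s).trans hs

/-- The multisets of a given degree. -/
abbrev Homog (d : ℕ) : Type w := {s : Multiset ι // D.mdeg s = d}

instance [Finite ι] (d : ℕ) : Fintype (D.Homog d) :=
  have : Finite (D.Homog d) := ((D.finite_mdeg_le d).subset fun _ hs => hs.le).to_subtype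
  Fintype.ofFinite _

/-- The ordered monomial in the basis of `n⁺`. -/
def eWord (s : Multiset ι) : U k L := envIncl np (word D.e s.toList)

/-- The ordered monomial in the basis of `n⁻`. -/
def fWord (s : Multiset ι) : U k L := envIncl nm (word D.f s.toList)

@[simp] lemma eWord_zero : D.eWord 0 = 1 := by simp [eWord]
@[simp] lemma fWord_zero : D.fWord 0 = 1 := by simp [fWord]

lemma iota_h_mul_word_e (w : List ι) : iota k L D.h * envIncl np (word D.e w) =
    envIncl np (word D.e w) * iota k L D.h + (D.mdeg w : k) • envIncl np (word D.e w) := by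
  induction w with
  | nil => simp
  | cons i w ih =>
    have h1 : iota k L D.h * iota k L (D.e i : L) =
        iota k L (D.e i : L) * iota k L D.h + (D.deg i : k) • iota k L (D.e i : L) := by
      rw [← map_smul, ← D.lie_h_e, iota_lie]; abel
    rw [word_cons, map_mul, envIncl_iota, ← mul_assoc, h1, add_mul, mul_assoc, ih,
      ← Multiset.cons_coe, mdeg_cons]
    simp only [mul_add, mul_smul_comm, smul_mul_assoc, mul_assoc, Nat.cast_add, add_smul]
    abel

lemma iota_h_mul_word_f (w : List ι) : iota k L D.h * envIncl nm (word D.f w) =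
    envIncl nm (word D.f w) * iota k L D.h - (D.mdeg w : k) • envIncl nm (word D.f w) := by
  induction w with
  | nil => simp
  | cons i w ih =>
    have h1 : iota k L D.h * iota k L (D.f i : L) =
        iota k L (D.f i : L) * iota k L D.h - (D.deg i : k) • iota k L (D.f i : L) := by
      rw [← map_smul, sub_eq_add_neg, ← map_neg, ← D.lie_h_f, iota_lie]; abel
    rw [word_cons, map_mul, envIncl_iota, ← mul_assoc, h1, sub_mul, mul_assoc, ih,
      ← Multiset.cons_coe, mdeg_cons]
    simp only [mul_sub, mul_smul_comm, smul_mul_assoc, mul_assoc, Nat.cast_add, add_smul]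
    abel

variable [CharZero k]

/-! ### The pairing of U(n⁺) and U(n⁻) and its Gram matrices -/

section Pairing

variable (X : Type*) [AddCommGroup X] [Module k X] [LieRingModule l X] [LieModule k l X]

/-- The pairing of `U(n⁺)` and `U(n⁻)` with values in the endomorphisms of `X`. -/
def pairing (s t : Multiset ι) : X →ₗ[k] X :=
  Verma.proj D X ∘ₗ envAct (Verma l np X) (D.eWord s * D.fWord t) ∘ₗ Verma.top l np X

variable {X}

lemma pairing_apply (s t : Multiset ι) (x : X) :
    D.pairing X s t x = Verma.proj D X (D.eWord s • D.fWord t • Verma.top l np X x) := by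
  rw [← mul_smul, ← envAct_verma]; rfl

/-- The grading element is central in `l`, hence commutes on X with the image of the Harish-Chandra
projection. -/
lemma proj_smul_lie_h (a : U k L) (x : X) :
    Verma.proj D X (a • Verma.top l np X ⁅(⟨D.h, D.h_mem⟩ : l), x⁆) =
      ⁅(⟨D.h, D.h_mem⟩ : l), Verma.proj D X (a • Verma.top l np X x)⁆ := by
  rw [Verma.proj_smul_top, Verma.proj_smul_top]
  generalize D.hcProj a = b
  induction b using env_induction generalizing x with
  | h1 => simp
  | hadd a b ha hb => rw [map_add, LinearMap.add_apply, ha, hb, LinearMap.add_apply, lie_add]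
  | hsmul r a ha => rw [map_smul, LinearMap.smul_apply, ha, LinearMap.smul_apply, lie_smul]
  | hmul y a ha =>
    rw [map_mul, Module.End.mul_apply, Module.End.mul_apply, ha, envAct_iota, envAct_iota,
      leibniz_lie]
    have : ⁅y, (⟨D.h, D.h_mem⟩ : l)⁆ = 0 := by
      rw [← lie_skew, neg_eq_zero]
      exact Subtype.ext (D.lie_h y y.2)
    rw [this, zero_lie, zero_add]

/-- Commuting h past e_s f_t produces the scalar deg s − deg t, while after projection h can be
moved from one side to the other. The scalar therefore kills the pairing. -/
lemma pairing_eq_zero {s t : Multiset ι} (h : D.mdeg s ≠ D.mdeg t) (x : X) :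
    D.pairing X s t x = 0 := by
  have h1 : iota k L D.h * (D.eWord s * D.fWord t) =
      (D.eWord s * D.fWord t) * iota k L D.h +
        ((D.mdeg s : k) - (D.mdeg t : k)) • (D.eWord s * D.fWord t) := by
    have he := D.iota_h_mul_word_e s.toList
    have hf := D.iota_h_mul_word_f t.toList
    rw [Multiset.coe_toList] at he hf
    rw [eWord, fWord, ← mul_assoc, he, add_mul, mul_assoc, hf, sub_smul]
    simp only [mul_sub, smul_mul_assoc, mul_smul_comm, mul_assoc]
    abel
  have h2 := D.proj_smul_lie_h (D.eWord s * D.fWord t) x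
  rw [← Verma.lie_top, ← Verma.proj_lie, Verma.lie_def, Verma.lie_def, ← mul_smul, ← mul_smul, h1,
    add_smul, map_add, smul_assoc, left_eq_add] at h2
  have h3 : D.pairing X s t x =
      Verma.proj D X ((D.eWord s * D.fWord t) • Verma.top l np X x) := by
    rw [pairing_apply, mul_smul]
  rw [(Verma.proj D X).map_smul ((D.mdeg s : k) - D.mdeg t), ← h3, smul_eq_zero] at h2
  rcases h2 with h2 | h2
  · exact absurd (Nat.cast_injective (sub_eq_zero.1 h2)) h
  · exact h2

variable (X) in
/-- The matrix of the pairing in a given degree. -/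
def gram [Finite ι] (d : ℕ) : (D.Homog d → X) →ₗ[k] (D.Homog d → X) :=
  LinearMap.pi fun s => ∑ t : D.Homog d, D.pairing X s t ∘ₗ LinearMap.proj t

lemma gram_apply [Finite ι] (d : ℕ) (y : D.Homog d → X) (s : D.Homog d) :
    D.gram X d y s = ∑ t : D.Homog d, D.pairing X s t (y t) := by
  simp [gram, LinearMap.sum_apply]

variable (X) in
/-- The nondegeneracy of the pairing. -/
def IsGeneric [Finite ι] : Prop := ∀ d, Function.Bijective (D.gram X d)

-- By PBW for n⁻, the vectors f_t ⊗ x span M_X.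
include D in
lemma verma_eq_sum (m : Verma l np X) : ∃ c : Multiset ι →₀ X,
    m = c.sum fun t x => D.fWord t • Verma.top l np X x := by
  have hadd : ∀ c c' : Multiset ι →₀ X, (c + c').sum (fun t x => D.fWord t • Verma.top l np X x) =
      c.sum (fun t x => D.fWord t • Verma.top l np X x) +
        c'.sum fun t x => D.fWord t • Verma.top l np X x := fun c c' =>
    Finsupp.sum_add_index' (fun t => by rw [map_zero, smul_zero])
      (fun t x y => by rw [map_add, smul_add])
  induction m using Verma.induction with
  | hadd a b ha hb =>
    obtain ⟨c, rfl⟩ := ha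
    obtain ⟨c', rfl⟩ := hb
    exact ⟨c + c', (hadd c c').symm⟩
  | h u x =>
    induction u using D.env_triple_induction with
    | hadd a b ha hb =>
      obtain ⟨c, hc⟩ := ha
      obtain ⟨c', hc'⟩ := hb
      exact ⟨c + c', by rw [add_smul, hc, hc', hadd]⟩
    | h a b c =>
      rw [mul_smul, mul_smul, Verma.envIncl_np_smul_top, ← map_smul, Verma.envIncl_l_smul_top]
      generalize envAct X b _ = y
      have ha : a ∈ Submodule.span k (Set.range fun s : Multiset ι => word D.f s.toList) := by
        rw [span_words_eq_top D.f _ toList_bijective.2]; trivial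
      induction ha using Submodule.span_induction with
      | mem a ha =>
        obtain ⟨s, rfl⟩ := ha
        refine ⟨Finsupp.single s y, ?_⟩
        rw [Finsupp.sum_single_index (by rw [map_zero, smul_zero])]
        rfl
      | zero => exact ⟨0, by simp⟩
      | add a b _ _ ha hb =>
        obtain ⟨c, hc⟩ := ha
        obtain ⟨c', hc'⟩ := hb
        exact ⟨c + c', by rw [map_add, add_smul, hc, hc', hadd]⟩
      | smul r a _ ha =>
        obtain ⟨c, hc⟩ := ha
        refine ⟨r • c, ?_⟩
        rw [map_smul, smul_assoc, hc, Finsupp.smul_sum,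
          Finsupp.sum_of_support_subset _ (Finsupp.support_smul (b := r) (g := c)) _
            fun t _ => by rw [map_zero, smul_zero]]
        refine Finset.sum_congr rfl fun t _ => ?_
        rw [Finsupp.smul_apply, map_smul, smul_comm]

variable [Finite ι]

/-- Genericity means that the functionals m ↦ proj(e_s m) separate the points of M_X. -/
lemma eq_zero_of_proj (hX : D.IsGeneric X) {m : Verma l np X}
    (h : ∀ s, Verma.proj D X (D.eWord s • m) = 0) : m = 0 := by
  obtain ⟨c, rfl⟩ := D.verma_eq_sum m
  have h1 : ∀ s, c.sum (fun t x => D.pairing X s t x) = 0 := by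
    intro s
    rw [← h s, Finsupp.sum, Finsupp.sum, Finset.smul_sum, map_sum]
    exact Finset.sum_congr rfl fun t _ => D.pairing_apply s t _
  suffices c = 0 by rw [this, Finsupp.sum_zero_index]
  ext t
  -- Monomials of different degrees are orthogonal, so the coefficients of each degree form a vector
  -- killed by the Gram matrix of that degree.
  have h2 : D.gram X (D.mdeg t) (fun s => c s) = 0 := by
    funext s
    rw [gram_apply, Pi.zero_apply, ← h1 s]
    classical
    have e1 : c.sum (fun t x => D.pairing X s t x) = ∑ t' ∈ c.support ∪
        (Finset.univ : Finset (D.Homog (D.mdeg t))).image Subtype.val, D.pairing X s t' (c t') :=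
      Finsupp.sum_of_support_subset _ Finset.subset_union_left _ fun _ _ => map_zero _
    rw [e1, ← Finset.sum_subset Finset.subset_union_right, Finset.sum_image
      (fun a _ b _ e => Subtype.ext e)]
    intro t' _ ht'
    apply D.pairing_eq_zero
    rw [s.2]
    intro e
    exact ht' (Finset.mem_image.2 ⟨⟨t', e.symm⟩, Finset.mem_univ _, rfl⟩)
  have h3 := (hX (D.mdeg t)).1 (h2.trans (map_zero _).symm)
  exact congrFun h3 ⟨t, rfl⟩

/-- The coefficients of the inverse of the matrix of the pairing. -/
def invGram (hX : D.IsGeneric X) (s : Multiset ι) : X →ₗ[k] (D.Homog (D.mdeg s) → X) :=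
  open Classical in
  (LinearEquiv.ofBijective _ (hX (D.mdeg s))).symm.toLinearMap ∘ₗ
    LinearMap.single k (fun _ => X) (⟨s, rfl⟩ : D.Homog (D.mdeg s))

open Classical in
lemma gram_invGram (hX : D.IsGeneric X) (s : Multiset ι) (x : X) :
    D.gram X (D.mdeg s) (D.invGram hX s x) = Pi.single ⟨s, rfl⟩ x :=
  (LinearEquiv.ofBijective _ (hX (D.mdeg s))).apply_symm_apply
    (Pi.single (⟨s, rfl⟩ : D.Homog (D.mdeg s)) x)

/-- The elements of `M_X` dual to the monomials in the basis of `n⁺`. -/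
def dualVec (hX : D.IsGeneric X) (s : Multiset ι) : X →ₗ[k] Verma l np X :=
  ∑ t : D.Homog (D.mdeg s), envAct (Verma l np X) (D.fWord t) ∘ₗ Verma.top l np X ∘ₗ
    LinearMap.proj t ∘ₗ D.invGram hX s

lemma dualVec_apply (hX : D.IsGeneric X) (s : Multiset ι) (x : X) :
    D.dualVec hX s x = ∑ t, D.fWord t.1 • Verma.top l np X (D.invGram hX s x t) := by
  rw [dualVec, LinearMap.sum_apply]
  exact Finset.sum_congr rfl fun t _ => envAct_verma _ _

open Classical in
lemma proj_dualVec (hX : D.IsGeneric X) (s s' : Multiset ι) (x : X) :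
    Verma.proj D X (D.eWord s' • D.dualVec hX s x) = if s' = s then x else 0 := by
  have h1 : Verma.proj D X (D.eWord s' • D.dualVec hX s x) =
      ∑ t, D.pairing X s' t.1 (D.invGram hX s x t) := by
    rw [dualVec_apply, Finset.smul_sum, map_sum]
    exact Finset.sum_congr rfl fun t _ => (D.pairing_apply s' _ _).symm
  rw [h1]
  by_cases hd : D.mdeg s' = D.mdeg s
  · have h2 := congrFun (D.gram_invGram hX s x) ⟨s', hd⟩
    rw [gram_apply] at h2
    rw [h2, Pi.single_apply]
    simp only [Subtype.mk.injEq]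
  · rw [if_neg (fun e => hd (by rw [e]))]
    exact Finset.sum_eq_zero fun t _ => D.pairing_eq_zero (by rw [t.2]; exact hd) _

end Pairing

end Triangular

end Singular

end DynQuant

end

open scoped TensorProduct

noncomputable section

namespace DynQuant

universe u v w

/-! ### Existence and uniqueness of singular vectors with given expectation value -/

section Induced

variable {k : Type v} [Field k] {L : Type u} [LieRing L] [LieAlgebra k L]

lemma lie_tensor {M W : Type*} [AddCommGroup M] [Module k M] [LieRingModule L M] [LieModule k L M]
    [AddCommGroup W] [Module k W] [LieRingModule L W] [LieModule k L W] (z : L) (s : M ⊗[k] W) :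
    ⁅z, s⁆ = (LieModule.toEnd k L M z).rTensor W s + (LieModule.toEnd k L W z).lTensor M s := by
  induction s using TensorProduct.induction_on with
  | zero => simp
  | add a b ha hb => rw [lie_add, ha, hb, map_add, map_add]; abel
  | tmul m w => rw [TensorProduct.LieModule.lie_tmul_right]; rfl

lemma lTensor_rTensor_comm {M N V W : Type*} [AddCommGroup M] [Module k M] [AddCommGroup N]
    [Module k N] [AddCommGroup V] [Module k V] [AddCommGroup W] [Module k W] (f : M →ₗ[k] N)
    (g : V →ₗ[k] W) (s : M ⊗[k] V) :
    f.rTensor W (g.lTensor M s) = g.lTensor N (f.rTensor V s) := by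
  rw [← LinearMap.comp_apply, ← LinearMap.comp_apply, LinearMap.rTensor_comp_lTensor,
    LinearMap.lTensor_comp_rTensor]

/-- In coordinates with respect to a basis of W, a jointly injective family of maps on M stays
jointly injective on M ⊗ W. -/
lemma tensor_eq_zero_of_forall {M X W : Type*} [AddCommGroup M] [Module k M] [AddCommGroup X]
    [Module k X] [AddCommGroup W] [Module k W] {I : Type*} (g : I → M →ₗ[k] X)
    (hg : ∀ m, (∀ i, g i m = 0) → m = 0) {s : M ⊗[k] W} (hs : ∀ i, (g i).rTensor W s = 0) :
    s = 0 := by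
  classical
  let 𝓑 := Module.Basis.ofVectorSpace k W
  apply (TensorProduct.equivFinsuppOfBasisRight 𝓑).injective
  ext β
  rw [map_zero, Finsupp.zero_apply, TensorProduct.equivFinsuppOfBasisRight_apply]
  apply hg
  intro i
  have h1 : ∀ t : M ⊗[k] k, g i (TensorProduct.rid k M t) =
      TensorProduct.rid k X ((g i).rTensor k t) := by
    intro t
    induction t using TensorProduct.induction_on with
    | zero => simp
    | add a b ha hb => rw [map_add, map_add, ha, hb, map_add, map_add]
    | tmul m r => simp
  rw [h1, lTensor_rTensor_comm, hs, map_zero, map_zero]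

namespace Triangular

variable {nm l np : LieSubalgebra k L} {ι : Type w} (D : Triangular nm l np ι)

/-- The subalgebra `n⁺` acts locally nilpotently on `W`. -/
def IsLocNil (W : Type*) [AddCommGroup W] [Module k W] [LieRingModule L W] [LieModule k L W] :
    Prop :=
  ∀ w : W, ∃ N, ∀ s : Multiset ι, N ≤ D.mdeg s → (antiAct W (D.eWord s)).unop w = 0

variable [CharZero k] [Finite ι]
  {X : Type*} [AddCommGroup X] [Module k X] [LieRingModule l X] [LieModule k l X]
  {W : Type*} [AddCommGroup W] [Module k W] [LieRingModule L W] [LieModule k L W]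

-- On a vector killed by n⁺, the action on the first factor is minus the action on the second;
-- iterating moves all of U(n⁺) to W through the antipode.
omit [CharZero k] [Finite ι] in
lemma singular_rTensor {s : Verma l np X ⊗[k] W} (hs : ∀ z : np, ⁅(z : L), s⁆ = 0)
    (a : U k np) (P : Verma l np X →ₗ[k] X) :
    (P ∘ₗ envAct (Verma l np X) (envIncl np a)).rTensor W s =
      (antiAct W (envIncl np a)).unop.lTensor X (P.rTensor W s) := by
  induction a using env_induction generalizing P with
  | h1 => simp [Module.End.one_eq_id]
  | hadd a b ha hb =>
    rw [map_add, map_add, LinearMap.comp_add, LinearMap.rTensor_add, LinearMap.add_apply, ha, hb,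
      map_add, MulOpposite.unop_add, LinearMap.lTensor_add, LinearMap.add_apply]
  | hsmul r a ha =>
    rw [map_smul, map_smul, LinearMap.comp_smul, LinearMap.rTensor_smul, LinearMap.smul_apply, ha,
      map_smul, MulOpposite.unop_smul, LinearMap.lTensor_smul, LinearMap.smul_apply]
  | hmul y a ha =>
    have h1 : envAct (Verma l np X) (iota k L (y : L)) = LieModule.toEnd k L (Verma l np X) y :=
      LinearMap.ext fun m => envAct_iota (y : L) m
    have h2 : (antiAct W (iota k L (y : L))).unop = -LieModule.toEnd k L W y :=
      LinearMap.ext fun m => antiAct_iota (y : L) m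
    have h3 : (LieModule.toEnd k L (Verma l np X) y).rTensor W s =
        -(LieModule.toEnd k L W y).lTensor (Verma l np X) s := by
      rw [eq_neg_iff_add_eq_zero, ← lie_tensor, hs]
    rw [map_mul, map_mul, map_mul, MulOpposite.unop_mul, envIncl_iota, h1, h2,
      Module.End.mul_eq_comp, ← LinearMap.comp_assoc, ha, LinearMap.rTensor_comp,
      LinearMap.comp_apply, h3, map_neg, lTensor_rTensor_comm, Module.End.mul_eq_comp,
      LinearMap.lTensor_comp, LinearMap.comp_apply, LinearMap.lTensor_neg, LinearMap.neg_apply]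

/-- The expectation value determines all the values proj(e_t ·) on the first factor, and for generic
X these separate points. -/
lemma singular_eq_zero (hX : D.IsGeneric X) {s : Verma l np X ⊗[k] W}
    (hs : ∀ z : np, ⁅(z : L), s⁆ = 0) (h0 : (Verma.proj D X).rTensor W s = 0) : s = 0 := by
  refine tensor_eq_zero_of_forall
    (fun t => Verma.proj D X ∘ₗ envAct (Verma l np X) (D.eWord t)) (fun m hm => ?_) fun t => ?_
  · refine D.eq_zero_of_proj hX fun t => ?_
    rw [← envAct_verma]
    exact hm t
  · rw [eWord, singular_rTensor hs, h0, map_zero]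

/-- The singular vector with expectation value `x ⊗ w` (if `n⁺` annihilates `w` in degrees above
`N`). -/
def singSum (hX : D.IsGeneric X) (N : ℕ) (x : X) (w : W) : Verma l np X ⊗[k] W :=
  ∑ s ∈ (D.finite_mdeg_le N).toFinset, D.dualVec hX s x ⊗ₜ (antiAct W (D.eWord s)).unop w

/-- Duality of `dualVec` to the monomials gives the formula when a is an ordered monomial, and PBW
extends it to all of U(n⁺). -/
lemma proj_singSum (hX : D.IsGeneric X) {N : ℕ} (x : X) {w : W}
    (hN : ∀ s : Multiset ι, N ≤ D.mdeg s → (antiAct W (D.eWord s)).unop w = 0) (a : U k np) :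
    (Verma.proj D X ∘ₗ envAct (Verma l np X) (envIncl np a)).rTensor W (D.singSum hX N x w) =
      x ⊗ₜ (antiAct W (envIncl np a)).unop w := by
  classical
  have ha : a ∈ Submodule.span k (Set.range fun s : Multiset ι => word D.e s.toList) := by
    rw [span_words_eq_top D.e _ toList_bijective.2]; trivial
  induction ha using Submodule.span_induction with
  | zero => simp
  | add a b _ _ ha hb =>
    rw [map_add, map_add, LinearMap.comp_add, LinearMap.rTensor_add, LinearMap.add_apply, ha, hb,
      map_add, MulOpposite.unop_add, LinearMap.add_apply, TensorProduct.tmul_add]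
  | smul r a _ ha =>
    rw [map_smul, map_smul, LinearMap.comp_smul, LinearMap.rTensor_smul, LinearMap.smul_apply, ha,
      map_smul, MulOpposite.unop_smul, LinearMap.smul_apply, TensorProduct.tmul_smul]
  | mem a ha =>
    obtain ⟨t, rfl⟩ := ha
    change LinearMap.rTensor W (Verma.proj D X ∘ₗ envAct (Verma l np X) (D.eWord t)) _ =
      x ⊗ₜ[k] (antiAct W (D.eWord t)).unop w
    have h1 : ∀ s, (Verma.proj D X ∘ₗ envAct (Verma l np X) (D.eWord t)) (D.dualVec hX s x) =
        if t = s then x else 0 := fun s => by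
      rw [LinearMap.comp_apply, envAct_verma, proj_dualVec]
    simp only [singSum, map_sum, LinearMap.rTensor_tmul, h1]
    -- Truncating the sum at N is harmless: above N the term on the right vanishes as well.
    by_cases ht : D.mdeg t ≤ N
    · rw [Finset.sum_eq_single t (fun s _ hst => by rw [if_neg hst.symm, TensorProduct.zero_tmul])
        (fun h => absurd (by simpa using ht) h), if_pos rfl]
    · rw [hN t (by omega), TensorProduct.tmul_zero]
      refine Finset.sum_eq_zero fun s hs => ?_
      have hs' : D.mdeg s ≤ N := by simpa using hs
      rw [if_neg (by rintro rfl; exact ht hs'), TensorProduct.zero_tmul]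

/-- Tested against the separating maps proj(e_t ·), z on the first factor gives x ⊗ S(e_t z) w with
S the antipode, and this cancels the action of z on the second factor. -/
lemma np_lie_singSum (hX : D.IsGeneric X) {N : ℕ} (x : X) {w : W}
    (hN : ∀ s : Multiset ι, N ≤ D.mdeg s → (antiAct W (D.eWord s)).unop w = 0) (z : np) :
    ⁅(z : L), D.singSum hX N x w⁆ = 0 := by
  refine tensor_eq_zero_of_forall
    (fun t => Verma.proj D X ∘ₗ envAct (Verma l np X) (D.eWord t)) (fun m hm => ?_) fun t => ?_
  · refine D.eq_zero_of_proj hX fun t => ?_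
    rw [← envAct_verma]
    exact hm t
  · have h1 : envAct (Verma l np X) (iota k L (z : L)) = LieModule.toEnd k L (Verma l np X) z :=
      LinearMap.ext fun m => envAct_iota (z : L) m
    rw [lie_tensor, map_add, lTensor_rTensor_comm, ← LinearMap.comp_apply, ← LinearMap.rTensor_comp,
      ← h1, LinearMap.comp_assoc, ← Module.End.mul_eq_comp, ← map_mul, eWord, ← envIncl_iota,
      ← map_mul, proj_singSum D hX x hN, proj_singSum D hX x hN, LinearMap.lTensor_tmul, map_mul,
      envIncl_iota, antiAct_mul_iota, ← TensorProduct.tmul_add]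
    change x ⊗ₜ[k] (-⁅_, _⁆ + ⁅_, _⁆) = 0
    rw [neg_add_cancel, TensorProduct.tmul_zero]

lemma proj_singSum_one (hX : D.IsGeneric X) {N : ℕ} (x : X) {w : W}
    (hN : ∀ s : Multiset ι, N ≤ D.mdeg s → (antiAct W (D.eWord s)).unop w = 0) :
    (Verma.proj D X).rTensor W (D.singSum hX N x w) = x ⊗ₜ w := by
  simpa [Module.End.one_eq_id] using D.proj_singSum hX x hN 1

lemma exists_singular (hX : D.IsGeneric X) (hW : D.IsLocNil W) (y : X ⊗[k] W) :
    ∃ s : Verma l np X ⊗[k] W, (∀ z : np, ⁅(z : L), s⁆ = 0) ∧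
      (Verma.proj D X).rTensor W s = y := by
  induction y using TensorProduct.induction_on with
  | zero => exact ⟨0, by simp, by simp⟩
  | add a b ha hb =>
    obtain ⟨s, h1, h2⟩ := ha
    obtain ⟨t, h3, h4⟩ := hb
    exact ⟨s + t, fun z => by rw [lie_add, h1, h3, add_zero], by rw [map_add, h2, h4]⟩
  | tmul x w =>
    obtain ⟨N, hN⟩ := hW w
    exact ⟨D.singSum hX N x w, D.np_lie_singSum hX x hN, D.proj_singSum_one hX x hN⟩

lemma singular_ext (hX : D.IsGeneric X) {s t : Verma l np X ⊗[k] W}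
    (hs : ∀ z : np, ⁅(z : L), s⁆ = 0) (ht : ∀ z : np, ⁅(z : L), t⁆ = 0)
    (h : (Verma.proj D X).rTensor W s = (Verma.proj D X).rTensor W t) : s = t := by
  rw [← sub_eq_zero]
  exact D.singular_eq_zero hX (fun z => by rw [lie_sub, hs, ht, sub_zero])
    (by rw [map_sub, h, sub_self])

/-- The singular vector with a given expectation value. -/
def sing (hX : D.IsGeneric X) (hW : D.IsLocNil W) : X ⊗[k] W →ₗ[k] Verma l np X ⊗[k] W where
  toFun y := (D.exists_singular hX hW y).choose
  map_add' a b := by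
    have h := fun y => (D.exists_singular hX hW y).choose_spec
    -- The chosen vectors depend linearly on y because a singular vector is determined by its
    -- expectation value.
    refine D.singular_ext hX (h _).1 (fun z => ?_) ?_
    · rw [lie_add, (h _).1, (h _).1, add_zero]
    · rw [map_add, (h _).2, (h _).2, (h _).2]
  map_smul' r a := by
    have h := fun y => (D.exists_singular hX hW y).choose_spec
    refine D.singular_ext hX (h _).1 (fun z => ?_) ?_
    · rw [RingHom.id_apply, lie_smul, (h _).1, smul_zero]
    · rw [RingHom.id_apply, map_smul, (h _).2, (h _).2]

lemma np_lie_sing (hX : D.IsGeneric X) (hW : D.IsLocNil W) (y : X ⊗[k] W) (z : np) :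
    ⁅(z : L), D.sing hX hW y⁆ = 0 :=
  (D.exists_singular hX hW y).choose_spec.1 z

lemma proj_sing (hX : D.IsGeneric X) (hW : D.IsLocNil W) (y : X ⊗[k] W) :
    (Verma.proj D X).rTensor W (D.sing hX hW y) = y :=
  (D.exists_singular hX hW y).choose_spec.2

lemma eq_sing (hX : D.IsGeneric X) (hW : D.IsLocNil W) {s : Verma l np X ⊗[k] W}
    (hs : ∀ z : np, ⁅(z : L), s⁆ = 0) {y : X ⊗[k] W} (h : (Verma.proj D X).rTensor W s = y) :
    s = D.sing hX hW y :=
  D.singular_ext hX hs (D.np_lie_sing hX hW y) (by rw [h, proj_sing])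

omit [Finite ι] in
lemma proj_rTensor_lie (z : l) (s : Verma l np X ⊗[k] W) :
    (Verma.proj D X).rTensor W ⁅(z : L), s⁆ = ⁅z, (Verma.proj D X).rTensor W s⁆ := by
  induction s using TensorProduct.induction_on with
  | zero => simp
  | add a b ha hb => rw [lie_add, map_add, ha, hb, map_add, lie_add]
  | tmul m w =>
    rw [TensorProduct.LieModule.lie_tmul_right, map_add, LinearMap.rTensor_tmul,
      LinearMap.rTensor_tmul, LinearMap.rTensor_tmul, TensorProduct.LieModule.lie_tmul_right,
      Verma.proj_lie]
    rfl

lemma sing_lie (hX : D.IsGeneric X) (hW : D.IsLocNil W) (z : l) (y : X ⊗[k] W) :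
    D.sing hX hW ⁅z, y⁆ = ⁅(z : L), D.sing hX hW y⁆ := by
  refine (D.eq_sing hX hW (fun x => ?_) ?_).symm
  · rw [leibniz_lie, np_lie_sing, lie_zero, add_zero]
    have h := D.lie_mem_np _ z.2 _ x.2
    rw [← lie_skew, neg_lie, neg_eq_zero]
    exact D.np_lie_sing hX hW y ⟨_, h⟩
  · rw [proj_rTensor_lie, proj_sing]

/-- The morphism `M_Y → M_X ⊗ W` with expectation value `φ`. -/
def ind (hX : D.IsGeneric X) (hW : D.IsLocNil W) {Y : Type*} [AddCommGroup Y] [Module k Y]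
    [LieRingModule l Y] [LieModule k l Y] (φ : Y →ₗ⁅k,l⁆ X ⊗[k] W) :
    Verma l np Y →ₗ⁅k,L⁆ Verma l np X ⊗[k] W :=
  Verma.lift (D.sing hX hW ∘ₗ φ.toLinearMap)
    (fun z y => by
      change D.sing hX hW (φ ⁅z, y⁆) = ⁅(z : L), D.sing hX hW (φ y)⁆
      rw [LieModuleHom.map_lie, sing_lie])
    (fun z y => D.np_lie_sing hX hW _ z)

@[simp] lemma ind_top (hX : D.IsGeneric X) (hW : D.IsLocNil W) {Y : Type*} [AddCommGroup Y]
    [Module k Y] [LieRingModule l Y] [LieModule k l Y] (φ : Y →ₗ⁅k,l⁆ X ⊗[k] W) (y : Y) :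
    D.ind hX hW φ (Verma.top l np Y y) = D.sing hX hW (φ y) :=
  Verma.lift_top _ _ _ y

omit [CharZero k] [Finite ι] D in
lemma np_lie_hom_top {Y N : Type*} [AddCommGroup Y] [Module k Y]
    [LieRingModule l Y] [LieModule k l Y] [AddCommGroup N] [Module k N] [LieRingModule L N]
    [LieModule k L N] (Φ : Verma l np Y →ₗ⁅k,L⁆ N) (y : Y) (z : np) :
    ⁅(z : L), Φ (Verma.top l np Y y)⁆ = 0 := by
  rw [← LieModuleHom.map_lie, Verma.np_lie_top, map_zero]

/-- Such a morphism is determined by the images of the generators, which are singular vectors, and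
these by their expectation values. -/
lemma hom_ext_of_proj (hX : D.IsGeneric X) {Y : Type*} [AddCommGroup Y] [Module k Y]
    [LieRingModule l Y] [LieModule k l Y] {Φ Φ' : Verma l np Y →ₗ⁅k,L⁆ Verma l np X ⊗[k] W}
    (h : ∀ y, (Verma.proj D X).rTensor W (Φ (Verma.top l np Y y)) =
      (Verma.proj D X).rTensor W (Φ' (Verma.top l np Y y))) : Φ = Φ' :=
  Verma.hom_ext fun y => D.singular_ext hX (np_lie_hom_top Φ y) (np_lie_hom_top Φ' y) (h y)

end Triangular

end Induced

end DynQuant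

end

open scoped TensorProduct

noncomputable section

namespace DynQuant

universe u v w

/-! ## The dynamical twist and the dynamical multiplication -/

section DynTwist

variable {k : Type v} [Field k] {L : Type u} [LieRing L] [LieAlgebra k L]

section Homs

variable {M N V W : Type*} [AddCommGroup M] [Module k M] [LieRingModule L M] [LieModule k L M]
  [AddCommGroup N] [Module k N] [LieRingModule L N] [LieModule k L N]
  [AddCommGroup V] [Module k V] [LieRingModule L V] [LieModule k L V]
  [AddCommGroup W] [Module k W] [LieRingModule L W] [LieModule k L W]

lemma lie_rTensor_hom (Φ : M →ₗ⁅k,L⁆ N) (z : L) (s : M ⊗[k] W) :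
    Φ.toLinearMap.rTensor W ⁅z, s⁆ = ⁅z, Φ.toLinearMap.rTensor W s⁆ := by
  induction s using TensorProduct.induction_on with
  | zero => simp
  | add a b ha hb => rw [lie_add, map_add, ha, hb, map_add, lie_add]
  | tmul m w => simp [TensorProduct.LieModule.lie_tmul_right]

lemma lie_lTensor_hom (Φ : V →ₗ⁅k,L⁆ W) (z : L) (s : M ⊗[k] V) :
    Φ.toLinearMap.lTensor M ⁅z, s⁆ = ⁅z, Φ.toLinearMap.lTensor M s⁆ := by
  induction s using TensorProduct.induction_on with
  | zero => simp
  | add a b ha hb => rw [lie_add, map_add, ha, hb, map_add, lie_add]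
  | tmul m w => simp [TensorProduct.LieModule.lie_tmul_right]

/-- `id ⊗ Φ` as a morphism of `L`-modules. -/
def lTensorHom (M : Type*) [AddCommGroup M] [Module k M] [LieRingModule L M] [LieModule k L M]
    (Φ : V →ₗ⁅k,L⁆ W) : M ⊗[k] V →ₗ⁅k,L⁆ M ⊗[k] W :=
  { Φ.toLinearMap.lTensor M with map_lie' := fun {z s} => lie_lTensor_hom Φ z s }

lemma lTensorHom_apply (Φ : V →ₗ⁅k,L⁆ W) (s : M ⊗[k] V) :
    lTensorHom M Φ s = Φ.toLinearMap.lTensor M s := rfl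

lemma lie_assoc (z : L) (s : (M ⊗[k] V) ⊗[k] W) :
    TensorProduct.assoc k M V W ⁅z, s⁆ = ⁅z, TensorProduct.assoc k M V W s⁆ := by
  induction s using TensorProduct.induction_on with
  | zero => simp
  | add a b ha hb => rw [lie_add, map_add, ha, hb, map_add, lie_add]
  | tmul m w =>
    induction m using TensorProduct.induction_on with
    | zero => simp
    | add a b ha hb => rw [TensorProduct.add_tmul, lie_add, map_add, ha, hb, map_add, lie_add]
    | tmul m v =>
      simp only [TensorProduct.LieModule.lie_tmul_right, TensorProduct.add_tmul, map_add,
        TensorProduct.assoc_tmul, TensorProduct.tmul_add]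
      abel

end Homs

namespace Verma

variable {nm l np : LieSubalgebra k L} {X Y : Type*} [AddCommGroup X] [Module k X]
  [LieRingModule l X] [LieModule k l X] [AddCommGroup Y] [Module k Y] [LieRingModule l Y]
  [LieModule k l Y]

/-- The functoriality of the generalized Verma module. -/
def map (np : LieSubalgebra k L) (β : X →ₗ⁅k,l⁆ Y) : Verma l np X →ₗ⁅k,L⁆ Verma l np Y :=
  lift (top l np Y ∘ₗ β.toLinearMap)
    (fun z x => by
      change top l np Y (β ⁅z, x⁆) = ⁅(z : L), top l np Y (β x)⁆
      rw [LieModuleHom.map_lie, lie_top])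
    (fun z x => np_lie_top z _)

@[simp] lemma map_top (β : X →ₗ⁅k,l⁆ Y) (x : X) :
    map np β (top l np X x) = top l np Y (β x) :=
  lift_top _ _ _ x

lemma proj_map [CharZero k] {ι : Type w} (D : Triangular nm l np ι) (β : X →ₗ⁅k,l⁆ Y)
    (m : Verma l np X) : proj D Y (map np β m) = β (proj D X m) := by
  have h : m - top l np X (proj D X m) ∈ lower l np X nm := sub_top_proj_mem D X m
  have h2 : ∀ m' ∈ lower l np X nm, proj D Y (map np β m') = 0 := by
    intro m' hm'
    induction hm' using Submodule.span_induction with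
    | mem m' hm' =>
      obtain ⟨y, m', rfl⟩ := hm'
      rw [LieModuleHom.map_lie, proj_nm_lie]
    | zero => simp
    | add a b _ _ ha hb => rw [map_add, map_add, ha, hb, add_zero]
    | smul r a _ ha => rw [map_smul, map_smul, ha, smul_zero]
  have h3 := h2 _ h
  rwa [map_sub, map_sub, map_top, proj_top, sub_eq_zero] at h3

end Verma

/-! ### Multiplication of the last two tensor factors -/

section MulLast

variable {A : Type*} [CommRing A] [Algebra k A] [LieRingModule L A] [LieModule k L A]

/-- The multiplication of the last two factors of `M ⊗ A ⊗ A`. -/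
def mulLast (k : Type*) [Field k] (M A : Type*) [AddCommGroup M] [Module k M] [CommRing A]
    [Algebra k A] : (M ⊗[k] A) ⊗[k] A →ₗ[k] M ⊗[k] A :=
  (LinearMap.mul' k A).lTensor M ∘ₗ (TensorProduct.assoc k M A A).toLinearMap

@[simp] lemma mulLast_tmul {M : Type*} [AddCommGroup M] [Module k M] (m : M) (a b : A) :
    mulLast k M A ((m ⊗ₜ a) ⊗ₜ b) = m ⊗ₜ (a * b) := by
  simp [mulLast]

/-- The associativity of A, in the form in which it enters the comparison of two iterated
intertwiners. -/
lemma mulLast_mulLast {M N : Type*} [AddCommGroup M] [Module k M] [AddCommGroup N] [Module k N]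
    (θ : M →ₗ[k] N ⊗[k] A) (s : (M ⊗[k] A) ⊗[k] A) :
    mulLast k N A (θ.rTensor A (mulLast k M A s)) =
      mulLast k N A ((mulLast k N A ∘ₗ θ.rTensor A).rTensor A s) := by
  have h : ∀ (y : N ⊗[k] A) (a b : A), mulLast k N A (y ⊗ₜ (a * b)) =
      mulLast k N A (mulLast k N A (y ⊗ₜ a) ⊗ₜ b) := by
    intro y a b
    induction y using TensorProduct.induction_on with
    | zero => simp
    | add p q hp hq => simp only [TensorProduct.add_tmul, map_add, hp, hq]
    | tmul n c => simp [mul_assoc]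
  induction s using TensorProduct.induction_on with
  | zero => simp
  | add a b ha hb => rw [map_add, map_add, map_add, ha, hb, map_add, map_add]
  | tmul m w =>
    induction m using TensorProduct.induction_on with
    | zero => simp
    | add a b ha hb =>
      rw [TensorProduct.add_tmul, map_add, map_add, map_add, ha, hb, map_add, map_add]
    | tmul m v =>
      rw [mulLast_tmul, LinearMap.rTensor_tmul, LinearMap.rTensor_tmul, LinearMap.comp_apply,
        LinearMap.rTensor_tmul, h]

variable (hA : ∀ (z : L) (a b : A), ⁅z, a * b⁆ = ⁅z, a⁆ * b + a * ⁅z, b⁆)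

include hA in
lemma mulLast_lie {M : Type*} [AddCommGroup M] [Module k M] [LieRingModule L M] [LieModule k L M]
    (z : L) (s : (M ⊗[k] A) ⊗[k] A) : mulLast k M A ⁅z, s⁆ = ⁅z, mulLast k M A s⁆ := by
  have h : (LinearMap.mul' k A).lTensor M ⁅z, TensorProduct.assoc k M A A s⁆ =
      ⁅z, (LinearMap.mul' k A).lTensor M (TensorProduct.assoc k M A A s)⁆ :=
    lie_lTensor_hom (M := M) (V := A ⊗[k] A) (W := A)
      { LinearMap.mul' k A with
        map_lie' := fun {z t} => by
          change LinearMap.mul' k A ⁅z, t⁆ = ⁅z, LinearMap.mul' k A t⁆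
          induction t using TensorProduct.induction_on with
          | zero => simp
          | add a b ha hb => rw [lie_add, map_add, ha, hb, map_add, lie_add]
          | tmul a b => simp [TensorProduct.LieModule.lie_tmul_right, hA] } z _
  rw [← lie_assoc] at h
  exact h

end MulLast

namespace Triangular

variable {nm l np : LieSubalgebra k L} {ι : Type w} (D : Triangular nm l np ι)
variable [CharZero k] [Finite ι]
  {X : Type*} [AddCommGroup X] [Module k X] [LieRingModule l X] [LieModule k l X]
  {V : Type*} [AddCommGroup V] [Module k V] [LieRingModule L V] [LieModule k L V]
  {W : Type*} [AddCommGroup W] [Module k W] [LieRingModule L W] [LieModule k L W]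

lemma sing_map {X' : Type*} [AddCommGroup X'] [Module k X'] [LieRingModule l X']
    [LieModule k l X'] (hX : D.IsGeneric X) (hX' : D.IsGeneric X') (hW : D.IsLocNil W)
    (β : X' →ₗ⁅k,l⁆ X) (y : X' ⊗[k] W) :
    (Verma.map np β).toLinearMap.rTensor W (D.sing hX' hW y) =
      D.sing hX hW (β.toLinearMap.rTensor W y) := by
  refine D.eq_sing hX hW (fun z => ?_) ?_
  · rw [← lie_rTensor_hom, np_lie_sing, map_zero]
  · rw [← LinearMap.comp_apply, ← LinearMap.rTensor_comp]
    have : Verma.proj D X ∘ₗ (Verma.map np β).toLinearMap = β.toLinearMap ∘ₗ Verma.proj D X' :=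
      LinearMap.ext fun m => Verma.proj_map D β m
    rw [this, LinearMap.rTensor_comp, LinearMap.comp_apply, proj_sing]

lemma sing_lTensor {W' : Type*} [AddCommGroup W'] [Module k W'] [LieRingModule L W']
    [LieModule k L W'] (hX : D.IsGeneric X) (hW : D.IsLocNil W) (hW' : D.IsLocNil W')
    (φ : W →ₗ⁅k,L⁆ W') (y : X ⊗[k] W) :
    φ.toLinearMap.lTensor (Verma l np X) (D.sing hX hW y) =
      D.sing hX hW' (φ.toLinearMap.lTensor X y) := by
  refine D.eq_sing hX hW' (fun z => ?_) ?_
  · rw [← lie_lTensor_hom, np_lie_sing, map_zero]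
  · rw [lTensor_rTensor_comm, proj_sing]

/-- The morphism `M_{X ⊗ V} → M_X ⊗ V` with expectation value the identity. -/
def fuse (hX : D.IsGeneric X) (hV : D.IsLocNil V) :
    Verma l np (X ⊗[k] V) →ₗ⁅k,L⁆ Verma l np X ⊗[k] V :=
  D.ind hX hV LieModuleHom.id

@[simp] lemma fuse_top (hX : D.IsGeneric X) (hV : D.IsLocNil V) (y : X ⊗[k] V) :
    D.fuse hX hV (Verma.top l np _ y) = D.sing hX hV y := D.ind_top hX hV _ y

lemma ind_eq_fuse_map (hX : D.IsGeneric X) (hV : D.IsLocNil V) {Y : Type*} [AddCommGroup Y]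
    [Module k Y] [LieRingModule l Y] [LieModule k l Y] (φ : Y →ₗ⁅k,l⁆ X ⊗[k] V)
    (m : Verma l np Y) : D.ind hX hV φ m = D.fuse hX hV (Verma.map np φ m) := by
  have : D.ind hX hV φ = (D.fuse hX hV).comp (Verma.map np φ) := by
    apply Verma.hom_ext
    intro y
    rw [ind_top, LieModuleHom.comp_apply, Verma.map_top, fuse_top]
  rw [this]; rfl

/-- The dynamical twist. -/
def twist (hX : D.IsGeneric X) (hV : D.IsLocNil V) (hXV : D.IsGeneric (X ⊗[k] V))
    (hW : D.IsLocNil W) : (X ⊗[k] V) ⊗[k] W →ₗ[k] X ⊗[k] (V ⊗[k] W) :=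
  (Verma.proj D X).rTensor (V ⊗[k] W) ∘ₗ (TensorProduct.assoc k (Verma l np X) V W).toLinearMap ∘ₗ
    (D.fuse hX hV).toLinearMap.rTensor W ∘ₗ D.sing hXV hW

/-- Both intertwiners in the definition are forced by their expectation values, which gives
existence and uniqueness of the twist at once. -/
lemma isDynTwist_iff (hX : D.IsGeneric X) (hV : D.IsLocNil V) (hXV : D.IsGeneric (X ⊗[k] V))
    (hW : D.IsLocNil W) (F : (X ⊗[k] V) ⊗[k] W →ₗ[k] X ⊗[k] (V ⊗[k] W)) :
    IsDynTwist nm l np X V W F ↔ F = D.twist hX hV hXV hW := by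
  constructor
  · rintro ⟨Φ, Ψ, h1, h2, h3⟩
    rw [Verma.hasExpectation_iff D] at h1 h2 h3
    have hΨ : Ψ = D.fuse hX hV := D.hom_ext_of_proj hX fun y => by
      rw [fuse_top, proj_sing]; exact h2 y
    have hΦ : Φ = D.ind hXV hW LieModuleHom.id := D.hom_ext_of_proj hXV fun y => by
      rw [ind_top, proj_sing]; exact h1 y
    refine LinearMap.ext fun y => ?_
    have h4 := (h3 y).symm
    rw [hΨ, hΦ] at h4
    rw [h4]
    change _ = (Verma.proj D X).rTensor (V ⊗[k] W) (TensorProduct.assoc k (Verma l np X) V W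
      ((D.fuse hX hV).toLinearMap.rTensor W (D.sing hXV hW y)))
    have h5 : D.sing hXV hW y = D.ind hXV hW LieModuleHom.id (Verma.top l np _ y) :=
      (D.ind_top hXV hW LieModuleHom.id y).symm
    rw [h5]
    rfl
  · rintro rfl
    refine ⟨D.ind hXV hW LieModuleHom.id, D.fuse hX hV, ?_, ?_, ?_⟩
    · rw [Verma.hasExpectation_iff D]
      intro y
      change (Verma.proj D _).rTensor W (D.ind hXV hW LieModuleHom.id _) = _
      rw [ind_top, proj_sing]; rfl
    · rw [Verma.hasExpectation_iff D]
      intro y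
      change (Verma.proj D X).rTensor V (D.fuse hX hV _) = _
      rw [fuse_top, proj_sing]; rfl
    · rw [Verma.hasExpectation_iff D]
      intro y
      change (Verma.proj D X).rTensor (V ⊗[k] W) (TensorProduct.assoc k (Verma l np X) V W
        ((D.fuse hX hV).toLinearMap.rTensor W (D.ind hXV hW LieModuleHom.id (Verma.top l np _ y))))
        = _
      rw [ind_top]
      rfl

variable {A : Type*} [CommRing A] [Algebra k A] [LieRingModule L A] [LieModule k L A]

/-! ### The dynamical multiplication of an algebra on which L acts by derivations -/

section Star

variable (hA : ∀ (z : L) (a b : A), ⁅z, a * b⁆ = ⁅z, a⁆ * b + a * ⁅z, b⁆)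

variable (hX : D.IsGeneric X) (hXA : D.IsGeneric (X ⊗[k] A)) (hN : D.IsLocNil A)

/-- The expectation value of `M_{X ⊗ A ⊗ A} → M_{X ⊗ A} ⊗ A → M_X ⊗ A ⊗ A → M_X ⊗ A`. -/
def starMap : (X ⊗[k] A) ⊗[k] A →ₗ[k] X ⊗[k] A :=
  (Verma.proj D X).rTensor A ∘ₗ mulLast k _ A ∘ₗ (D.fuse hX hN).toLinearMap.rTensor A ∘ₗ
    D.sing hXA hN

lemma starMap_apply (y : (X ⊗[k] A) ⊗[k] A) : D.starMap hX hXA hN y =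
    (Verma.proj D X).rTensor A (mulLast k _ A ((D.fuse hX hN).toLinearMap.rTensor A
      (D.sing hXA hN y))) := rfl

lemma starMap_eq_twist (y : (X ⊗[k] A) ⊗[k] A) : D.starMap hX hXA hN y =
    (LinearMap.mul' k A).lTensor X (D.twist hX hN hXA hN y) := by
  rw [starMap_apply]
  exact lTensor_rTensor_comm _ _ _

-- As the multiplication of A is L-equivariant, the left side is again singular, so it is determined
-- by its expectation value, which is `starMap` by definition.
include hA in
lemma mulLast_fuse_sing (y : (X ⊗[k] A) ⊗[k] A) :
    mulLast k _ A ((D.fuse hX hN).toLinearMap.rTensor A (D.sing hXA hN y)) =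
      D.sing hX hN (D.starMap hX hXA hN y) := by
  refine D.eq_sing hX hN (fun z => ?_) rfl
  rw [← mulLast_lie hA, ← lie_rTensor_hom, np_lie_sing, map_zero, map_zero]

include hA in
lemma starMap_lie (z : l) (y : (X ⊗[k] A) ⊗[k] A) :
    D.starMap hX hXA hN ⁅z, y⁆ = ⁅z, D.starMap hX hXA hN y⁆ := by
  rw [starMap_apply, starMap_apply, sing_lie, lie_rTensor_hom, mulLast_lie hA, proj_rTensor_lie]

include hA in
/-- The associativity of the dynamical multiplication, for an `l`-morphism `α : X' → X ⊗ A` in place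
of the first factor. -/
lemma starMap_assoc {X' : Type*} [AddCommGroup X'] [Module k X'] [LieRingModule l X']
    [LieModule k l X'] (hX' : D.IsGeneric X') (hXA' : D.IsGeneric (X' ⊗[k] A))
    (α : X' →ₗ⁅k,l⁆ X ⊗[k] A) :
    ∃ h : X' ⊗[k] A →ₗ[k] X ⊗[k] A,
      (∀ y, h y = D.starMap hX hXA hN (α.toLinearMap.rTensor A y)) ∧
      ∀ y, h (D.starMap hX' hXA' hN y) = D.starMap hX hXA hN (h.rTensor A y) := by
  -- θ is the intertwiner M_X' → M_X ⊗ A attached to α. It plays the role of multiplication by the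
  -- first factor before expectation values are taken.
  let θ := D.ind hX hN α
  have hθ : ∀ s : Verma l np X' ⊗[k] A, θ.toLinearMap.rTensor A s =
      (D.fuse hX hN).toLinearMap.rTensor A ((Verma.map np α).toLinearMap.rTensor A s) := by
    intro s
    rw [← LinearMap.comp_apply, ← LinearMap.rTensor_comp]
    congr 2
    exact LinearMap.ext fun m => D.ind_eq_fuse_map hX hN α m
  -- The composite M_{X' ⊗ A} → M_X' ⊗ A → M_X ⊗ A ⊗ A → M_X ⊗ A, whose expectation value h is the
  -- product of α with a second factor.
  let g : Verma l np (X' ⊗[k] A) →ₗ⁅k,L⁆ Verma l np X ⊗[k] A :=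
    { mulLast k _ A ∘ₗ θ.toLinearMap.rTensor A ∘ₗ (D.fuse hX' hN).toLinearMap with
      map_lie' := fun {z m} => by
        change mulLast k _ A (θ.toLinearMap.rTensor A (D.fuse hX' hN ⁅z, m⁆)) =
          ⁅z, mulLast k _ A (θ.toLinearMap.rTensor A (D.fuse hX' hN m))⁆
        rw [LieModuleHom.map_lie, lie_rTensor_hom, mulLast_lie hA] }
  have hg : ∀ m, g m = mulLast k _ A (θ.toLinearMap.rTensor A (D.fuse hX' hN m)) := fun m => rfl
  let h : X' ⊗[k] A →ₗ⁅k,l⁆ X ⊗[k] A :=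
    { (Verma.proj D X).rTensor A ∘ₗ g.toLinearMap ∘ₗ Verma.top l np _ with
      map_lie' := fun {z y} => by
        change (Verma.proj D X).rTensor A (g (Verma.top l np _ ⁅z, y⁆)) =
          ⁅z, (Verma.proj D X).rTensor A (g (Verma.top l np _ y))⁆
        rw [← Verma.lie_top, LieModuleHom.map_lie, proj_rTensor_lie] }
  have hh : ∀ y, h y = (Verma.proj D X).rTensor A (g (Verma.top l np _ y)) := fun y => rfl
  -- Since g is an intertwiner, it can be rebuilt from h alone; this is what lets h be inserted as
  -- the first factor of a further product.
  have hgh : ∀ m, g m = D.fuse hX hN (Verma.map np h m) := by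
    have : g = (D.fuse hX hN).comp (Verma.map np h) := D.hom_ext_of_proj hX fun y => by
      rw [LieModuleHom.comp_apply, Verma.map_top, fuse_top, proj_sing, hh]
    intro m; rw [this]; rfl
  have h1 : ∀ y, h y = D.starMap hX hXA hN (α.toLinearMap.rTensor A y) := by
    intro y
    rw [hh, hg, fuse_top, hθ, D.sing_map hXA hX' hN, starMap_apply]
  refine ⟨h.toLinearMap, h1, fun y => ?_⟩
  change h (D.starMap hX' hXA' hN y) = _
  -- Both bracketings become one expression: the singular vector of the product b ⋆' c is the
  -- multiplied image of an iterated one, and associativity in A moves the inner multiplication to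
  -- the front.
  rw [hh, hg, fuse_top, ← D.mulLast_fuse_sing hA hX' hXA' hN, mulLast_mulLast, ← LinearMap.comp_apply
    (f := LinearMap.rTensor A (mulLast k (Verma l np X) A ∘ₗ LinearMap.rTensor A θ.toLinearMap)),
    ← LinearMap.rTensor_comp]
  have h2 : (mulLast k (Verma l np X) A ∘ₗ LinearMap.rTensor A θ.toLinearMap) ∘ₗ
      (D.fuse hX' hN).toLinearMap =
      (D.fuse hX hN).toLinearMap ∘ₗ (Verma.map np h).toLinearMap :=
    LinearMap.ext fun m => hgh m
  rw [h2, LinearMap.rTensor_comp, LinearMap.comp_apply, D.sing_map hXA hXA' hN, starMap_apply]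

/-- Naturality of the intertwiner in its second argument, needed so that symmetries of A become
symmetries of the product. -/
lemma fuse_lTensor (φ : A →ₗ⁅k,L⁆ A) (β : X ⊗[k] A →ₗ⁅k,l⁆ X ⊗[k] A)
    (hβ : ∀ y, β y = φ.toLinearMap.lTensor X y) (m : Verma l np (X ⊗[k] A)) :
    D.fuse hX hN (Verma.map np β m) = φ.toLinearMap.lTensor _ (D.fuse hX hN m) := by
  have : (D.fuse hX hN).comp (Verma.map np β) = (lTensorHom _ φ).comp (D.fuse hX hN) := by
    apply Verma.hom_ext
    intro y
    rw [LieModuleHom.comp_apply, LieModuleHom.comp_apply, Verma.map_top, fuse_top, fuse_top,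
      lTensorHom_apply, D.sing_lTensor hX hN hN, hβ]
  exact congr($this m)

/-- A derivation of `A` that commutes with `L` is a derivation of the dynamical multiplication. -/
lemma starMap_derivation (φ : A →ₗ⁅k,L⁆ A) (hφ : ∀ a b, φ (a * b) = φ a * b + a * φ b)
    (y : (X ⊗[k] A) ⊗[k] A) : φ.toLinearMap.lTensor X (D.starMap hX hXA hN y) =
      D.starMap hX hXA hN ((φ.toLinearMap.lTensor X).rTensor A y) +
        D.starMap hX hXA hN (φ.toLinearMap.lTensor _ y) := by
  let β : X ⊗[k] A →ₗ⁅k,l⁆ X ⊗[k] A :=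
    { φ.toLinearMap.lTensor X with
      map_lie' := fun {z y} => by
        change φ.toLinearMap.lTensor X ⁅z, y⁆ = ⁅z, φ.toLinearMap.lTensor X y⁆
        induction y using TensorProduct.induction_on with
        | zero => simp
        | add a b ha hb => rw [lie_add, map_add, ha, hb, map_add, lie_add]
        | tmul x a =>
          rw [TensorProduct.LieModule.lie_tmul_right, map_add, LinearMap.lTensor_tmul,
            LinearMap.lTensor_tmul, LinearMap.lTensor_tmul, TensorProduct.LieModule.lie_tmul_right]
          congr 2
          exact φ.map_lie (z : L) a }
  have h1 : ∀ s : (Verma l np X ⊗[k] A) ⊗[k] A,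
      φ.toLinearMap.lTensor _ (mulLast k _ A s) =
        mulLast k _ A ((φ.toLinearMap.lTensor _).rTensor A s) +
          mulLast k _ A (φ.toLinearMap.lTensor _ s) := by
    intro s
    induction s using TensorProduct.induction_on with
    | zero => simp
    | add a b ha hb => simp only [map_add, ha, hb]; abel
    | tmul m w =>
      induction m using TensorProduct.induction_on with
      | zero => simp
      | add a b ha hb => simp only [map_add, TensorProduct.add_tmul, ha, hb] at *; abel
      | tmul m v => simp [hφ, TensorProduct.tmul_add]
  have h2 : (φ.toLinearMap.lTensor X).rTensor A y = β.toLinearMap.rTensor A y := rfl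
  rw [starMap_apply, ← lTensor_rTensor_comm, h1, map_add]
  congr 1
  · have h3 : ∀ s : Verma l np (X ⊗[k] A) ⊗[k] A, (φ.toLinearMap.lTensor _).rTensor A
        ((D.fuse hX hN).toLinearMap.rTensor A s) =
        (D.fuse hX hN).toLinearMap.rTensor A ((Verma.map np β).toLinearMap.rTensor A s) := by
      intro s
      rw [← LinearMap.rTensor_comp_apply, ← LinearMap.rTensor_comp_apply]
      congr 2
      exact (LinearMap.ext fun m => D.fuse_lTensor hX hN φ β (fun _ => rfl) m).symm
    rw [h2, starMap_apply, ← D.sing_map hXA hXA hN, h3]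
  · rw [starMap_apply, ← D.sing_lTensor hXA hN hN, ← lTensor_rTensor_comm]

-- The part of the action of n⁻ on the Verma factor is lost under the projection, so n⁻ acts on
-- expectation values through W alone.
omit [Finite ι] in
lemma proj_rTensor_nm (a : U k nm) (s : Verma l np X ⊗[k] W) :
    (Verma.proj D X).rTensor W (envAct _ (envIncl nm a) s) =
      (envAct W (envIncl nm a)).lTensor X ((Verma.proj D X).rTensor W s) := by
  induction a using env_induction generalizing s with
  | h1 => simp [Module.End.one_eq_id]
  | hadd a b ha hb =>
    rw [map_add, map_add, LinearMap.add_apply, map_add, ha, hb, map_add, LinearMap.lTensor_add,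
      LinearMap.add_apply]
  | hsmul r a ha =>
    rw [map_smul, map_smul, LinearMap.smul_apply, map_smul, ha, map_smul, LinearMap.lTensor_smul,
      LinearMap.smul_apply]
  | hmul y a ha =>
    have h1 : envAct W (iota k L (y : L)) = LieModule.toEnd k L W y :=
      LinearMap.ext fun m => envAct_iota (y : L) m
    have h2 : Verma.proj D X ∘ₗ LieModule.toEnd k L _ (y : L) = 0 :=
      LinearMap.ext fun m => Verma.proj_nm_lie D X y m
    rw [map_mul, map_mul, Module.End.mul_apply, envIncl_iota, envAct_iota, lie_tensor, map_add,
      lTensor_rTensor_comm, ha, ← LinearMap.comp_apply, ← LinearMap.rTensor_comp, h2,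
      LinearMap.rTensor_zero, LinearMap.zero_apply, zero_add, map_mul, h1, Module.End.mul_eq_comp,
      LinearMap.lTensor_comp, LinearMap.comp_apply]

/-- The dynamical multiplication in terms of the inverse of the pairing. -/
lemma starMap_eq_sum (y : X ⊗[k] A) (b : A) {N : ℕ}
    (hb : ∀ s : Multiset ι, N ≤ D.mdeg s → (antiAct A (D.eWord s)).unop b = 0) :
    D.starMap hX hXA hN (y ⊗ₜ b) = ∑ s ∈ (D.finite_mdeg_le N).toFinset,
      ∑ t : D.Homog (D.mdeg s), (LinearMap.mulRight k ((antiAct A (D.eWord s)).unop b)).lTensor X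
        ((envAct A (D.fWord t.1)).lTensor X (D.invGram hXA s y t)) := by
  have h1 : D.sing hXA hN (y ⊗ₜ b) = D.singSum hXA N y b :=
    (D.eq_sing hXA hN (D.np_lie_singSum hXA y hb) (D.proj_singSum_one hXA y hb)).symm
  have h2 : ∀ (s : Verma l np X ⊗[k] A) (c : A), mulLast k _ A (s ⊗ₜ c) =
      (LinearMap.mulRight k c).lTensor _ s := by
    intro s c
    induction s using TensorProduct.induction_on with
    | zero => simp
    | add a b ha hb => rw [TensorProduct.add_tmul, map_add, ha, hb, map_add]
    | tmul m w => simp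
  rw [starMap_apply, h1, singSum]
  simp only [map_sum, LinearMap.rTensor_tmul, h2, lTensor_rTensor_comm]
  refine Finset.sum_congr rfl fun s _ => ?_
  rw [dualVec_apply, ← map_sum]
  congr 1
  simp only [map_sum]
  refine Finset.sum_congr rfl fun t _ => ?_
  -- The dual vectors are combinations of words in the f_j applied to the top; under the intertwiner
  -- and the projection such words act on A only.
  change (Verma.proj D X).rTensor A (D.fuse hX hN _) = _
  rw [Verma.hom_env, fWord, proj_rTensor_nm, fuse_top, proj_sing]

end Star

end Triangular

end DynTwist

end DynQuant

end

open scoped TensorProduct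

noncomputable section

namespace DynQuant

universe u v w

/-! ## Roots of a Levi decomposition -/

section Roots

open LieAlgebra LieAlgebra.IsKilling LieModule

variable {g : Type u} [LieRing g] [LieAlgebra ℂ g] [FiniteDimensional ℂ g] [IsKilling ℂ g]
  {H : LieSubalgebra ℂ g} [H.IsCartanSubalgebra]

/-- A subspace containing a nonzero root vector contains the root space. -/
lemma rootSpace_le_of_mem {S : Submodule ℂ g} {α : Weight ℂ H g} (hα : α.IsNonZero) {x : g}
    (hx : x ∈ rootSpace H α) (hx0 : x ≠ 0) (hS : x ∈ S) : (rootSpace H α).toSubmodule ≤ S := by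
  intro y hy
  obtain ⟨c, hc⟩ := (finrank_eq_one_iff_of_nonzero' (⟨x, hx⟩ : rootSpace H α)
    (by simpa [LieSubmodule.mk_eq_zero] using hx0)).mp (finrank_rootSpace_eq_one α hα) ⟨y, hy⟩
  have : c • x = y := congrArg Subtype.val hc
  exact this ▸ S.smul_mem c hS

lemma lie_of_mem_rootSpace {α : H → ℂ} {x : g} (hx : x ∈ rootSpace H α) (z : H) :
    ⁅(z : g), x⁆ = α z • x := lie_eq_smul_of_mem_rootSpace hx z

-- A subspace stable under the Cartan subalgebra is the sum of its intersections with the root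
-- spaces, so linear statements may be checked on root vectors.
omit [IsKilling ℂ g] in
lemma stable_induction {S : Submodule ℂ g} (hS : ∀ z ∈ H, ∀ x ∈ S, ⁅z, x⁆ ∈ S) {P : g → Prop}
    (h : ∀ χ : Weight ℂ H g, ∀ x ∈ S, x ∈ rootSpace H χ → P x) (h0 : P 0)
    (hadd : ∀ x y, P x → P y → P (x + y)) {x : g} (hx : x ∈ S) : P x := by
  let N : LieSubmodule ℂ H g := { S with lie_mem := fun {z y} hy => hS z z.2 y hy }
  have hN : x ∈ N := hx
  rw [eq_iSup_inf_genWeightSpace ℂ H g N] at hN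
  exact LieSubmodule.iSup_induction (motive := P) _ hN (fun χ y hy => h χ y hy.1 hy.2) h0 hadd

omit [IsKilling ℂ g] in
lemma mem_of_mem_rootSpace_zero {χ : Weight ℂ H g} (hχ : χ.IsZero) {x : g}
    (hx : x ∈ rootSpace H χ) : x ∈ H := by
  rw [hχ.eq, rootSpace_zero_eq] at hx
  exact hx

/-- The reflection of a root in `S` along a root whose root space preserves `S`. -/
lemma rootSpace_reflect_le {S : Submodule ℂ g} {α γ : Weight ℂ H g} (hα : α.IsNonZero)
    (hγ : γ.IsNonZero) (hS : ∀ y ∈ rootSpace H γ, ∀ x ∈ S, ⁅y, x⁆ ∈ S)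
    (hαS : (rootSpace H α).toSubmodule ≤ S) {m : ℤ} (hm : α (coroot γ) = m) (hneg : m < 0) :
    (rootSpace H (reflectRoot γ α)).toSubmodule ≤ S := by
  -- x is a highest vector of the γ-string through α, on which an sl₂-triple for γ acts.
  obtain ⟨x, hx, x0⟩ := (chainTop γ α).exists_ne_zero
  obtain ⟨h, e, f, ht, he, hf⟩ := exists_isSl2Triple_of_weight_isNonZero hγ
  obtain rfl := ht.h_eq_coroot hγ he hf
  have prim : ht.HasPrimitiveVectorWith x (chainLength γ α : ℂ) :=
    have := lie_mem_genWeightSpace_of_mem_genWeightSpace he hx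
    ⟨x0, (chainLength_smul _ _ hx).symm, by rwa [genWeightSpace_add_chainTop _ _ hγ] at this⟩
  have hval := apply_coroot_eq_cast' γ α
  have hle := chainTopCoeff_le_chainLength γ α
  set n := chainLength γ α
  set T := chainTopCoeff γ α
  have hm' : m = n - 2 * T := by rw [hm] at hval; exact_mod_cast hval
  have hroot : ∀ i : ℕ, ((toEnd ℂ g g f) ^ i) x ∈ rootSpace H (i • (-γ : H → ℂ) + chainTop γ α) :=
    fun i => toEnd_pow_apply_mem hf hx i
  -- The root α sits T steps below the top of a string of length n, and its reflection n − T steps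
  -- below. As m = n − 2T is negative, the reflection is reached from α by raising with e, which
  -- preserves S.
  have hS' : ∀ j ≤ T, ((toEnd ℂ g g f) ^ (T - j)) x ∈ S := by
    intro j
    induction j with
    | zero =>
      intro _
      refine hαS ?_
      have := hroot T
      rw [coe_chainTop'] at this
      rwa [smul_neg, neg_add_cancel_left] at this
    | succ j ih =>
      intro hj
      have h1 := hS e he _ (ih (by omega))
      have h2 : T - j = (T - (j + 1)) + 1 := by omega
      rw [h2, prim.lie_e_pow_succ_toEnd_f] at h1
      refine (S.smul_mem_iff ?_).1 h1
      have h3 : ((T - (j + 1) : ℕ) : ℂ) + 1 ≠ 0 := Nat.cast_add_one_ne_zero _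
      refine mul_ne_zero h3 (sub_ne_zero.2 ?_)
      exact_mod_cast (by omega : n ≠ T - (j + 1))
  have hfin := hS' (2 * T - n) (by omega)
  have h4 : T - (2 * T - n) = n - T := by omega
  rw [h4] at hfin
  refine rootSpace_le_of_mem (reflectRoot_isNonZero γ α hα) ?_
    (prim.pow_toEnd_f_ne_zero_of_eq_nat rfl (Nat.sub_le n T)) hfin
  have := hroot (n - T)
  rw [coe_chainTop'] at this
  convert! this using 2
  change (α : H → ℂ) - α (coroot γ) • (γ : H → ℂ) = _
  rw [hval]
  ext z
  simp only [Pi.sub_apply, Pi.smul_apply, Pi.add_apply, Pi.neg_apply, smul_eq_mul, nsmul_eq_mul,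
    smul_neg, Pi.mul_apply, Pi.natCast_apply]
  push_cast [Nat.cast_sub hle]
  ring

/-- A sum over a set on which negative terms can be cancelled by an involution. -/
lemma sum_involution_nonneg {ι : Type*} [DecidableEq ι] (Q : Finset ι) (c : ι → ℤ) (σ : ι → ι)
    (hσ : ∀ a, σ (σ a) = a) (hc : ∀ a, c (σ a) = - c a) (hQ : ∀ a ∈ Q, c a < 0 → σ a ∈ Q) :
    0 ≤ ∑ a ∈ Q, c a ∧ ∀ b ∈ Q, 0 < c b → σ b ∉ Q → 0 < ∑ a ∈ Q, c a := by
  -- Elements whose σ-image is also in Q cancel in pairs. The others have nonnegative c, since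
  -- negative ones have their image in Q.
  have h1 : ∑ a ∈ Q with σ a ∈ Q, c a = 0 := by
    have h2 : ∑ a ∈ Q with σ a ∈ Q, c a = ∑ a ∈ Q with σ a ∈ Q, - c a := by
      refine Finset.sum_bij (fun a _ => σ a) ?_ ?_ ?_ ?_
      · intro a ha
        rw [Finset.mem_filter] at ha ⊢
        exact ⟨ha.2, by rw [hσ]; exact ha.1⟩
      · intro a _ b _ hab
        rw [← hσ a, hab, hσ]
      · intro b hb
        rw [Finset.mem_filter] at hb
        exact ⟨σ b, Finset.mem_filter.2 ⟨hb.2, by rw [hσ]; exact hb.1⟩, hσ b⟩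
      · intro a _
        rw [hc, neg_neg]
    rw [Finset.sum_neg_distrib] at h2
    omega
  rw [← Finset.sum_filter_add_sum_filter_not Q (fun a => σ a ∈ Q), h1, zero_add]
  have h3 : ∀ a ∈ Q.filter fun a => σ a ∉ Q, 0 ≤ c a := by
    intro a ha
    rw [Finset.mem_filter] at ha
    by_contra hlt
    exact ha.2 (hQ a ha.1 (not_le.1 hlt))
  exact ⟨Finset.sum_nonneg h3, fun b hb hpos hσb =>
    Finset.sum_pos' h3 ⟨b, Finset.mem_filter.2 ⟨hb, hσb⟩, hpos⟩⟩

/-- The roots whose root spaces lie in `S`. -/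
def rootsIn (H : LieSubalgebra ℂ g) [H.IsCartanSubalgebra] (S : Submodule ℂ g) : Finset H.root :=
  open Classical in Finset.univ.filter fun α => (rootSpace H (α : Weight ℂ H g)).toSubmodule ≤ S

omit [IsKilling ℂ g] in
lemma mem_rootsIn {S : Submodule ℂ g} {α : H.root} :
    α ∈ rootsIn H S ↔ (rootSpace H (α : Weight ℂ H g)).toSubmodule ≤ S := by
  simp [rootsIn]

/-- The sum of the coroots of the roots in `S`. -/
def corootSum (H : LieSubalgebra ℂ g) [H.IsCartanSubalgebra] (S : Submodule ℂ g) : H :=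
  ∑ α ∈ rootsIn H S, coroot (α : Weight ℂ H g)

/-- The value of a root at the sum of the coroots of the roots in `S`. -/
def corootSumVal (H : LieSubalgebra ℂ g) [H.IsCartanSubalgebra] (S : Submodule ℂ g)
    (γ : H.root) : ℤ :=
  ∑ α ∈ rootsIn H S, (rootSystem H).pairingIn ℤ γ α

lemma apply_corootSum (S : Submodule ℂ g) (γ : H.root) :
    (γ : Weight ℂ H g) (corootSum H S) = corootSumVal H S γ := by
  rw [corootSum, corootSumVal, Int.cast_sum]
  refine (map_sum (γ : Weight ℂ H g).toLinear _ _).trans ?_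
  refine Finset.sum_congr rfl fun α _ => ?_
  exact ((rootSystem H).algebraMap_pairingIn ℤ γ α).symm

lemma apply_coroot_eq_pairingIn (α γ : H.root) :
    (α : Weight ℂ H g) (coroot (γ : Weight ℂ H g)) = (rootSystem H).pairingIn ℤ α γ :=
  ((rootSystem H).algebraMap_pairingIn ℤ α γ).symm

lemma coe_reflectionPerm (α γ : H.root) :
    ((rootSystem H).reflectionPerm γ α : Weight ℂ H g) = reflectRoot γ α := by
  apply Weight.ext
  intro z
  have h5 := LinearMap.congr_fun ((rootSystem H).root_reflectionPerm γ α) z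
  rw [RootPairing.reflection_apply] at h5
  exact h5

lemma reflectionPerm_mem_rootsIn {S : Submodule ℂ g} {α γ : H.root}
    (hS : ∀ y ∈ rootSpace H (γ : Weight ℂ H g), ∀ x ∈ S, ⁅y, x⁆ ∈ S) (hα : α ∈ rootsIn H S)
    (hneg : (rootSystem H).pairingIn ℤ γ α < 0) :
    (rootSystem H).reflectionPerm γ α ∈ rootsIn H S := by
  have h1 : (rootSystem H).pairingIn ℤ α γ < 0 :=
    ((rootSystem H).pairingIn_lt_zero_iff ℤ).2 hneg
  have h2 := apply_coroot_eq_pairingIn α γ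
  generalize (rootSystem H).pairingIn ℤ α γ = m at h1 h2
  rw [mem_rootsIn] at hα ⊢
  rw [coe_reflectionPerm]
  exact rootSpace_reflect_le (LieSubalgebra.isNonZero_coe_root α)
    (LieSubalgebra.isNonZero_coe_root γ) hS hα h2 h1

/-- The reflection in γ changes the sign of the pairing of γ with α, and maps roots of S with
negative pairing back into S, so the negative terms cancel. If γ is in S and −γ is not, the
self-pairing 2 of γ survives. -/
lemma corootSumVal_nonneg {S : Submodule ℂ g} {γ : H.root}
    (hS : ∀ y ∈ rootSpace H (γ : Weight ℂ H g), ∀ x ∈ S, ⁅y, x⁆ ∈ S) :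
    0 ≤ corootSumVal H S γ ∧
      (γ ∈ rootsIn H S → (rootSystem H).reflectionPerm γ γ ∉ rootsIn H S →
        0 < corootSumVal H S γ) := by
  classical
  obtain ⟨h1, h2⟩ := sum_involution_nonneg (rootsIn H S) (fun α => (rootSystem H).pairingIn ℤ γ α)
    (fun α => (rootSystem H).reflectionPerm γ α)
    (fun a => (rootSystem H).reflectionPerm_self γ a) (fun a => by
      have : ((rootSystem H).pairingIn ℤ γ ((rootSystem H).reflectionPerm γ a) : ℂ) =
          ((-(rootSystem H).pairingIn ℤ γ a : ℤ) : ℂ) := by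
        push_cast
        have e1 := (rootSystem H).algebraMap_pairingIn ℤ γ ((rootSystem H).reflectionPerm γ a)
        have e2 := (rootSystem H).algebraMap_pairingIn ℤ γ a
        rw [RootPairing.pairing_reflectionPerm, RootPairing.pairing_reflectionPerm_self_left,
          ← e2] at e1
        exact e1
      exact_mod_cast this)
    (fun a ha hneg => reflectionPerm_mem_rootsIn hS ha hneg)
  refine ⟨h1, fun h3 h4 => h2 γ h3 ?_ h4⟩
  rw [RootPairing.pairingIn_same]
  norm_num

lemma reflectionPerm_self_eq (γ : H.root) :
    ((rootSystem H).reflectionPerm γ γ : Weight ℂ H g) = -(γ : Weight ℂ H g) := by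
  apply Weight.ext
  intro z
  have h5 := LinearMap.congr_fun ((rootSystem H).root_reflectionPerm γ γ) z
  rw [RootPairing.reflection_apply_self] at h5
  exact h5

end Roots

end DynQuant

end

open scoped TensorProduct

noncomputable section

namespace DynQuant

universe u v w

/-! ## The grading of a Levi decomposition -/

section Levi

open LieAlgebra LieAlgebra.IsKilling LieModule

variable {g : Type u} [LieRing g] [LieAlgebra ℂ g]

lemma IsLeviDecomposition.bijective {nm l np : LieSubalgebra ℂ g}
    (hdec : IsLeviDecomposition nm l np) :
    Function.Bijective fun p : nm × l × np => (p.1 + (p.2.1 + p.2.2) : g) := by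
  have h := hdec.isInternal
  let φ : (nm × l × np) →ₗ[ℂ] g := nm.toSubmodule.subtype.coprod
    (l.toSubmodule.subtype.coprod np.toSubmodule.subtype)
  change Function.Bijective φ
  let S : Fin 3 → Submodule ℂ g := ![nm.toSubmodule, l.toSubmodule, np.toSubmodule]
  constructor
  · rw [← LinearMap.ker_eq_bot, LinearMap.ker_eq_bot']
    rintro ⟨a, b, c⟩ habc
    have habc' : (a + (b + c) : g) = 0 := habc
    have hz : ∀ i, ∀ x ∈ S i, x ∈ ⨆ j, ⨆ (_ : j ≠ i), S j → x = 0 := fun i =>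
      Submodule.disjoint_def.1 (h.submodule_iSupIndep i)
    have hle : ∀ i j, j ≠ i → S j ≤ ⨆ j, ⨆ (_ : j ≠ i), S j := fun i j hij =>
      le_iSup₂_of_le j hij le_rfl
    have ha : (a : g) = 0 := by
      refine hz 0 a a.2 ?_
      rw [eq_neg_of_add_eq_zero_left habc']
      exact Submodule.neg_mem _ (Submodule.add_mem _ (hle 0 1 (by decide) b.2)
        (hle 0 2 (by decide) c.2))
    rw [ha, zero_add] at habc'
    have hb : (b : g) = 0 := by
      refine hz 1 b b.2 ?_
      rw [eq_neg_of_add_eq_zero_left habc']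
      exact Submodule.neg_mem _ (hle 1 2 (by decide) c.2)
    rw [hb, zero_add] at habc'
    exact Prod.ext (Subtype.ext ha) (Prod.ext (Subtype.ext hb) (Subtype.ext habc'))
  · rw [← LinearMap.range_eq_top, eq_top_iff, ← h.submodule_iSup_eq_top, iSup_le_iff]
    intro i
    fin_cases i
    · exact fun x hx => ⟨(⟨x, hx⟩, 0, 0), by simp [φ]⟩
    · exact fun x hx => ⟨(0, ⟨x, hx⟩, 0), by simp [φ]⟩
    · exact fun x hx => ⟨(0, 0, ⟨x, hx⟩), by simp [φ]; rfl⟩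

variable [FiniteDimensional ℂ g] [IsKilling ℂ g]
  {H : LieSubalgebra ℂ g} [H.IsCartanSubalgebra] {nm l np : LieSubalgebra ℂ g} {s : g}

lemma lie_eq_zero_of_mem_cartan {x y : g} (hx : x ∈ H) (hy : y ∈ H) : ⁅x, y⁆ = 0 :=
  congrArg Subtype.val (trivial_lie_zero H H ⟨x, hx⟩ ⟨y, hy⟩)

lemma cartan_le_centralizer (hs : s ∈ H) (hl : ∀ x : g, x ∈ l ↔ ⁅s, x⁆ = 0) {z : g} (hz : z ∈ H) :
    z ∈ l := (hl z).2 (lie_eq_zero_of_mem_cartan hs hz)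

/-- If n⁺ contained two opposite root spaces, it would contain the coroot, which also lies in `l`.
-/
lemma neg_notMem_rootsIn (hs : s ∈ H) (hl : ∀ x : g, x ∈ l ↔ ⁅s, x⁆ = 0)
    (hdisj : ∀ x ∈ l, x ∈ np → x = 0) {γ : H.root} (hγ : γ ∈ rootsIn H np.toSubmodule) :
    (rootSystem H).reflectionPerm γ γ ∉ rootsIn H np.toSubmodule := by
  intro hneg
  rw [mem_rootsIn, reflectionPerm_self_eq] at hneg
  rw [mem_rootsIn] at hγ
  have hγ0 := LieSubalgebra.isNonZero_coe_root γ
  obtain ⟨h, e, f, ht, he, hf⟩ := exists_isSl2Triple_of_weight_isNonZero hγ0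
  obtain rfl := ht.h_eq_coroot hγ0 he hf
  have h1 : ((coroot (γ : Weight ℂ H g) : H) : g) ∈ np := by
    rw [← ht.lie_e_f]
    exact np.lie_mem (hγ he) (hneg (by simpa using hf))
  exact ht.h_ne_zero (hdisj _ (cartan_le_centralizer hs hl (coroot _).2) h1)

/-- For a root γ of `l`, both γ and −γ normalize n⁺, so the value of γ at the coroot sum is both
nonnegative and nonpositive. -/
lemma corootSumVal_eq_zero (hs : s ∈ H) (hl : ∀ x : g, x ∈ l ↔ ⁅s, x⁆ = 0)
    (hnp : ∀ x ∈ l, ∀ y ∈ np, ⁅x, y⁆ ∈ np) {γ : H.root} (hγ : γ ∈ rootsIn H l.toSubmodule) :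
    corootSumVal H np.toSubmodule γ = 0 := by
  rw [mem_rootsIn] at hγ
  have hγs : (γ : Weight ℂ H g) ⟨s, hs⟩ = 0 := by
    obtain ⟨x, hx, x0⟩ := (γ : Weight ℂ H g).exists_ne_zero
    have h1 := (hl x).1 (hγ hx)
    have h2 := lie_of_mem_rootSpace hx ⟨s, hs⟩
    rw [h1, eq_comm, smul_eq_zero] at h2
    exact h2.resolve_right x0
  have h1 := (corootSumVal_nonneg (S := np.toSubmodule) (γ := γ)
    (fun y hy x hx => hnp y (hγ hy) x hx)).1
  have h2 := (corootSumVal_nonneg (S := np.toSubmodule) (γ := (rootSystem H).reflectionPerm γ γ)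
    (fun y hy x hx => hnp y (by
      rw [reflectionPerm_self_eq] at hy
      refine (hl y).2 ?_
      have h3 := lie_of_mem_rootSpace hy ⟨s, hs⟩
      rw [Weight.coe_neg, Pi.neg_apply, hγs, neg_zero, zero_smul] at h3
      exact h3) x hx)).1
  have h3 := apply_corootSum np.toSubmodule ((rootSystem H).reflectionPerm γ γ)
  rw [reflectionPerm_self_eq, Weight.coe_neg, Pi.neg_apply, apply_corootSum] at h3
  have h4 : -corootSumVal H np.toSubmodule γ =
    corootSumVal H np.toSubmodule ((rootSystem H).reflectionPerm γ γ) := by exact_mod_cast h3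
  omega

lemma mem_rootsIn_of_mem {S : Submodule ℂ g} {γ : H.root} {x : g}
    (hx : x ∈ rootSpace H (γ : Weight ℂ H g)) (hx0 : x ≠ 0) (hS : x ∈ S) : γ ∈ rootsIn H S :=
  mem_rootsIn.2 (rootSpace_le_of_mem (LieSubalgebra.isNonZero_coe_root γ) hx hx0 hS)

lemma corootSum_lie_eq_zero (hs : s ∈ H) (hl : ∀ x : g, x ∈ l ↔ ⁅s, x⁆ = 0)
    (hnp : ∀ x ∈ l, ∀ y ∈ np, ⁅x, y⁆ ∈ np) {z : g} (hz : z ∈ l) :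
    ⁅(corootSum H np.toSubmodule : g), z⁆ = 0 := by
  refine stable_induction (H := H) (S := l.toSubmodule)
    (P := fun z => ⁅(corootSum H np.toSubmodule : g), z⁆ = 0)
    (fun z hz x hx => l.lie_mem (cartan_le_centralizer hs hl hz) hx) (fun χ x hx hχ => ?_)
    (lie_zero _) (fun x y hx hy => by rw [lie_add, hx, hy, add_zero]) hz
  by_cases h0 : χ.IsZero
  · exact lie_eq_zero_of_mem_cartan (corootSum H _).2 (mem_of_mem_rootSpace_zero h0 hχ)
  by_cases hx0 : x = 0
  · rw [hx0, lie_zero]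
  let γ : H.root := ⟨χ, by simpa using h0⟩
  have h1 := apply_corootSum np.toSubmodule γ
  rw [corootSumVal_eq_zero hs hl hnp (mem_rootsIn_of_mem (γ := γ) hχ hx0 hx), Int.cast_zero] at h1
  rw [lie_of_mem_rootSpace hχ]
  exact (congrArg (· • x) h1).trans (zero_smul _ _)

/-- A root vector. -/
def rootVector (γ : H.root) : g := (γ : Weight ℂ H g).exists_ne_zero.choose

omit [IsKilling ℂ g] in
lemma rootVector_mem (γ : H.root) : rootVector γ ∈ rootSpace H (γ : Weight ℂ H g) :=
  (γ : Weight ℂ H g).exists_ne_zero.choose_spec.1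

omit [IsKilling ℂ g] in
lemma rootVector_ne_zero (γ : H.root) : rootVector γ ≠ 0 :=
  (γ : Weight ℂ H g).exists_ne_zero.choose_spec.2

/-- As n⁺ meets `l`, and hence the Cartan subalgebra, trivially, it is a sum of one dimensional root
spaces. -/
lemma le_of_rootVector_mem (hs : s ∈ H) (hl : ∀ x : g, x ∈ l ↔ ⁅s, x⁆ = 0)
    (hnp : ∀ x ∈ l, ∀ y ∈ np, ⁅x, y⁆ ∈ np) (hdisj : ∀ x ∈ l, x ∈ np → x = 0) (T : Submodule ℂ g)
    (hT : ∀ γ ∈ rootsIn H np.toSubmodule, rootVector γ ∈ T) : np.toSubmodule ≤ T := by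
  intro x hx
  refine stable_induction (H := H) (S := np.toSubmodule) (P := fun x => x ∈ T)
    (fun z hz x hx => hnp z (cartan_le_centralizer hs hl hz) x hx) (fun χ x hx hχ => ?_)
    (Submodule.zero_mem _) (fun x y hx hy => Submodule.add_mem _ hx hy) hx
  by_cases hx0 : x = 0
  · rw [hx0]; exact Submodule.zero_mem _
  have h0 : ¬ χ.IsZero := fun h0 => hx0 (hdisj x
    (cartan_le_centralizer hs hl (mem_of_mem_rootSpace_zero h0 hχ)) hx)
  obtain ⟨γ, rfl⟩ : ∃ γ : H.root, (γ : Weight ℂ H g) = χ := ⟨⟨χ, by simpa using h0⟩, rfl⟩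
  have hγT : rootVector γ ∈ T := hT γ (mem_rootsIn_of_mem hχ hx0 hx)
  exact rootSpace_le_of_mem (LieSubalgebra.isNonZero_coe_root γ) (rootVector_mem γ)
    (rootVector_ne_zero γ) hγT hχ

omit [IsKilling ℂ g] in
lemma linearIndependent_rootVector :
    LinearIndependent ℂ (rootVector : H.root → g) := by
  have h1 := (LieSubmodule.iSupIndep_toSubmodule.2 (iSupIndep_genWeightSpace' ℂ H g)).comp
    (Subtype.val_injective : Function.Injective (Subtype.val : H.root → Weight ℂ H g))
  exact iSupIndep.linearIndependent _ h1 rootVector_mem rootVector_ne_zero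

/-- The basis of root vectors of `n⁺`. -/
lemma exists_root_basis (hs : s ∈ H) (hl : ∀ x : g, x ∈ l ↔ ⁅s, x⁆ = 0)
    (hnp : ∀ x ∈ l, ∀ y ∈ np, ⁅x, y⁆ ∈ np) (hdisj : ∀ x ∈ l, x ∈ np → x = 0) :
    ∃ e : Module.Basis {γ : H.root // γ ∈ rootsIn H np.toSubmodule} ℂ np,
      ∀ γ, (e γ : g) = rootVector γ.1 := by
  let v : {γ : H.root // γ ∈ rootsIn H np.toSubmodule} → np := fun γ =>
    ⟨rootVector γ.1, mem_rootsIn.1 γ.2 (rootVector_mem γ.1)⟩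
  have hind : LinearIndependent ℂ v :=
    LinearIndependent.of_comp np.toSubmodule.subtype
      (linearIndependent_rootVector.comp _ Subtype.val_injective)
  have hspan : ⊤ ≤ Submodule.span ℂ (Set.range v) := by
    have key := le_of_rootVector_mem hs hl hnp hdisj
      ((Submodule.span ℂ (Set.range v)).map np.toSubmodule.subtype)
      (fun γ hγ => ⟨v ⟨γ, hγ⟩, Submodule.subset_span ⟨_, rfl⟩, rfl⟩)
    rintro ⟨x, hx⟩ -
    obtain ⟨y, hy, hyx⟩ := key hx
    have : y = ⟨x, hx⟩ := Subtype.ext hyx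
    exact this ▸ hy
  exact ⟨Module.Basis.mk hind hspan, fun γ => by rw [Module.Basis.mk_apply]⟩

/-- The pairing of `n⁺` and `n⁻` defined by a linear form. -/
def nilPairing (nm np : LieSubalgebra ℂ g) (μ : Module.Dual ℂ g) : np →ₗ[ℂ] nm →ₗ[ℂ] ℂ :=
  LinearMap.mk₂ ℂ (fun x y => μ ⁅(x : g), (y : g)⁆) (fun x x' y => by simp)
    (fun c x y => by simp) (fun x y y' => by simp) (fun c x y => by simp)

omit [FiniteDimensional ℂ g] [IsKilling ℂ g] in
lemma nilPairing_apply (μ : Module.Dual ℂ g) (x : np) (y : nm) :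
    nilPairing nm np μ x y = μ ⁅(x : g), (y : g)⁆ := rfl

variable (hdec : IsLeviDecomposition nm l np) (μ : Module.Dual ℂ g)
  (hμ : μ ∈ centreDual nm l np)
  (hstab : ∀ x : g, x ∈ l ↔ ∀ y : g, μ ⁅x, y⁆ = 0)

omit [FiniteDimensional ℂ g] [IsKilling ℂ g] in
include hdec in
lemma IsLeviDecomposition.eq_zero_of_mem {x y z : g} (hx : x ∈ nm) (hy : y ∈ l) (hz : z ∈ np)
    (h : x + (y + z) = 0) : x = 0 ∧ y = 0 ∧ z = 0 := by
  have := @hdec.bijective.1 (⟨x, hx⟩, ⟨y, hy⟩, ⟨z, hz⟩) 0 (by simpa using h)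
  simp only [Prod.ext_iff, Subtype.ext_iff] at this
  exact this

-- For x in n⁺ the form μ([x, ·]) is automatically zero on `l` and n⁺. If it also vanishes on n⁻,
-- then x stabilizes μ, so x lies in `l` and is zero. The same holds with n⁺ and n⁻ exchanged.
omit [IsKilling ℂ g] in
include hdec hμ hstab in
lemma nilPairing_isPerfPair : (nilPairing nm np μ).IsPerfPair := by
  refine LinearMap.IsPerfPair.of_injective ?_ ?_
  · rw [← LinearMap.ker_eq_bot, LinearMap.ker_eq_bot']
    rintro ⟨x, hx⟩ h
    have hxl : x ∈ l := by
      rw [hstab]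
      intro y
      obtain ⟨⟨a, b, c⟩, rfl⟩ := hdec.bijective.2 y
      have h1 := LinearMap.congr_fun h a
      simp only [nilPairing_apply, LinearMap.zero_apply] at h1
      have h2 : ⁅x, (b : g)⁆ ∈ np := by
        rw [← lie_skew]; exact np.neg_mem (hdec.lie_mem_np b b.2 x hx)
      simp only [lie_add, map_add, h1, hμ.2.1 _ h2, hμ.2.1 _ (np.lie_mem hx c.2), add_zero]
    have := (hdec.eq_zero_of_mem (x := 0) (y := x) (z := -x) nm.zero_mem hxl (np.neg_mem hx)
      (by simp)).2.1
    exact Subtype.ext this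
  · rw [← LinearMap.ker_eq_bot, LinearMap.ker_eq_bot']
    rintro ⟨x, hx⟩ h
    have hxl : x ∈ l := by
      rw [hstab]
      intro y
      obtain ⟨⟨a, b, c⟩, rfl⟩ := hdec.bijective.2 y
      have h1 := LinearMap.congr_fun h c
      simp only [LinearMap.flip_apply, nilPairing_apply, LinearMap.zero_apply] at h1
      have h3 : μ ⁅x, (c : g)⁆ = 0 := by rw [← lie_skew, map_neg, h1, neg_zero]
      have h2 : ⁅x, (b : g)⁆ ∈ nm := by
        rw [← lie_skew]; exact nm.neg_mem (hdec.lie_mem_nm b b.2 x hx)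
      simp only [lie_add, map_add, h3, hμ.1 _ h2, hμ.1 _ (nm.lie_mem hx a.2), add_zero]
    have := (hdec.eq_zero_of_mem (x := -x) (y := x) (z := 0) (nm.neg_mem hx) hxl np.zero_mem
      (by simp)).2.1
    exact Subtype.ext this

/-- `g` embeds into its enveloping algebra. -/
lemma iota_injective_of_isKilling : Function.Injective (iota ℂ g) := by
  intro x y hxy
  have h : ∀ z : g, ⁅x, z⁆ = ⁅y, z⁆ := fun z => by
    rw [← envAct_iota (k := ℂ) (N := g), ← envAct_iota (k := ℂ) (N := g), hxy]
  have h2 : x - y ∈ LieAlgebra.center ℂ g := by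
    rw [LieModule.mem_maxTrivSubmodule]
    intro z
    rw [← lie_skew, sub_lie, h, sub_self, neg_zero]
  rw [LieAlgebra.center_eq_bot, LieSubmodule.mem_bot] at h2
  exact sub_eq_zero.1 h2

include hdec hμ hstab in
open Classical in
/-- A Levi decomposition has a grading, with bases of `n⁺` and `n⁻` that are dual for the pairing
defined by `μ`. -/
theorem exists_triangular :
    ∃ (ι : Type u) (_ : Finite ι) (D : Triangular nm l np ι), ∀ i j,
      μ ⁅(D.e i : g), (D.f j : g)⁆ = if i = j then 1 else 0 := by
  obtain ⟨H, hH, s, hs, hl⟩ := hdec.levi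
  have hdisj : ∀ x ∈ l, x ∈ np → x = 0 := fun x hxl hxn =>
    (hdec.eq_zero_of_mem (x := 0) (y := x) (z := -x) nm.zero_mem hxl (np.neg_mem hxn)
      (by simp)).2.1
  have hnp := hdec.lie_mem_np
  obtain ⟨e, he⟩ := exists_root_basis (H := H) hs hl hnp hdisj
  let ι := {γ : H.root // γ ∈ rootsIn H np.toSubmodule}
  have := nilPairing_isPerfPair hdec μ hμ hstab
  -- The basis of n⁻ is the one dual to the root vectors of n⁺ under μ([·,·]), so no root analysis
  -- of n⁻ is needed.
  let f : Module.Basis ι ℂ nm := e.dualBasis.map (nilPairing nm np μ).flip.toPerfPair.symm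
  have hf : ∀ i j, μ ⁅(e i : g), (f j : g)⁆ = if i = j then 1 else 0 := by
    intro i j
    have h1 : (nilPairing nm np μ).flip.toPerfPair (f j) = e.dualBasis j := by
      simp [f]
    have h2 := LinearMap.congr_fun h1 (e i)
    rw [Module.Basis.dualBasis_apply_self] at h2
    exact h2
  let h : g := (corootSum H np.toSubmodule : H)
  have hmem : h ∈ l := cartan_le_centralizer hs hl (corootSum H np.toSubmodule).2
  have hpos : ∀ γ : ι, 0 < corootSumVal H np.toSubmodule γ.1 := fun γ =>
    (corootSumVal_nonneg (fun y hy x hx => np.lie_mem (mem_rootsIn.1 γ.2 hy) hx)).2 γ.2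
      (neg_notMem_rootsIn hs hl hdisj γ.2)
  have hcast : ∀ γ : ι, (((corootSumVal H np.toSubmodule γ.1).toNat : ℕ) : ℂ) =
      ((corootSumVal H np.toSubmodule γ.1 : ℤ) : ℂ) := fun γ => by
    exact_mod_cast Int.toNat_of_nonneg (hpos γ).le
  have hhe : ∀ γ : ι, ⁅h, (e γ : g)⁆ =
      ((corootSumVal H np.toSubmodule γ.1).toNat : ℂ) • (e γ : g) := fun γ => by
    rw [he, hcast, ← apply_corootSum]
    exact lie_of_mem_rootSpace (rootVector_mem γ.1) (corootSum H np.toSubmodule)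
  refine ⟨ι, inferInstance, ⟨e, f, fun γ => (corootSumVal H np.toSubmodule γ.1).toNat,
    fun γ => ?_, h, hmem, fun z hz => corootSum_lie_eq_zero hs hl hnp hz, hhe, fun j => ?_,
    hdec.lie_mem_nm, hnp, hdec.bijective, iota_injective_of_isKilling⟩,
    fun i j => by convert! hf i j⟩
  · have := hpos γ
    omega
  · have hmem' := hdec.lie_mem_nm h hmem (f j) (f j).2
    -- As h lies in the stabilizer of μ, the form μ([·,·]) is invariant under h; on the dual basis h
    -- therefore has the opposite eigenvalues.
    have key : (⟨⁅h, (f j : g)⁆, hmem'⟩ : nm) =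
        -(((corootSumVal H np.toSubmodule j.1).toNat : ℂ) • f j) := by
      apply (nilPairing nm np μ).flip.toPerfPair.injective
      refine e.ext fun i => ?_
      change μ ⁅(e i : g), ⁅h, (f j : g)⁆⁆ =
        μ ⁅(e i : g), ((-(((corootSumVal H np.toSubmodule j.1).toNat : ℂ) • f j) : nm) : g)⁆
      have h1 : μ ⁅h, ⁅(e i : g), (f j : g)⁆⁆ = 0 := (hstab h).1 hmem _
      rw [leibniz_lie, hhe, smul_lie, map_add, map_smul, hf] at h1
      have h2 : ((-(((corootSumVal H np.toSubmodule j.1).toNat : ℂ) • f j) : nm) : g) =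
        -(((corootSumVal H np.toSubmodule j.1).toNat : ℂ) • (f j : g)) := rfl
      rw [h2, lie_neg, lie_smul, map_neg, map_smul, hf]
      by_cases hij : i = j
      · subst hij
        linear_combination h1
      · simp only [hij, if_false, smul_zero, zero_add] at h1 ⊢
        rw [h1, neg_zero]
    exact congrArg Subtype.val key

end Levi

end DynQuant

end

open scoped TensorProduct

noncomputable section

namespace DynQuant

universe u v w

/-! ## Lattices in generalized Verma modules -/

section Lattice

open scoped Pointwise

lemma card_tsub_le {α : Type*} [DecidableEq α] (s r : Multiset α) :
    Multiset.card r - Multiset.card s ≤ Multiset.card (r - s) := by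
  have := Multiset.card_le_card (le_tsub_add : r ≤ r - s + s)
  rw [Multiset.card_add] at this
  omega

section Bracket

variable {K : Type v} [Field K] {L : Type u} [LieRing L] [LieAlgebra K L] {O : Subring K}
  {M : Type*} [AddCommGroup M] [Module K M] [LieRingModule L M] [LieModule K L M]

lemma subring_smul_lie (c : O) (y : L) (m : M) : ⁅c • y, m⁆ = c • ⁅y, m⁆ := smul_lie (c : K) y m

lemma subring_lie_smul (c : O) (y : L) (m : M) : ⁅y, c • m⁆ = c • ⁅y, m⁆ := lie_smul (c : K) y m

lemma lie_mem_of_mem_span {S : Set L} {T : Set M} {P : Submodule O M}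
    (h : ∀ y ∈ S, ∀ m ∈ T, ⁅y, m⁆ ∈ P) {y : L} (hy : y ∈ Submodule.span O S) {m : M}
    (hm : m ∈ Submodule.span O T) : ⁅y, m⁆ ∈ P := by
  induction hy, hm using Submodule.span_induction₂ with
  | mem_mem y m hy hm => exact h y hy m hm
  | zero_left m hm => rw [zero_lie]; exact P.zero_mem
  | zero_right y hy => rw [lie_zero]; exact P.zero_mem
  | add_left x y z _ _ _ h1 h2 => rw [add_lie]; exact P.add_mem h1 h2
  | add_right x y z _ _ _ h1 h2 => rw [lie_add]; exact P.add_mem h1 h2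
  | smul_left r x y _ _ h => rw [subring_smul_lie]; exact P.smul_mem r h
  | smul_right r x y _ _ h => rw [subring_lie_smul]; exact P.smul_mem r h

lemma mem_smul_iff {N : Submodule O M} {t : O} {m : M} : m ∈ t • N ↔ ∃ y ∈ N, t • y = m :=
  Submodule.mem_smul_pointwise_iff_exists _ _ _

lemma smul_mem_smul {N : Submodule O M} (t : O) {m : M} (hm : m ∈ N) : t • m ∈ t • N :=
  mem_smul_iff.2 ⟨m, hm, rfl⟩

lemma lie_mem_smul_left {Y : Submodule O L} {N P : Submodule O M} {t : O}
    (h : ∀ y ∈ Y, ∀ m ∈ N, ⁅y, m⁆ ∈ P) {y : L} (hy : y ∈ t • Y) {m : M} (hm : m ∈ N) :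
    ⁅y, m⁆ ∈ t • P := by
  obtain ⟨y', hy', rfl⟩ := Submodule.mem_smul_pointwise_iff_exists _ _ _ |>.1 hy
  rw [subring_smul_lie]
  exact smul_mem_smul t (h y' hy' m hm)

lemma lie_mem_smul_right {y : L} {N P : Submodule O M} {t : O}
    (h : ∀ m ∈ N, ⁅y, m⁆ ∈ P) {m : M} (hm : m ∈ t • N) : ⁅y, m⁆ ∈ t • P := by
  obtain ⟨m', hm', rfl⟩ := mem_smul_iff.1 hm
  rw [subring_lie_smul]
  exact smul_mem_smul t (h m' hm')

lemma smul_le_smul {N P : Submodule O M} (h : N ≤ P) (t : O) : t • N ≤ t • P := by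
  intro m hm
  obtain ⟨y, hy, rfl⟩ := mem_smul_iff.1 hm
  exact smul_mem_smul t (h hy)

lemma map_mem_smul {M' : Type*} [AddCommGroup M'] [Module K M'] (φ : M →ₗ[K] M')
    {N : Submodule O M} {P : Submodule O M'} {t : O} (h : ∀ m ∈ N, φ m ∈ P) {m : M}
    (hm : m ∈ t • N) : φ m ∈ t • P := by
  obtain ⟨m', hm', rfl⟩ := mem_smul_iff.1 hm
  have : φ (t • m') = t • φ m' := φ.map_smul (t : K) m'
  rw [this]
  exact smul_mem_smul t (h m' hm')

end Bracket

variable {K : Type v} [Field K] {L : Type u} [LieRing L] [LieAlgebra K L]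
  {nm l np : LieSubalgebra K L} {ι : Type w} (D : Triangular nm l np ι) (O : Subring K) (t : O)

namespace Triangular

/-- The `O`-span of the basis of `n⁻`. -/
def fSpan : Submodule O L := Submodule.span O (Set.range fun j => (D.f j : L))

/-- The `O`-span of the basis of `n⁺`. -/
def eSpan : Submodule O L := Submodule.span O (Set.range fun j => (D.e j : L))

open Classical in
/-- Modulo `t` and `n⁻`, the bases of `n⁺` and `n⁻` satisfy the commutation relations of a
Heisenberg algebra, with `z i j` in place of the scalar `δ_ij`. -/
structure IsHeisenberg (z : ι → ι → l) : Prop where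
  lie_f_f : ∀ j k, ⁅(D.f j : L), (D.f k : L)⁆ ∈ t • D.fSpan O
  lie_e_f : ∀ i j, ∃ a ∈ D.fSpan O, ∃ b ∈ t • D.eSpan O,
    ⁅(D.e i : L), (D.f j : L)⁆ = a + z i j + b
  lie_z_f : ∀ i j k, ⁅(z i j : L), (D.f k : L)⁆ ∈ t • D.fSpan O

variable {X : Type*} [AddCommGroup X] [Module K X] [LieRingModule l X] [LieModule K l X]

variable {O} in
open Classical in
/-- A finitely generated `O`-submodule of `X` on which `z i j` is `δ_ij` modulo `t`. -/
structure IsLattice (z : ι → ι → l) (E : Submodule O X) : Prop where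
  fg : E.FG
  lie_sub_mem : ∀ i j, ∀ x ∈ E, ⁅z i j, x⁆ - (if i = j then x else 0) ∈ t • E

/-- The vectors `f_w ⊗ x` of the Verma module. -/
def fTop : List ι → X →ₗ[K] Verma l np X
  | [] => Verma.top l np X
  | j :: w => LieModule.toEnd K L (Verma l np X) (D.f j : L) ∘ₗ fTop w

@[simp] lemma fTop_nil (x : X) : D.fTop [] x = Verma.top l np X x := rfl

@[simp] lemma fTop_cons (j : ι) (w : List ι) (x : X) :
    D.fTop (j :: w) x = ⁅(D.f j : L), D.fTop w x⁆ := rfl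

lemma fTop_eq (w : List ι) (x : X) :
    D.fTop w x = envIncl nm (word D.f w) • Verma.top l np X x := by
  induction w with
  | nil => simp
  | cons j w ih => rw [fTop_cons, ih, word_cons, map_mul, mul_smul, envIncl_iota, Verma.lie_def]

variable {O} {E : Submodule O X} {z : ι → ι → l}

/-- The span of the vectors `f_w ⊗ x` with `x ∈ E` and `w` of length at least `n`. -/
def vLat (E : Submodule O X) (n : ℕ) : Submodule O (Verma l np X) :=
  Submodule.span O {m | ∃ w x, n ≤ w.length ∧ x ∈ E ∧ m = D.fTop w x}

/-- The filtration by length, modulo `t`. -/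
def vFil (E : Submodule O X) (n : ℕ) : Submodule O (Verma l np X) :=
  D.vLat E n ⊔ t • D.vLat E 0

variable {t}

lemma fTop_mem_vLat {w : List ι} {n : ℕ} (hn : n ≤ w.length) {x : X} (hx : x ∈ E) :
    D.fTop w x ∈ D.vLat E n := Submodule.subset_span ⟨w, x, hn, hx, rfl⟩

lemma vLat_anti {m n : ℕ} (h : m ≤ n) : D.vLat E n ≤ D.vLat E m := by
  refine Submodule.span_mono ?_
  rintro _ ⟨w, x, hw, hx, rfl⟩
  exact ⟨w, x, h.trans hw, hx, rfl⟩

lemma vLat_le_vFil {n : ℕ} : D.vLat E n ≤ D.vFil t E n := le_sup_left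

lemma smul_vLat_le_vFil {n : ℕ} : t • D.vLat E 0 ≤ D.vFil t E n := le_sup_right

lemma vFil_anti {m n : ℕ} (h : m ≤ n) : D.vFil t E n ≤ D.vFil t E m :=
  sup_le_sup_right (D.vLat_anti h) _

lemma smul_le_self {M : Type*} [AddCommGroup M] [Module K M] (N : Submodule O M) (t : O) :
    t • N ≤ N := by
  intro m hm
  obtain ⟨y, hy, rfl⟩ := Submodule.mem_smul_pointwise_iff_exists _ _ _ |>.1 hm
  exact N.smul_mem t hy

lemma vFil_zero_le {n : ℕ} : D.vFil t E n ≤ D.vLat E 0 :=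
  sup_le (D.vLat_anti (Nat.zero_le n)) (smul_le_self _ t)

lemma fSpan_lie_vLat {n : ℕ} {y : L} (hy : y ∈ D.fSpan O) {m : Verma l np X}
    (hm : m ∈ D.vLat E n) : ⁅y, m⁆ ∈ D.vLat E (n + 1) := by
  refine lie_mem_of_mem_span ?_ hy hm
  rintro _ ⟨j, rfl⟩ _ ⟨w, x, hw, hx, rfl⟩
  exact D.fTop_mem_vLat (w := j :: w) (by simpa using hw) hx

lemma f_mem_fSpan (j : ι) : (D.f j : L) ∈ D.fSpan O := Submodule.subset_span ⟨j, rfl⟩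

lemma f_lie_smul_vLat (j : ι) {m : Verma l np X} (hm : m ∈ t • D.vLat E 0) :
    ⁅(D.f j : L), m⁆ ∈ t • D.vLat E 0 :=
  lie_mem_smul_right (fun _ hm => D.vLat_anti (Nat.zero_le 1)
    (D.fSpan_lie_vLat (D.f_mem_fSpan j) hm)) hm

lemma f_lie_vFil (j : ι) {n : ℕ} {m : Verma l np X} (hm : m ∈ D.vFil t E n) :
    ⁅(D.f j : L), m⁆ ∈ D.vFil t E (n + 1) := by
  obtain ⟨a, ha, b, hb, rfl⟩ := Submodule.mem_sup.1 hm
  rw [lie_add]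
  exact add_mem (D.vLat_le_vFil (D.fSpan_lie_vLat (D.f_mem_fSpan j) ha))
    (D.smul_vLat_le_vFil (D.f_lie_smul_vLat j hb))

lemma smul_fSpan_lie {y : L} (hy : y ∈ t • D.fSpan O) {m : Verma l np X}
    (hm : m ∈ D.vLat E 0) : ⁅y, m⁆ ∈ t • D.vLat E 0 :=
  lie_mem_smul_left (fun _ hy _ hm => D.vLat_anti (Nat.zero_le 1) (D.fSpan_lie_vLat hy hm)) hy hm

lemma fTop_smul_mem {w : List ι} {x : X} (hx : x ∈ t • E) : D.fTop w x ∈ t • D.vLat E 0 :=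
  map_mem_smul (D.fTop w) (fun _ hx => D.fTop_mem_vLat (Nat.zero_le _) hx) hx

variable (hz : D.IsHeisenberg O t z) (hE : IsLattice t z E)

-- Reordering a word costs brackets of the f_j, which lie in t times their span.
include hz in
lemma fTop_perm {w w' : List ι} (h : w.Perm w') {x : X} (hx : x ∈ E) :
    D.fTop w x - D.fTop w' x ∈ t • D.vLat E 0 := by
  induction h with
  | nil => rw [sub_self]; exact Submodule.zero_mem _
  | cons j h ih => rw [fTop_cons, fTop_cons, ← lie_sub]; exact D.f_lie_smul_vLat j ih
  | swap j k w =>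
    rw [fTop_cons, fTop_cons, fTop_cons, fTop_cons, ← lie_lie]
    exact D.smul_fSpan_lie (hz.lie_f_f _ _) (D.fTop_mem_vLat (Nat.zero_le _) hx)
  | trans h h' ih ih' => rw [← sub_add_sub_cancel]; exact add_mem ih ih'

include hz in
lemma z_lie_fTop_sub (i j : ι) (w : List ι) {x : X} (hx : x ∈ E) :
    ⁅(z i j : L), D.fTop w x⁆ - D.fTop w ⁅z i j, x⁆ ∈ t • D.vLat E 0 := by
  induction w with
  | nil => rw [fTop_nil, fTop_nil, Verma.lie_top, sub_self]; exact Submodule.zero_mem _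
  | cons k w ih =>
    rw [fTop_cons, fTop_cons, leibniz_lie, add_sub_assoc, ← lie_sub]
    exact add_mem (D.smul_fSpan_lie (hz.lie_z_f i j k) (D.fTop_mem_vLat (Nat.zero_le _) hx))
      (D.f_lie_smul_vLat k ih)

include hz hE in
open Classical in
lemma z_lie_fTop (i j : ι) (w : List ι) {x : X} (hx : x ∈ E) :
    ⁅(z i j : L), D.fTop w x⁆ - (if i = j then D.fTop w x else 0) ∈ t • D.vLat E 0 := by
  have h1 := D.fTop_smul_mem (w := w) (hE.lie_sub_mem i j x hx)
  have h2 := add_mem (D.z_lie_fTop_sub hz i j w hx) h1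
  rw [map_sub, sub_add_sub_cancel] at h2
  split_ifs at h2 ⊢ with hij
  · exact h2
  · simpa using h2

include hz hE in
open Classical in
/-- `e_i` acts on `f_w ⊗ x` as a derivative, up to terms of higher length. -/
lemma e_lie_fTop (w : List ι) {x : X} (hx : x ∈ E) (i : ι) :
    ⁅(D.e i : L), D.fTop w x⁆ - w.count i • D.fTop (w.erase i) x ∈ D.vFil t E w.length := by
  induction w generalizing i with
  | nil =>
    rw [fTop_nil, Verma.np_lie_top, List.count_nil, zero_smul, sub_zero]
    exact Submodule.zero_mem _
  | cons j w ih =>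
    -- The three parts of [e_i, f_j] act differently on the rest of the word: a makes it longer, z
    -- contributes δ_ij modulo t, and b is t times a combination of the e_k, which the induction
    -- hypothesis for all k keeps in the lattice.
    obtain ⟨a, ha, b, hb, hab⟩ := hz.lie_e_f i j
    have he : ∀ k, ⁅(D.e k : L), D.fTop w x⁆ ∈ D.vLat E 0 := fun k => by
      have h1 := D.vFil_zero_le (ih k)
      rw [← sub_add_cancel ⁅(D.e k : L), D.fTop w x⁆ (w.count k • D.fTop (w.erase k) x)]
      exact add_mem h1 (nsmul_mem (D.fTop_mem_vLat (Nat.zero_le _) hx) _)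
    have hE1 : ∀ y ∈ D.eSpan O, ⁅y, D.fTop w x⁆ ∈ D.vLat E 0 := fun y hy =>
      lie_mem_of_mem_span (T := {D.fTop w x}) (by
        rintro _ ⟨k, rfl⟩ _ rfl
        exact he k) hy (Submodule.subset_span rfl)
    have hb' : ⁅b, D.fTop w x⁆ ∈ t • D.vLat E 0 := by
      obtain ⟨y, hy, rfl⟩ := mem_smul_iff.1 hb
      rw [subring_smul_lie]
      exact smul_mem_smul t (hE1 y hy)
    have ha' : ⁅a, D.fTop w x⁆ ∈ D.vFil t E (w.length + 1) :=
      D.vLat_le_vFil (D.fSpan_lie_vLat ha (D.fTop_mem_vLat le_rfl hx))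
    have hz' := D.z_lie_fTop hz hE i j w hx
    have hf := D.f_lie_vFil j (ih i)
    -- The Leibniz rule for removing the letter i from j :: w; when i = j the position of the
    -- removed letter matters only modulo t.
    have key : (w.count i • ⁅(D.f j : L), D.fTop (w.erase i) x⁆ + if i = j then D.fTop w x else 0) -
        (j :: w).count i • D.fTop ((j :: w).erase i) x ∈ t • D.vLat E 0 := by
      by_cases hij : i = j
      · subst hij
        rw [if_pos rfl, List.count_cons_self, List.erase_cons_head, add_smul, one_smul,
          add_sub_add_right_eq_sub, ← smul_sub]
        by_cases hmem : i ∈ w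
        · exact nsmul_mem (D.fTop_perm hz (List.perm_cons_erase hmem).symm hx) _
        · rw [List.count_eq_zero_of_not_mem hmem, zero_smul]
          exact Submodule.zero_mem _
      · rw [if_neg hij, List.count_cons_of_ne (Ne.symm hij),
          List.erase_cons_tail (by simpa using Ne.symm hij), fTop_cons, add_zero, sub_self]
        exact Submodule.zero_mem _
    rw [fTop_cons, leibniz_lie, hab, add_lie, add_lie, List.length_cons]
    have total := add_mem (add_mem (add_mem ha' (D.smul_vLat_le_vFil hz'))
      (D.smul_vLat_le_vFil hb')) (add_mem hf (D.smul_vLat_le_vFil key))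
    rw [lie_sub, lie_nsmul] at total
    convert! total using 1
    abel

include hz hE in
lemma e_lie_vLat_zero (i : ι) {m : Verma l np X} (hm : m ∈ D.vLat E 0) :
    ⁅(D.e i : L), m⁆ ∈ D.vLat E 0 := by
  classical
  refine lie_mem_of_mem_span (S := {(D.e i : L)}) ?_ (Submodule.subset_span rfl) hm
  rintro _ rfl _ ⟨w, x, hw, hx, rfl⟩
  rw [← sub_add_cancel ⁅(D.e i : L), D.fTop w x⁆ (w.count i • D.fTop (w.erase i) x)]
  exact add_mem (D.vFil_zero_le (D.e_lie_fTop hz hE w hx i))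
    (nsmul_mem (D.fTop_mem_vLat (Nat.zero_le _) hx) _)

-- Each e_i lowers the filtration by at most one step, since it removes at most one letter.
include hz hE in
lemma e_lie_vFil (i : ι) {n : ℕ} {m : Verma l np X} (hm : m ∈ D.vFil t E n) :
    ⁅(D.e i : L), m⁆ ∈ D.vFil t E (n - 1) := by
  classical
  obtain ⟨a, ha, b, hb, rfl⟩ := Submodule.mem_sup.1 hm
  rw [lie_add]
  refine add_mem ?_ (D.smul_vLat_le_vFil (lie_mem_smul_right
    (fun _ hm => D.e_lie_vLat_zero hz hE i hm) hb))
  refine lie_mem_of_mem_span (S := {(D.e i : L)}) ?_ (Submodule.subset_span rfl) ha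
  rintro _ rfl _ ⟨w, x, hw, hx, rfl⟩
  rw [← sub_add_cancel ⁅(D.e i : L), D.fTop w x⁆ (w.count i • D.fTop (w.erase i) x)]
  refine add_mem (D.vFil_anti (by omega) (D.e_lie_fTop hz hE w hx i))
    (D.vLat_le_vFil (nsmul_mem (D.fTop_mem_vLat ?_ hx) _))
  have := List.le_length_erase (a := i) (l := w)
  omega

-- Iterating the derivatives removes the letters of I from w one by one. N is the product of the
-- multiplicities met on the way, hence nonzero exactly when all removals are possible.
include hz hE in
open Classical in
lemma word_e_smul_fTop (I w : List ι) : ∃ (N : ℕ) (w' : List ι),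
    (w' : Multiset ι) = (w : Multiset ι) - (I : Multiset ι) ∧
    (N ≠ 0 ↔ (I : Multiset ι) ≤ (w : Multiset ι)) ∧
    ∀ x ∈ E, envIncl np (word D.e I) • D.fTop w x - N • D.fTop w' x ∈
      D.vFil t E (w.length + 1 - I.length) := by
  induction I with
  | nil => exact ⟨1, w, by simp, by simp, fun x hx => by simp⟩
  | cons i I ih =>
    obtain ⟨N, w', hw', hN, h⟩ := ih
    have hsub : (w : Multiset ι) - ((i :: I : List ι) : Multiset ι) = (w' : Multiset ι).erase i := by
      rw [hw', ← Multiset.cons_coe, ← Multiset.sub_singleton, tsub_tsub, add_comm,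
        Multiset.singleton_add]
    refine ⟨N * w'.count i, w'.erase i, by rw [hsub, Multiset.coe_erase], ?_, fun x hx => ?_⟩
    · rw [mul_ne_zero_iff, hN, ← Multiset.coe_count, hw', Multiset.count_sub,
        Multiset.le_iff_count, Multiset.le_iff_count]
      constructor
      · rintro ⟨h1, h2⟩ a
        rw [← Multiset.cons_coe, Multiset.count_cons]
        split_ifs with ha
        · subst ha; omega
        · simpa using h1 a
      · intro h1
        have h2 := h1 i
        rw [← Multiset.cons_coe, Multiset.count_cons_self] at h2
        refine ⟨fun a => (Multiset.count_le_of_le a ?_).trans (h1 a), by omega⟩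
        rw [← Multiset.cons_coe]
        exact Multiset.le_cons_self _ _
    · rw [word_cons, map_mul, mul_smul, envIncl_iota, ← Verma.lie_def]
      have h1 := D.e_lie_vFil hz hE i (h x hx)
      have h2 := D.vFil_anti (m := w.length + 1 - (I.length + 1)) (n := w'.length) (t := t) (E := E)
        (by
          have := congrArg Multiset.card hw'
          rw [Multiset.coe_card] at this
          have h3 := card_tsub_le (I : Multiset ι) (w : Multiset ι)
          rw [Multiset.coe_card, Multiset.coe_card] at h3
          omega) (nsmul_mem (D.e_lie_fTop hz hE w' hx i) N)
      rw [List.length_cons]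
      have h3 := add_mem h1 (D.vFil_anti (by omega) h2)
      rw [lie_sub, lie_nsmul, smul_sub, sub_add_sub_cancel, smul_smul] at h3
      exact D.vFil_anti (by omega) h3

variable [CharZero K]

lemma proj_fTop (w : List ι) (x : X) :
    Verma.proj D X (D.fTop w x) = if w = [] then x else 0 := by
  cases w with
  | nil => simp [Verma.proj_top]
  | cons j w => simp [Verma.proj_nm_lie]

lemma proj_vLat {m : Verma l np X} (hm : m ∈ D.vLat E 0) : Verma.proj D X m ∈ E := by
  have : D.vLat E 0 ≤ E.comap ((Verma.proj D X).restrictScalars O) := by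
    refine Submodule.span_le.2 ?_
    rintro _ ⟨w, x, -, hx, rfl⟩
    change Verma.proj D X _ ∈ E
    rw [proj_fTop]
    split_ifs
    exacts [hx, E.zero_mem]
  exact this hm

lemma proj_vLat_one {m : Verma l np X} (hm : m ∈ D.vLat E 1) : Verma.proj D X m = 0 := by
  have : D.vLat E 1 ≤ LinearMap.ker ((Verma.proj D X).restrictScalars O) := by
    refine Submodule.span_le.2 ?_
    rintro _ ⟨w, x, hw, hx, rfl⟩
    change Verma.proj D X _ = 0
    rw [proj_fTop, if_neg]
    rintro rfl
    simp at hw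
  exact this hm

lemma proj_vFil_one {n : ℕ} (hn : 1 ≤ n) {m : Verma l np X} (hm : m ∈ D.vFil t E n) :
    Verma.proj D X m ∈ t • E := by
  obtain ⟨a, ha, b, hb, rfl⟩ := Submodule.mem_sup.1 hm
  rw [map_add, D.proj_vLat_one (D.vLat_anti hn ha), zero_add]
  exact map_mem_smul _ (fun m hm => D.proj_vLat hm) hb

-- Projecting to X keeps only the empty word. Modulo t the Gram matrix is therefore block triangular
-- in the number of letters, and its blocks with equal numbers of letters are diagonal with nonzero
-- natural numbers as entries.
include hz hE in
lemma pairing_lattice (s r : Multiset ι) : ∃ N : ℕ, (N ≠ 0 ↔ s ≤ r) ∧ ∀ x ∈ E,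
    D.pairing X s r x ∈ E ∧
    (Multiset.card s < Multiset.card r → D.pairing X s r x ∈ t • E) ∧
    (Multiset.card s = Multiset.card r → D.pairing X s r x - N • x ∈ t • E) := by
  classical
  obtain ⟨N, w', hw', hN, h⟩ := D.word_e_smul_fTop hz hE s.toList r.toList
  simp only [Multiset.coe_toList, Multiset.length_toList] at hw' hN h
  refine ⟨N, hN, fun x hx => ?_⟩
  have h1 := h x hx
  have hp : D.pairing X s r x =
      Verma.proj D X (envIncl np (word D.e s.toList) • D.fTop r.toList x) := by
    rw [pairing_apply, fTop_eq]; rfl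
  have h3 : Multiset.card r - Multiset.card s ≤ w'.length := by
    rw [← Multiset.coe_card w', hw']
    exact card_tsub_le _ _
  refine ⟨?_, fun hlt => ?_, fun heq => ?_⟩
  · rw [hp, ← sub_add_cancel (envIncl np (word D.e s.toList) • D.fTop r.toList x)
      (N • D.fTop w' x)]
    exact D.proj_vLat (add_mem (D.vFil_zero_le h1)
      (nsmul_mem (D.fTop_mem_vLat (Nat.zero_le _) hx) _))
  · rw [hp, ← sub_add_cancel (envIncl np (word D.e s.toList) • D.fTop r.toList x)
      (N • D.fTop w' x)]
    refine D.proj_vFil_one le_rfl (add_mem (D.vFil_anti (by omega) h1)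
      (D.vLat_le_vFil (nsmul_mem (D.fTop_mem_vLat (by omega) hx) _)))
  · have h4 := D.proj_vFil_one (n := Multiset.card r + 1 - Multiset.card s) (by omega) h1
    rw [map_sub, map_nsmul, ← hp, proj_fTop] at h4
    by_cases hN0 : N = 0
    · simpa [hN0] using h4
    · have h5 : w' = [] := by
        rw [← Multiset.coe_eq_zero, hw', Multiset.eq_of_le_of_card_le (hN.1 hN0) heq.ge, tsub_self]
      rwa [if_pos h5] at h4

-- For single letters the diagonal entry is exactly 1 modulo t; this fixes the coefficient of the
-- first order term of the product.
include hz hE in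
lemma pairing_singleton_sub (i : ι) {x : X} (hx : x ∈ E) :
    D.pairing X {i} {i} x - x ∈ t • E := by
  classical
  have h1 := D.proj_vFil_one le_rfl (D.e_lie_fTop hz hE [i] hx i)
  rw [map_sub, map_nsmul, List.count_singleton_self, one_smul, List.erase_cons_head, proj_fTop,
    if_pos rfl, fTop_cons, fTop_nil] at h1
  convert! h1 using 2
  rw [pairing_apply, eWord, fWord, Multiset.toList_singleton, word_cons, word_cons]
  simp [Verma.lie_def]

end Triangular

end Lattice

end DynQuant

end

open scoped TensorProduct

noncomputable section

namespace DynQuant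

universe u v w

/-! ## Invertibility of the contravariant form -/

section Nakayama

open scoped Pointwise

variable {K : Type v} [Field K] {L : Type u} [LieRing L] [LieAlgebra K L]
  {nm l np : LieSubalgebra K L} {ι : Type w} [Finite ι] (D : Triangular nm l np ι)
  {O : Subring K} {t : O} {X : Type*} [AddCommGroup X] [Module K X] {E : Submodule O X} {z : ι → ι → l}

namespace Triangular

/-- The families of vectors of `E` indexed by monomials of degree `d`. -/
def famLat (E : Submodule O X) (d : ℕ) : Submodule O (D.Homog d → X) :=
  Submodule.pi Set.univ fun _ => E

omit [Finite ι] in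
lemma mem_famLat {d : ℕ} {c : D.Homog d → X} : c ∈ D.famLat E d ↔ ∀ J, c J ∈ E := by
  simp [famLat, Submodule.mem_pi]

open Classical in
omit [Finite ι] in
lemma single_mem_famLat {d : ℕ} {J : D.Homog d} {x : X} (hx : x ∈ E) :
    (Pi.single J x : D.Homog d → X) ∈ D.famLat E d := by
  rw [mem_famLat]
  intro J'
  by_cases h : J' = J
  · subst h; rwa [Pi.single_eq_same]
  · rw [Pi.single_eq_of_ne h]; exact E.zero_mem

open Classical in
omit [Finite ι] in
lemma single_mem_smul_famLat {d : ℕ} {J : D.Homog d} {x : X} (hx : x ∈ t • E) :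
    (Pi.single J x : D.Homog d → X) ∈ t • D.famLat E d :=
  map_mem_smul (LinearMap.single K (fun _ : D.Homog d => X) J)
    (fun _ hx => D.single_mem_famLat hx) hx

variable [CharZero K] [LieRingModule l X] [LieModule K l X]
  (hz : D.IsHeisenberg O t z) (hE : IsLattice t z E)

include hz hE

lemma gram_mem_famLat {d : ℕ} {c : D.Homog d → X} (hc : c ∈ D.famLat E d) :
    D.gram X d c ∈ D.famLat E d := by
  rw [mem_famLat] at hc ⊢
  intro I
  rw [gram_apply]
  refine Submodule.sum_mem _ fun J _ => ?_
  obtain ⟨N, -, h⟩ := D.pairing_lattice hz hE I.1 J.1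
  exact (h _ (hc J)).1

variable (ht : ¬ IsUnit t) (hnat : ∀ n : ℕ, n ≠ 0 → IsUnit (n : O))

-- Modulo t the image of the Gram matrix contains every unit vector, by descending induction on the
-- number of letters; n bounds how far that number is below the degree d.
include hnat in
open Classical in
lemma single_mem_sup {d : ℕ} (n : ℕ) (I : D.Homog d) (hn : d - Multiset.card I.1 ≤ n) {y : X}
    (hy : y ∈ E) : (Pi.single I y : D.Homog d → X) ∈
      (D.famLat E d).map ((D.gram X d).restrictScalars O) ⊔ t • D.famLat E d := by
  induction n using Nat.strong_induction_on generalizing I y with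
  | _ n ih =>
  obtain ⟨N, hN, h⟩ := D.pairing_lattice hz hE I.1 I.1
  obtain ⟨v, hv⟩ := (hnat N (hN.2 le_rfl)).exists_left_inv
  have hvy : v • y ∈ E := E.smul_mem v hy
  have hNv : N • v • y = y := by
    rw [← Nat.cast_smul_eq_nsmul O, smul_smul, mul_comm, hv, one_smul]
  have h1 := h _ hvy
  have h2 : D.gram X d (Pi.single I (v • y)) =
      ∑ I' : D.Homog d, Pi.single I' (D.pairing X I'.1 I.1 (v • y)) := by
    rw [Finset.univ_sum_single]
    ext I'
    rw [gram_apply, Finset.sum_eq_single I (fun J _ hJ => by rw [Pi.single_eq_of_ne hJ, map_zero])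
      (fun h => absurd (Finset.mem_univ _) h), Pi.single_eq_same]
  have h3 : (Pi.single I y : D.Homog d → X) = D.gram X d (Pi.single I (v • y)) -
      ((∑ I' ∈ Finset.univ.erase I, Pi.single I' (D.pairing X I'.1 I.1 (v • y))) +
        Pi.single I (D.pairing X I.1 I.1 (v • y) - N • v • y)) := by
    rw [h2, ← Finset.add_sum_erase _ _ (Finset.mem_univ I), hNv, Pi.single_sub]
    abel
  rw [h3]
  refine sub_mem (Submodule.mem_sup_left ⟨_, D.single_mem_famLat hvy, rfl⟩) (add_mem ?_ ?_)
  · refine Submodule.sum_mem _ fun I' hI' => ?_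
    obtain ⟨N', hN', h'⟩ := D.pairing_lattice hz hE I'.1 I.1
    obtain ⟨h4, h5, h6⟩ := h' _ hvy
    rcases lt_trichotomy (Multiset.card I'.1) (Multiset.card I.1) with hlt | heq | hgt
    · exact Submodule.mem_sup_right (D.single_mem_smul_famLat (h5 hlt))
    · have hN0 : N' = 0 := by
        by_contra hne
        exact (Finset.mem_erase.1 hI').1
          (Subtype.ext (Multiset.eq_of_le_of_card_le (hN'.1 hne) heq.ge))
      have h7 := h6 heq
      rw [hN0, zero_smul, sub_zero] at h7
      exact Submodule.mem_sup_right (D.single_mem_smul_famLat h7)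
    -- Entries with more letters need not be small, but their unit vectors are covered by the
    -- induction hypothesis.
    · have h8 := (D.card_le_mdeg I'.1).trans I'.2.le
      exact ih (d - Multiset.card I'.1) (by omega) I' le_rfl h4
  · exact Submodule.mem_sup_right (D.single_mem_smul_famLat (h1.2.2 rfl))

variable [IsLocalRing O]

include ht hnat

/-- Nakayama's lemma: the lattice is finitely generated, t lies in the maximal ideal, and the Gram
matrix is surjective modulo t. -/
lemma famLat_le_map_gram (d : ℕ) :
    D.famLat E d ≤ (D.famLat E d).map ((D.gram X d).restrictScalars O) := by
  classical
  have hfg : (D.famLat E d).FG := Submodule.fg_pi fun _ => hE.fg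
  refine Submodule.le_of_le_smul_of_le_jacobson_bot (I := Ideal.span {t}) hfg ?_ ?_
  · rw [IsLocalRing.jacobson_eq_maximalIdeal ⊥ bot_ne_top, Ideal.span_singleton_le_iff_mem]
    exact ht
  · rw [Submodule.ideal_span_singleton_smul]
    intro c hc
    rw [← Finset.univ_sum_single c]
    refine Submodule.sum_mem _ fun I _ => ?_
    exact D.single_mem_sup hz hE hnat _ I le_rfl (D.mem_famLat.1 hc I)

/-- A surjective endomorphism of a finitely generated module over a commutative ring is injective.
-/
lemma gram_injOn_famLat (d : ℕ) {c : D.Homog d → X} (hc : c ∈ D.famLat E d)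
    (h : D.gram X d c = 0) : c = 0 := by
  have hfg : (D.famLat E d).FG := Submodule.fg_pi fun _ => hE.fg
  have : Module.Finite O (D.famLat E d) := Module.Finite.iff_fg.2 hfg
  let φ : D.famLat E d →ₗ[O] D.famLat E d :=
    ((D.gram X d).restrictScalars O).restrict fun c hc => D.gram_mem_famLat hz hE hc
  have hφ : Function.Surjective φ := by
    rintro ⟨c, hc⟩
    obtain ⟨c', hc', h⟩ := D.famLat_le_map_gram hz hE ht hnat d hc
    exact ⟨⟨c', hc'⟩, Subtype.ext h⟩
  have hinj := OrzechProperty.injective_of_surjective_endomorphism φ hφ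
  have h0 : φ ⟨c, hc⟩ = φ 0 := by
    rw [map_zero]; exact Subtype.ext h
  exact congrArg Subtype.val (hinj h0)

omit hE in
lemma isGeneric_of_isLattice
    (hcov : ∀ s : Finset X, ∃ E : Submodule O X, IsLattice t z E ∧ ∀ x ∈ s, x ∈ E) :
    D.IsGeneric X := by
  classical
  intro d
  have hc : ∀ c : D.Homog d → X, ∃ E : Submodule O X, IsLattice t z E ∧ c ∈ D.famLat E d := by
    intro c
    obtain ⟨E, hE, h⟩ := hcov (Finset.univ.image c)
    exact ⟨E, hE, D.mem_famLat.2 fun J => h _ (Finset.mem_image_of_mem _ (Finset.mem_univ J))⟩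
  constructor
  · rw [← LinearMap.ker_eq_bot, LinearMap.ker_eq_bot']
    intro c h
    obtain ⟨E, hE, hcE⟩ := hc c
    exact D.gram_injOn_famLat hz hE ht hnat d hcE h
  · intro c
    obtain ⟨E, hE, hcE⟩ := hc c
    obtain ⟨c', -, h⟩ := D.famLat_le_map_gram hz hE ht hnat d hcE
    exact ⟨c', h⟩

variable (hX : D.IsGeneric X)

/-- The inverse Gram matrix preserves the lattice, so it introduces no negative powers of t. -/
lemma invGram_mem (s : Multiset ι) {y : X} (hy : y ∈ E) (J : D.Homog (D.mdeg s)) :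
    D.invGram hX s y J ∈ E := by
  classical
  obtain ⟨c, hc, h⟩ := D.famLat_le_map_gram hz hE ht hnat (D.mdeg s)
    (D.single_mem_famLat (J := ⟨s, rfl⟩) hy)
  have h1 : D.invGram hX s y = c := by
    apply (hX (D.mdeg s)).1
    rw [gram_invGram]
    convert! h.symm
  rw [h1]
  exact D.mem_famLat.1 hc J

-- Compare the J-th entries of Gram times inverse Gram for a one letter word J. The diagonal entry
-- is 1 modulo t, and the other entries of this row are divisible by t.
open Classical in
lemma invGram_singleton (s : Multiset ι) {y : X} (hy : y ∈ E) (J : D.Homog (D.mdeg s))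
    (hJ : Multiset.card J.1 = 1) :
    D.invGram hX s y J - (if J.1 = s then y else 0) ∈ t • E := by
  have h1 := congrFun (D.gram_invGram hX s y) J
  rw [gram_apply, ← Finset.add_sum_erase _ _ (Finset.mem_univ J)] at h1
  have hmem := D.invGram_mem hz hE ht hnat hX s hy
  have h2 : (Pi.single ⟨s, rfl⟩ y : D.Homog (D.mdeg s) → X) J = if J.1 = s then y else 0 := by
    rw [Pi.single_apply]
    exact if_congr Subtype.ext_iff rfl rfl
  rw [h2] at h1
  obtain ⟨i, hi⟩ := Multiset.card_eq_one.1 hJ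
  have h3 := D.pairing_singleton_sub hz hE i (hmem J)
  rw [← hi] at h3
  have h4 : ∑ x ∈ Finset.univ.erase J, D.pairing X J.1 x.1 (D.invGram hX s y x) ∈ t • E := by
    refine Submodule.sum_mem _ fun J' hJ' => ?_
    obtain ⟨N, hN, h⟩ := D.pairing_lattice hz hE J.1 J'.1
    obtain ⟨-, h5, h6⟩ := h _ (hmem J')
    rcases lt_trichotomy (Multiset.card J.1) (Multiset.card J'.1) with hlt | heq | hgt
    · exact h5 hlt
    · have hN0 : N = 0 := by
        by_contra hne
        exact (Finset.mem_erase.1 hJ').1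
          (Subtype.ext (Multiset.eq_of_le_of_card_le (hN.1 hne) heq.ge).symm)
      have h7 := h6 heq
      rwa [hN0, zero_smul, sub_zero] at h7
    -- A column with fewer letters could only be the empty word, which has degree zero and so does
    -- not share the degree of J.
    · have h8 : J'.1 = 0 := Multiset.card_eq_zero.1 (by omega)
      have h9 : D.mdeg J.1 = 0 := by rw [J.2, ← J'.2, h8, mdeg_zero]
      rw [D.mdeg_eq_zero.1 h9] at hJ
      simp at hJ
  rw [← h1]
  have h5 := add_mem h3 h4
  rw [← neg_mem_iff]
  convert! h5 using 1
  abel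

end Triangular

end Nakayama

end DynQuant

end

open scoped TensorProduct

noncomputable section

namespace DynQuant

universe u v w

/-! ## Extension of scalars -/

section Extension

open scoped Pointwise

variable {g : Type u} [LieRing g] [LieAlgebra ℂ g] (K : Type v) [Field K] [Algebra ℂ K]

variable {K} in
lemma tmul_mem_extendScalars {l : LieSubalgebra ℂ g} (c : K) {x : g} (hx : x ∈ l) :
    c ⊗ₜ[ℂ] x ∈ extendScalars K l :=
  Submodule.tmul_mem_baseChange_of_mem (p := l.toSubmodule) c hx

variable {K} in
lemma extendScalars_induction {l : LieSubalgebra ℂ g} {P : K ⊗[ℂ] g → Prop}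
    (htmul : ∀ (c : K), ∀ x ∈ l, P (c ⊗ₜ[ℂ] x)) (hadd : ∀ x y, P x → P y → P (x + y))
    {x : K ⊗[ℂ] g} (hx : x ∈ extendScalars K l) : P x := by
  obtain ⟨y, rfl⟩ : ∃ y : K ⊗[ℂ] l.toSubmodule, l.toSubmodule.subtype.baseChange K y = x := hx
  induction y using TensorProduct.induction_on with
  | zero => simpa using htmul 0 0 l.zero_mem
  | tmul c y => exact htmul c y y.2
  | add y y' h h' => rw [map_add]; exact hadd _ _ h h'

lemma extendScalars_lie_mem {l n : LieSubalgebra ℂ g} (h : ∀ x ∈ l, ∀ y ∈ n, ⁅x, y⁆ ∈ n) :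
    ∀ x ∈ extendScalars K l, ∀ y ∈ extendScalars K n, ⁅x, y⁆ ∈ extendScalars K n := by
  intro x hx y hy
  refine extendScalars_induction (P := fun x => ⁅x, y⁆ ∈ extendScalars K n) (fun c x hx => ?_)
    (fun x x' h h' => by rw [add_lie]; exact add_mem h h') hx
  refine extendScalars_induction (P := fun y => ⁅c ⊗ₜ[ℂ] x, y⁆ ∈ extendScalars K n)
    (fun d y hy => ?_) (fun x x' h h' => by rw [lie_add]; exact add_mem h h') hy
  rw [LieAlgebra.ExtendScalars.bracket_tmul]
  exact tmul_mem_extendScalars _ (h x hx y hy)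

/-- The extension of scalars of a subalgebra is a tensor product. -/
def extendEquiv (l : LieSubalgebra ℂ g) : (K ⊗[ℂ] l) ≃ₗ[K] extendScalars K l :=
  Submodule.toBaseChange.toLinearEquiv K l.toSubmodule

lemma extendEquiv_tmul (l : LieSubalgebra ℂ g) (c : K) (x : l) :
    (extendEquiv K l (c ⊗ₜ[ℂ] x) : K ⊗[ℂ] g) = c ⊗ₜ[ℂ] (x : g) := rfl

/-- A basis of a subalgebra is a basis of its extension of scalars. -/
def extendBasis {ι : Type w} (l : LieSubalgebra ℂ g) (b : Module.Basis ι ℂ l) :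
    Module.Basis ι K (extendScalars K l) :=
  (b.baseChange K).map (extendEquiv K l)

lemma extendBasis_apply {ι : Type w} (l : LieSubalgebra ℂ g) (b : Module.Basis ι ℂ l) (i : ι) :
    (extendBasis K l b i : K ⊗[ℂ] g) = 1 ⊗ₜ[ℂ] (b i : g) := by
  rw [extendBasis, Module.Basis.map_apply, Module.Basis.baseChange_apply, extendEquiv_tmul]

attribute [local instance 100] LieRing.ofAssociativeRing in
/-- The extension of scalars of a Lie algebra that embeds into its enveloping algebra embeds into
its enveloping algebra. -/
lemma iota_extendScalars_injective (h : Function.Injective (iota ℂ g)) :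
    Function.Injective (iota K (K ⊗[ℂ] g)) := by
  let ψ : U K (K ⊗[ℂ] g) →ₐ[K] K ⊗[ℂ] U ℂ g := envLift K ((iota ℂ g).baseChange K) (by
    intro x y
    induction x using TensorProduct.induction_on with
    | zero => simp
    | add x x' h h' => rw [add_lie, map_add, h, h', map_add, add_mul, mul_add]; abel
    | tmul c x =>
      induction y using TensorProduct.induction_on with
      | zero => simp
      | add y y' h h' => rw [lie_add, map_add, h, h', map_add, add_mul, mul_add]; abel
      | tmul d y =>
        rw [LieAlgebra.ExtendScalars.bracket_tmul, LinearMap.baseChange_tmul,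
          LinearMap.baseChange_tmul, LinearMap.baseChange_tmul, iota_lie,
          Algebra.TensorProduct.tmul_mul_tmul, Algebra.TensorProduct.tmul_mul_tmul, mul_comm d c,
          TensorProduct.tmul_sub])
  have hψ : ∀ x, ψ (iota K (K ⊗[ℂ] g) x) = (iota ℂ g).baseChange K x := fun x =>
    envLift_iota K _ _ x
  intro x y hxy
  have h1 := congrArg ψ hxy
  rw [hψ, hψ] at h1
  exact Module.Flat.lTensor_preserves_injective_linearMap (M := K) (iota ℂ g) h h1

variable {nm l np : LieSubalgebra ℂ g} {ι : Type w} (D : Triangular nm l np ι)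

include D in
lemma Triangular.extend_bijective :
    Function.Bijective fun p : extendScalars K nm × extendScalars K l × extendScalars K np =>
      (p.1 + (p.2.1 + p.2.2) : K ⊗[ℂ] g) := by
  -- A map acting on n by a scalar still does so after extension of scalars. Applied to the
  -- projections to n⁻ and `l`, this separates the three components.
  have key : ∀ (n : LieSubalgebra ℂ g) (c : ℂ) (P : g →ₗ[ℂ] g), (∀ x ∈ n, P x = c • x) →
      ∀ x ∈ extendScalars K n, P.baseChange K x = c • x := by
    intro n c P h x hx
    refine extendScalars_induction (P := fun x => P.baseChange K x = c • x) (fun d x hx => ?_)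
      (fun x y hx hy => by rw [map_add, hx, hy, smul_add]) hx
    rw [LinearMap.baseChange_tmul, h x hx, TensorProduct.tmul_smul]
  let pm : g →ₗ[ℂ] g := nm.toSubmodule.subtype ∘ₗ LinearMap.fst ℂ nm (l × np) ∘ₗ
    D.decompEquiv.symm.toLinearMap
  let pl : g →ₗ[ℂ] g := l.toSubmodule.subtype ∘ₗ LinearMap.fst ℂ l np ∘ₗ
    LinearMap.snd ℂ nm (l × np) ∘ₗ D.decompEquiv.symm.toLinearMap
  have hm : ∀ x (hx : x ∈ nm), D.decompEquiv.symm x = (⟨x, hx⟩, 0, 0) := fun x hx => by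
    rw [LinearEquiv.symm_apply_eq, D.decompEquiv_apply]; simp
  have hl : ∀ x (hx : x ∈ l), D.decompEquiv.symm x = (0, ⟨x, hx⟩, 0) := fun x hx => by
    rw [LinearEquiv.symm_apply_eq, D.decompEquiv_apply]; simp
  have hp : ∀ x (hx : x ∈ np), D.decompEquiv.symm x = (0, 0, ⟨x, hx⟩) := fun x hx => by
    rw [LinearEquiv.symm_apply_eq, D.decompEquiv_apply]; simp
  have m1 := key nm 1 pm (fun x hx => by simp [pm, hm x hx])
  have m2 := key l 0 pm (fun x hx => by simp [pm, hl x hx])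
  have m3 := key np 0 pm (fun x hx => by simp [pm, hp x hx])
  have l1 := key nm 0 pl (fun x hx => by simp [pl, hm x hx])
  have l2 := key l 1 pl (fun x hx => by simp [pl, hl x hx])
  have l3 := key np 0 pl (fun x hx => by simp [pl, hp x hx])
  constructor
  · rintro ⟨a, b, c⟩ ⟨a', b', c'⟩ h
    have h' : (a + (b + c) : K ⊗[ℂ] g) = a' + (b' + c') := h
    have e1 := congrArg (pm.baseChange K) h'
    have e2 := congrArg (pl.baseChange K) h'
    simp only [map_add, m1 _ a.2, m1 _ a'.2, m2 _ b.2, m2 _ b'.2, m3 _ c.2, m3 _ c'.2, one_smul,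
      zero_smul, add_zero] at e1
    simp only [map_add, l1 _ a.2, l1 _ a'.2, l2 _ b.2, l2 _ b'.2, l3 _ c.2, l3 _ c'.2, one_smul,
      zero_smul, add_zero, zero_add] at e2
    rw [e1, e2, add_right_inj, add_right_inj] at h'
    exact Prod.ext (Subtype.ext e1) (Prod.ext (Subtype.ext e2) (Subtype.ext h'))
  · intro x
    induction x using TensorProduct.induction_on with
    | zero => exact ⟨0, by simp⟩
    | tmul c x =>
      obtain ⟨a, ha, b, hb, d, hd, rfl⟩ := D.exists_decomp x
      exact ⟨(⟨_, tmul_mem_extendScalars c ha⟩, ⟨_, tmul_mem_extendScalars c hb⟩,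
        ⟨_, tmul_mem_extendScalars c hd⟩), by simp [TensorProduct.tmul_add]⟩
    | add x y hx hy =>
      obtain ⟨p, rfl⟩ := hx
      obtain ⟨q, rfl⟩ := hy
      refine ⟨p + q, ?_⟩
      simp only [Prod.fst_add, Prod.snd_add, AddMemClass.coe_add]
      abel

variable {K}

/-- The extension of scalars of a triangular decomposition, with the basis of `n⁻` multiplied by a
unit. -/
def Triangular.extend (t : Kˣ) :
    Triangular (extendScalars K nm) (extendScalars K l) (extendScalars K np) ι where
  e := extendBasis K np D.e
  -- The unit will be the variable t of the series field: it compensates the simple pole of the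
  -- character on the brackets [e_i, f_j].
  f := (extendBasis K nm D.f).unitsSMul fun _ => t
  deg := D.deg
  deg_pos := D.deg_pos
  h := 1 ⊗ₜ[ℂ] D.h
  h_mem := tmul_mem_extendScalars 1 D.h_mem
  lie_h := fun z hz => extendScalars_induction (P := fun z => ⁅(1 : K) ⊗ₜ[ℂ] D.h, z⁆ = 0)
    (fun c x hx => by
      rw [LieAlgebra.ExtendScalars.bracket_tmul, D.lie_h x hx, TensorProduct.tmul_zero])
    (fun x y hx hy => by rw [lie_add, hx, hy, add_zero]) hz
  lie_h_e := fun i => by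
    rw [extendBasis_apply, LieAlgebra.ExtendScalars.bracket_tmul, D.lie_h_e, mul_one,
      TensorProduct.tmul_smul, Nat.cast_smul_eq_nsmul, Nat.cast_smul_eq_nsmul]
  lie_h_f := fun i => by
    have h1 : (((extendBasis K nm D.f).unitsSMul (fun _ => t) i : extendScalars K nm) :
        K ⊗[ℂ] g) = (t : K) • (extendBasis K nm D.f i : K ⊗[ℂ] g) := by
      rw [Module.Basis.unitsSMul_apply]; rfl
    rw [h1, extendBasis_apply, lie_smul, LieAlgebra.ExtendScalars.bracket_tmul, D.lie_h_f, mul_one,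
      TensorProduct.tmul_neg, TensorProduct.tmul_smul, Nat.cast_smul_eq_nsmul,
      Nat.cast_smul_eq_nsmul, smul_neg, smul_comm]
  lie_mem_nm := extendScalars_lie_mem K D.lie_mem_nm
  lie_mem_np := extendScalars_lie_mem K D.lie_mem_np
  bijective := D.extend_bijective K
  iota_injective := iota_extendScalars_injective K D.iota_injective

lemma Triangular.extend_e (t : Kˣ) (i : ι) :
    ((D.extend t).e i : K ⊗[ℂ] g) = 1 ⊗ₜ[ℂ] (D.e i : g) := extendBasis_apply K np D.e i

lemma Triangular.extend_f (t : Kˣ) (i : ι) :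
    ((D.extend t).f i : K ⊗[ℂ] g) = (t : K) ⊗ₜ[ℂ] (D.f i : g) := by
  have h1 : ((D.extend t).f i : K ⊗[ℂ] g) = (t : K) • (extendBasis K nm D.f i : K ⊗[ℂ] g) := by
    change (((extendBasis K nm D.f).unitsSMul (fun _ => t) i : extendScalars K nm) :
        K ⊗[ℂ] g) = _
    rw [Module.Basis.unitsSMul_apply]; rfl
  rw [h1, extendBasis_apply, TensorProduct.smul_tmul', smul_eq_mul, mul_one]

/-- The component in `l` of `[e_i, f_j]`. -/
def Triangular.lieComponent (i j : ι) : l := (D.decompEquiv.symm ⁅(D.e i : g), (D.f j : g)⁆).2.1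

lemma Triangular.lie_e_f_eq (i j : ι) : ∃ a ∈ nm, ∃ c ∈ np,
    ⁅(D.e i : g), (D.f j : g)⁆ = a + (D.lieComponent i j : g) + c := by
  have h := D.decompEquiv.apply_symm_apply ⁅(D.e i : g), (D.f j : g)⁆
  rw [D.decompEquiv_apply] at h
  exact ⟨_, (D.decompEquiv.symm ⁅(D.e i : g), (D.f j : g)⁆).1.2, _,
    (D.decompEquiv.symm ⁅(D.e i : g), (D.f j : g)⁆).2.2.2, by
      rw [add_assoc]; exact h.symm⟩

variable {O : Subring K} (hO : ∀ c : ℂ, algebraMap ℂ K c ∈ O) (t : Kˣ) {tO : O} (htO : (tO : K) = t)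

/-- The extension of the component in `l` of `[e_i, t f_j]`. -/
def Triangular.extendComponent (i j : ι) : extendScalars K l :=
  ⟨(t : K) ⊗ₜ[ℂ] (D.lieComponent i j : g), tmul_mem_extendScalars _ (D.lieComponent i j).2⟩

omit [Algebra ℂ K] in
lemma mem_smul_of_eq {M : Type*} [AddCommGroup M] [Module K M] {N : Submodule O M} {c : O}
    {m m' : M} (h : m' = (c : K) • m) (hm : m ∈ N) : m' ∈ c • N :=
  h ▸ smul_mem_smul c hm

include hO in
lemma complex_smul_mem {M : Type*} [AddCommGroup M] [Module K M] [Module ℂ M]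
    [IsScalarTower ℂ K M] {N : Submodule O M} (c : ℂ) {m : M} (hm : m ∈ N) : c • m ∈ N := by
  have : c • m = (⟨_, hO c⟩ : O) • m := by
    rw [Subring.smul_def, algebraMap_smul]
  rw [this]
  exact N.smul_mem _ hm

include hO in
lemma Triangular.tmul_mem_fSpan {a : g} (ha : a ∈ nm) :
    (t : K) ⊗ₜ[ℂ] a ∈ (D.extend t).fSpan O := by
  have h := D.f.mem_span ⟨a, ha⟩
  have : ∀ x ∈ Submodule.span ℂ (Set.range D.f), (t : K) ⊗ₜ[ℂ] (x : g) ∈ (D.extend t).fSpan O := by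
    intro x hx
    induction hx using Submodule.span_induction with
    | mem x hx =>
      obtain ⟨j, rfl⟩ := hx
      rw [← D.extend_f]
      exact Submodule.subset_span ⟨j, rfl⟩
    | zero => simp
    | add x y _ _ hx hy =>
      change _ ⊗ₜ[ℂ] ((x : g) + y) ∈ _
      rw [TensorProduct.tmul_add]
      exact add_mem hx hy
    | smul c x _ hx =>
      change _ ⊗ₜ[ℂ] (c • (x : g)) ∈ _
      rw [TensorProduct.tmul_smul]
      exact complex_smul_mem hO c hx
  exact this _ h

include hO in
lemma Triangular.tmul_mem_eSpan {a : g} (ha : a ∈ np) :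
    (1 : K) ⊗ₜ[ℂ] a ∈ (D.extend t).eSpan O := by
  have h := D.e.mem_span ⟨a, ha⟩
  have : ∀ x ∈ Submodule.span ℂ (Set.range D.e), (1 : K) ⊗ₜ[ℂ] (x : g) ∈ (D.extend t).eSpan O := by
    intro x hx
    induction hx using Submodule.span_induction with
    | mem x hx =>
      obtain ⟨j, rfl⟩ := hx
      rw [← D.extend_e t]
      exact Submodule.subset_span ⟨j, rfl⟩
    | zero => simp
    | add x y _ _ hx hy =>
      change _ ⊗ₜ[ℂ] ((x : g) + y) ∈ _
      rw [TensorProduct.tmul_add]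
      exact add_mem hx hy
    | smul c x _ hx =>
      change _ ⊗ₜ[ℂ] (c • (x : g)) ∈ _
      rw [TensorProduct.tmul_smul]
      exact complex_smul_mem hO c hx
  exact this _ h

-- The brackets of the rescaled basis: [t f_j, t f_k] and [t z, t f_k] have a factor t to spare,
-- while in [e_i, t f_j] only the n⁺ part, whose basis is not rescaled, is divisible by t.
include hO htO in
lemma Triangular.extend_isHeisenberg :
    (D.extend t).IsHeisenberg O tO (D.extendComponent t) where
  lie_f_f := fun j k => by
    rw [D.extend_f, D.extend_f, LieAlgebra.ExtendScalars.bracket_tmul]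
    refine mem_smul_of_eq (by rw [htO, TensorProduct.smul_tmul', smul_eq_mul])
      (D.tmul_mem_fSpan hO t (nm.lie_mem (D.f j).2 (D.f k).2))
  lie_e_f := fun i j => by
    obtain ⟨a, ha, c, hc, h⟩ := D.lie_e_f_eq i j
    refine ⟨_, D.tmul_mem_fSpan hO t ha, _, mem_smul_of_eq rfl (D.tmul_mem_eSpan hO t hc), ?_⟩
    rw [D.extend_e, D.extend_f, LieAlgebra.ExtendScalars.bracket_tmul, h, one_mul,
      TensorProduct.tmul_add, TensorProduct.tmul_add, htO,
      TensorProduct.smul_tmul', smul_eq_mul, mul_one]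
    rfl
  lie_z_f := fun i j k => by
    rw [D.extend_f]
    change ⁅(t : K) ⊗ₜ[ℂ] (D.lieComponent i j : g), _⁆ ∈ _
    rw [LieAlgebra.ExtendScalars.bracket_tmul]
    refine mem_smul_of_eq (by rw [htO, TensorProduct.smul_tmul', smul_eq_mul]) (D.tmul_mem_fSpan hO t
      (D.lie_mem_nm _ (D.lieComponent i j).2 _ (D.f k).2))

end Extension

end DynQuant

end

open scoped TensorProduct

noncomputable section

namespace DynQuant

universe u v w

/-! ## The dynamical multiplication of a one dimensional module over a field of series -/

section CharLattice

open scoped Pointwise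

/-- The `O`-span of a set. -/
def oSpan {K : Type v} [Field K] (O : Subring K) {M : Type*} [AddCommGroup M] [Module K M]
    (G : Set M) : Submodule O M := Submodule.span O G

lemma subring_smul_mem {K : Type v} [Field K] {O : Subring K} {M : Type*} [AddCommGroup M]
    [Module K M] {N : Submodule O M} {c : K} (hc : c ∈ O) {m : M} (hm : m ∈ N) : c • m ∈ N :=
  N.smul_mem (⟨c, hc⟩ : O) hm

open Classical in
lemma isLattice_oSpan {K : Type v} [Field K] {L : Type u} [LieRing L] [LieAlgebra K L]
    {l : LieSubalgebra K L} {ι : Type w} {O : Subring K} {t : O} {X : Type*} [AddCommGroup X]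
    [Module K X] [LieRingModule l X] [LieModule K l X] {z : ι → ι → l} {G : Set X} (hG : G.Finite)
    (h : ∀ i j, ∀ x ∈ G, ⁅z i j, x⁆ - (if i = j then x else 0) ∈ t • oSpan O G) :
    Triangular.IsLattice t z (oSpan O G) := by
  refine ⟨Submodule.fg_span hG, fun i j m hm => ?_⟩
  induction hm using Submodule.span_induction with
  | mem m hm => exact h i j m hm
  | zero => rw [lie_zero, ite_self, sub_zero]; exact Submodule.zero_mem _
  | add m m' _ _ h h' =>
    have := add_mem h h'
    rw [lie_add]
    convert! this using 1
    split_ifs <;> abel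
  | smul c m _ h =>
    rw [subring_lie_smul]
    have : c • ⁅z i j, m⁆ - (if i = j then c • m else 0) =
        c • (⁅z i j, m⁆ - if i = j then m else 0) := by
      rw [smul_sub]
      split_ifs
      · rfl
      · rw [smul_zero]
    rw [this]
    exact Submodule.smul_mem _ c h

variable {g : Type u} [LieRing g] [LieAlgebra ℂ g] {K : Type v} [Field K] [Algebra ℂ K]
  {nm l np : LieSubalgebra ℂ g} {ι : Type w} (D : Triangular nm l np ι)
  {O : Subring K} (hO : ∀ c : ℂ, algebraMap ℂ K c ∈ O) (t : Kˣ) {tO : O} (htO : (tO : K) = t)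
  {χ : LieAlgebra.LieCharacter K (extendScalars K l)}

open Classical in
/-- The character `χ` has a pole of order one at `t = 0`, with leading coefficient dual to the
bracket of `n⁺` and `n⁻`. -/
def HasPole (O : Subring K) (t : Kˣ) (χ : LieAlgebra.LieCharacter K (extendScalars K l)) : Prop :=
  ∀ i j, ∃ o ∈ O, χ (D.extendComponent t i j) = (if i = j then 1 else 0) + t * o

variable (N : Type*) [AddCommGroup N] [Module ℂ N] [LieRingModule g N] [LieModule ℂ g N]

/-- A locally finite module. -/
def IsLocFin (g : Type u) [LieRing g] [LieAlgebra ℂ g] (N : Type*) [AddCommGroup N] [Module ℂ N]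
    [LieRingModule g N] : Prop :=
  ∀ a : N, ∃ S : Set N, S.Finite ∧ a ∈ Submodule.span ℂ S ∧
    ∀ x : g, ∀ b ∈ S, ⁅x, b⁆ ∈ Submodule.span ℂ S

variable {N}

omit [LieRingModule g N] [LieModule ℂ g N] in
include hO in
lemma tmul_mem_oSpan (x : CharModule χ) {S : Set N} {a : N} (ha : a ∈ Submodule.span ℂ S) :
    x ⊗ₜ[K] ((1 : K) ⊗ₜ[ℂ] a) ∈ oSpan O ((fun a : N => x ⊗ₜ[K] ((1 : K) ⊗ₜ[ℂ] a)) '' S) := by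
  induction ha using Submodule.span_induction with
  | mem a ha => exact Submodule.subset_span ⟨a, ha, rfl⟩
  | zero => rw [TensorProduct.tmul_zero, TensorProduct.tmul_zero]; exact Submodule.zero_mem _
  | add a b _ _ ha hb =>
    rw [TensorProduct.tmul_add, TensorProduct.tmul_add]; exact add_mem ha hb
  | smul c a _ ha =>
    rw [TensorProduct.tmul_smul, ← algebraMap_smul K c ((1 : K) ⊗ₜ[ℂ] a), TensorProduct.tmul_smul]
    exact subring_smul_mem (hO c) ha

variable {D t} (hχ : HasPole D O t χ)

lemma char_lie (z : extendScalars K l) (x : CharModule χ) : ⁅z, x⁆ = χ z • x := rfl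

include hχ htO

/-- The rescaled component of [e_i, f_j] acts by the character, which by `HasPole` is δ_ij modulo t;
so every finitely generated O-submodule qualifies. -/
lemma isLattice_char (E : Submodule O (CharModule χ)) (hE : E.FG) :
    Triangular.IsLattice tO (D.extendComponent t) E where
  fg := hE
  lie_sub_mem := fun i j x hx => by
    obtain ⟨o, ho, h⟩ := hχ i j
    have hox : (⟨o, ho⟩ : O) • x ∈ E := E.smul_mem _ hx
    refine mem_smul_of_eq ?_ hox
    rw [char_lie, h, add_smul, mul_smul, htO]
    split_ifs
    · rw [one_smul, add_sub_cancel_left]; rfl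
    · rw [zero_smul, zero_add, sub_zero]; rfl

include hO

/-- The lattice in `ℂ_χ ⊗ N` spanned by the vectors `x ⊗ a`, `a ∈ S`. -/
lemma isLattice_tmul (x : CharModule χ) {S : Set N} (hS : S.Finite)
    (hg : ∀ y : g, ∀ b ∈ S, ⁅y, b⁆ ∈ Submodule.span ℂ S) :
    Triangular.IsLattice tO (D.extendComponent t)
      (oSpan O ((fun a : N => x ⊗ₜ[K] ((1 : K) ⊗ₜ[ℂ] a)) '' S)) := by
  classical
  refine isLattice_oSpan (hS.image _) fun i j m hm => ?_
  obtain ⟨a, ha, rfl⟩ := hm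
  obtain ⟨o, ho, h⟩ := hχ i j
  have h1 : o • (x ⊗ₜ[K] ((1 : K) ⊗ₜ[ℂ] a)) +
      x ⊗ₜ[K] ((1 : K) ⊗ₜ[ℂ] ⁅(D.lieComponent i j : g), a⁆) ∈
        oSpan O ((fun a : N => x ⊗ₜ[K] ((1 : K) ⊗ₜ[ℂ] a)) '' S) :=
    add_mem (subring_smul_mem ho (Submodule.subset_span ⟨a, ha, rfl⟩))
      (tmul_mem_oSpan hO x (hg _ a ha))
  refine mem_smul_of_eq ?_ h1
  have h2 : ⁅D.extendComponent t i j, ((1 : K) ⊗ₜ[ℂ] a)⁆ =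
      (t : K) • ((1 : K) ⊗ₜ[ℂ] ⁅(D.lieComponent i j : g), a⁆) := by
    change ⁅(t : K) ⊗ₜ[ℂ] (D.lieComponent i j : g), (1 : K) ⊗ₜ[ℂ] a⁆ = _
    rw [LieAlgebra.ExtendScalars.bracket_tmul, TensorProduct.smul_tmul', smul_eq_mul]
  dsimp only
  rw [TensorProduct.LieModule.lie_tmul_right, h2, char_lie, h, htO, smul_add,
    smul_smul, TensorProduct.tmul_smul, add_smul, TensorProduct.add_tmul,
    ← TensorProduct.smul_tmul' ((t : K) * o)]
  split_ifs
  · rw [one_smul]; abel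
  · rw [zero_smul, TensorProduct.zero_tmul]; abel

omit hO hχ htO

lemma isLattice_sup {X : Type*} [AddCommGroup X] [Module K X] [LieRingModule (extendScalars K l) X]
    [LieModule K (extendScalars K l) X] {z : ι → ι → extendScalars K l} {E E' : Submodule O X}
    (hE : Triangular.IsLattice tO z E) (hE' : Triangular.IsLattice tO z E') :
    Triangular.IsLattice tO z (E ⊔ E') where
  fg := hE.fg.sup hE'.fg
  lie_sub_mem := fun i j x hx => by
    obtain ⟨a, ha, b, hb, rfl⟩ := Submodule.mem_sup.1 hx
    have h := add_mem (smul_le_smul le_sup_left tO (hE.lie_sub_mem i j a ha))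
      (smul_le_smul le_sup_right tO (hE'.lie_sub_mem i j b hb))
    rw [lie_add]
    convert! h using 1
    split_ifs <;> abel

lemma exists_isLattice_finset {X : Type*} [AddCommGroup X] [Module K X]
    [LieRingModule (extendScalars K l) X] [LieModule K (extendScalars K l) X]
    {z : ι → ι → extendScalars K l}
    (h : ∀ x : X, ∃ E : Submodule O X, Triangular.IsLattice tO z E ∧ x ∈ E) (s : Finset X) :
    ∃ E : Submodule O X, Triangular.IsLattice tO z E ∧ ∀ x ∈ s, x ∈ E := by
  classical
  induction s using Finset.induction_on with
  | empty =>
    obtain ⟨E, hE, -⟩ := h 0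
    exact ⟨E, hE, by simp⟩
  | insert a s _ ih =>
    obtain ⟨E, hE, ha⟩ := h a
    obtain ⟨E', hE', hs⟩ := ih
    refine ⟨E ⊔ E', isLattice_sup hE hE', fun x hx => ?_⟩
    rcases Finset.mem_insert.1 hx with rfl | hx
    · exact Submodule.mem_sup_left ha
    · exact Submodule.mem_sup_right (hs x hx)

include hO htO hχ

/-- A finite dimensional `g`-stable subspace of N spans a lattice, and lattices can be added, so
local finiteness of N puts every vector into one. -/
lemma exists_isLattice_tmul (hN : IsLocFin g N) (m : CharModule χ ⊗[K] (K ⊗[ℂ] N)) :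
    ∃ E : Submodule O (CharModule χ ⊗[K] (K ⊗[ℂ] N)),
      Triangular.IsLattice tO (D.extendComponent t) E ∧ m ∈ E := by
  induction m using TensorProduct.induction_on with
  | zero =>
    obtain ⟨S, hS, -, hg⟩ := hN 0
    exact ⟨_, isLattice_tmul hO htO hχ 0 hS hg, Submodule.zero_mem _⟩
  | add m m' h h' =>
    obtain ⟨E, hE, hm⟩ := h
    obtain ⟨E', hE', hm'⟩ := h'
    exact ⟨E ⊔ E', isLattice_sup hE hE',
      add_mem (Submodule.mem_sup_left hm) (Submodule.mem_sup_right hm')⟩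
  | tmul x y =>
    induction y using TensorProduct.induction_on with
    | zero =>
      obtain ⟨S, hS, -, hg⟩ := hN 0
      rw [TensorProduct.tmul_zero]
      exact ⟨_, isLattice_tmul hO htO hχ 0 hS hg, Submodule.zero_mem _⟩
    | add m m' h h' =>
      obtain ⟨E, hE, hm⟩ := h
      obtain ⟨E', hE', hm'⟩ := h'
      rw [TensorProduct.tmul_add]
      exact ⟨E ⊔ E', isLattice_sup hE hE',
        add_mem (Submodule.mem_sup_left hm) (Submodule.mem_sup_right hm')⟩
    | tmul c a =>
      obtain ⟨S, hS, ha, hg⟩ := hN a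
      -- The scalar c may have a pole; it is absorbed into the one dimensional factor, where any
      -- generator is allowed.
      have : x ⊗ₜ[K] (c ⊗ₜ[ℂ] a) = (c • x) ⊗ₜ[K] ((1 : K) ⊗ₜ[ℂ] a) := by
        rw [TensorProduct.smul_tmul, TensorProduct.smul_tmul', smul_eq_mul, mul_one]
      rw [this]
      exact ⟨_, isLattice_tmul hO htO hχ (c • x) hS hg, tmul_mem_oSpan hO _ ha⟩

omit hχ htO in
lemma isUnit_natCast {n : ℕ} (hn : n ≠ 0) : IsUnit (n : O) := by
  refine IsUnit.of_mul_eq_one ⟨_, hO (n : ℂ)⁻¹⟩ (Subtype.ext ?_)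
  change ((n : O) : K) * algebraMap ℂ K (n : ℂ)⁻¹ = 1
  rw [Subring.coe_natCast, ← map_natCast (algebraMap ℂ K) n, ← map_mul,
    mul_inv_cancel₀ (Nat.cast_ne_zero.2 hn), map_one]

variable [Finite ι] [CharZero K] [IsLocalRing O] (ht : ¬ IsUnit tO)

include ht

lemma isGeneric_char : (D.extend t).IsGeneric (CharModule χ) := by
  refine (D.extend t).isGeneric_of_isLattice (D.extend_isHeisenberg hO t htO) ht
    (fun n hn => isUnit_natCast hO hn) (exists_isLattice_finset fun x => ?_)
  exact ⟨_, isLattice_char htO hχ (oSpan O {x}) (Submodule.fg_span (Set.finite_singleton x)),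
    Submodule.subset_span rfl⟩

lemma isGeneric_char_tmul (hN : IsLocFin g N) :
    (D.extend t).IsGeneric (CharModule χ ⊗[K] (K ⊗[ℂ] N)) := by
  exact (D.extend t).isGeneric_of_isLattice (D.extend_isHeisenberg hO t htO) ht
    (fun n hn => isUnit_natCast hO hn)
    (exists_isLattice_finset fun x => exists_isLattice_tmul hO htO hχ hN x)

end CharLattice

/-! ## Words acting on an extension of scalars -/

section Words

variable {g : Type u} [LieRing g] [LieAlgebra ℂ g] {K : Type v} [Field K] [Algebra ℂ K]
  {nm l np : LieSubalgebra ℂ g} {ι : Type w} (D : Triangular nm l np ι) (t : Kˣ)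
  {N : Type*} [AddCommGroup N] [Module ℂ N] [LieRingModule g N] [LieModule ℂ g N]

lemma envIncl_word_cons {k : Type*} [Field k] {L : Type*} [LieRing L] [LieAlgebra k L]
    (l : LieSubalgebra k L) {κ : Type*} (b : Module.Basis κ k l) (i : κ) (w : List κ) :
    envIncl l (word b (i :: w)) = iota k L (b i : L) * envIncl l (word b w) := by
  rw [word_cons, map_mul, envIncl_iota]

lemma antiAct_extend_word (w : List ι) (c : K) (a : N) :
    (antiAct (K ⊗[ℂ] N) (envIncl (extendScalars K np) (word (D.extend t).e w))).unop (c ⊗ₜ[ℂ] a) =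
      c ⊗ₜ[ℂ] (antiAct N (envIncl np (word D.e w))).unop a := by
  induction w generalizing a with
  | nil => simp
  | cons i w ih =>
    rw [envIncl_word_cons, envIncl_word_cons, antiAct_iota_mul, antiAct_iota_mul, D.extend_e,
      LieAlgebra.ExtendScalars.bracket_tmul, one_mul, ih,
      TensorProduct.tmul_neg]

/-- Every letter of n⁻ is rescaled, which produces the factor t to the length of the word and makes
long words negligible. -/
lemma envAct_extend_word (w : List ι) (c : K) (a : N) :
    envAct (K ⊗[ℂ] N) (envIncl (extendScalars K nm) (word (D.extend t).f w)) (c ⊗ₜ[ℂ] a) =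
      ((t : K) ^ w.length * c) ⊗ₜ[ℂ] envAct N (envIncl nm (word D.f w)) a := by
  induction w with
  | nil => simp
  | cons i w ih =>
    rw [envIncl_word_cons, envIncl_word_cons, map_mul, map_mul,
      Module.End.mul_apply, Module.End.mul_apply, ih, envAct_iota, envAct_iota, D.extend_f,
      LieAlgebra.ExtendScalars.bracket_tmul, List.length_cons, pow_succ', mul_assoc]

lemma isLocNil_extend (hN : D.IsLocNil N) : (D.extend t).IsLocNil (K ⊗[ℂ] N) := by
  intro m
  induction m using TensorProduct.induction_on with
  | zero => exact ⟨0, fun s _ => map_zero _⟩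
  | tmul c a =>
    obtain ⟨n, hn⟩ := hN a
    exact ⟨n, fun s hs => (antiAct_extend_word D t s.toList c a).trans
      ((congrArg (c ⊗ₜ[ℂ] ·) (hn s hs)).trans (TensorProduct.tmul_zero _ _))⟩
  | add m m' h h' =>
    obtain ⟨n, hn⟩ := h
    obtain ⟨n', hn'⟩ := h'
    exact ⟨max n n', fun s hs => by
      rw [map_add, hn s (le_of_max_le_left hs), hn' s (le_of_max_le_right hs), add_zero]⟩

/-- Words of large degree act by zero in a finite dimensional representation. -/
lemma exists_word_eq_zero {B : Type*} [Ring B] [Algebra ℂ B] [Module.Finite ℂ B]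
    (π : U ℂ g →ₐ[ℂ] B) :
    ∃ n, ∀ w : List ι, n ≤ D.mdeg w → π (envIncl np (word D.e w)) = 0 := by
  -- Words are eigenvectors of the commutator with π(h), with their degree as eigenvalue. An
  -- operator on a finite dimensional space has finitely many eigenvalues, so words of large degree
  -- must vanish.
  let φ : Module.End ℂ B :=
    LinearMap.mulLeft ℂ (π (iota ℂ g D.h)) - LinearMap.mulRight ℂ (π (iota ℂ g D.h))
  have hfin : {n : ℕ | φ.HasEigenvalue (n : ℂ)}.Finite :=
    Module.End.finite_hasEigenvalue φ |>.preimage Nat.cast_injective.injOn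
  obtain ⟨n, hn⟩ := hfin.bddAbove
  refine ⟨n + 1, fun w hw => ?_⟩
  by_contra hne
  have h1 : φ (π (envIncl np (word D.e w))) = (D.mdeg w : ℂ) • π (envIncl np (word D.e w)) := by
    have h2 := congrArg π (D.iota_h_mul_word_e w)
    rw [map_add, map_mul, map_mul, map_smul] at h2
    change π _ * π _ - π _ * π _ = _
    rw [h2, add_sub_cancel_left]
  have h3 := hn (Module.End.hasEigenvalue_of_hasEigenvector
    (Module.End.hasEigenvector_iff.2 ⟨Module.End.mem_eigenspace_iff.2 h1, hne⟩))
  omega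

lemma antiAct_word_polyFun (w : List ι) (a : PolyFun g) (y : U ℂ g) :
    ((antiAct (PolyFun g) (envIncl np (word D.e w))).unop a).1 y =
      (-1) ^ w.length * a.1 (y * envIncl np (word D.e w.reverse)) := by
  induction w generalizing a with
  | nil => simp
  | cons i w ih =>
    have h1 : envIncl np (word D.e (i :: w).reverse) =
        envIncl np (word D.e w.reverse) * iota ℂ g (D.e i : g) := by
      rw [List.reverse_cons, word_append, map_mul, envIncl_word_cons, word_nil, map_one, mul_one]
    have h2 := ih ⁅(D.e i : g), a⁆
    rw [lie_polyFun, rho2_apply] at h2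
    rw [envIncl_word_cons, antiAct_iota_mul, h1]
    refine (congrArg Neg.neg h2).trans ?_
    rw [List.length_cons, pow_succ, mul_assoc y]
    ring

lemma isLocNil_polyFun : D.IsLocNil (PolyFun g) := by
  intro a
  obtain ⟨n, π, ξ, h⟩ := a.2
  obtain ⟨d, hd⟩ := exists_word_eq_zero D π
  refine ⟨d, fun s hs => ?_⟩
  apply PolyFun.ext'
  intro y
  rw [Triangular.eWord, antiAct_word_polyFun, h, map_mul, hd, mul_zero, map_zero, mul_zero]
  · rfl
  · have : ((s.toList.reverse : List ι) : Multiset ι) = s := by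
      rw [Multiset.coe_reverse, Multiset.coe_toList]
    rwa [this]

/-- A matrix coefficient ξ ∘ π lies in the finite dimensional space of functionals ξ(π(·) m), with m
a matrix, and ρ₂ only multiplies m on the left. -/
lemma isLocFin_polyFun : IsLocFin g (PolyFun g) := by
  intro a
  obtain ⟨n, π, ξ, h⟩ := a.2
  let Θ : Matrix (Fin n) (Fin n) ℂ →ₗ[ℂ] PolyFun g :=
    { toFun := fun m => ⟨WithConv.toConv (ξ ∘ₗ LinearMap.mulRight ℂ m ∘ₗ π.toLinearMap),
        n, π, ξ ∘ₗ LinearMap.mulRight ℂ m, fun _ => rfl⟩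
      map_add' := fun m m' => by
        apply PolyFun.ext'; intro y
        change ξ (π y * (m + m')) = ξ (π y * m) + ξ (π y * m')
        rw [mul_add, map_add]
      map_smul' := fun c m => by
        apply PolyFun.ext'; intro y
        change ξ (π y * (c • m)) = c • ξ (π y * m)
        rw [mul_smul_comm, map_smul] }
  have hΘ : ∀ m y, (Θ m).1 y = ξ (π y * m) := fun _ _ => rfl
  obtain ⟨S, hS⟩ := (inferInstance : Module.Finite ℂ (Matrix (Fin n) (Fin n) ℂ)).fg_top
  have hΘS : ∀ m, Θ m ∈ Submodule.span ℂ (Θ '' S) := fun m => by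
    rw [Submodule.span_image, hS]
    exact ⟨m, trivial, rfl⟩
  refine ⟨Θ '' S, S.finite_toSet.image _, ?_, ?_⟩
  · have : a = Θ 1 := by
      apply PolyFun.ext'; intro y
      rw [hΘ, mul_one, h]
    rw [this]
    exact hΘS 1
  · rintro x _ ⟨m, -, rfl⟩
    have : ⁅x, Θ m⁆ = Θ (π (iota ℂ g x) * m) := by
      apply PolyFun.ext'; intro y
      rw [lie_polyFun, rho2_apply, hΘ, hΘ, map_mul π, mul_assoc]
    rw [this]
    exact hΘS _

end Words

end DynQuant

end

open scoped TensorProduct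

noncomputable section

namespace DynQuant

universe u v w

/-! ## The dynamical multiplication of a character -/

section CharStar

variable {k : Type v} [Field k] {L : Type u} [LieRing L] [LieAlgebra k L]
  {nm l np : LieSubalgebra k L}

/-- The generator of the one dimensional module. -/
def charOne (χ : LieAlgebra.LieCharacter k l) : CharModule χ := (1 : k)

/-- Tensoring with a one dimensional vector space. -/
def charEquiv (χ : LieAlgebra.LieCharacter k l) (Y : Type*) [AddCommGroup Y] [Module k Y] :
    CharModule χ ⊗[k] Y ≃ₗ[k] Y := (TensorProduct.lid k Y : k ⊗[k] Y ≃ₗ[k] Y)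

variable (χ χ' : LieAlgebra.LieCharacter k l) {Y : Type*} [AddCommGroup Y] [Module k Y]

@[simp] lemma charEquiv_tmul (y : Y) : charEquiv χ Y (charOne χ ⊗ₜ y) = y :=
  (TensorProduct.lid_tmul y (1 : k)).trans (one_smul k y)

@[simp] lemma charEquiv_symm_apply (y : Y) : (charEquiv χ Y).symm y = charOne χ ⊗ₜ y := by
  rw [LinearEquiv.symm_apply_eq, charEquiv_tmul]

lemma charOne_tmul_charEquiv (y : CharModule χ ⊗[k] Y) : charOne χ ⊗ₜ charEquiv χ Y y = y := by
  rw [← charEquiv_symm_apply, LinearEquiv.symm_apply_apply]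

lemma charEquiv_lTensor {Z : Type*} [AddCommGroup Z] [Module k Z] (φ : Y →ₗ[k] Z)
    (y : CharModule χ ⊗[k] Y) : charEquiv χ Z (φ.lTensor _ y) = φ (charEquiv χ Y y) := by
  obtain ⟨y, rfl⟩ := (charEquiv χ Y).symm.surjective y
  simp

namespace Triangular

variable {ι : Type w} (D : Triangular nm l np ι) [CharZero k] [Finite ι]
  {A : Type*} [CommRing A] [Algebra k A] [LieRingModule L A] [LieModule k L A]
  (hA : ∀ (z : L) (a b : A), ⁅z, a * b⁆ = ⁅z, a⁆ * b + a * ⁅z, b⁆)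

section OneCharacter

variable {χ} (hX : D.IsGeneric (CharModule χ)) (hXA : D.IsGeneric (CharModule χ ⊗[k] A))
  (hN : D.IsLocNil A)

/-- The dynamical multiplication on `A` of the character `χ`. -/
def charStar : A →ₗ[k] A →ₗ[k] A :=
  TensorProduct.curry ((charEquiv χ A).toLinearMap ∘ₗ D.starMap hX hXA hN ∘ₗ
    (charEquiv χ A).symm.toLinearMap.rTensor A)

lemma charStar_apply (a b : A) : D.charStar hX hXA hN a b =
    charEquiv χ A (D.starMap hX hXA hN ((charOne χ ⊗ₜ a) ⊗ₜ b)) := by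
  simp [charStar]

lemma charOne_tmul_charStar (a b : A) : charOne χ ⊗ₜ D.charStar hX hXA hN a b =
    D.starMap hX hXA hN ((charOne χ ⊗ₜ a) ⊗ₜ b) := by
  rw [charStar_apply, charOne_tmul_charEquiv]

include D hX hXA hN in
lemma exists_isCharTwist :
    ∃ F : A ⊗[k] A →ₗ[k] A ⊗[k] A, IsCharTwist nm np χ A A F := by
  refine ⟨(charEquiv χ _).toLinearMap ∘ₗ D.twist hX hN hXA hN ∘ₗ
    (TensorProduct.assoc k (CharModule χ) A A).symm.toLinearMap ∘ₗ
      (charEquiv χ _).symm.toLinearMap, ?_⟩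
  rw [IsCharTwist, D.isDynTwist_iff hX hN hXA hN]
  refine LinearMap.ext fun y => ?_
  obtain ⟨y, rfl⟩ := (TensorProduct.assoc k (CharModule χ) A A).symm.surjective y
  obtain ⟨y, rfl⟩ := (charEquiv χ (A ⊗[k] A)).symm.surjective y
  apply (charEquiv χ _).injective
  simp

/-- The product does not depend on the choice of F, and is the one built from singular vectors. -/
lemma mul_isCharTwist {F : A ⊗[k] A →ₗ[k] A ⊗[k] A} (hF : IsCharTwist nm np χ A A F) (a b : A) :
    LinearMap.mul' k A (F (a ⊗ₜ b)) = D.charStar hX hXA hN a b := by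
  rw [IsCharTwist, D.isDynTwist_iff hX hN hXA hN] at hF
  rw [charStar_apply, starMap_eq_twist, ← hF]
  simp

include hA in
lemma charStar_lie (z : l) (a b : A) : ⁅(z : L), D.charStar hX hXA hN a b⁆ =
    D.charStar hX hXA hN ⁅(z : L), a⁆ b + D.charStar hX hXA hN a ⁅(z : L), b⁆ := by
  have h := D.starMap_lie hA hX hXA hN z ((charOne χ ⊗ₜ a) ⊗ₜ b)
  have h1 : ∀ c : A, ⁅z, charOne χ ⊗ₜ[k] c⁆ =
      χ z • (charOne χ ⊗ₜ[k] c) + charOne χ ⊗ₜ ⁅(z : L), c⁆ := fun c => by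
    rw [TensorProduct.LieModule.lie_tmul_right]
    rfl
  have h2 : ⁅z, (charOne χ ⊗ₜ[k] a) ⊗ₜ[k] b⁆ = χ z • ((charOne χ ⊗ₜ[k] a) ⊗ₜ[k] b) +
      (charOne χ ⊗ₜ ⁅(z : L), a⁆) ⊗ₜ b + (charOne χ ⊗ₜ[k] a) ⊗ₜ[k] ⁅(z : L), b⁆ := by
    rw [TensorProduct.LieModule.lie_tmul_right, h1, TensorProduct.add_tmul,
      TensorProduct.smul_tmul']
    rfl
  rw [h2, ← charOne_tmul_charStar, h1, map_add, map_add, map_smul, ← charOne_tmul_charStar,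
    ← charOne_tmul_charStar, ← charOne_tmul_charStar, add_assoc, add_right_inj] at h
  have h3 := congrArg (charEquiv χ A) h
  simpa using h3.symm

lemma charStar_derivation (φ : A →ₗ⁅k,L⁆ A) (hφ : ∀ a b, φ (a * b) = φ a * b + a * φ b)
    (a b : A) : φ (D.charStar hX hXA hN a b) =
      D.charStar hX hXA hN (φ a) b + D.charStar hX hXA hN a (φ b) := by
  have h := congrArg (charEquiv χ A)
    (D.starMap_derivation hX hXA hN φ hφ ((charOne χ ⊗ₜ a) ⊗ₜ b))
  rw [charEquiv_lTensor, map_add] at h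
  exact h

end OneCharacter

-- The weight of a makes 1 ↦ 1 ⊗ a an `l`-morphism ℂ_χ' → ℂ_χ ⊗ A. Associativity for this morphism
-- mixes the two characters: the inner product of b and c is taken at χ', the other products at χ.
include hA in
lemma charStar_assoc {χ χ' : LieAlgebra.LieCharacter k l} (hX : D.IsGeneric (CharModule χ))
    (hXA : D.IsGeneric (CharModule χ ⊗[k] A)) (hN : D.IsLocNil A)
    (hX' : D.IsGeneric (CharModule χ')) (hXA' : D.IsGeneric (CharModule χ' ⊗[k] A))
    {a : A} (ha : ∀ z : l, ⁅(z : L), a⁆ = (χ' z - χ z) • a) (b c : A) :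
    D.charStar hX hXA hN a (D.charStar hX' hXA' hN b c) =
      D.charStar hX hXA hN (D.charStar hX hXA hN a b) c := by
  let α₀ : k →ₗ[k] CharModule χ ⊗[k] A := LinearMap.toSpanSingleton k _ (charOne χ ⊗ₜ a)
  let α₁ : CharModule χ' →ₗ[k] CharModule χ ⊗[k] A := α₀
  have h1 : α₁ (charOne χ') = charOne χ ⊗ₜ a := by
    change α₀ (1 : k) = _
    simp [α₀]
  have h2 : ∀ x : CharModule χ', ∃ r : k, x = r • charOne χ' := fun x =>
    ⟨x, (mul_one (show k from x)).symm⟩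
  let α : CharModule χ' →ₗ⁅k,l⁆ CharModule χ ⊗[k] A :=
    { α₁ with
      map_lie' := fun {z x} => by
        obtain ⟨r, rfl⟩ := h2 x
        change α₁ (χ' z • r • charOne χ') = ⁅z, α₁ (r • charOne χ')⁆
        have h3 : ⁅z, charOne χ ⊗ₜ[k] a⁆ = χ' z • (charOne χ ⊗ₜ[k] a) := by
          rw [TensorProduct.LieModule.lie_tmul_right]
          change (χ z • charOne χ) ⊗ₜ[k] a + charOne χ ⊗ₜ ⁅(z : L), a⁆ = _
          rw [ha, TensorProduct.tmul_smul, ← TensorProduct.smul_tmul', ← add_smul,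
            add_sub_cancel]
        rw [map_smul, map_smul, h1, lie_smul, h3, smul_comm] }
  have hα : α (charOne χ') = charOne χ ⊗ₜ a := h1
  obtain ⟨h, h3, h4⟩ := D.starMap_assoc hA hX hXA hN hX' hXA' α
  have h5 : ∀ y, h (charOne χ' ⊗ₜ y) = charOne χ ⊗ₜ D.charStar hX hXA hN a y := fun y => by
    rw [h3, LinearMap.rTensor_tmul, charOne_tmul_charStar]
    exact congrArg (fun x => D.starMap hX hXA hN (x ⊗ₜ y)) hα
  have h6 := h4 ((charOne χ' ⊗ₜ b) ⊗ₜ c)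
  rw [← charOne_tmul_charStar, h5, LinearMap.rTensor_tmul, h5, ← charOne_tmul_charStar] at h6
  simpa using congrArg (charEquiv χ A) h6

end Triangular

end CharStar

end DynQuant

end

open scoped TensorProduct

noncomputable section

namespace DynQuant

universe u v w

/-! ## The expansion of the dynamical multiplication at a simple pole of the character -/

section Expansion

open scoped Pointwise

namespace Triangular

section General

variable {k : Type v} [Field k] {L : Type u} [LieRing L] [LieAlgebra k L] [CharZero k]
  {nm l np : LieSubalgebra k L} {ι : Type w} [Finite ι] (D : Triangular nm l np ι)
  {X : Type*} [AddCommGroup X] [Module k X] [LieRingModule l X] [LieModule k l X]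

lemma invGram_zero (hX : D.IsGeneric X) (x : X) (J : D.Homog (D.mdeg 0)) :
    D.invGram hX 0 x J = x := by
  classical
  have hsub : ∀ J : D.Homog (D.mdeg 0), J = ⟨0, rfl⟩ := fun J =>
    Subtype.ext (D.mdeg_eq_zero.1 (J.2.trans D.mdeg_zero))
  have h := congrFun (D.gram_invGram hX 0 x) J
  rw [gram_apply, Finset.sum_eq_single J (fun J' _ hJ' => absurd ((hsub J').trans (hsub J).symm) hJ')
    (fun hJ => absurd (Finset.mem_univ J) hJ), hsub J, Pi.single_eq_same, pairing_apply,
    eWord_zero, fWord_zero, one_smul, one_smul, Verma.proj_top] at h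
  rw [hsub J]
  exact h

variable {A : Type*} [CommRing A] [Algebra k A] [LieRingModule L A] [LieModule k L A]

/-- If the element `1 ∈ A` is invariant, it is a right unit. -/
lemma charStar_one {χ : LieAlgebra.LieCharacter k l} (hX : D.IsGeneric (CharModule χ))
    (hXA : D.IsGeneric (CharModule χ ⊗[k] A)) (hN : D.IsLocNil A)
    (h1 : ∀ z : L, ⁅z, (1 : A)⁆ = 0) (a : A) : D.charStar hX hXA hN a 1 = a := by
  -- All nonempty words kill the invariant element 1, so only the empty word contributes to the sum
  -- for the product.
  have h2 : ∀ s : Multiset ι, s ≠ 0 → (antiAct A (D.eWord s)).unop 1 = 0 := by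
    intro s hs
    obtain ⟨i, w, hw⟩ : ∃ i w, s.toList = i :: w := by
      cases h : s.toList with
      | nil => exact absurd (Multiset.toList_eq_nil.1 h) hs
      | cons i w => exact ⟨i, w, rfl⟩
    rw [eWord, hw, envIncl_word_cons, antiAct_iota_mul, h1, map_zero, neg_zero]
  have h3 : ∀ s : Multiset ι, 1 ≤ D.mdeg s → (antiAct A (D.eWord s)).unop 1 = 0 := by
    intro s hs
    refine h2 s fun h => ?_
    rw [h, mdeg_zero] at hs
    omega
  rw [charStar_apply, D.starMap_eq_sum hX hXA hN _ _ h3, Finset.sum_eq_single 0]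
  · rw [Finset.sum_congr rfl fun J _ => by
      rw [D.invGram_zero, show J.1 = 0 from D.mdeg_eq_zero.1 (J.2.trans D.mdeg_zero), fWord_zero,
        eWord_zero]]
    have : Fintype.card (D.Homog (D.mdeg 0)) = 1 := Fintype.card_eq_one_iff.2 ⟨⟨0, rfl⟩, fun J =>
      Subtype.ext (D.mdeg_eq_zero.1 (J.2.trans D.mdeg_zero))⟩
    rw [Finset.sum_const, Finset.card_univ, this, one_smul]
    simp
  · intro s _ hs
    exact Finset.sum_eq_zero fun J _ => by rw [h2 s hs]; simp
  · intro h
    exact absurd ((D.finite_mdeg_le 1).mem_toFinset.2 (by simp [mdeg_zero])) h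

end General

end Triangular

variable {g : Type u} [LieRing g] [LieAlgebra ℂ g] {K : Type v} [Field K] [Algebra ℂ K]
  {nm l np : LieSubalgebra ℂ g} {ι : Type w} (D : Triangular nm l np ι)
  {O : Subring K} (hO : ∀ c : ℂ, algebraMap ℂ K c ∈ O) (t : Kˣ) {tO : O} (htO : (tO : K) = t)
  {χ : LieAlgebra.LieCharacter K (extendScalars K l)}
  {A : Type*} [CommRing A] [Algebra ℂ A] [LieRingModule g A] [LieModule ℂ g A]

/-- The lattice `O ⊗ A` in `K ⊗ A`. -/
def intSpan (O : Subring K) (A : Type*) [AddCommGroup A] [Module ℂ A] : Submodule O (K ⊗[ℂ] A) :=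
  oSpan O (Set.range fun a : A => (1 : K) ⊗ₜ[ℂ] a)

lemma one_tmul_mem_intSpan (a : A) : (1 : K) ⊗ₜ[ℂ] a ∈ intSpan O A :=
  Submodule.subset_span ⟨a, rfl⟩

/-- The terms of the dynamical multiplication. -/
def starTerm (χ : LieAlgebra.LieCharacter K (extendScalars K l)) (s : Multiset ι) (c : A) :
    CharModule χ ⊗[K] (K ⊗[ℂ] A) →ₗ[K] K ⊗[ℂ] A :=
  (charEquiv χ _).toLinearMap ∘ₗ (LinearMap.mulRight K ((1 : K) ⊗ₜ[ℂ] c)).lTensor _ ∘ₗ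
    (envAct (K ⊗[ℂ] A) ((D.extend t).fWord s)).lTensor _

lemma starTerm_tmul (s : Multiset ι) (a c : A) :
    starTerm D t χ s c (charOne χ ⊗ₜ ((1 : K) ⊗ₜ[ℂ] a)) =
      (t : K) ^ Multiset.card s • ((1 : K) ⊗ₜ[ℂ] (envAct A (D.fWord s) a * c)) := by
  have h := envAct_extend_word D t s.toList (1 : K) a
  rw [Multiset.length_toList, mul_one] at h
  simp only [starTerm, LinearMap.comp_apply, LinearMap.lTensor_tmul, LinearEquiv.coe_coe,
    charEquiv_tmul]
  rw [Triangular.fWord, h, LinearMap.mulRight_apply, Algebra.TensorProduct.tmul_mul_tmul, mul_one,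
    TensorProduct.smul_tmul', smul_eq_mul, mul_one]
  rfl

/-- On an integral lattice the term of a word with r letters is divisible by t^r. -/
lemma starTerm_mem (s : Multiset ι) (c : A) {S : Set A} {x : CharModule χ ⊗[K] (K ⊗[ℂ] A)}
    (hx : x ∈ oSpan O ((fun a : A => charOne χ ⊗ₜ[K] ((1 : K) ⊗ₜ[ℂ] a)) '' S)) :
    ∃ Z ∈ intSpan O A, starTerm D t χ s c x = (t : K) ^ Multiset.card s • Z := by
  induction hx using Submodule.span_induction with
  | mem x hx =>
    obtain ⟨a, -, rfl⟩ := hx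
    exact ⟨_, one_tmul_mem_intSpan _, starTerm_tmul D t s a c⟩
  | zero => exact ⟨0, Submodule.zero_mem _, by simp⟩
  | add x y _ _ hx hy =>
    obtain ⟨Z, hZ, h⟩ := hx
    obtain ⟨Z', hZ', h'⟩ := hy
    exact ⟨Z + Z', add_mem hZ hZ', by rw [map_add, h, h', smul_add]⟩
  | smul r x _ hx =>
    obtain ⟨Z, hZ, h⟩ := hx
    refine ⟨(r : K) • Z, subring_smul_mem r.2 hZ, ?_⟩
    change starTerm D t χ s c ((r : K) • x) = _
    rw [map_smul, h, smul_comm]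

/-- The leading terms of the dynamical multiplication. -/
def leadTerm (a b : A) (s : Multiset ι) : K ⊗[ℂ] A :=
  if Multiset.card s ≤ 1 then (t : K) ^ Multiset.card s •
    ((1 : K) ⊗ₜ[ℂ] (envAct A (D.fWord s) a * (antiAct A (D.eWord s)).unop b)) else 0

/-- The part of first order in `t` of the dynamical multiplication. -/
def firstOrder [Fintype ι] (a b : A) : A := ∑ i, ⁅(D.f i : g), a⁆ * ⁅(D.e i : g), b⁆

/-- Only the empty word and the single letters have leading terms; the minus sign comes from the
antipode. -/
lemma sum_leadTerm [Fintype ι] (a b : A) {F : Finset (Multiset ι)} (h0 : 0 ∈ F)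
    (h1 : ∀ i, {i} ∈ F) : ∑ s ∈ F, leadTerm D t a b s =
      (1 : K) ⊗ₜ[ℂ] (a * b) - (t : K) • ((1 : K) ⊗ₜ[ℂ] firstOrder D a b) := by
  classical
  have hsub : insert 0 (Finset.univ.image fun i : ι => ({i} : Multiset ι)) ⊆ F := by
    intro s hs
    rcases Finset.mem_insert.1 hs with rfl | hs
    · exact h0
    · obtain ⟨i, -, rfl⟩ := Finset.mem_image.1 hs
      exact h1 i
  have hs1 : ∀ i, leadTerm D t a b {i} =
      - ((t : K) • ((1 : K) ⊗ₜ[ℂ] (⁅(D.f i : g), a⁆ * ⁅(D.e i : g), b⁆))) := by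
    intro i
    have he : D.eWord {i} = iota ℂ g (D.e i) := by
      simp [Triangular.eWord, word_cons, envIncl_iota]
    have hf : D.fWord {i} = iota ℂ g (D.f i) := by
      simp [Triangular.fWord, word_cons, envIncl_iota]
    rw [leadTerm, if_pos (by simp), he, hf, envAct_iota, antiAct_iota, Multiset.card_singleton,
      pow_one, mul_neg, TensorProduct.tmul_neg, smul_neg]
  rw [← Finset.sum_subset hsub, Finset.sum_insert, Finset.sum_image]
  · simp only [hs1, Finset.sum_neg_distrib]
    rw [← Finset.smul_sum, ← TensorProduct.tmul_sum, sub_eq_add_neg]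
    congr 1
    simp [leadTerm]
  · intro i _ j _ h
    exact Multiset.singleton_inj.1 h
  · simp
  · intro s _ hs
    rw [leadTerm, if_neg]
    intro hcard
    apply hs
    rcases Nat.le_one_iff_eq_zero_or_eq_one.1 hcard with h | h
    · rw [Multiset.card_eq_zero.1 h]; exact Finset.mem_insert_self _ _
    · obtain ⟨i, rfl⟩ := Multiset.card_eq_one.1 h
      exact Finset.mem_insert_of_mem (Finset.mem_image_of_mem _ (Finset.mem_univ i))

variable [CharZero K] [IsLocalRing O] (ht : ¬ IsUnit tO) {D t} (hχ : HasPole D O t χ)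

include hO htO hχ ht

-- The matrix entry for the word J comes with t to the number of letters of J. For two or more
-- letters integrality of the inverse Gram matrix suffices; for one letter that matrix is the
-- identity modulo t; the empty word is exact.
open Classical in
lemma starTerm_sub_mem [Finite ι] (hfin : IsLocFin g A)
    (hXA : (D.extend t).IsGeneric (CharModule χ ⊗[K] (K ⊗[ℂ] A))) (a b : A) (s : Multiset ι)
    (J : (D.extend t).Homog ((D.extend t).mdeg s)) :
    ∃ Z ∈ intSpan O A, starTerm D t χ J.1 ((antiAct A (D.eWord s)).unop b)
      ((D.extend t).invGram hXA s (charOne χ ⊗ₜ ((1 : K) ⊗ₜ[ℂ] a)) J) =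
        (if J.1 = s then leadTerm D t a b s else 0) + (t : K) ^ 2 • Z := by
  obtain ⟨S, hS, haS, hg⟩ := hfin a
  have hE := isLattice_tmul hO htO hχ (charOne χ) hS hg
  have hy := tmul_mem_oSpan (χ := χ) hO (charOne χ) haS
  have hH := D.extend_isHeisenberg hO t htO
  have hnat : ∀ n : ℕ, n ≠ 0 → IsUnit (n : O) := fun n hn => isUnit_natCast hO hn
  set c := (antiAct A (D.eWord s)).unop b with hc
  rcases lt_trichotomy (Multiset.card J.1) 1 with h | h | h
  · have hJ0 : J.1 = 0 := Multiset.card_eq_zero.1 (by omega)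
    have hs0 : s = 0 := (D.extend t).mdeg_eq_zero.1 (by rw [← J.2, hJ0, Triangular.mdeg_zero])
    subst hs0
    refine ⟨0, Submodule.zero_mem _, ?_⟩
    rw [(D.extend t).invGram_zero, hJ0, if_pos rfl, starTerm_tmul, leadTerm, if_pos (by simp),
      smul_zero, add_zero]
  · have h1 := (D.extend t).invGram_singleton hH hE ht hnat hXA s hy J h
    obtain ⟨x, hx, h2⟩ := mem_smul_iff.1 h1
    obtain ⟨Z, hZ, h3⟩ := starTerm_mem D t J.1 c hx
    have h4 : (D.extend t).invGram hXA s (charOne χ ⊗ₜ ((1 : K) ⊗ₜ[ℂ] a)) J =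
        (if J.1 = s then charOne χ ⊗ₜ ((1 : K) ⊗ₜ[ℂ] a) else 0) + (t : K) • x := by
      have h5 : (tO : K) • x = _ := h2
      rw [← htO, h5]
      abel
    refine ⟨Z, hZ, ?_⟩
    rw [h4, map_add, map_smul, h3, h, pow_one, smul_smul, ← sq]
    congr 1
    split_ifs with hJ
    · rw [starTerm_tmul, leadTerm, if_pos (by rw [← hJ, h]), hJ]
    · exact map_zero _
  · have h1 := (D.extend t).invGram_mem hH hE ht hnat hXA s hy J
    obtain ⟨Z, hZ, h3⟩ := starTerm_mem D t J.1 c h1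
    obtain ⟨n, hn⟩ : ∃ n, Multiset.card J.1 = 2 + n := ⟨_, (Nat.add_sub_of_le h).symm⟩
    refine ⟨(t : K) ^ n • Z, subring_smul_mem (pow_mem (htO ▸ tO.2) n) hZ, ?_⟩
    rw [h3, hn, pow_add, mul_smul]
    split_ifs with hJ
    · rw [leadTerm, if_neg (by rw [← hJ]; omega), zero_add]
    · rw [zero_add]

/-- The dynamical multiplication modulo `t²`. -/
lemma charStar_expansion [Fintype ι] (hfin : IsLocFin g A) (hnil : D.IsLocNil A)
    (hX : (D.extend t).IsGeneric (CharModule χ))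
    (hXA : (D.extend t).IsGeneric (CharModule χ ⊗[K] (K ⊗[ℂ] A)))
    (hN : (D.extend t).IsLocNil (K ⊗[ℂ] A)) (a b : A) :
    ∃ Z ∈ intSpan O A, (D.extend t).charStar hX hXA hN (1 ⊗ₜ[ℂ] a) (1 ⊗ₜ[ℂ] b) =
      (1 : K) ⊗ₜ[ℂ] (a * b) - (t : K) • ((1 : K) ⊗ₜ[ℂ] firstOrder D a b) + (t : K) ^ 2 • Z := by
  classical
  obtain ⟨n, hn⟩ := hnil b
  -- Beyond the bound n for the nilpotency on b, N is enlarged so that the range of summation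
  -- contains all single letters.
  let N := n + ∑ i, D.mdeg {i}
  have hb : ∀ s : Multiset ι, N ≤ (D.extend t).mdeg s →
      (antiAct (K ⊗[ℂ] A) ((D.extend t).eWord s)).unop ((1 : K) ⊗ₜ[ℂ] b) = 0 := fun s hs => by
    rw [Triangular.eWord, antiAct_extend_word D t s.toList (1 : K) b]
    exact (congrArg ((1 : K) ⊗ₜ[ℂ] ·) (hn s ((Nat.le_add_right _ _).trans hs))).trans
      (TensorProduct.tmul_zero _ _)
  have hterm : ∀ s : Multiset ι, (antiAct (K ⊗[ℂ] A) ((D.extend t).eWord s)).unop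
      ((1 : K) ⊗ₜ[ℂ] b) = (1 : K) ⊗ₜ[ℂ] (antiAct A (D.eWord s)).unop b := fun s =>
    antiAct_extend_word D t s.toList (1 : K) b
  choose Z hZ hZeq using starTerm_sub_mem hO htO ht hχ hfin hXA a b
  refine ⟨∑ s ∈ ((D.extend t).finite_mdeg_le N).toFinset, ∑ J, Z s J,
    Submodule.sum_mem _ fun s _ => Submodule.sum_mem _ fun J _ => hZ s J, ?_⟩
  rw [Triangular.charStar_apply, Triangular.starMap_eq_sum _ hX hXA hN _ _ hb,
    ← sum_leadTerm D t a b (F := ((D.extend t).finite_mdeg_le N).toFinset), Finset.smul_sum,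
    ← Finset.sum_add_distrib, map_sum]
  · refine Finset.sum_congr rfl fun s _ => ?_
    rw [Finset.smul_sum, map_sum]
    have h1 : leadTerm D t a b s =
        ∑ J : (D.extend t).Homog ((D.extend t).mdeg s), if J.1 = s then leadTerm D t a b s else 0 := by
      let J₀ : (D.extend t).Homog ((D.extend t).mdeg s) := ⟨s, rfl⟩
      exact ((Finset.sum_eq_single J₀ (fun J _ hJ => if_neg fun h => hJ (Subtype.ext h))
        (fun h => absurd (Finset.mem_univ _) h)).trans (if_pos rfl)).symm
    rw [h1, ← Finset.sum_add_distrib]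
    refine Finset.sum_congr rfl fun J _ => ?_
    rw [← hZeq s J, hterm]
    rfl
  · exact (Set.Finite.mem_toFinset _).2 (by simp [Triangular.mdeg_zero])
  · intro i
    refine (Set.Finite.mem_toFinset _).2 ?_
    change D.mdeg {i} ≤ N
    exact (Finset.single_le_sum (f := fun i => D.mdeg {i}) (fun _ _ => Nat.zero_le _)
      (Finset.mem_univ i)).trans (Nat.le_add_left _ _)

end Expansion

end DynQuant

end

open scoped TensorProduct

noncomputable section

namespace DynQuant

universe u v w

/-! ## Formal Laurent series -/

section Laurent

open HahnSeries

instance : CharZero LaurentC := charZero_of_injective_algebraMap (algebraMap ℂ LaurentC).injective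

/-- The subring `ℂ[[t]]` of `ℂ((t))`. -/
def integerRing : Subring LaurentC := (ofPowerSeries ℤ ℂ : PowerSeries ℂ →+* LaurentSeries ℂ).range

/-- The power series as Laurent series. -/
def ofSeries : PowerSeries ℂ →+* LaurentC := (ofPowerSeries ℤ ℂ : PowerSeries ℂ →+* LaurentSeries ℂ)

lemma ofSeries_injective : Function.Injective ofSeries := ofPowerSeries_injective

lemma mem_integerRing {c : LaurentC} : c ∈ integerRing ↔ ∃ p, ofSeries p = c := Iff.rfl

lemma ofSeries_C (c : ℂ) : ofSeries (PowerSeries.C c) = algebraMap ℂ LaurentC c :=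
  ofPowerSeries_C (Γ := ℤ) c

lemma laurentCoeff_ofSeries (p : PowerSeries ℂ) (n : ℕ) :
    laurentCoeff n (ofSeries p) = PowerSeries.coeff n p :=
  ofPowerSeries_apply_coeff (Γ := ℤ) p n

lemma laurentCoeff_ofSeries_neg (p : PowerSeries ℂ) {n : ℤ} (hn : n < 0) :
    laurentCoeff n (ofSeries p) = 0 := by
  change HahnSeries.coeff (ofPowerSeries ℤ ℂ p) n = 0
  rw [ofPowerSeries_apply]
  apply embDomain_of_notMem_range
  rintro ⟨j, hj⟩
  rw [← hj] at hn
  exact absurd (Int.natCast_nonneg j) (not_le.2 hn)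

lemma ofSeries_X_ne_zero : ofSeries PowerSeries.X ≠ 0 := fun h =>
  PowerSeries.X_ne_zero (ofSeries_injective (h.trans (map_zero _).symm))

/-- The variable `t`. -/
def laurentT : LaurentCˣ := Units.mk0 (ofSeries PowerSeries.X) ofSeries_X_ne_zero

lemma coe_laurentT : (laurentT : LaurentC) = ofSeries PowerSeries.X := rfl

/-- The variable `t`, as an element of `ℂ[[t]]`. -/
def integerT : integerRing := ⟨ofSeries PowerSeries.X, _, rfl⟩

lemma coe_integerT : (integerT : LaurentC) = laurentT := rfl

lemma algebraMap_mem_integerRing (c : ℂ) : algebraMap ℂ LaurentC c ∈ integerRing :=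
  ⟨_, ofSeries_C c⟩

instance : IsLocalRing integerRing :=
  IsLocalRing.of_surjective' (ofPowerSeries ℤ ℂ : PowerSeries ℂ →+* LaurentSeries ℂ).rangeRestrict
    (RingHom.rangeRestrict_surjective _)

lemma not_isUnit_integerT : ¬ IsUnit integerT := by
  intro h
  obtain ⟨⟨u, p, rfl⟩, hu⟩ := h.exists_right_inv
  have h1 : ofSeries (PowerSeries.X * p) = ofSeries 1 := by
    rw [map_mul, map_one]
    exact congrArg Subtype.val hu
  have h2 := congrArg PowerSeries.constantCoeff (ofSeries_injective h1)
  simp at h2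

lemma laurentT_mul_divT (a : ℕ → ℂ) : (laurentT : LaurentC) * divT a = ofSeries (PowerSeries.mk a) := by
  have h : (single (1 : ℤ) (1 : ℂ)) * (single (-1 : ℤ) (1 : ℂ)) = 1 := by
    rw [single_mul_single]; simp
  have hX : (ofPowerSeries ℤ ℂ PowerSeries.X) = single (1 : ℤ) (1 : ℂ) := ofPowerSeries_X
  change ofPowerSeries ℤ ℂ PowerSeries.X *
    (single (-1 : ℤ) (1 : ℂ) * ofPowerSeries ℤ ℂ (PowerSeries.mk a)) = _
  rw [hX, ← mul_assoc, h, one_mul]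
  rfl

lemma laurentT_mul_divT' (a : ℕ → ℂ) : ∃ o ∈ integerRing,
    (laurentT : LaurentC) * divT a = algebraMap ℂ LaurentC (a 0) + laurentT * o := by
  refine ⟨_, ⟨PowerSeries.mk fun n => a (n + 1), rfl⟩, ?_⟩
  rw [laurentT_mul_divT, coe_laurentT, ← ofSeries_C]
  change _ = _ + _ * ofSeries _
  rw [← map_mul, ← map_add]
  congr 1
  ext n
  cases n with
  | zero => simp
  | succ n => simp [PowerSeries.coeff_succ_X_mul]

lemma laurentCoeff_mul {r s : LaurentC} (hr : r ∈ integerRing) (hs : s ∈ integerRing) (n : ℕ) :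
    laurentCoeff n (r * s) =
      ∑ p ∈ Finset.HasAntidiagonal.antidiagonal n, laurentCoeff p.1 r * laurentCoeff p.2 s := by
  obtain ⟨r, rfl⟩ := mem_integerRing.1 hr
  obtain ⟨s, rfl⟩ := mem_integerRing.1 hs
  rw [← map_mul, laurentCoeff_ofSeries, PowerSeries.coeff_mul]
  simp only [laurentCoeff_ofSeries]

end Laurent

/-! ## Coefficients -/

section Coefficients

variable {g : Type u} [LieRing g] [LieAlgebra ℂ g]

lemma coeffT_tmul (n : ℤ) (c : LaurentC) (a : PolyFun g) :
    coeffT n (c ⊗ₜ[ℂ] a) = laurentCoeff n c • a := by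
  simp [coeffT]

variable (g) in
/-- The lattice `ℂ[[t]] ⊗ 𝒜(G)`. -/
abbrev intFun : Submodule integerRing (PolyFunT g) := intSpan integerRing (PolyFun g)

/-- P is not assumed stable under scalars, so it is proved for all integral multiples of Y at once.
-/
lemma intFun_induction {P : PolyFunT g → Prop} (h0 : P 0) (hadd : ∀ Y Z, P Y → P Z → P (Y + Z))
    (h : ∀ r ∈ integerRing, ∀ a, P (r ⊗ₜ[ℂ] a)) {Y : PolyFunT g} (hY : Y ∈ intFun g) : P Y := by
  suffices ∀ r ∈ integerRing, P (r • Y) by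
    have h1 := this 1 (one_mem _)
    rwa [one_smul] at h1
  induction hY using Submodule.span_induction with
  | mem Y hY =>
    obtain ⟨a, rfl⟩ := hY
    intro r hr
    change P (r • ((1 : LaurentC) ⊗ₜ[ℂ] a))
    rw [TensorProduct.smul_tmul', smul_eq_mul, mul_one]
    exact h r hr a
  | zero => intro r _; rwa [smul_zero]
  | add Y Z _ _ hY hZ => intro r hr; rw [smul_add]; exact hadd _ _ (hY r hr) (hZ r hr)
  | smul c Y _ hY =>
    intro r hr
    change P (r • ((c : LaurentC) • Y))
    rw [smul_smul]
    exact hY _ (mul_mem hr c.2)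

lemma coeffT_neg {Y : PolyFunT g} (hY : Y ∈ intFun g) {n : ℤ} (hn : n < 0) : coeffT n Y = 0 := by
  refine intFun_induction (P := fun Y => coeffT n Y = 0) ?_ ?_ ?_ hY
  · exact map_zero _
  · intro Y Z hY hZ
    rw [map_add, hY, hZ, add_zero]
  · intro r hr a
    obtain ⟨p, rfl⟩ := mem_integerRing.1 hr
    rw [coeffT_tmul, laurentCoeff_ofSeries_neg p hn, zero_smul]

lemma coeffT_smul {r : LaurentC} (hr : r ∈ integerRing) {Y : PolyFunT g} (hY : Y ∈ intFun g)
    (n : ℕ) : coeffT n (r • Y) =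
      ∑ p ∈ Finset.HasAntidiagonal.antidiagonal n, laurentCoeff p.1 r • coeffT p.2 Y := by
  refine intFun_induction (P := fun Y => coeffT n (r • Y) =
      ∑ p ∈ Finset.HasAntidiagonal.antidiagonal n, laurentCoeff p.1 r • coeffT p.2 Y) ?_ ?_ ?_ hY
  · simp
  · intro Y Z hY hZ
    simp only [smul_add, map_add, hY, hZ, Finset.sum_add_distrib]
  · intro s hs a
    rw [TensorProduct.smul_tmul', smul_eq_mul, coeffT_tmul, laurentCoeff_mul hr hs, Finset.sum_smul]
    simp only [coeffT_tmul, smul_smul]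

/-- A map that preserves the integral lattice acts on coefficients by a Cauchy product; this passes
from products over ℂ((t)) to the operations ⋆ₙ. -/
lemma coeffT_map (φ : PolyFunT g →ₗ[LaurentC] PolyFunT g)
    (hφ : ∀ a : PolyFun g, φ (1 ⊗ₜ[ℂ] a) ∈ intFun g) {Y : PolyFunT g} (hY : Y ∈ intFun g) (n : ℕ) :
    coeffT n (φ Y) =
      ∑ p ∈ Finset.HasAntidiagonal.antidiagonal n, coeffT p.1 (φ (1 ⊗ₜ[ℂ] coeffT p.2 Y)) := by
  refine intFun_induction (P := fun Y => coeffT n (φ Y) =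
      ∑ p ∈ Finset.HasAntidiagonal.antidiagonal n, coeffT p.1 (φ (1 ⊗ₜ[ℂ] coeffT p.2 Y))) ?_ ?_ ?_ hY
  · simp
  · intro Y Z hY hZ
    simp only [map_add, hY, hZ, TensorProduct.tmul_add, Finset.sum_add_distrib]
  · intro r hr a
    have h1 : r ⊗ₜ[ℂ] a = r • ((1 : LaurentC) ⊗ₜ[ℂ] a) := by
      rw [TensorProduct.smul_tmul', smul_eq_mul, mul_one]
    rw [h1, map_smul, coeffT_smul hr (hφ a), ← Finset.Nat.sum_antidiagonal_swap]
    refine Finset.sum_congr rfl fun p _ => ?_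
    rw [← h1, coeffT_tmul, TensorProduct.tmul_smul, LinearMap.map_smul_of_tower, map_smul]
    rfl

lemma laurentT_smul_mem {Y : PolyFunT g} (hY : Y ∈ intFun g) : (laurentT : LaurentC) • Y ∈ intFun g :=
  subring_smul_mem integerT.2 hY

lemma coeffT_zero_laurentT_smul {Y : PolyFunT g} (hY : Y ∈ intFun g) :
    coeffT 0 ((laurentT : LaurentC) • Y) = 0 := by
  have h := coeffT_smul integerT.2 hY 0
  rw [Finset.HasAntidiagonal.antidiagonal_zero, Finset.sum_singleton] at h
  change coeffT 0 ((integerT : LaurentC) • Y) = 0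
  refine h.trans ?_
  change laurentCoeff ((0 : ℕ) : ℤ) (ofSeries PowerSeries.X) • _ = _
  rw [laurentCoeff_ofSeries, PowerSeries.coeff_zero_X, zero_smul]

lemma coeffT_one_laurentT_smul {Y : PolyFunT g} (hY : Y ∈ intFun g) :
    coeffT 1 ((laurentT : LaurentC) • Y) = coeffT 0 Y := by
  have h := coeffT_smul integerT.2 hY 1
  rw [Finset.Nat.sum_antidiagonal_succ, Finset.HasAntidiagonal.antidiagonal_zero,
    Finset.sum_singleton] at h
  refine h.trans ?_
  change laurentCoeff ((0 : ℕ) : ℤ) (ofSeries PowerSeries.X) • coeffT ((1 : ℕ) : ℤ) Y +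
    laurentCoeff ((1 : ℕ) : ℤ) (ofSeries PowerSeries.X) • coeffT 0 Y = _
  rw [laurentCoeff_ofSeries, laurentCoeff_ofSeries, PowerSeries.coeff_zero_X, zero_smul, zero_add,
    PowerSeries.coeff_one_X, one_smul]

lemma laurentCoeff_one (n : ℕ) : laurentCoeff n 1 = if n = 0 then 1 else 0 := by
  rw [← map_one ofSeries, laurentCoeff_ofSeries, PowerSeries.coeff_one]

lemma coeffT_one_tmul (n : ℕ) (a : PolyFun g) : coeffT n (1 ⊗ₜ[ℂ] a) = if n = 0 then a else 0 := by
  rw [coeffT_tmul, laurentCoeff_one]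
  split_ifs <;> simp

/-- `ρ₁(x)` is a derivation of `𝒜(G)`. -/
lemma rho1_mul (x : g) (a b : PolyFun g) : rho1 x (a * b) = rho1 x a * b + a * rho1 x b := by
  apply PolyFun.ext'; intro z
  change -((a.1 * b.1) (iota ℂ g x * z)) = ((rho1 x a).1 * b.1) z + (a.1 * (rho1 x b).1) z
  rw [LinearMap.convMul_apply, LinearMap.convMul_apply, LinearMap.convMul_apply,
    Bialgebra.comul_mul, comul_iota]
  induction (Coalgebra.comul z : U ℂ g ⊗[ℂ] U ℂ g) using TensorProduct.induction_on with
  | zero => simp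
  | tmul p q =>
    simp only [add_mul, Algebra.TensorProduct.tmul_mul_tmul, one_mul, map_add,
      TensorProduct.map_tmul, LinearMap.mul'_apply]
    change -(a.1 (iota ℂ g x * p) * b.1 q + a.1 p * b.1 (iota ℂ g x * q)) =
      -a.1 (iota ℂ g x * p) * b.1 q + a.1 p * -b.1 (iota ℂ g x * q)
    ring
  | add p q hp hq =>
    simp only [mul_add, map_add] at hp hq ⊢
    rw [neg_add, hp, hq]; ring

lemma rho1_lie (x z : g) (a : PolyFun g) : rho1 x ⁅z, a⁆ = ⁅z, rho1 x a⁆ := by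
  apply PolyFun.ext'; intro y
  rw [lie_polyFun, lie_polyFun, rho1_apply, rho2_apply, rho2_apply, rho1_apply, mul_assoc]

lemma lie_mul_extend {K A : Type*} [Field K] [Algebra ℂ K] [CommRing A] [Algebra ℂ A]
    [LieRingModule g A] [LieModule ℂ g A]
    (h : ∀ (z : g) (a b : A), ⁅z, a * b⁆ = ⁅z, a⁆ * b + a * ⁅z, b⁆) (z : K ⊗[ℂ] g)
    (a b : K ⊗[ℂ] A) : ⁅z, a * b⁆ = ⁅z, a⁆ * b + a * ⁅z, b⁆ := by
  induction z using TensorProduct.induction_on with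
  | zero => simp
  | add z z' hz hz' => rw [add_lie, hz, hz', add_lie, add_lie, add_mul, mul_add]; abel
  | tmul c z =>
    induction a using TensorProduct.induction_on with
    | zero => simp
    | add a a' ha ha' => rw [add_mul, lie_add, ha, ha', lie_add, add_mul, add_mul]; abel
    | tmul r a =>
      induction b using TensorProduct.induction_on with
      | zero => simp
      | add b b' hb hb' => rw [mul_add, lie_add, hb, hb', lie_add, mul_add, mul_add]; abel
      | tmul s b =>
        simp only [LieAlgebra.ExtendScalars.bracket_tmul, Algebra.TensorProduct.tmul_mul_tmul, h,
          TensorProduct.tmul_add]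
        rw [mul_assoc, mul_left_comm r c s]

/-- The extension of scalars of a morphism of modules. -/
def extendHom {K A : Type*} [Field K] [Algebra ℂ K] [CommRing A] [Algebra ℂ A]
    [LieRingModule g A] [LieModule ℂ g A] (φ : A →ₗ[ℂ] A) (hφ : ∀ (z : g) a, φ ⁅z, a⁆ = ⁅z, φ a⁆) :
    K ⊗[ℂ] A →ₗ⁅K, K ⊗[ℂ] g⁆ K ⊗[ℂ] A :=
  { φ.baseChange K with
    map_lie' := fun {z a} => by
      change φ.baseChange K ⁅z, a⁆ = ⁅z, φ.baseChange K a⁆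
      induction z using TensorProduct.induction_on with
      | zero => simp
      | add z z' hz hz' => rw [add_lie, map_add, hz, hz', add_lie]
      | tmul c z =>
        induction a using TensorProduct.induction_on with
        | zero => simp
        | add a a' ha ha' => rw [lie_add, map_add, ha, ha', map_add, lie_add]
        | tmul r a => simp [hφ] }

lemma extendHom_tmul {K A : Type*} [Field K] [Algebra ℂ K] [CommRing A] [Algebra ℂ A]
    [LieRingModule g A] [LieModule ℂ g A] (φ : A →ₗ[ℂ] A) (hφ : ∀ (z : g) a, φ ⁅z, a⁆ = ⁅z, φ a⁆)
    (c : K) (a : A) : extendHom φ hφ (c ⊗ₜ[ℂ] a) = c ⊗ₜ[ℂ] φ a := rfl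

lemma extendHom_mul {K A : Type*} [Field K] [Algebra ℂ K] [CommRing A] [Algebra ℂ A]
    [LieRingModule g A] [LieModule ℂ g A] (φ : A →ₗ[ℂ] A) (hφ : ∀ (z : g) a, φ ⁅z, a⁆ = ⁅z, φ a⁆)
    (h : ∀ a b : A, φ (a * b) = φ a * b + a * φ b) (a b : K ⊗[ℂ] A) :
    extendHom φ hφ (a * b) = extendHom φ hφ a * b + a * extendHom φ hφ b := by
  induction a using TensorProduct.induction_on with
  | zero => simp
  | add a a' ha ha' => rw [add_mul, map_add, ha, ha', map_add, add_mul, add_mul]; abel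
  | tmul r a =>
    induction b using TensorProduct.induction_on with
    | zero => simp
    | add b b' hb hb' => rw [mul_add, map_add, hb, hb', map_add, mul_add, mul_add]; abel
    | tmul s b =>
      rw [Algebra.TensorProduct.tmul_mul_tmul, extendHom_tmul, extendHom_tmul, extendHom_tmul, h,
        Algebra.TensorProduct.tmul_mul_tmul, Algebra.TensorProduct.tmul_mul_tmul,
        TensorProduct.tmul_add]

end Coefficients

end DynQuant

end

open scoped TensorProduct

noncomputable section

namespace DynQuant

universe u v w

/-! ## The dynamical multiplication at `λ(t)/t` -/

section PathStar

variable {g : Type u} [LieRing g] [LieAlgebra ℂ g] {nm l np : LieSubalgebra ℂ g} {ι : Type w}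
  [Fintype ι] {D : Triangular nm l np ι} {lam : ℕ → centreDual nm l np}

open Classical in
/-- The bases of `n⁺` and `n⁻` are dual with respect to `μ([·, ·])`. -/
def IsDualBasis (D : Triangular nm l np ι) (μ : Module.Dual ℂ g) : Prop :=
  ∀ i j, μ ⁅(D.e i : g), (D.f j : g)⁆ = if i = j then 1 else 0

lemma pathCharacter_tmul (lam : ℕ → centreDual nm l np) (c : LaurentC) {x : g} (hx : x ∈ l) :
    pathCharacter lam ⟨c ⊗ₜ[ℂ] x, tmul_mem_extendScalars c hx⟩ =
      c * divT fun i => (lam i : Module.Dual ℂ g) x := by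
  change (pathForm lam).liftBaseChange LaurentC (c ⊗ₜ[ℂ] x) = _
  rw [LinearMap.liftBaseChange_tmul, smul_eq_mul]
  rfl

lemma shiftPath_zero (α : centreDual nm l np) : shiftPath lam α 0 = lam 0 := by
  simp [shiftPath]

/-- Division by t turns the path λ(t) − tα into λ(t)/t − α, so the two characters differ by the
constant weight −α. -/
lemma pathCharacter_shiftPath (α : centreDual nm l np) (c : LaurentC) {x : g} (hx : x ∈ l) :
    pathCharacter (shiftPath lam α) ⟨c ⊗ₜ[ℂ] x, tmul_mem_extendScalars c hx⟩ -
      pathCharacter lam ⟨c ⊗ₜ[ℂ] x, tmul_mem_extendScalars c hx⟩ =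
        -(c * algebraMap ℂ LaurentC ((α : Module.Dual ℂ g) x)) := by
  rw [pathCharacter_tmul _ _ hx, pathCharacter_tmul _ _ hx, ← mul_sub, ← mul_neg]
  congr 1
  apply laurentCoeff_ext
  intro n
  have h0 : ∀ r : ℂ, laurentCoeff n (algebraMap ℂ LaurentC r) = if n = 0 then r else 0 := fun r =>
    (HahnSeries.coeff_single (Γ := ℤ)).trans (by split_ifs <;> rfl)
  rw [map_sub, map_neg, laurentCoeff_divT, laurentCoeff_divT, h0]
  rcases lt_trichotomy n 0 with h | h | h
  · rw [if_neg h.ne]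
    split_ifs with h1
    · have : (n + 1).toNat = 0 := by omega
      rw [this, shiftPath_zero, sub_self, neg_zero]
    · simp
  · subst h
    simp [shiftPath]
  · rw [if_pos (by omega), if_pos (by omega), if_neg h.ne']
    have : (n + 1).toNat ≠ 1 := by omega
    simp [shiftPath, this]

-- As λ₀ vanishes on n±, its value on the `l`-component of [e_i, f_j] is its value on the whole
-- bracket, namely δ_ij; the later λ_n enter only in higher order.
omit [Fintype ι] in
lemma IsDualBasis.hasPole (hD : IsDualBasis D (lam 0)) :
    HasPole D integerRing laurentT (pathCharacter lam) := by
  classical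
  intro i j
  obtain ⟨a, ha, c, hc, h⟩ := D.lie_e_f_eq i j
  have h1 : (lam 0 : Module.Dual ℂ g) (D.lieComponent i j) = if i = j then 1 else 0 := by
    have h2 := hD i j
    rw [h, map_add, map_add, (lam 0).2.1 a ha, (lam 0).2.2.1 c hc, zero_add, add_zero] at h2
    rw [h2]
  obtain ⟨o, ho, h3⟩ := laurentT_mul_divT' fun n => (lam n : Module.Dual ℂ g) (D.lieComponent i j)
  refine ⟨o, ho, (pathCharacter_tmul lam _ (D.lieComponent i j).2).trans (h3.trans ?_)⟩
  rw [h1]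
  split_ifs <;> simp

variable (hD : IsDualBasis D (lam 0))

include hD in
lemma IsDualBasis.isGeneric : (D.extend laurentT).IsGeneric (CharModule (pathCharacter lam)) :=
  isGeneric_char algebraMap_mem_integerRing coe_integerT hD.hasPole not_isUnit_integerT

include hD in
lemma IsDualBasis.isGeneric_tmul : (D.extend laurentT).IsGeneric
    (CharModule (pathCharacter lam) ⊗[LaurentC] PolyFunT g) :=
  isGeneric_char_tmul algebraMap_mem_integerRing coe_integerT hD.hasPole not_isUnit_integerT
    isLocFin_polyFun

omit [Fintype ι] in
lemma isLocNil_polyFunT (D : Triangular nm l np ι) :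
    (D.extend laurentT).IsLocNil (PolyFunT g) :=
  isLocNil_extend D laurentT (isLocNil_polyFun D)

/-- The dynamical multiplication at `λ(t)/t` over the field of Laurent series. -/
def pathStar : PolyFunT g →ₗ[LaurentC] PolyFunT g →ₗ[LaurentC] PolyFunT g :=
  (D.extend laurentT).charStar hD.isGeneric hD.isGeneric_tmul (isLocNil_polyFunT D)

lemma lie_polyFun_mul (z : g) (a b : PolyFun g) : ⁅z, a * b⁆ = ⁅z, a⁆ * b + a * ⁅z, b⁆ :=
  rho2_mul z a b

lemma pathStar_expansion (a b : PolyFun g) :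
    ∃ Z ∈ intFun g, pathStar hD (1 ⊗ₜ[ℂ] a) (1 ⊗ₜ[ℂ] b) =
      (1 : LaurentC) ⊗ₜ[ℂ] (a * b) - (laurentT : LaurentC) • ((1 : LaurentC) ⊗ₜ[ℂ] firstOrder D a b) +
        (laurentT : LaurentC) ^ 2 • Z :=
  charStar_expansion algebraMap_mem_integerRing coe_integerT not_isUnit_integerT hD.hasPole
    isLocFin_polyFun (isLocNil_polyFun D) _ _ _ a b

lemma pathStar_mem (a b : PolyFun g) : pathStar hD (1 ⊗ₜ[ℂ] a) (1 ⊗ₜ[ℂ] b) ∈ intFun g := by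
  obtain ⟨Z, hZ, h⟩ := pathStar_expansion hD a b
  rw [h, sq, mul_smul]
  exact add_mem (sub_mem (one_tmul_mem_intSpan _) (laurentT_smul_mem (one_tmul_mem_intSpan _)))
    (laurentT_smul_mem (laurentT_smul_mem hZ))

/-- The coefficients of the dynamical multiplication. -/
def starCoeff (n : ℕ) : PolyFun g →ₗ[ℂ] PolyFun g →ₗ[ℂ] PolyFun g :=
  LinearMap.mk₂ ℂ (fun a b => coeffT n (pathStar hD (1 ⊗ₜ[ℂ] a) (1 ⊗ₜ[ℂ] b)))
    (fun a a' b => by rw [TensorProduct.tmul_add, map_add, LinearMap.add_apply, map_add])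
    (fun r a b => by
      rw [TensorProduct.tmul_smul, LinearMap.map_smul_of_tower, LinearMap.smul_apply, map_smul])
    (fun a b b' => by rw [TensorProduct.tmul_add, map_add, map_add])
    (fun r a b => by rw [TensorProduct.tmul_smul, LinearMap.map_smul_of_tower, map_smul])

lemma starCoeff_apply (n : ℕ) (a b : PolyFun g) :
    starCoeff hD n a b = coeffT n (pathStar hD (1 ⊗ₜ[ℂ] a) (1 ⊗ₜ[ℂ] b)) := rfl

/-- The twist exists, its product is forced, and integrality rules out negative powers of t. -/
lemma isDynMul_iff (star : ℕ → PolyFun g →ₗ[ℂ] PolyFun g →ₗ[ℂ] PolyFun g) :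
    IsDynMul lam star ↔ star = starCoeff hD := by
  constructor
  · rintro ⟨F, hF, h⟩
    funext n
    refine LinearMap.ext₂ fun a b => ?_
    have h1 := h a b n
    rw [(D.extend laurentT).mul_isCharTwist hD.isGeneric hD.isGeneric_tmul (isLocNil_polyFunT D) hF,
      if_pos (Int.natCast_nonneg n), Int.toNat_natCast] at h1
    exact h1.symm
  · rintro rfl
    obtain ⟨F, hF⟩ := (D.extend laurentT).exists_isCharTwist hD.isGeneric hD.isGeneric_tmul
      (isLocNil_polyFunT D)
    refine ⟨F, hF, fun a b n => ?_⟩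
    rw [(D.extend laurentT).mul_isCharTwist hD.isGeneric hD.isGeneric_tmul (isLocNil_polyFunT D) hF]
    change coeffT n (pathStar hD _ _) = _
    split_ifs with hn
    · obtain ⟨m, rfl⟩ := Int.eq_ofNat_of_zero_le hn
      rfl
    · exact coeffT_neg (pathStar_mem hD a b) (not_le.1 hn)

lemma starCoeff_zero (a b : PolyFun g) : starCoeff hD 0 a b = a * b := by
  obtain ⟨Z, hZ, h⟩ := pathStar_expansion hD a b
  have h1 := coeffT_one_tmul 0 (a * b)
  rw [starCoeff_apply, h, sq, mul_smul, map_add, map_sub]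
  rw [Nat.cast_zero] at h1 ⊢
  rw [h1, coeffT_zero_laurentT_smul (one_tmul_mem_intSpan _),
    coeffT_zero_laurentT_smul (laurentT_smul_mem hZ)]
  simp

lemma starCoeff_one (a b : PolyFun g) : starCoeff hD 1 a b = -firstOrder D a b := by
  obtain ⟨Z, hZ, h⟩ := pathStar_expansion hD a b
  have h1 := coeffT_one_tmul 1 (a * b)
  have h2 := coeffT_one_tmul 0 (firstOrder D a b)
  rw [starCoeff_apply, h, sq, mul_smul, map_add, map_sub]
  rw [Nat.cast_zero] at h2
  rw [Nat.cast_one] at h1 ⊢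
  rw [h1, coeffT_one_laurentT_smul (one_tmul_mem_intSpan _),
    coeffT_one_laurentT_smul (laurentT_smul_mem hZ), coeffT_zero_laurentT_smul hZ, h2]
  simp

lemma coeffT_pathStar_left {Y : PolyFunT g} (hY : Y ∈ intFun g) (c : PolyFun g) (n : ℕ) :
    coeffT n (pathStar hD Y (1 ⊗ₜ[ℂ] c)) =
      ∑ p ∈ Finset.HasAntidiagonal.antidiagonal n, starCoeff hD p.1 (coeffT p.2 Y) c :=
  coeffT_map ((pathStar hD).flip (1 ⊗ₜ[ℂ] c)) (fun a => pathStar_mem hD a c) hY n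

lemma coeffT_pathStar_right (a : PolyFun g) {Y : PolyFunT g} (hY : Y ∈ intFun g) (n : ℕ) :
    coeffT n (pathStar hD (1 ⊗ₜ[ℂ] a) Y) =
      ∑ p ∈ Finset.HasAntidiagonal.antidiagonal n, starCoeff hD p.1 a (coeffT p.2 Y) :=
  coeffT_map (pathStar hD (1 ⊗ₜ[ℂ] a)) (fun b => pathStar_mem hD a b) hY n

/-- The weight −α of a is exactly the difference of the characters at the shifted and the original
path. -/
lemma pathStar_assoc {α : centreDual nm l np} (hD' : IsDualBasis D (shiftPath lam α 0))
    {a : PolyFun g} (ha : ∀ z ∈ l, rho2 z a = -((α : Module.Dual ℂ g) z • a)) (b c : PolyFunT g) :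
    pathStar hD (1 ⊗ₜ[ℂ] a) (pathStar hD' b c) = pathStar hD (pathStar hD (1 ⊗ₜ[ℂ] a) b) c := by
  refine (D.extend laurentT).charStar_assoc (lie_mul_extend lie_polyFun_mul) _ _ _ _ _ ?_ b c
  rintro ⟨z, hz⟩
  have key : ∃ h : z ∈ extendScalars LaurentC l, ⁅z, (1 : LaurentC) ⊗ₜ[ℂ] a⁆ =
      (pathCharacter (shiftPath lam α) ⟨z, h⟩ - pathCharacter lam ⟨z, h⟩) •
        ((1 : LaurentC) ⊗ₜ[ℂ] a) := by
    refine extendScalars_induction (P := fun z => ∃ h : z ∈ extendScalars LaurentC l,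
      ⁅z, (1 : LaurentC) ⊗ₜ[ℂ] a⁆ =
      (pathCharacter (shiftPath lam α) ⟨z, h⟩ - pathCharacter lam ⟨z, h⟩) •
        ((1 : LaurentC) ⊗ₜ[ℂ] a)) (fun c x hx => ⟨tmul_mem_extendScalars c hx, ?_⟩) ?_ hz
    · rw [pathCharacter_shiftPath _ _ hx, LieAlgebra.ExtendScalars.bracket_tmul, lie_polyFun, ha x hx,
        mul_one, TensorProduct.tmul_neg, TensorProduct.tmul_smul, neg_smul, mul_smul,
        algebraMap_smul, smul_comm, TensorProduct.smul_tmul' c, smul_eq_mul, mul_one]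
    · rintro x y ⟨hx, h⟩ ⟨hy, h'⟩
      refine ⟨add_mem hx hy, ?_⟩
      have h1 : ∀ χ : LieAlgebra.LieCharacter LaurentC (extendScalars LaurentC l),
          χ ⟨x + y, add_mem hx hy⟩ = χ ⟨x, hx⟩ + χ ⟨y, hy⟩ := fun χ => map_add χ ⟨x, hx⟩ ⟨y, hy⟩
      rw [add_lie, h, h', h1, h1, ← add_smul]
      congr 1
      abel
  exact key.2

/-- The associativity of the dynamical multiplication. -/
lemma starCoeff_assoc {α : centreDual nm l np} (hD' : IsDualBasis D (shiftPath lam α 0))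
    {a : PolyFun g} (ha : ∀ z ∈ l, rho2 z a = -((α : Module.Dual ℂ g) z • a)) (b c : PolyFun g)
    (n : ℕ) : ∑ p ∈ Finset.HasAntidiagonal.antidiagonal n, starCoeff hD p.1 a (starCoeff hD' p.2 b c) =
      ∑ p ∈ Finset.HasAntidiagonal.antidiagonal n, starCoeff hD p.1 (starCoeff hD p.2 a b) c := by
  have h := congrArg (coeffT (n : ℤ)) (pathStar_assoc hD hD' ha (1 ⊗ₜ[ℂ] b) (1 ⊗ₜ[ℂ] c))
  rw [coeffT_pathStar_right hD a (pathStar_mem hD' b c),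
    coeffT_pathStar_left hD (pathStar_mem hD a b)] at h
  exact h

/-- ρ₁ acts by derivations that commute with ρ₂, hence are symmetries of the whole construction. -/
lemma starCoeff_rho1 (n : ℕ) (x : g) (a b : PolyFun g) : rho1 x (starCoeff hD n a b) =
    starCoeff hD n (rho1 x a) b + starCoeff hD n a (rho1 x b) := by
  have h := congrArg (coeffT (n : ℤ)) ((D.extend laurentT).charStar_derivation hD.isGeneric
    hD.isGeneric_tmul (isLocNil_polyFunT D) (extendHom (K := LaurentC) (rho1 x) (rho1_lie x))
    (extendHom_mul _ _ (rho1_mul x)) (1 ⊗ₜ[ℂ] a) (1 ⊗ₜ[ℂ] b))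
  have h1 : ∀ Y : PolyFunT g, coeffT (n : ℤ) (extendHom (K := LaurentC) (rho1 x) (rho1_lie x) Y) =
      rho1 x (coeffT n Y) := by
    intro Y
    induction Y using TensorProduct.induction_on with
    | zero => simp
    | add Y Z hY hZ => simp only [map_add, hY, hZ]
    | tmul c a => rw [extendHom_tmul, coeffT_tmul, coeffT_tmul, map_smul]
  rw [h1, map_add] at h
  exact h

lemma starCoeff_rho2 (n : ℕ) {z : g} (hz : z ∈ l) (a b : PolyFun g) :
    rho2 z (starCoeff hD n a b) =
      starCoeff hD n (rho2 z a) b + starCoeff hD n a (rho2 z b) := by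
  have h := congrArg (coeffT (n : ℤ)) ((D.extend laurentT).charStar_lie
    (lie_mul_extend lie_polyFun_mul) hD.isGeneric hD.isGeneric_tmul (isLocNil_polyFunT D)
    ⟨1 ⊗ₜ[ℂ] z, tmul_mem_extendScalars 1 hz⟩ (1 ⊗ₜ[ℂ] a) (1 ⊗ₜ[ℂ] b))
  have h1 : ∀ Y : PolyFunT g, coeffT (n : ℤ) ⁅(1 : LaurentC) ⊗ₜ[ℂ] z, Y⁆ =
      rho2 z (coeffT n Y) := by
    intro Y
    induction Y using TensorProduct.induction_on with
    | zero => simp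
    | add Y Z hY hZ => simp only [lie_add, map_add, hY, hZ]
    | tmul c a =>
      rw [LieAlgebra.ExtendScalars.bracket_tmul, coeffT_tmul, coeffT_tmul, map_smul, one_mul]; rfl
  rw [h1, map_add, LieAlgebra.ExtendScalars.bracket_tmul, LieAlgebra.ExtendScalars.bracket_tmul,
    one_mul] at h
  exact h

lemma starCoeff_apply_one (n : ℕ) (a : PolyFun g) :
    starCoeff hD n a 1 = if n = 0 then a else 0 := by
  have h : pathStar hD (1 ⊗ₜ[ℂ] a) (1 ⊗ₜ[ℂ] 1) = 1 ⊗ₜ[ℂ] a := by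
    refine (D.extend laurentT).charStar_one hD.isGeneric hD.isGeneric_tmul (isLocNil_polyFunT D)
      (fun z => ?_) _
    change ⁅z, (1 : LaurentC) ⊗ₜ[ℂ] (1 : PolyFun g)⁆ = 0
    induction z using TensorProduct.induction_on with
    | zero => simp
    | add x y hx hy => rw [add_lie, hx, hy, add_zero]
    | tmul c x =>
      rw [LieAlgebra.ExtendScalars.bracket_tmul, lie_polyFun, rho2_one, TensorProduct.tmul_zero]
  rw [starCoeff_apply, h, coeffT_one_tmul]

/-- That 1 is a left unit follows indirectly: since 1 is a right unit, 1 ⋆ (1 ⋆ b) = (1 ⋆ 1) ⋆ b = 1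
⋆ b, so b ↦ 1 ⋆ b is idempotent; being the identity modulo t, it is the identity. -/
lemma starCoeff_one_apply (n : ℕ) (b : PolyFun g) :
    starCoeff hD n 1 b = if n = 0 then b else 0 := by
  have h0 : starCoeff hD 0 1 b = b := by rw [starCoeff_zero, one_mul]
  have hshift : shiftPath lam 0 0 = lam 0 := shiftPath_zero 0
  have hlam : shiftPath lam 0 = lam := by simp [shiftPath]
  have hassoc : ∀ m, ∑ p ∈ Finset.HasAntidiagonal.antidiagonal m,
      starCoeff hD p.1 1 (starCoeff hD p.2 1 b) = starCoeff hD m 1 b := by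
    intro m
    have hD' : IsDualBasis D (shiftPath lam 0 0) := by rw [hshift]; exact hD
    have h1 := starCoeff_assoc hD hD' (a := 1)
      (fun z _ => by rw [rho2_one]; simp) 1 b m
    have h2 : starCoeff hD' = starCoeff hD := by
      congr!
    rw [h2] at h1
    rw [h1]
    simp only [starCoeff_apply_one]
    rw [Finset.sum_eq_single (m, 0)]
    · simp
    · rintro ⟨p, q⟩ hpq hne
      rw [Finset.HasAntidiagonal.mem_antidiagonal] at hpq
      have : q ≠ 0 := by
        rintro rfl
        exact hne (by rw [← hpq]; simp)
      simp [this]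
    · intro h; exact absurd (by simp) h
  induction n using Nat.strong_induction_on with
  | _ n ih =>
    rcases Nat.eq_zero_or_pos n with rfl | hn
    · rw [h0, if_pos rfl]
    · rw [if_neg hn.ne']
      have h1 := hassoc n
      obtain ⟨m, rfl⟩ := Nat.exists_eq_succ_of_ne_zero hn.ne'
      -- With the intermediate terms zero by induction, the coefficient of tⁿ occurs twice on the
      -- left and once on the right, so it vanishes.
      rw [Finset.Nat.sum_antidiagonal_succ, Finset.sum_eq_single (m, 0)] at h1
      · dsimp only at h1
        rw [h0, starCoeff_zero, one_mul] at h1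
        simpa using h1
      · rintro ⟨p, q⟩ hpq hne
        rw [Finset.HasAntidiagonal.mem_antidiagonal] at hpq
        have : q ≠ 0 := by
          rintro rfl
          exact hne (by rw [← hpq]; simp)
        dsimp only at hpq ⊢
        rw [ih q (by omega), if_neg this, map_zero]
      · intro h; exact absurd (by simp) h

end PathStar

end DynQuant

end

open scoped TensorProduct

noncomputable section

namespace DynQuant

universe u v w

/-! ## Products of formal series -/

section Series

open Finset.HasAntidiagonal

variable {E F N : Type*} [AddCommGroup E] [Module ℂ E] [AddCommGroup F] [Module ℂ F]
  [AddCommGroup N] [Module ℂ N]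

lemma seriesMul_single_left (B : ℕ → E →ₗ[ℂ] F →ₗ[ℂ] F) (e : E) (f : ℕ → F)
    (h : ∀ n i, B n e (f i) = if n = 0 then f i else 0) : seriesMul B (Pi.single 0 e) f = f := by
  funext n
  rw [seriesMul, Finset.sum_eq_single (0, n), Finset.sum_eq_single (0, n)]
  · simp [h]
  · rintro ⟨p, q⟩ hpq hne
    have : p ≠ 0 := by
      rintro rfl
      simp_all
    simp [this]
  · intro h; exact absurd (by simp) h
  · rintro ⟨p, q⟩ hpq hne
    have : p ≠ 0 := by
      rintro rfl
      simp_all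
    refine Finset.sum_eq_zero fun x _ => ?_
    rcases Nat.eq_zero_or_pos x.1 with h0 | h0
    · simp [h0, h, this]
    · simp [Pi.single_eq_of_ne h0.ne']
  · intro h; exact absurd (by simp) h

lemma seriesMul_single_right (B : ℕ → E →ₗ[ℂ] F →ₗ[ℂ] E) (e : ℕ → E) (f : F)
    (h : ∀ n i, B n (e i) f = if n = 0 then e i else 0) : seriesMul B e (Pi.single 0 f) = e := by
  funext n
  rw [seriesMul, Finset.sum_eq_single (0, n), Finset.sum_eq_single (n, 0)]
  · simp [h]
  · rintro ⟨p, q⟩ hpq hne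
    have : q ≠ 0 := by
      rintro rfl
      simp_all
    simp [this]
  · intro h; exact absurd (by simp) h
  · rintro ⟨p, q⟩ hpq hne
    have : p ≠ 0 := by
      rintro rfl
      simp_all
    refine Finset.sum_eq_zero fun x _ => ?_
    rcases Nat.eq_zero_or_pos x.2 with h0 | h0
    · simp [h0, h, this]
    · simp [Pi.single_eq_of_ne h0.ne']
  · intro h; exact absurd (by simp) h

variable {A B C AB BC : Type*} [AddCommGroup A] [Module ℂ A] [AddCommGroup B] [Module ℂ B]
  [AddCommGroup C] [Module ℂ C] [AddCommGroup AB] [Module ℂ AB] [AddCommGroup BC] [Module ℂ BC]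

/-- Associativity of products of formal series. -/
lemma seriesMul_assoc (P : ℕ → A →ₗ[ℂ] B →ₗ[ℂ] AB) (Q : ℕ → AB →ₗ[ℂ] C →ₗ[ℂ] N)
    (R : ℕ → B →ₗ[ℂ] C →ₗ[ℂ] BC) (T : ℕ → A →ₗ[ℂ] BC →ₗ[ℂ] N) (a : ℕ → A) (b : ℕ → B) (c : ℕ → C)
    (h : ∀ i j k n, ∑ p ∈ antidiagonal n, Q p.1 (P p.2 (a i) (b j)) (c k) =
      ∑ p ∈ antidiagonal n, T p.1 (a i) (R p.2 (b j) (c k))) :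
    seriesMul Q (seriesMul P a b) c = seriesMul T a (seriesMul R b c) := by
  funext n
  have h1 : seriesMul Q (seriesMul P a b) c n = ∑ x ∈ antidiagonal n, ∑ y ∈ antidiagonal x.2,
      ∑ z ∈ antidiagonal y.2, ∑ p ∈ antidiagonal z.2,
        Q p.1 (P p.2 (a x.1) (b y.1)) (c z.1) := by
    simp only [seriesMul, map_sum, LinearMap.sum_apply, Finset.sum_sigma']
    -- Both bracketings are reindexed by the degrees of a, b and c followed by the orders of the
    -- outer and the inner operation.
    refine Finset.sum_nbij'
      (fun x => ⟨(x.2.2.2.1, x.2.2.2.2 + x.2.1.2 + x.1.1 + x.2.2.1.1),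
        ⟨(x.2.2.2.2, x.2.1.2 + x.1.1 + x.2.2.1.1), ⟨(x.2.1.2, x.1.1 + x.2.2.1.1),
          (x.1.1, x.2.2.1.1)⟩⟩⟩)
      (fun x => ⟨(x.2.2.2.1, x.2.2.2.2 + x.1.1 + x.2.1.1 + x.2.2.1.1),
        ⟨(x.2.2.2.2 + x.1.1 + x.2.1.1, x.2.2.1.1), ⟨(x.2.2.2.2, x.1.1 + x.2.1.1),
          (x.1.1, x.2.1.1)⟩⟩⟩) ?_ ?_ ?_ ?_ ?_
    · rintro ⟨⟨a, b⟩, ⟨m, k⟩, ⟨c, d⟩, ⟨i, j⟩⟩ hx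
      simp only [Finset.mem_sigma, mem_antidiagonal] at hx ⊢
      obtain ⟨rfl, rfl, rfl, rfl⟩ := hx
      refine ⟨?_, ?_, ?_, ?_⟩ <;> first | trivial | omega
    · rintro ⟨⟨a, b⟩, ⟨m, k⟩, ⟨c, d⟩, ⟨i, j⟩⟩ hx
      simp only [Finset.mem_sigma, mem_antidiagonal] at hx ⊢
      obtain ⟨rfl, rfl, rfl, rfl⟩ := hx
      refine ⟨?_, ?_, ?_, ?_⟩ <;> first | trivial | omega
    · rintro ⟨⟨a, b⟩, ⟨m, k⟩, ⟨c, d⟩, ⟨i, j⟩⟩ hx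
      simp only [Finset.mem_sigma, mem_antidiagonal] at hx
      obtain ⟨rfl, rfl, rfl, rfl⟩ := hx
      simp only [Sigma.mk.injEq, Prod.mk.injEq, heq_eq_eq, true_and, and_true]
      omega
    · rintro ⟨⟨a, b⟩, ⟨m, k⟩, ⟨c, d⟩, ⟨i, j⟩⟩ hx
      simp only [Finset.mem_sigma, mem_antidiagonal] at hx
      obtain ⟨rfl, rfl, rfl, rfl⟩ := hx
      simp only [Sigma.mk.injEq, Prod.mk.injEq, heq_eq_eq, true_and, and_true]
      omega
    · intro x _
      rfl
  have h2 : seriesMul T a (seriesMul R b c) n = ∑ x ∈ antidiagonal n, ∑ y ∈ antidiagonal x.2,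
      ∑ z ∈ antidiagonal y.2, ∑ p ∈ antidiagonal z.2,
        T p.1 (a x.1) (R p.2 (b y.1) (c z.1)) := by
    simp only [seriesMul, map_sum, Finset.sum_sigma']
    refine Finset.sum_nbij'
      (fun x => ⟨(x.2.1.1, x.2.2.2.1 + x.2.2.2.2 + x.1.1 + x.2.2.1.1),
        ⟨(x.2.2.2.1, x.2.2.2.2 + x.1.1 + x.2.2.1.1), ⟨(x.2.2.2.2, x.1.1 + x.2.2.1.1),
          (x.1.1, x.2.2.1.1)⟩⟩⟩)
      (fun x => ⟨(x.2.2.2.1, x.1.1 + x.2.2.2.2 + x.2.1.1 + x.2.2.1.1),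
        ⟨(x.1.1, x.2.2.2.2 + x.2.1.1 + x.2.2.1.1), ⟨(x.2.2.2.2, x.2.1.1 + x.2.2.1.1),
          (x.2.1.1, x.2.2.1.1)⟩⟩⟩) ?_ ?_ ?_ ?_ ?_
    · rintro ⟨⟨a, b⟩, ⟨m, k⟩, ⟨c, d⟩, ⟨i, j⟩⟩ hx
      simp only [Finset.mem_sigma, mem_antidiagonal] at hx ⊢
      obtain ⟨rfl, rfl, rfl, rfl⟩ := hx
      refine ⟨?_, ?_, ?_, ?_⟩ <;> first | trivial | omega
    · rintro ⟨⟨a, b⟩, ⟨m, k⟩, ⟨c, d⟩, ⟨i, j⟩⟩ hx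
      simp only [Finset.mem_sigma, mem_antidiagonal] at hx ⊢
      obtain ⟨rfl, rfl, rfl, rfl⟩ := hx
      refine ⟨?_, ?_, ?_, ?_⟩ <;> first | trivial | omega
    · rintro ⟨⟨a, b⟩, ⟨m, k⟩, ⟨c, d⟩, ⟨i, j⟩⟩ hx
      simp only [Finset.mem_sigma, mem_antidiagonal] at hx
      obtain ⟨rfl, rfl, rfl, rfl⟩ := hx
      simp only [Sigma.mk.injEq, Prod.mk.injEq, heq_eq_eq, true_and, and_true]
      omega
    · rintro ⟨⟨a, b⟩, ⟨m, k⟩, ⟨c, d⟩, ⟨i, j⟩⟩ hx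
      simp only [Finset.mem_sigma, mem_antidiagonal] at hx
      obtain ⟨rfl, rfl, rfl, rfl⟩ := hx
      simp only [Sigma.mk.injEq, Prod.mk.injEq, heq_eq_eq, true_and, and_true]
      omega
    · intro x _
      rfl
  rw [h1, h2]
  simp only [h]

end Series

/-! ## The Kirillov bracket -/

section Kirillov

variable {g : Type u} [LieRing g] [LieAlgebra ℂ g] {nm l np : LieSubalgebra ℂ g} {ι : Type w}
  [Fintype ι] {D : Triangular nm l np ι}

lemma firstOrder_mul_right (a b c : PolyFun g) :
    firstOrder D a (b * c) = firstOrder D a b * c + b * firstOrder D a c := by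
  rw [firstOrder, firstOrder, firstOrder, Finset.sum_mul, Finset.mul_sum, ← Finset.sum_add_distrib]
  refine Finset.sum_congr rfl fun i _ => ?_
  rw [lie_polyFun_mul]
  ring

lemma firstOrder_mul_left (a b c : PolyFun g) :
    firstOrder D (b * c) a = firstOrder D b a * c + b * firstOrder D c a := by
  rw [firstOrder, firstOrder, firstOrder, Finset.sum_mul, Finset.mul_sum, ← Finset.sum_add_distrib]
  refine Finset.sum_congr rfl fun i _ => ?_
  rw [lie_polyFun_mul]
  ring

lemma rho1_firstOrder (x : g) (a b : PolyFun g) :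
    rho1 x (firstOrder D a b) = firstOrder D (rho1 x a) b + firstOrder D a (rho1 x b) := by
  rw [firstOrder, firstOrder, firstOrder, map_sum, ← Finset.sum_add_distrib]
  refine Finset.sum_congr rfl fun i _ => ?_
  rw [rho1_mul, rho1_lie, rho1_lie]

lemma polyFun_mul_one (a b : PolyFun g) : (a * b).1 1 = a.1 1 * b.1 1 := by
  change (a.1 * b.1) 1 = _
  rw [LinearMap.convMul_apply, Bialgebra.comul_one, Algebra.TensorProduct.one_def]
  rfl

variable [FiniteDimensional ℂ g]

lemma rho1_coordFun (μ : Module.Dual ℂ g) (z x : g) :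
    rho1 z (coordFun μ x) = coordFun μ ⁅z, x⁆ := by
  apply PolyFun.ext'
  intro y
  rw [rho1_apply, coordFun_apply, coordFun_apply, map_mul, Module.End.mul_apply, envAction_iota]
  simp

lemma lie_coordFun_one (μ : Module.Dual ℂ g) (z x : g) :
    (⁅z, coordFun μ x⁆ : PolyFun g).1 1 = -μ ⁅z, x⁆ := by
  rw [lie_polyFun, rho2_apply, coordFun_apply, one_mul, envAction_iota]
  simp

variable {μ : Module.Dual ℂ g} (hμ : μ ∈ centreDual nm l np)
  (hstab : ∀ x : g, x ∈ l ↔ ∀ y : g, μ ⁅x, y⁆ = 0) (hD : IsDualBasis D μ)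

-- The expansion of the form μ([·,·]) in the dual bases of n⁺ and n⁻. Both sides are linear in x and
-- vanish for x in `l`, so x may be taken to be a basis vector.
include hμ hstab hD in
omit [FiniteDimensional ℂ g] in
lemma IsDualBasis.sum_eq (x y : g) :
    ∑ i, (μ ⁅(D.f i : g), y⁆ * μ ⁅(D.e i : g), x⁆ - μ ⁅(D.f i : g), x⁆ * μ ⁅(D.e i : g), y⁆) =
      μ ⁅x, y⁆ := by
  classical
  have hee : ∀ x ∈ np, ∀ y ∈ np, μ ⁅x, y⁆ = 0 := fun x hx y hy => hμ.2.1 _ (np.lie_mem hx hy)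
  have hff : ∀ x ∈ nm, ∀ y ∈ nm, μ ⁅x, y⁆ = 0 := fun x hx y hy => hμ.1 _ (nm.lie_mem hx hy)
  have hef : ∀ i j, μ ⁅(D.e i : g), (D.f j : g)⁆ = if i = j then 1 else 0 := fun i j => by
    rw [hD i j]
  have hfe : ∀ i j, μ ⁅(D.f i : g), (D.e j : g)⁆ = if i = j then -1 else 0 := fun i j => by
    rw [← lie_skew, map_neg, hef]
    simp only [eq_comm (a := i)]
    split_ifs <;> simp
  let Q : g →ₗ[ℂ] ℂ := ∑ i, (μ ⁅(D.f i : g), y⁆ • (μ ∘ₗ (LieAlgebra.ad ℂ g (D.e i : g))) -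
    μ ⁅(D.e i : g), y⁆ • (μ ∘ₗ (LieAlgebra.ad ℂ g (D.f i : g))))
  have hQ : ∀ x, Q x = ∑ i, (μ ⁅(D.f i : g), y⁆ * μ ⁅(D.e i : g), x⁆ -
      μ ⁅(D.f i : g), x⁆ * μ ⁅(D.e i : g), y⁆) := fun x => by
    simp only [Q, LinearMap.sum_apply]
    refine Finset.sum_congr rfl fun i _ => ?_
    simp [mul_comm]
  let R : g →ₗ[ℂ] ℂ := -(μ ∘ₗ (LieAlgebra.ad ℂ g y))
  have hR : ∀ x, R x = μ ⁅x, y⁆ := fun x => by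
    rw [← lie_skew, map_neg]; rfl
  have h1 : Q ∘ₗ nm.toSubmodule.subtype = R ∘ₗ nm.toSubmodule.subtype := by
    refine D.f.ext fun j => ?_
    change Q (D.f j) = R (D.f j)
    rw [hQ, hR, Finset.sum_eq_single j]
    · rw [hef, if_pos rfl, hff _ (D.f j).2 _ (D.f j).2, mul_one, zero_mul, sub_zero]
    · intro i _ hij
      rw [hef, if_neg hij, hff _ (D.f i).2 _ (D.f j).2, mul_zero, zero_mul, sub_zero]
    · intro h; exact absurd (Finset.mem_univ _) h
  have h2 : Q ∘ₗ np.toSubmodule.subtype = R ∘ₗ np.toSubmodule.subtype := by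
    refine D.e.ext fun j => ?_
    change Q (D.e j) = R (D.e j)
    rw [hQ, hR, Finset.sum_eq_single j]
    · rw [hfe, if_pos rfl, hee _ (D.e j).2 _ (D.e j).2]
      ring
    · intro i _ hij
      rw [hfe, if_neg hij, hee _ (D.e i).2 _ (D.e j).2, mul_zero, zero_mul, sub_zero]
    · intro h; exact absurd (Finset.mem_univ _) h
  have h3 : ∀ b ∈ l, Q b = R b := by
    intro b hb
    have hb0 : ∀ y, μ ⁅y, b⁆ = 0 := fun y => by
      rw [← lie_skew, map_neg, (hstab b).1 hb, neg_zero]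
    rw [hQ, hR, (hstab b).1 hb y]
    refine Finset.sum_eq_zero fun i _ => ?_
    rw [hb0, hb0, mul_zero, zero_mul, sub_zero]
  obtain ⟨a, ha, b, hb, c, hc, rfl⟩ := D.exists_decomp x
  rw [← hQ, ← hR, map_add, map_add, map_add, map_add, h3 b hb]
  congr 1
  · exact congr($h1 ⟨a, ha⟩)
  · congr 1
    exact congr($h2 ⟨c, hc⟩)

-- At the identity this is the dual basis expansion of μ([x, y]). Since both sides are equivariant
-- under ρ₁, and left multiplication by z on U(g) is −ρ₁(z), the values on all of U(g) follow.
include hμ hstab hD in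
lemma firstOrder_coordFun (x y : g) :
    firstOrder D (coordFun μ y) (coordFun μ x) - firstOrder D (coordFun μ x) (coordFun μ y) =
      coordFun μ ⁅x, y⁆ := by
  apply PolyFun.ext'
  intro u
  induction u using env_induction generalizing x y with
  | h1 =>
    have h : ∀ x y : g, (firstOrder D (coordFun μ x) (coordFun μ y)).1 1 =
        ∑ i, μ ⁅(D.f i : g), x⁆ * μ ⁅(D.e i : g), y⁆ := by
      intro x y
      let ev : PolyFun g →ₗ[ℂ] ℂ :=
        { toFun := fun a => a.1 1
          map_add' := fun _ _ => rfl
          map_smul' := fun _ _ => rfl }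
      change ev (∑ i, _) = _
      rw [map_sum]
      refine Finset.sum_congr rfl fun i _ => ?_
      change (_ * _ : PolyFun g).1 1 = _
      rw [polyFun_mul_one, lie_coordFun_one, lie_coordFun_one, neg_mul_neg]
    change (firstOrder D (coordFun μ y) (coordFun μ x)).1 1 -
      (firstOrder D (coordFun μ x) (coordFun μ y)).1 1 = _
    rw [h, h, ← Finset.sum_sub_distrib, hD.sum_eq hμ hstab, coordFun_apply, map_one]
    rfl
  | hadd a b ha hb =>
    have h : ∀ c : PolyFun g, c.1 (a + b) = c.1 a + c.1 b := fun c => map_add c.1.ofConv a b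
    rw [h, h, ha, hb]
  | hsmul r a ha =>
    have h : ∀ c : PolyFun g, c.1 (r • a) = r • c.1 a := fun c => map_smul c.1.ofConv r a
    rw [h, h, ha]
  | hmul z a ha =>
    have h : ∀ c : PolyFun g, c.1 (iota ℂ g z * a) = -(rho1 z c).1 a := fun c => by
      rw [rho1_apply, neg_neg]
    have hadd : ∀ c d : PolyFun g, (c + d).1 a = c.1 a + d.1 a := fun _ _ => rfl
    have h1 : rho1 z (firstOrder D (coordFun μ y) (coordFun μ x) -
        firstOrder D (coordFun μ x) (coordFun μ y)) =
        (firstOrder D (coordFun μ y) (coordFun μ ⁅z, x⁆) -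
          firstOrder D (coordFun μ ⁅z, x⁆) (coordFun μ y)) +
        (firstOrder D (coordFun μ ⁅z, y⁆) (coordFun μ x) -
          firstOrder D (coordFun μ x) (coordFun μ ⁅z, y⁆)) := by
      rw [map_sub, rho1_firstOrder, rho1_firstOrder, rho1_coordFun, rho1_coordFun]
      abel
    rw [h, h, h1, hadd, ha, ha, ← hadd, rho1_coordFun, leibniz_lie z x y]
    have h2 : coordFun μ (⁅⁅z, x⁆, y⁆ + ⁅x, ⁅z, y⁆⁆) =
        coordFun μ ⁅⁅z, x⁆, y⁆ + coordFun μ ⁅x, ⁅z, y⁆⁆ := by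
      apply PolyFun.ext'
      intro v
      exact map_add (envAction (g := g) (Module.Dual ℂ g) v μ) _ _
    rw [h2]

end Kirillov

end DynQuant

end

open scoped TensorProduct

noncomputable section

namespace DynQuant

universe u v w

/-! ## Functions on the orbit and sections of vector bundles -/

section Orbit

open Finset.HasAntidiagonal

variable {g : Type u} [LieRing g] [LieAlgebra ℂ g] {nm l np : LieSubalgebra ℂ g} {ι : Type w}
  [Fintype ι] {D : Triangular nm l np ι} {lam : ℕ → centreDual nm l np}
  (hD : IsDualBasis D (lam 0))

/-- The dynamical multiplication of functions on the orbit. -/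
def orbitStar (n : ℕ) : orbitFun l →ₗ[ℂ] orbitFun l →ₗ[ℂ] orbitFun l :=
  LinearMap.mk₂ ℂ (fun a b => ⟨starCoeff hD n a b, fun z hz => by
      rw [starCoeff_rho2 hD n hz, a.2 z hz, b.2 z hz, map_zero, map_zero, LinearMap.zero_apply,
        add_zero]⟩)
    (fun a a' b => Subtype.ext (by
      change starCoeff hD n (a + a' : PolyFun g) b = _
      rw [map_add]; rfl))
    (fun r a b => Subtype.ext (by
      change starCoeff hD n (r • (a : PolyFun g)) b = _
      rw [map_smul]; rfl))
    (fun a b b' => Subtype.ext (map_add (starCoeff hD n a) (b : PolyFun g) b'))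
    (fun r a b => Subtype.ext (map_smul (starCoeff hD n a) r (b : PolyFun g)))

lemma coe_orbitStar (n : ℕ) (a b : orbitFun l) :
    (orbitStar hD n a b : PolyFun g) = starCoeff hD n a b := rfl

lemma isRestriction_orbitStar : IsRestriction l (starCoeff hD) (orbitStar hD) := fun _ _ _ => rfl

/-- An invariant function has weight zero, so the path is not shifted and b, c may be arbitrary. -/
lemma starCoeff_assoc_orbit (a : orbitFun l) (b c : PolyFun g) (n : ℕ) :
    ∑ p ∈ antidiagonal n, starCoeff hD p.1 a (starCoeff hD p.2 b c) =
      ∑ p ∈ antidiagonal n, starCoeff hD p.1 (starCoeff hD p.2 a b) c := by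
  have hlam : shiftPath lam 0 = lam := by simp [shiftPath]
  have hD' : IsDualBasis D (shiftPath lam 0 0) := by rw [hlam]; exact hD
  have h2 : starCoeff hD' = starCoeff hD := by congr!
  have h1 := starCoeff_assoc hD hD' (a := a)
    (fun z hz => by rw [a.2 z hz]; simp) b c n
  rwa [h2] at h1

lemma orbitStar_assoc (a b c : orbitFun l) (n : ℕ) :
    ∑ p ∈ antidiagonal n, orbitStar hD p.1 (orbitStar hD p.2 a b) c =
      ∑ p ∈ antidiagonal n, orbitStar hD p.1 a (orbitStar hD p.2 b c) := by
  apply Subtype.ext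
  rw [AddSubmonoidClass.coe_finsetSum, AddSubmonoidClass.coe_finsetSum]
  exact (starCoeff_assoc_orbit hD a b c n).symm

lemma orbitStar_zero (a b : orbitFun l) : orbitStar hD 0 a b = a * b :=
  Subtype.ext (starCoeff_zero hD a b)

lemma isDeformationQuantization_orbitStar :
    IsDeformationQuantization (orbitStar hD 1 - (orbitStar hD 1).flip) (orbitStar hD) where
  assoc a b c := seriesMul_assoc _ _ _ _ a b c fun i j k n => orbitStar_assoc hD _ _ _ n
  one_mul a := seriesMul_single_left _ _ _ fun n i => Subtype.ext
    ((starCoeff_one_apply hD n (a i : PolyFun g)).trans (by split_ifs <;> rfl))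
  mul_one a := seriesMul_single_right _ _ _ fun n i => Subtype.ext
    ((starCoeff_apply_one hD n (a i : PolyFun g)).trans (by split_ifs <;> rfl))
  zeroth := orbitStar_zero hD
  first a b := rfl

lemma orbitStar_jacobi (a b c : orbitFun l) :
    (orbitStar hD 1 - (orbitStar hD 1).flip) a ((orbitStar hD 1 - (orbitStar hD 1).flip) b c) +
      (orbitStar hD 1 - (orbitStar hD 1).flip) b ((orbitStar hD 1 - (orbitStar hD 1).flip) c a) +
      (orbitStar hD 1 - (orbitStar hD 1).flip) c ((orbitStar hD 1 - (orbitStar hD 1).flip) a b) =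
        0 := by
  -- The t² coefficient of associativity. In the alternating sum over the orders of a, b, c the
  -- terms with ⋆₂ cancel, because ⋆₀ is commutative.
  have h : ∀ a b c : orbitFun l,
      orbitStar hD 1 a (orbitStar hD 1 b c) - orbitStar hD 1 (orbitStar hD 1 a b) c =
        orbitStar hD 2 a b * c + orbitStar hD 2 (a * b) c - a * orbitStar hD 2 b c -
          orbitStar hD 2 a (b * c) := by
    intro a b c
    have h1 := orbitStar_assoc hD a b c 2
    simp only [Finset.Nat.sum_antidiagonal_succ, Finset.HasAntidiagonal.antidiagonal_zero,
      Finset.sum_singleton, zero_add, orbitStar_zero] at h1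
    norm_num at h1
    linear_combination -h1
  have h1 := h a b c
  have h2 := h b c a
  have h3 := h c a b
  have h4 := h a c b
  have h5 := h b a c
  have h6 := h c b a
  rw [mul_comm b a] at h5
  rw [mul_comm c b, mul_comm b a] at h6
  rw [mul_comm c b] at h4
  rw [mul_comm c a] at h2 h3
  simp only [LinearMap.sub_apply, LinearMap.flip_apply, map_sub]
  linear_combination h1 + h2 + h3 - h4 - h5 - h6

lemma isKirillovBracket_orbitStar [FiniteDimensional ℂ g]
    (hstab : ∀ x : g, x ∈ l ↔ ∀ y : g, (lam 0 : Module.Dual ℂ g) ⁅x, y⁆ = 0) :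
    IsKirillovBracket l (lam 0) (orbitStar hD 1 - (orbitStar hD 1).flip) where
  skew a := sub_self _
  jacobi := orbitStar_jacobi hD
  leibniz a b c := by
    apply Subtype.ext
    change starCoeff hD 1 (a : PolyFun g) (b * c) - starCoeff hD 1 (b * c) a =
      (starCoeff hD 1 a b - starCoeff hD 1 b a) * c + b * (starCoeff hD 1 a c - starCoeff hD 1 c a)
    simp only [starCoeff_one, firstOrder_mul_left, firstOrder_mul_right]
    ring
  coord x y hx hy := by
    rw [← firstOrder_coordFun (lam 0).2 hstab hD]
    change starCoeff hD 1 (coordFun _ x) (coordFun _ y) -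
      starCoeff hD 1 (coordFun _ y) (coordFun _ x) = _
    rw [starCoeff_one, starCoeff_one]
    abel

/-! ### Products of functions and sections of vector bundles -/

section Sections

variable {V W : Type*} [AddCommGroup V] [Module ℂ V] [LieRingModule l V] [LieModule ℂ l V]
  [AddCommGroup W] [Module ℂ W] [LieRingModule l W] [LieModule ℂ l W]

lemma mem_bundleSections {s : PolyFun g ⊗[ℂ] V} :
    s ∈ bundleSections l V ↔ ∀ z : l, ⁅z, s⁆ = 0 := Iff.rfl

lemma lie_tmul_section (z : l) (a : PolyFun g) (v : V) :
    ⁅z, a ⊗ₜ[ℂ] v⁆ = rho2 (z : g) a ⊗ₜ v + a ⊗ₜ ⁅z, v⁆ := rfl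

lemma sectionMul_tmul (star : ℕ → PolyFun g →ₗ[ℂ] PolyFun g →ₗ[ℂ] PolyFun g) (n : ℕ)
    (a b : PolyFun g) (v : V) (w : W) : sectionMul V W star n (a ⊗ₜ v) (b ⊗ₜ w) =
      star n a b ⊗ₜ (v ⊗ₜ w) := rfl

/-- Equality of bilinear operations on tensor products can be checked on pure tensors. -/
lemma tensor_induction₂ {P : PolyFun g ⊗[ℂ] V → PolyFun g ⊗[ℂ] W → Prop}
    (h : ∀ a v b w, P (a ⊗ₜ v) (b ⊗ₜ w))
    (h1 : ∀ s, P s 0) (h2 : ∀ s, P 0 s) (h3 : ∀ s s' s'', P s s' → P s s'' → P s (s' + s''))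
    (h4 : ∀ s s' s'', P s s'' → P s' s'' → P (s + s') s'') (s : PolyFun g ⊗[ℂ] V)
    (s' : PolyFun g ⊗[ℂ] W) : P s s' := by
  induction s using TensorProduct.induction_on with
  | zero => exact h2 _
  | add x y hx hy => exact h4 _ _ _ hx hy
  | tmul a v =>
    induction s' using TensorProduct.induction_on with
    | zero => exact h1 _
    | add x y hx hy => exact h3 _ _ _ hx hy
    | tmul b w => exact h a v b w

lemma sectionMul_lie (n : ℕ) (z : l) (s : PolyFun g ⊗[ℂ] V) (s' : PolyFun g ⊗[ℂ] W) :
    ⁅z, sectionMul V W (starCoeff hD) n s s'⁆ =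
      sectionMul V W (starCoeff hD) n ⁅z, s⁆ s' + sectionMul V W (starCoeff hD) n s ⁅z, s'⁆ := by
  refine tensor_induction₂ (P := fun s s' => ⁅z, sectionMul V W (starCoeff hD) n s s'⁆ =
      sectionMul V W (starCoeff hD) n ⁅z, s⁆ s' + sectionMul V W (starCoeff hD) n s ⁅z, s'⁆)
    (fun a v b w => ?_) (fun s => by simp) (fun s => by simp)
    (fun s s' s'' h h' => by rw [map_add, lie_add, h, h', lie_add, map_add, map_add]; abel)
    (fun s s' s'' h h' => by
      rw [map_add, LinearMap.add_apply, lie_add, h, h', lie_add]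
      simp only [map_add, LinearMap.add_apply]
      abel) s s'
  rw [sectionMul_tmul, lie_tmul_section, lie_tmul_section, lie_tmul_section,
    TensorProduct.LieModule.lie_tmul_right, starCoeff_rho2 hD n z.2, map_add, map_add,
    LinearMap.add_apply, sectionMul_tmul, sectionMul_tmul, sectionMul_tmul, sectionMul_tmul,
    TensorProduct.add_tmul, TensorProduct.tmul_add]
  abel

omit [LieRingModule l V] [LieModule ℂ l V] [LieRingModule l W] [LieModule ℂ l W] in
lemma sectionMul_rho1 (n : ℕ) (x : g) (s : PolyFun g ⊗[ℂ] V) (s' : PolyFun g ⊗[ℂ] W) :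
    (rho1 x).rTensor (V ⊗[ℂ] W) (sectionMul V W (starCoeff hD) n s s') =
      sectionMul V W (starCoeff hD) n ((rho1 x).rTensor V s) s' +
        sectionMul V W (starCoeff hD) n s ((rho1 x).rTensor W s') := by
  refine tensor_induction₂ (P := fun s s' =>
      (rho1 x).rTensor (V ⊗[ℂ] W) (sectionMul V W (starCoeff hD) n s s') =
      sectionMul V W (starCoeff hD) n ((rho1 x).rTensor V s) s' +
        sectionMul V W (starCoeff hD) n s ((rho1 x).rTensor W s'))
    (fun a v b w => ?_) (fun s => by simp) (fun s => by simp)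
    (fun s s' s'' h h' => by rw [map_add, map_add, h, h', map_add, map_add, map_add]; abel)
    (fun s s' s'' h h' => by
      rw [map_add, LinearMap.add_apply, map_add, h, h']
      simp only [map_add, LinearMap.add_apply]
      abel) s s'
  rw [sectionMul_tmul, LinearMap.rTensor_tmul, LinearMap.rTensor_tmul, LinearMap.rTensor_tmul,
    starCoeff_rho1, TensorProduct.add_tmul, sectionMul_tmul, sectionMul_tmul]

omit [LieRingModule l V] [LieModule ℂ l V] [LieRingModule l W] [LieModule ℂ l W] in
lemma sectionMul_zero (s : PolyFun g ⊗[ℂ] V) (s' : PolyFun g ⊗[ℂ] W) :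
    sectionMul V W (starCoeff hD) 0 s s' = sectionTensor V W s s' := by
  have : starCoeff hD 0 = LinearMap.mul ℂ (PolyFun g) := LinearMap.ext₂ (starCoeff_zero hD)
  rw [sectionMul, this]
  rfl

omit [LieRingModule l V] [LieModule ℂ l V] in
lemma leftAct_tmul (star : ℕ → PolyFun g →ₗ[ℂ] PolyFun g →ₗ[ℂ] PolyFun g) (n : ℕ)
    (a : orbitFun l) (b : PolyFun g) (v : V) :
    leftAct V l star n a (b ⊗ₜ v) = star n a b ⊗ₜ v := rfl

omit [LieRingModule l V] [LieModule ℂ l V] in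
lemma rightAct_tmul (star : ℕ → PolyFun g →ₗ[ℂ] PolyFun g →ₗ[ℂ] PolyFun g) (n : ℕ)
    (a : PolyFun g) (v : V) (b : orbitFun l) :
    rightAct V l star n (a ⊗ₜ v) b = star n a b ⊗ₜ v := rfl

lemma leftAct_mem (n : ℕ) (a : orbitFun l) {s : PolyFun g ⊗[ℂ] V} (hs : s ∈ bundleSections l V) :
    leftAct V l (starCoeff hD) n a s ∈ bundleSections l V := by
  rw [mem_bundleSections] at hs ⊢
  intro z
  suffices ⁅z, leftAct V l (starCoeff hD) n a s⁆ = leftAct V l (starCoeff hD) n a ⁅z, s⁆ by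
    rw [this, hs, map_zero]
  clear hs
  induction s using TensorProduct.induction_on with
  | zero => simp
  | add s s' h h' => rw [map_add, lie_add, h, h', lie_add, map_add]
  | tmul b v =>
    rw [leftAct_tmul, lie_tmul_section, lie_tmul_section, starCoeff_rho2 hD n z.2, a.2 z z.2,
      map_zero, LinearMap.zero_apply, zero_add, map_add, leftAct_tmul, leftAct_tmul]

lemma rightAct_mem (n : ℕ) {s : PolyFun g ⊗[ℂ] V} (hs : s ∈ bundleSections l V) (b : orbitFun l) :
    rightAct V l (starCoeff hD) n s b ∈ bundleSections l V := by
  rw [mem_bundleSections] at hs ⊢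
  intro z
  suffices ⁅z, rightAct V l (starCoeff hD) n s b⁆ = rightAct V l (starCoeff hD) n ⁅z, s⁆ b by
    rw [this, hs, map_zero, LinearMap.zero_apply]
  clear hs
  induction s using TensorProduct.induction_on with
  | zero => simp
  | add s s' h h' => rw [map_add, LinearMap.add_apply, lie_add, h, h', lie_add, map_add,
      LinearMap.add_apply]
  | tmul a v =>
    rw [rightAct_tmul, lie_tmul_section, lie_tmul_section, starCoeff_rho2 hD n z.2, b.2 z z.2,
      map_zero, add_zero, map_add, LinearMap.add_apply, rightAct_tmul, rightAct_tmul]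

omit [LieRingModule l V] [LieModule ℂ l V] [LieRingModule l W] [LieModule ℂ l W] in
lemma leftAct_sectionMul (a : orbitFun l) (s : PolyFun g ⊗[ℂ] V) (s' : PolyFun g ⊗[ℂ] W) (n : ℕ) :
    ∑ p ∈ antidiagonal n, sectionMul V W (starCoeff hD) p.1
      (leftAct V l (starCoeff hD) p.2 a s) s' =
    ∑ p ∈ antidiagonal n, leftAct (V ⊗[ℂ] W) l (starCoeff hD) p.1 a
      (sectionMul V W (starCoeff hD) p.2 s s') := by
  refine tensor_induction₂ (P := fun s s' =>
    ∑ p ∈ antidiagonal n, sectionMul V W (starCoeff hD) p.1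
      (leftAct V l (starCoeff hD) p.2 a s) s' =
    ∑ p ∈ antidiagonal n, leftAct (V ⊗[ℂ] W) l (starCoeff hD) p.1 a
      (sectionMul V W (starCoeff hD) p.2 s s'))
    (fun b v c w => ?_) (fun s => by simp) (fun s => by simp)
    (fun s s' s'' h h' => by simp only [map_add, Finset.sum_add_distrib, h, h'])
    (fun s s' s'' h h' => by
      simp only [map_add, LinearMap.add_apply, Finset.sum_add_distrib, h, h']) s s'
  simp only [leftAct_tmul, sectionMul_tmul, ← TensorProduct.sum_tmul]
  rw [starCoeff_assoc_orbit]

omit [LieRingModule l V] [LieModule ℂ l V] in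
lemma leftAct_assoc (a b : orbitFun l) (s : PolyFun g ⊗[ℂ] V) (n : ℕ) :
    ∑ p ∈ antidiagonal n, leftAct V l (starCoeff hD) p.1 (orbitStar hD p.2 a b) s =
    ∑ p ∈ antidiagonal n, leftAct V l (starCoeff hD) p.1 a
      (leftAct V l (starCoeff hD) p.2 b s) := by
  induction s using TensorProduct.induction_on with
  | zero => simp
  | add s s' h h' => simp only [map_add, Finset.sum_add_distrib, h, h']
  | tmul c v =>
    simp only [leftAct_tmul, coe_orbitStar, ← TensorProduct.sum_tmul]
    rw [starCoeff_assoc_orbit]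

omit [LieRingModule l V] [LieModule ℂ l V] in
lemma leftAct_one (n : ℕ) (s : PolyFun g ⊗[ℂ] V) :
    leftAct V l (starCoeff hD) n 1 s = if n = 0 then s else 0 := by
  induction s using TensorProduct.induction_on with
  | zero => simp
  | add s s' h h' => rw [map_add, h, h']; split_ifs <;> simp
  | tmul c v =>
    rw [leftAct_tmul]
    refine (congrArg (· ⊗ₜ[ℂ] v) (starCoeff_one_apply hD n c)).trans ?_
    split_ifs <;> simp

omit [LieRingModule l V] [LieModule ℂ l V] in
lemma rightAct_one (n : ℕ) (s : PolyFun g ⊗[ℂ] V) :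
    rightAct V l (starCoeff hD) n s 1 = if n = 0 then s else 0 := by
  induction s using TensorProduct.induction_on with
  | zero => simp
  | add s s' h h' => rw [map_add, LinearMap.add_apply, h, h']; split_ifs <;> simp
  | tmul c v =>
    rw [rightAct_tmul]
    refine (congrArg (· ⊗ₜ[ℂ] v) (starCoeff_apply_one hD n c)).trans ?_
    split_ifs <;> simp

end Sections

lemma seriesMul_mem {E F N : Type*} [AddCommGroup E] [Module ℂ E] [AddCommGroup F] [Module ℂ F]
    [AddCommGroup N] [Module ℂ N] (B : ℕ → E →ₗ[ℂ] F →ₗ[ℂ] N) {S : Submodule ℂ N} {e : ℕ → E}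
    {f : ℕ → F} (h : ∀ n i j, B n (e i) (f j) ∈ S) (n : ℕ) : seriesMul B e f n ∈ S :=
  Submodule.sum_mem _ fun _ _ => Submodule.sum_mem _ fun _ _ => h _ _ _

/-- A section of the line bundle of α is a function on G of weight −α for the action ρ₂ of `l`. -/
lemma exists_section_eq {α : centreDual nm l np} {s : PolyFun g ⊗[ℂ] CharModule (charOf α)}
    (hs : s ∈ bundleSections l (CharModule (charOf α))) :
    ∃ a : PolyFun g, (∀ z ∈ l, rho2 z a = -((α : Module.Dual ℂ g) z • a)) ∧
      s = a ⊗ₜ charOne (charOf α) := by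
  obtain ⟨y, rfl⟩ := (TensorProduct.comm ℂ (CharModule (charOf α)) (PolyFun g)).surjective s
  obtain ⟨a, rfl⟩ := (charEquiv (charOf α) (PolyFun g)).symm.surjective y
  rw [charEquiv_symm_apply, TensorProduct.comm_tmul] at hs ⊢
  refine ⟨a, fun z hz => ?_, rfl⟩
  have h := hs ⟨z, hz⟩
  rw [lie_tmul_section] at h
  change rho2 z a ⊗ₜ[ℂ] charOne (charOf α) +
    a ⊗ₜ[ℂ] ((α : Module.Dual ℂ g) z • charOne (charOf α)) = 0 at h
  rw [TensorProduct.tmul_smul, TensorProduct.smul_tmul', ← TensorProduct.add_tmul] at h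
  have h1 := congrArg (charEquiv (charOf α) (PolyFun g) ∘ (TensorProduct.comm ℂ _ _)) h
  simp only [Function.comp_apply, TensorProduct.comm_tmul, charEquiv_tmul, map_zero] at h1
  exact eq_neg_of_add_eq_zero_left h1

lemma rightAct_assoc {α : centreDual nm l np} (hD' : IsDualBasis D (shiftPath lam α 0))
    {s : PolyFun g ⊗[ℂ] CharModule (charOf α)}
    (hs : s ∈ bundleSections l (CharModule (charOf α))) (b c : orbitFun l) (n : ℕ) :
    ∑ p ∈ antidiagonal n, rightAct (CharModule (charOf α)) l (starCoeff hD) p.1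
      (rightAct (CharModule (charOf α)) l (starCoeff hD) p.2 s b) c =
    ∑ p ∈ antidiagonal n, rightAct (CharModule (charOf α)) l (starCoeff hD) p.1 s
      (orbitStar hD' p.2 b c) := by
  obtain ⟨a, ha, rfl⟩ := exists_section_eq hs
  simp only [rightAct_tmul, coe_orbitStar, ← TensorProduct.sum_tmul]
  rw [starCoeff_assoc hD hD' ha]

end Orbit

end DynQuant

end

/-! ### The main theorem -/

open scoped TensorProduct in
open DynQuant in
theorem mainTheorem2 {g : Type*} [LieRing g] [LieAlgebra ℂ g] [FiniteDimensional ℂ g]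
    [LieAlgebra.IsSemisimple ℂ g] (nm l np : LieSubalgebra ℂ g)
    (hdec : IsLeviDecomposition nm l np)
    (lam : ℕ → centreDual nm l np)
    (hstab : ∀ x : g, x ∈ l ↔ ∀ y : g, (lam 0 : Module.Dual ℂ g) ⁅x, y⁆ = 0) :
    (∃! star : ℕ → PolyFun g →ₗ[ℂ] PolyFun g →ₗ[ℂ] PolyFun g, IsDynMul lam star) ∧
    ∀ star : ℕ → PolyFun g →ₗ[ℂ] PolyFun g →ₗ[ℂ] PolyFun g, IsDynMul lam star →
      -- equivariant multiplication of sections, deforming the tensor product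
      (∀ (n : ℕ) (x : g) (a b : PolyFun g),
        rho1 x (star n a b) = star n (rho1 x a) b + star n a (rho1 x b)) ∧
      (∀ (V W : Type*) [AddCommGroup V] [Module ℂ V] [LieRingModule l V] [LieModule ℂ l V]
        [FiniteDimensional ℂ V] [AddCommGroup W] [Module ℂ W] [LieRingModule l W]
        [LieModule ℂ l W] [FiniteDimensional ℂ W],
        ∀ s ∈ bundleSections l V, ∀ s' ∈ bundleSections l W,
          (∀ n : ℕ, sectionMul V W star n s s' ∈ bundleSections l (V ⊗[ℂ] W)) ∧
          sectionMul V W star 0 s s' = sectionTensor V W s s' ∧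
          ∀ (n : ℕ) (x : g), (rho1 x).rTensor (V ⊗[ℂ] W) (sectionMul V W star n s s') =
            sectionMul V W star n ((rho1 x).rTensor V s) s' +
              sectionMul V W star n s ((rho1 x).rTensor W s')) ∧
      ∃ B : ℕ → orbitFun l →ₗ[ℂ] orbitFun l →ₗ[ℂ] orbitFun l, IsRestriction l star B ∧
        -- deformation quantization of the Kirillov bracket
        (∃ P : orbitFun l →ₗ[ℂ] orbitFun l →ₗ[ℂ] orbitFun l,
          IsKirillovBracket l (lam 0 : Module.Dual ℂ g) P ∧ IsDeformationQuantization P B) ∧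
        -- compatibility of the products of functions and sections
        (∀ (V W : Type*) [AddCommGroup V] [Module ℂ V] [LieRingModule l V] [LieModule ℂ l V]
          [FiniteDimensional ℂ V] [AddCommGroup W] [Module ℂ W] [LieRingModule l W]
          [LieModule ℂ l W] [FiniteDimensional ℂ W],
          ∀ (a : ℕ → orbitFun l) (s : ℕ → PolyFun g ⊗[ℂ] V) (s' : ℕ → PolyFun g ⊗[ℂ] W),
            (∀ i, s i ∈ bundleSections l V) → (∀ i, s' i ∈ bundleSections l W) →
            seriesMul (leftAct (V ⊗[ℂ] W) l star) a (seriesMul (sectionMul V W star) s s') =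
              seriesMul (sectionMul V W star) (seriesMul (leftAct V l star) a s) s') ∧
        -- vector bundles are left modules
        (∀ (V : Type*) [AddCommGroup V] [Module ℂ V] [LieRingModule l V] [LieModule ℂ l V]
          [FiniteDimensional ℂ V],
          ∀ s : ℕ → PolyFun g ⊗[ℂ] V, (∀ i, s i ∈ bundleSections l V) →
            (∀ (a : ℕ → orbitFun l) (i : ℕ),
              seriesMul (leftAct V l star) a s i ∈ bundleSections l V) ∧
            seriesMul (leftAct V l star) (Pi.single 0 1) s = s ∧
            ∀ a b : ℕ → orbitFun l,
              seriesMul (leftAct V l star) (seriesMul B a b) s =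
                seriesMul (leftAct V l star) a (seriesMul (leftAct V l star) b s)) ∧
        -- line bundles are right modules over the algebra at the shifted path
        (∀ α : centreDual nm l np,
          ∃ star' : ℕ → PolyFun g →ₗ[ℂ] PolyFun g →ₗ[ℂ] PolyFun g,
            IsDynMul (shiftPath lam α) star' ∧
            ∃ B' : ℕ → orbitFun l →ₗ[ℂ] orbitFun l →ₗ[ℂ] orbitFun l, IsRestriction l star' B' ∧
            ∀ s : ℕ → PolyFun g ⊗[ℂ] CharModule (charOf α),
              (∀ i, s i ∈ bundleSections l (CharModule (charOf α))) →
              (∀ (b : ℕ → orbitFun l) (i : ℕ),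
                seriesMul (rightAct (CharModule (charOf α)) l star) s b i ∈
                  bundleSections l (CharModule (charOf α))) ∧
              seriesMul (rightAct (CharModule (charOf α)) l star) s (Pi.single 0 1) = s ∧
              ∀ b c : ℕ → orbitFun l,
                seriesMul (rightAct (CharModule (charOf α)) l star)
                    (seriesMul (rightAct (CharModule (charOf α)) l star) s b) c =
                  seriesMul (rightAct (CharModule (charOf α)) l star) s (seriesMul B' b c)) := by
  obtain ⟨ι, hι, D, hD₀⟩ := exists_triangular hdec (lam 0 : Module.Dual ℂ g) (lam 0).2 hstab
  have : Fintype ι := Fintype.ofFinite ι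
  have hD : IsDualBasis D (lam 0 : Module.Dual ℂ g) := fun i j => by rw [hD₀ i j]
  refine ⟨⟨starCoeff hD, (isDynMul_iff hD _).2 rfl, fun star h => (isDynMul_iff hD star).1 h⟩, ?_⟩
  intro star hstar
  obtain rfl := (isDynMul_iff hD star).1 hstar
  refine ⟨starCoeff_rho1 hD, ?_, orbitStar hD, isRestriction_orbitStar hD, ?_, ?_, ?_, ?_⟩
  · intro V W _ _ _ _ _ _ _ _ _ _ s hs s' hs'
    refine ⟨fun n => ?_, sectionMul_zero hD s s', fun n x => sectionMul_rho1 hD n x s s'⟩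
    rw [mem_bundleSections] at hs hs' ⊢
    intro z
    rw [sectionMul_lie, hs, hs', map_zero, map_zero, LinearMap.zero_apply, add_zero]
  · exact ⟨_, isKirillovBracket_orbitStar hD hstab, isDeformationQuantization_orbitStar hD⟩
  · intro V W _ _ _ _ _ _ _ _ _ _ a s s' _ _
    exact (seriesMul_assoc _ _ _ _ a s s' fun i j k n =>
      leftAct_sectionMul hD (a i) (s j) (s' k) n).symm
  · intro V _ _ _ _ _ s hs
    refine ⟨fun a i => seriesMul_mem _ (fun n i j => leftAct_mem hD n (a i) (hs j)) i,
      seriesMul_single_left _ _ _ fun n i => leftAct_one hD n (s i), fun a b => ?_⟩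
    exact seriesMul_assoc _ _ _ _ a b s fun i j k n => leftAct_assoc hD (a i) (b j) (s k) n
  · intro α
    -- The shift by −tα does not change λ₀, so the same decomposition and dual bases serve the
    -- shifted path.
    have hD' : IsDualBasis D (shiftPath lam α 0 : Module.Dual ℂ g) := by
      rw [shiftPath_zero]; exact hD
    refine ⟨starCoeff hD', (isDynMul_iff hD' _).2 rfl, orbitStar hD', isRestriction_orbitStar hD',
      fun s hs => ⟨fun b i => seriesMul_mem _ (fun n i j => rightAct_mem hD n (hs i) (b j)) i,
        seriesMul_single_right _ _ _ fun n i => rightAct_one hD n (s i), fun b c => ?_⟩⟩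
    exact seriesMul_assoc _ _ _ _ s b c fun i j k n => rightAct_assoc hD hD' (hs i) (b j) (c k) n
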